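/- Let $m,K>0$, let $\mathbb T=\mathbb R/2\pi\mathbb Z$, and let $g$ be a Borel probability measure on $\mathbb R$ with $\int_{\mathbb R}\Omega^2\,g(d\Omega)<\infty$ (written $g(\Omega)\,d\Omega$ if it has a density). Consider the hydrodynamic Kuramoto system with inertia $$\partial_t\rho+\partial_\theta(\rho u)=0,$$ $$\partial_t(\rho u)+\partial_\theta(\rho u^2)=\frac1m\Big(-\rho u+\rho\,\Omega+K\rho\int_{\mathbb T\times\mathbb R}\sin(\theta_*-\theta)\,\rho(\theta_*,\Omega_*,t)\,d\theta_*\,g(d\Omega_*)\Big),\qquad t>0,$$ with $(\rho,u)|_{t=0}=(\rho_0,u_0)$. Here $H^k_g$ is the space of functions $f$ on $\mathbb T\times\mathbb R$ whose weak $\theta$-derivatives $\partial_\theta^jf$, $0\le j\le k$, lie in $L^2(d\theta\otimes g)$, with norm $\big(\sum_{j\le k}\|\partial^j_\theta f\|^2_{L^2(d\theta\otimes g)}\big)^{1/2}$. Let $G\subset\mathbb R$ be a set of full $g$-measure, the set of frequencies at which the system is posed pointwise (for instance $G=\mathbb R$). Assume that $\rho_0\in H^2_g$ and $u_0\in H^3_g$,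 that $\rho_0$ and $\partial_\theta u_0$ are bounded on $\mathbb T\times G$, that $\rho_0>0$ on $\mathbb T\times G$, and that $\int_{\mathbb T}\rho_0(\theta,\Omega)\,d\theta=1$ for all $\Omega\in G$; for $\Omega\in G$ the sections $\rho_0(\cdot,\Omega)$ and $u_0(\cdot,\Omega)$ are of class $C^1$ and $C^2$ (which by Sobolev embedding holds, for a suitable representative, for $g$-almost every $\Omega$). A classical solution on a time interval $I=[0,T)$ or $I=[0,\infty)$ is a pair $(\rho,u)\in\mathcal C(I;H^2_g)\times\mathcal C(I;H^3_g)$ such that, for every $\Omega\in G$, the functions $\rho(\cdot,\Omega,\cdot)$ and $u(\cdot,\Omega,\cdot)$ are $C^1$ on $\mathbb T\times I$, satisfy the system at every $\theta\in\mathbb T$ and $t\in I$ with $t>0$, and have the initial values $\rho_0(\cdot,\Omega)$ and $u_0(\cdot,\Omega)$, and such that $\rho$ and $\partial_\theta u$ are bounded on $\mathbb T\times G\times[0,s]$ for every $s\in I$. (i) (Subcritical region) If $1\ge 4Km$ and $$\partial_\theta u_0(\theta,\Omega)\ \ge\ \frac{-1-\sqrt{1-4Km}}{2m}\qquad\text{for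 all }(\theta,\Omega)\in\mathbb T\times G,$$ then there is a classical solution on $[0,\infty)$, and every classical solution on an interval $[0,T)$ with $T>0$ coincides with it on $\mathbb T\times G\times[0,T)$. (ii) (Supercritical region) If there is $(\theta_*,\Omega_*)\in\mathbb T\times G$ with $$\partial_\theta u_0(\theta_*,\Omega_*)\ <\ \frac{-1-\sqrt{1+4Km}}{2m},$$ then the solution blows up in finite time: there is $T\in(0,\infty)$ such that a classical solution on $[0,T)$ exists, every classical solution on $[0,T)$ satisfies $\inf_{\mathbb T\times G}\partial_\theta u(\cdot,\cdot,t)\to-\infty$ as $t\uparrow T$, and for no $T'>T$ does a classical solution on $[0,T')$ exist. -/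

import Mathlib

open MeasureTheory Filter Topology
open scoped ContDiff

namespace KuramotoHydro

/-- The measure `dθ ⊗ g(dΩ)` on one period cell of `𝕋 × ℝ`, `𝕋 = ℝ / 2πℤ`. Functions on `𝕋 × ℝ` are
functions `ℝ → ℝ → ℝ` of `(θ, Ω)` that are `2π`-periodic in `θ`. The frequency distribution is a
Borel measure `g`; it is `g(Ω) dΩ` when it has a density. -/
noncomputable def cellMeasure (g : Measure ℝ) : Measure (ℝ × ℝ) :=
  ((volume : Measure ℝ).restrict (Set.Ioc 0 (2 * Real.pi))).prod g

/-- Smooth test functions on `𝕋 × ℝ` with compact support. -/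
structure IsTestFunction (φ : ℝ × ℝ → ℝ) : Prop where
  smooth : ContDiff ℝ ∞ φ
  periodic : ∀ θ Ω : ℝ, φ (θ + 2 * Real.pi, Ω) = φ (θ, Ω)
  support : ∃ R : ℝ, ∀ θ Ω : ℝ, R < |Ω| → φ (θ, Ω) = 0

/-- `f'` is the weak `θ`-derivative of `f` on `𝕋 × ℝ` with respect to `dθ ⊗ g(dΩ)`. -/
def IsWeakThetaDeriv (g : Measure ℝ) (f f' : ℝ × ℝ → ℝ) : Prop :=
  ∀ φ : ℝ × ℝ → ℝ, IsTestFunction φ →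
    ∫ p, f p * deriv (fun x => φ (x, p.2)) p.1 ∂(cellMeasure g) =
      - ∫ p, f' p * φ p ∂(cellMeasure g)

/-- Tuples `(U₀, …, U_k)` of elements of `L²_g(𝕋 × ℝ)` with norm `(∑ ‖U_j‖²)^{1/2}`. -/
abbrev L2Tuple (g : Measure ℝ) (k : ℕ) : Type :=
  PiLp 2 (fun _ : Fin (k + 1) => Lp ℝ 2 (cellMeasure g))

/-- The weighted Sobolev space `H^k_g(𝕋 × ℝ)` of functions with weak `θ`-derivatives up to order `k`
in `L²_g`, each function being identified with the tuple `(f, ∂_θ f, …, ∂_θ^k f)`; the norm of the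
tuple is the `H^k_g`-norm. -/
def Sobolev (g : Measure ℝ) (k : ℕ) : Set (L2Tuple g k) :=
  {U | ∀ j : Fin k, IsWeakThetaDeriv g (U j.castSucc) (U j.succ)}

/-- The element `U` of `H^k_g` is the class of the function `f`. -/
def Represents (g : Measure ℝ) (k : ℕ) (U : L2Tuple g k) (f : ℝ → ℝ → ℝ) : Prop :=
  U ∈ Sobolev g k ∧ (U 0 : ℝ × ℝ → ℝ) =ᵐ[cellMeasure g] fun p => f p.1 p.2

/-- `f ∈ H^k_g(𝕋 × ℝ)`. -/
def MemSobolev (g : Measure ℝ) (k : ℕ) (f : ℝ → ℝ → ℝ) : Prop :=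
  ∃ U : L2Tuple g k, Represents g k U f

/-- `f ∈ C(I; H^k_g(𝕋 × ℝ))`; the first argument of `f` is time. -/
def ContinuousInSobolev (g : Measure ℝ) (k : ℕ) (I : Set ℝ) (f : ℝ → ℝ → ℝ → ℝ) : Prop :=
  ∃ U : ℝ → L2Tuple g k, ContinuousOn U I ∧ ∀ t ∈ I, Represents g k (U t) (f t)

/-- Initial data: `ρ₀ ∈ H²_g ∩ L^∞`, `u₀ ∈ H³_g`, `∂_θ u₀ ∈ L^∞`, `ρ₀ > 0` and
`∫ ρ₀(θ, Ω) dθ = 1`. Pointwise conditions are imposed at the frequencies `Ω ∈ G`, where `G` has full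
`g`-measure; `sectC1` and `sectC2` select the continuous representatives of the sections
`ρ₀(·, Ω) ∈ H²(𝕋)` and `u₀(·, Ω) ∈ H³(𝕋)`. -/
structure IsInitialData (g : Measure ℝ) (G : Set ℝ) (ρ₀ u₀ : ℝ → ℝ → ℝ) : Prop where
  periodic_rho : ∀ Ω ∈ G, Function.Periodic (fun θ => ρ₀ θ Ω) (2 * Real.pi)
  periodic_u : ∀ Ω ∈ G, Function.Periodic (fun θ => u₀ θ Ω) (2 * Real.pi)
  sectC1 : ∀ Ω ∈ G, ContDiff ℝ 1 (fun θ => ρ₀ θ Ω)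
  sectC2 : ∀ Ω ∈ G, ContDiff ℝ 2 (fun θ => u₀ θ Ω)
  sobolev_rho : MemSobolev g 2 ρ₀
  sobolev_u : MemSobolev g 3 u₀
  bounded : ∃ C : ℝ, ∀ θ : ℝ, ∀ Ω ∈ G, |ρ₀ θ Ω| ≤ C ∧ |deriv (fun x => u₀ x Ω) θ| ≤ C
  positive : ∀ θ : ℝ, ∀ Ω ∈ G, 0 < ρ₀ θ Ω
  normalized : ∀ Ω ∈ G, ∫ θ in (0 : ℝ)..(2 * Real.pi), ρ₀ θ Ω = 1

/-- `(ρ, u)` is a classical solution on the time interval `I` (of the form `[0, T)` or `[0, ∞)`) of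
`∂_t ρ + ∂_θ (ρ u) = 0`,
`∂_t (ρ u) + ∂_θ (ρ u²) = (1/m) (-ρ u + ρ Ω + K ρ ∫ sin (θ_* - θ) ρ(θ_*, Ω_*, t) dθ_* g(dΩ_*))`
with `(ρ, u) = (ρ₀, u₀)` at `t = 0`. The arguments of `ρ` and `u` are `t`, `θ`, `Ω` in this order. -/
structure IsClassicalSolution (m K : ℝ) (g : Measure ℝ) (G : Set ℝ) (ρ₀ u₀ : ℝ → ℝ → ℝ)
    (I : Set ℝ) (ρ u : ℝ → ℝ → ℝ → ℝ) : Prop where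
  periodic_rho : ∀ t ∈ I, ∀ Ω ∈ G, Function.Periodic (fun θ => ρ t θ Ω) (2 * Real.pi)
  periodic_u : ∀ t ∈ I, ∀ Ω ∈ G, Function.Periodic (fun θ => u t θ Ω) (2 * Real.pi)
  contDiff_rho : ∀ Ω ∈ G, ContDiffOn ℝ 1 (fun p : ℝ × ℝ => ρ p.1 p.2 Ω) (I ×ˢ Set.univ)
  contDiff_u : ∀ Ω ∈ G, ContDiffOn ℝ 1 (fun p : ℝ × ℝ => u p.1 p.2 Ω) (I ×ˢ Set.univ)
  sobolev_rho : ContinuousInSobolev g 2 I ρ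
  sobolev_u : ContinuousInSobolev g 3 I u
  /-- `ρ` and `∂_θ u` are bounded on `𝕋 × G × [0, s]` for every `s ∈ I`. -/
  bounded : ∀ s ∈ I, ∃ C : ℝ, ∀ t ∈ Set.Icc 0 s, ∀ θ : ℝ, ∀ Ω ∈ G,
    |ρ t θ Ω| ≤ C ∧ |deriv (fun x => u t x Ω) θ| ≤ C
  initial : ∀ θ : ℝ, ∀ Ω ∈ G, ρ 0 θ Ω = ρ₀ θ Ω ∧ u 0 θ Ω = u₀ θ Ω
  continuity_eq : ∀ t ∈ I, 0 < t → ∀ θ : ℝ, ∀ Ω ∈ G,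
    deriv (fun s => ρ s θ Ω) t + deriv (fun x => ρ t x Ω * u t x Ω) θ = 0
  momentum_eq : ∀ t ∈ I, 0 < t → ∀ θ : ℝ, ∀ Ω ∈ G,
    deriv (fun s => ρ s θ Ω * u s θ Ω) t + deriv (fun x => ρ t x Ω * (u t x Ω) ^ 2) θ =
      1 / m * (-(ρ t θ Ω * u t θ Ω) + ρ t θ Ω * Ω +
        K * ρ t θ Ω * ∫ p, Real.sin (p.1 - θ) * ρ t p.1 p.2 ∂(cellMeasure g))

end KuramotoHydro

/-!
# Critical thresholds for the hydrodynamic Kuramoto system with inertia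

With `a = 1 / m` and `κ = K / m` the characteristics of the system solve `x'' = -a x' + a Ω + F(t, x)`
with the mean-field force `F(t, θ) = κ ∫ sin(θ_* - θ) ρ = S(t) cos θ - C(t) sin θ`. The force is
smooth and bounded in `θ` whatever the density does, so the particle system is solvable for all
times: by a contraction argument there is exactly one pair `(S, C)` which is the mean field of the
particles it moves (`IsMassData.exists_selfConsistent`, `IsMassData.selfConsistent_unique`). Let
`x(t, α, Ω)` be the flow, `J = ∂_α x` and `P = ∂_α ∂_t x`. In Lagrangian coordinates a classical
solution is `ρ = ρ₀ / J`, `u = ∂_t x`, `∂_θ u = P / J`, so the only possible obstruction is the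
vanishing of `J`: a classical solution exists on `I` if and only if `J` is bounded away from zero,
uniformly in `α` and in `Ω ∈ G`, on `[0, s]` for each `s ∈ I`
(`RegularData.isClassicalSolution`, `IsClassicalSolution.eq_flow`). The second of these results also
gives uniqueness.

The regularity of the solution in the spaces `H^k_g` has to be proved without loss of derivatives.
The quantity `W = J ∂_α P - P ∂_α J` satisfies `∂_t W = -a W - F(x) J³`, from which the highest
derivatives have disappeared, and `∂_θ² u = W / J³` (`SectionFlow.W_eq`). The third derivative of `u`
and the second derivative of `ρ` then contain the top derivatives of the data linearly and products
of two lower ones; the products are square integrable because of the interpolation inequality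
`‖f'‖₄² ≤ 3 ‖f‖_∞ ‖f''‖₂` (`integral_pow_four_le`). Continuity in time with values in `L²` holds since
compositions with the flow are continuous on the dense set of bounded continuous functions
(`tendsto_sqNorm_comp`).

The thresholds come from `J' = P`, `P' = -a P + ∂_θ F(t, x) J` with `|∂_θ F| ≤ κ`, the mass being one.
If `d² + a d + κ = 0`, then `N = P - d J` satisfies `N' = -(a + d) N + (∂_θ F + κ) J`, and the system
for `(J, N)` preserves the positive quadrant; so `J ≥ e^{dt}` if `∂_θ u₀ ≥ d`
(`SectionFlow.exp_le_J`). If `d` is the negative root of `d² + a d - κ = 0`, the last term becomes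
`(∂_θ F - κ) J ≤ 0`, and `∂_θ u₀ < d` at one point forces `J` to vanish in finite time
(`SectionFlow.time_lt_of_J_pos`). In this case let `T` be the supremum of the times up to which `J` is
bounded away from zero. Since a lower bound of the slope `P / J` at one time keeps `J` away from zero
for a time that depends on this bound only (`SectionFlow.mul_exp_le_J_of_slope`), the infimum of the
slope tends to `-∞` at `T` (`IsInitialData.exists_lifespan`).
-/


open MeasureTheory Filter Topology
open scoped ContDiff

namespace KuramotoHydro

/-! ### Differential inequalities and global solutions of differential equations -/

section Toolkit

variable {E : Type*} [NormedAddCommGroup E] [NormedSpace ℝ E]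

lemma gronwallBound_le {δ L ε t : ℝ} (hε : 0 ≤ ε) (hL : 0 ≤ L) :
    gronwallBound δ L ε t ≤ (δ + ε * t) * Real.exp (L * t) := by
  rcases eq_or_lt_of_le hL with h | h
  · subst h
    simp [gronwallBound_K0]
  · rw [gronwallBound_of_K_ne_0 h.ne']
    have h1 : Real.exp (L * t) - 1 ≤ L * t * Real.exp (L * t) := by
      have := Real.add_one_le_exp (-(L * t))
      have h2 : Real.exp (-(L * t)) * Real.exp (L * t) = 1 := by
        rw [← Real.exp_add]; simp
      nlinarith [Real.exp_pos (L * t)]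
    have h3 : ε / L * (Real.exp (L * t) - 1) ≤ ε / L * (L * t * Real.exp (L * t)) := by gcongr
    have h4 : ε / L * (L * t * Real.exp (L * t)) = ε * t * Real.exp (L * t) := by
      field_simp
    linarith

/-- Grönwall's inequality with differentiability only in the open interval. -/
lemma gronwall_Ioo {e e' : ℝ → E} {T L ε : ℝ} (hL : 0 ≤ L) (hε : 0 ≤ ε)
    (hc : ContinuousOn e (Set.Icc 0 T)) (hd : ∀ t ∈ Set.Ioo 0 T, HasDerivAt e (e' t) t)
    (hb : ∀ t ∈ Set.Ioo 0 T, ‖e' t‖ ≤ L * ‖e t‖ + ε) :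
    ∀ t ∈ Set.Icc 0 T, ‖e t‖ ≤ (‖e 0‖ + ε * t) * Real.exp (L * t) := by
  intro t ht
  rcases eq_or_lt_of_le ht.1 with h | h
  · simp [← h]
  have key : ∀ᶠ η in 𝓝[>] (0 : ℝ), ‖e t‖ ≤ (‖e η‖ + ε * t) * Real.exp (L * t) := by
    filter_upwards [Ioo_mem_nhdsGT h] with η hη
    have := norm_le_gronwallBound_of_norm_deriv_right_le (f := e) (f' := e') (δ := ‖e η‖)
      (K := L) (ε := ε) (a := η) (b := t)
      (hc.mono (Set.Icc_subset_Icc hη.1.le ht.2)) (fun x hx =>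
        (hd x ⟨hη.1.trans_le hx.1, hx.2.trans_le ht.2⟩).hasDerivWithinAt)
      le_rfl (fun x hx => hb x ⟨hη.1.trans_le hx.1, hx.2.trans_le ht.2⟩) t ⟨hη.2.le, le_rfl⟩
    refine this.trans ((gronwallBound_le hε hL).trans ?_)
    have : t - η ≤ t := by linarith [hη.1]
    gcongr
  have hlim : Tendsto (fun η => (‖e η‖ + ε * t) * Real.exp (L * t)) (𝓝[>] 0)
      (𝓝 ((‖e 0‖ + ε * t) * Real.exp (L * t))) := by
    have : Tendsto e (𝓝[>] 0) (𝓝 (e 0)) := by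
      have h0 : ContinuousWithinAt e (Set.Icc 0 T) 0 := hc 0 ⟨le_rfl, ht.1.trans ht.2⟩
      refine h0.mono_left ?_
      rw [nhdsWithin_le_iff]
      exact mem_of_superset (Ioo_mem_nhdsGT (h.trans_le ht.2)) Set.Ioo_subset_Icc_self
    exact ((this.norm).add_const _).mul_const _
  exact ge_of_tendsto hlim key

/-- Grönwall's inequality on a time interval around the initial time. -/
lemma gronwall_abs {e e' : ℝ → E} {T L ε : ℝ} (hL : 0 ≤ L) (hε : 0 ≤ ε)
    (hd : ∀ t, HasDerivAt e (e' t) t) (hb : ∀ t, |t| ≤ T → ‖e' t‖ ≤ L * ‖e t‖ + ε) :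
    ∀ t, |t| ≤ T → ‖e t‖ ≤ (‖e 0‖ + ε * T) * Real.exp (L * T) := by
  have hmain : ∀ (e e' : ℝ → E), (∀ t, HasDerivAt e (e' t) t) →
      (∀ t, |t| ≤ T → ‖e' t‖ ≤ L * ‖e t‖ + ε) → ∀ t, 0 ≤ t → t ≤ T →
      ‖e t‖ ≤ (‖e 0‖ + ε * T) * Real.exp (L * T) := by
    intro e e' hd hb t h0 hT
    have := gronwall_Ioo (T := T) hL hε
      (fun x _ => (hd x).continuousAt.continuousWithinAt) (fun x _ => hd x)
      (fun x hx => hb x (by rw [abs_of_pos hx.1]; exact hx.2.le)) t ⟨h0, hT⟩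
    have hT0 : 0 ≤ T := h0.trans hT
    exact this.trans (by gcongr)
  intro t ht
  rcases le_total 0 t with h | h
  · exact hmain e e' hd hb t h ((le_abs_self t).trans ht)
  · have := hmain (fun s => e (-s)) (fun s => -e' (-s))
      (fun s => by simpa [Function.comp_def] using (hd (-s)).scomp s (hasDerivAt_neg s))
      (fun s hs => by simpa using hb (-s) (by simpa using hs)) (-t) (by linarith)
      ((neg_le_abs t).trans ht)
    simpa using this

/-- A map of continuous curves which contracts all exponentially weighted distances
`sup_t e^{-λ|t|} ‖x(t) - y(t)‖` by the factor `1/2` has a fixed point. -/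
lemma exists_fixedPoint_weighted [CompleteSpace E] (Γ : (ℝ → E) → ℝ → E) (lam M : ℝ)
    (hcont : ∀ x, Continuous x → Continuous (Γ x))
    (hlip : ∀ x y, Continuous x → Continuous y → ∀ δ : ℝ, 0 ≤ δ →
      (∀ t, ‖x t - y t‖ ≤ δ * Real.exp (lam * |t|)) →
      ∀ t, ‖Γ x t - Γ y t‖ ≤ δ / 2 * Real.exp (lam * |t|))
    (h0 : ∀ t, ‖Γ (fun _ => 0) t‖ ≤ M * Real.exp (lam * |t|)) :
    ∃ x, Continuous x ∧ Γ x = x := by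
  have hM : 0 ≤ M := by
    have := (norm_nonneg _).trans (h0 0)
    simpa using this
  -- the weight and the transported map on bounded continuous functions
  have hw : Continuous fun t : ℝ => Real.exp (lam * |t|) := by fun_prop
  have hwi : Continuous fun t : ℝ => Real.exp (-(lam * |t|)) := by fun_prop
  have hunw : ∀ y : BoundedContinuousFunction ℝ E,
      Continuous (fun t => Real.exp (lam * |t|) • y t) := fun y => hw.smul y.continuous
  have hcancel : ∀ t : ℝ, Real.exp (-(lam * |t|)) * Real.exp (lam * |t|) = 1 := by
    intro t; rw [← Real.exp_add]; simp
  have hbd : ∀ y z : BoundedContinuousFunction ℝ E, ∀ t,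
      ‖Γ (fun t => Real.exp (lam * |t|) • y t) t - Γ (fun t => Real.exp (lam * |t|) • z t) t‖
        ≤ dist y z / 2 * Real.exp (lam * |t|) := by
    intro y z
    refine hlip _ _ (hunw y) (hunw z) _ dist_nonneg fun t => ?_
    rw [← smul_sub, norm_smul, Real.norm_eq_abs, abs_of_pos (Real.exp_pos _), mul_comm]
    gcongr
    rw [← dist_eq_norm]
    exact BoundedContinuousFunction.dist_coe_le_dist t
  have hb0 : ∀ y : BoundedContinuousFunction ℝ E, ∀ t,
      ‖Real.exp (-(lam * |t|)) • Γ (fun t => Real.exp (lam * |t|) • y t) t‖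
        ≤ dist y 0 / 2 + M := by
    intro y t
    have h1 := hbd y 0 t
    have h2 := h0 t
    simp only [BoundedContinuousFunction.coe_zero, Pi.zero_apply, smul_zero] at h1
    rw [norm_smul, Real.norm_eq_abs, abs_of_pos (Real.exp_pos _)]
    have h3 : ‖Γ (fun t => Real.exp (lam * |t|) • y t) t‖ ≤
        (dist y 0 / 2 + M) * Real.exp (lam * |t|) := by
      have := norm_le_norm_sub_add (Γ (fun t => Real.exp (lam * |t|) • y t) t)
        (Γ (fun _ => 0) t)
      linarith
    calc _ ≤ Real.exp (-(lam * |t|)) * ((dist y 0 / 2 + M) * Real.exp (lam * |t|)) := by gcongr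
      _ = (dist y 0 / 2 + M) * (Real.exp (-(lam * |t|)) * Real.exp (lam * |t|)) := by ring
      _ = _ := by rw [hcancel, mul_one]
  let Φ : BoundedContinuousFunction ℝ E → BoundedContinuousFunction ℝ E := fun y =>
    BoundedContinuousFunction.ofNormedAddCommGroup
      (fun t => Real.exp (-(lam * |t|)) • Γ (fun t => Real.exp (lam * |t|) • y t) t)
      (hwi.smul (hcont _ (hunw y))) _ (hb0 y)
  have hΦ : ContractingWith (1 / 2) Φ := by
    refine ⟨by norm_num, LipschitzWith.of_dist_le_mul fun y z => ?_⟩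
    rw [BoundedContinuousFunction.dist_le (by positivity)]
    intro t
    have h1 := hbd y z t
    have : dist (Φ y t) (Φ z t) = Real.exp (-(lam * |t|)) *
        ‖Γ (fun t => Real.exp (lam * |t|) • y t) t -
          Γ (fun t => Real.exp (lam * |t|) • z t) t‖ := by
      rw [dist_eq_norm]
      simp only [Φ, BoundedContinuousFunction.coe_ofNormedAddCommGroup]
      rw [← smul_sub, norm_smul, Real.norm_eq_abs, abs_of_pos (Real.exp_pos _)]
    rw [this]
    calc _ ≤ Real.exp (-(lam * |t|)) * (dist y z / 2 * Real.exp (lam * |t|)) := by gcongr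
      _ = dist y z / 2 * (Real.exp (-(lam * |t|)) * Real.exp (lam * |t|)) := by ring
      _ = _ := by rw [hcancel]; simp; ring
  refine ⟨fun t => Real.exp (lam * |t|) • (hΦ.fixedPoint Φ) t, hunw _, ?_⟩
  funext t
  have h := hΦ.fixedPoint_isFixedPt (f := Φ)
  have h1 : (Φ (hΦ.fixedPoint Φ)) t = (hΦ.fixedPoint Φ) t := by rw [h]
  rw [← h1]
  simp only [Φ, BoundedContinuousFunction.coe_ofNormedAddCommGroup]
  rw [smul_smul, mul_comm, hcancel, one_smul]

lemma abs_intervalIntegral_exp_le {lam : ℝ} (hlam : 0 < lam) (t : ℝ) :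
    |∫ s in (0 : ℝ)..t, Real.exp (lam * |s|)| ≤ Real.exp (lam * |t|) / lam := by
  have hpos : ∀ t : ℝ, 0 ≤ t → ∫ s in (0 : ℝ)..t, Real.exp (lam * |s|) =
      (Real.exp (lam * t) - 1) / lam := by
    intro t ht
    have : ∫ s in (0 : ℝ)..t, Real.exp (lam * |s|) = ∫ s in (0 : ℝ)..t, Real.exp (lam * s) := by
      refine intervalIntegral.integral_congr fun s hs => ?_
      rw [Set.uIcc_of_le ht] at hs
      simp only [abs_of_nonneg hs.1]
    rw [this, intervalIntegral.integral_comp_mul_left (fun s => Real.exp s) hlam.ne',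
      integral_exp]
    simp [div_eq_inv_mul]
  have hge : ∀ t : ℝ, 0 ≤ t → |∫ s in (0 : ℝ)..t, Real.exp (lam * |s|)| ≤
      Real.exp (lam * |t|) / lam := by
    intro t ht
    rw [hpos t ht, abs_of_nonneg ht, abs_of_nonneg]
    · gcongr; linarith
    · have : 1 ≤ Real.exp (lam * t) := Real.one_le_exp (by positivity)
      have : 0 ≤ Real.exp (lam * t) - 1 := by linarith
      positivity
  rcases le_total 0 t with h | h
  · exact hge t h
  · have h1 := hge (-t) (by linarith)
    have h2 : ∫ s in (0 : ℝ)..t, Real.exp (lam * |s|) =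
        - ∫ s in (0 : ℝ)..(-t), Real.exp (lam * |s|) := by
      have := intervalIntegral.integral_comp_neg (a := 0) (b := t)
        (fun s => Real.exp (lam * |s|))
      simp only [abs_neg, neg_zero] at this
      rw [this, intervalIntegral.integral_symm]
    rw [h2, abs_neg]
    simpa using h1

/-- Global solvability of `x' = f(t, x)` when `f` is globally Lipschitz in `x` and `f(·, 0)` grows
at most exponentially. -/
theorem exists_global_solution [CompleteSpace E] {f : ℝ → E → E}
    (hf : Continuous (fun p : ℝ × E => f p.1 p.2)) {L : ℝ}
    (hL : ∀ t x y, ‖f t x - f t y‖ ≤ L * ‖x - y‖) {M c : ℝ}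
    (hM : ∀ t, ‖f t 0‖ ≤ M * Real.exp (c * |t|)) (x₀ : E) :
    ∃ x : ℝ → E, x 0 = x₀ ∧ ∀ t, HasDerivAt x (f t (x t)) t := by
  set L' := max L 0
  have hL' : ∀ t x y, ‖f t x - f t y‖ ≤ L' * ‖x - y‖ := fun t x y =>
    (hL t x y).trans (by gcongr; exact le_max_left _ _)
  have hL'0 : 0 ≤ L' := le_max_right _ _
  set lam : ℝ := 2 * L' + |c| + 1
  have hlam : 0 < lam := by positivity
  have hM0 : 0 ≤ M := by simpa using (norm_nonneg _).trans (hM 0)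
  have hcurve : ∀ x : ℝ → E, Continuous x → Continuous fun s => f s (x s) := fun x hx =>
    hf.comp (continuous_id.prodMk hx)
  obtain ⟨x, hx, hfix⟩ := exists_fixedPoint_weighted
    (fun x t => x₀ + ∫ s in (0 : ℝ)..t, f s (x s)) lam (‖x₀‖ + M / lam)
    (fun x hx => continuous_const.add
      (intervalIntegral.continuous_primitive
        (fun a b => (hcurve x hx).intervalIntegrable a b) 0))
    (fun x y hx hy δ hδ h t => by
      simp only [add_sub_add_left_eq_sub]
      rw [← intervalIntegral.integral_sub ((hcurve x hx).intervalIntegrable _ _)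
        ((hcurve y hy).intervalIntegrable _ _)]
      have hint : IntervalIntegrable (fun s => L' * δ * Real.exp (lam * |s|)) volume 0 t :=
        Continuous.intervalIntegrable (by fun_prop) _ _
      calc _ ≤ |∫ s in (0 : ℝ)..t, L' * δ * Real.exp (lam * |s|)| := by
            refine intervalIntegral.norm_integral_le_abs_of_norm_le ?_ hint
            refine ae_of_all _ fun s => (hL' _ _ _).trans ?_
            rw [mul_assoc]; gcongr; exact h s
        _ ≤ L' * δ * (Real.exp (lam * |t|) / lam) := by
            rw [intervalIntegral.integral_const_mul, abs_mul,
              abs_of_nonneg (by positivity : 0 ≤ L' * δ)]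
            gcongr
            exact abs_intervalIntegral_exp_le hlam t
        _ ≤ _ := by
            rw [show L' * δ * (Real.exp (lam * |t|) / lam) =
              (L' / lam) * δ * Real.exp (lam * |t|) by ring]
            have : L' / lam ≤ 1 / 2 := by
              rw [div_le_div_iff₀ hlam two_pos]
              linarith [abs_nonneg c]
            calc _ ≤ 1 / 2 * δ * Real.exp (lam * |t|) := by gcongr
              _ = _ := by ring)
    (fun t => by
      have hint : IntervalIntegrable (fun s => M * Real.exp (lam * |s|)) volume 0 t :=
        Continuous.intervalIntegrable (by fun_prop) _ _
      have h1 : ‖∫ s in (0 : ℝ)..t, f s 0‖ ≤ M * (Real.exp (lam * |t|) / lam) := by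
        refine (intervalIntegral.norm_integral_le_abs_of_norm_le (ae_of_all _ fun s => ?_)
          hint).trans ?_
        · refine (hM s).trans ?_
          gcongr
          linarith [le_abs_self c]
        · rw [intervalIntegral.integral_const_mul, abs_mul, abs_of_nonneg hM0]
          gcongr
          exact abs_intervalIntegral_exp_le hlam t
      have h2 : 1 ≤ Real.exp (lam * |t|) := Real.one_le_exp (by positivity)
      calc _ ≤ ‖x₀‖ + M * (Real.exp (lam * |t|) / lam) := (norm_add_le _ _).trans (by gcongr)
        _ ≤ ‖x₀‖ * Real.exp (lam * |t|) + M * (Real.exp (lam * |t|) / lam) := by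
            gcongr; exact le_mul_of_one_le_right (norm_nonneg _) h2
        _ = _ := by ring)
  refine ⟨x, ?_, fun t => ?_⟩
  · rw [← hfix]; simp
  · have h1 : HasDerivAt (fun t => x₀ + ∫ s in (0 : ℝ)..t, f s (x s)) (f t (x t)) t := by
      refine HasDerivAt.const_add _ ?_
      exact intervalIntegral.integral_hasDerivAt_right
        ((hcurve x hx).intervalIntegrable _ _)
        ((hcurve x hx).stronglyMeasurableAtFilter _ _) (hcurve x hx).continuousAt
    rw [hfix] at h1
    exact h1

end Toolkit


/-! ### The Lagrangian flow at a fixed frequency -/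

section SecondOrder

/-- Grönwall's inequality for `e₁'' = g` with `|g| ≤ |a| |e₁'| + c |e₁| + ε`. It serves for the
flow, for both of its variations, and for the remainders of their difference quotients. -/
lemma secondOrder_bound {e₁ e₂ g : ℝ → ℝ} {a c ε T : ℝ} (hc : 0 ≤ c) (hε : 0 ≤ ε)
    (h₁ : ∀ t, HasDerivAt e₁ (e₂ t) t) (h₂ : ∀ t, HasDerivAt e₂ (g t) t)
    (hg : ∀ t, |t| ≤ T → |g t| ≤ |a| * |e₂ t| + c * |e₁ t| + ε) :
    ∀ t, |t| ≤ T → |e₁ t| ≤ (|e₁ 0| + |e₂ 0| + ε * T) * Real.exp ((1 + |a| + c) * T) ∧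
      |e₂ t| ≤ (|e₁ 0| + |e₂ 0| + ε * T) * Real.exp ((1 + |a| + c) * T) := by
  intro t ht
  have hL : 0 ≤ 1 + |a| + c := by positivity
  have hn : ∀ t, |e₁ t| ≤ ‖(e₁ t, e₂ t)‖ ∧ |e₂ t| ≤ ‖(e₁ t, e₂ t)‖ := fun t =>
    ⟨norm_fst_le (e₁ t, e₂ t), norm_snd_le (e₁ t, e₂ t)⟩
  have key := gronwall_abs (e := fun t => (e₁ t, e₂ t)) (e' := fun t => (e₂ t, g t)) (T := T)
    hL hε (fun t => (h₁ t).prodMk (h₂ t)) (fun t ht => by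
      have h3 := hg t ht
      obtain ⟨h4, h5⟩ := hn t
      have h6 : |a| * |e₂ t| ≤ |a| * ‖(e₁ t, e₂ t)‖ := by gcongr
      have h7 : c * |e₁ t| ≤ c * ‖(e₁ t, e₂ t)‖ := by gcongr
      have h8 : 0 ≤ |a| * ‖(e₁ t, e₂ t)‖ := by positivity
      have h9 : 0 ≤ c * ‖(e₁ t, e₂ t)‖ := by positivity
      rw [Prod.norm_def]
      refine max_le ?_ ?_
      · simp only [Real.norm_eq_abs]; linarith
      · simp only [Real.norm_eq_abs]; linarith [norm_nonneg (e₁ t, e₂ t)]) t ht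
  have h0 : ‖(e₁ 0, e₂ 0)‖ ≤ |e₁ 0| + |e₂ 0| := by
    rw [Prod.norm_def]
    exact max_le (by simp) (by simp)
  have hT : 0 ≤ T := (abs_nonneg t).trans ht
  have h1 : ‖(e₁ t, e₂ t)‖ ≤ (|e₁ 0| + |e₂ 0| + ε * T) * Real.exp ((1 + |a| + c) * T) :=
    key.trans (by gcongr)
  exact ⟨(hn t).1.trans h1, (hn t).2.trans h1⟩

/-- Global solutions of `x'' = -a x' + h(t, x)` for `h` Lipschitz in `x`. The exponential growth
admitted for `h(t, 0)` is needed for the second variation, whose source term grows with the first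
variation. -/
theorem exists_secondOrder_solution (a : ℝ) {h : ℝ → ℝ → ℝ}
    (hc : Continuous (fun p : ℝ × ℝ => h p.1 p.2)) {L M c : ℝ}
    (hL : ∀ t x y, |h t x - h t y| ≤ L * |x - y|) (hM : ∀ t, |h t 0| ≤ M * Real.exp (c * |t|))
    (x₀ y₀ : ℝ) :
    ∃ x y : ℝ → ℝ, x 0 = x₀ ∧ y 0 = y₀ ∧ (∀ t, HasDerivAt x (y t) t) ∧
      ∀ t, HasDerivAt y (-(a * y t) + h t (x t)) t := by
  have hL0 : 0 ≤ L := by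
    have := (abs_nonneg _).trans (hL 0 1 0)
    simpa using this
  have hM0 : 0 ≤ M := by simpa using (abs_nonneg _).trans (hM 0)
  obtain ⟨z, hz0, hz⟩ := exists_global_solution (E := ℝ × ℝ)
    (f := fun t z => (z.2, -(a * z.2) + h t z.1)) (L := 1 + |a| + L) (M := M) (c := c)
    (by
      refine Continuous.prodMk (by fun_prop) (Continuous.add (by fun_prop) ?_)
      exact hc.comp (by fun_prop : Continuous fun p : ℝ × ℝ × ℝ => (p.1, p.2.1)))
    (fun t z w => by
      have h1 : |z.1 - w.1| ≤ ‖z - w‖ := norm_fst_le (z - w)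
      have h2 : |z.2 - w.2| ≤ ‖z - w‖ := norm_snd_le (z - w)
      have h3 : |a| * |z.2 - w.2| ≤ |a| * ‖z - w‖ := by gcongr
      have h4 : L * |z.1 - w.1| ≤ L * ‖z - w‖ := by gcongr
      have h5 : 0 ≤ |a| * ‖z - w‖ := by positivity
      have h6 : 0 ≤ L * ‖z - w‖ := by positivity
      rw [Prod.norm_def]
      refine max_le ?_ ?_
      · simp only [Prod.mk_sub_mk, Real.norm_eq_abs]; linarith
      · simp only [Prod.mk_sub_mk, Real.norm_eq_abs]
        have : -(a * z.2) + h t z.1 - (-(a * w.2) + h t w.1) =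
          -(a * (z.2 - w.2)) + (h t z.1 - h t w.1) := by ring
        rw [this]
        refine (abs_add_le _ _).trans ?_
        rw [abs_neg, abs_mul]
        linarith [hL t z.1 w.1, norm_nonneg (z - w)])
    (fun t => by
      simp only [Prod.fst_zero, Prod.snd_zero, mul_zero, neg_zero, zero_add, Prod.norm_def,
        norm_zero]
      exact max_le (by positivity) (hM t)) (x₀, y₀)
  refine ⟨fun t => (z t).1, fun t => (z t).2, by simp [hz0], by simp [hz0], fun t => ?_,
    fun t => ?_⟩
  · exact (hasFDerivAt_fst.comp_hasDerivAt t (hz t) :)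
  · exact (hasFDerivAt_snd.comp_hasDerivAt t (hz t) :)

end SecondOrder

/-- The force `S(t) cos θ - C(t) sin θ` which a mean field exerts, given by its two bounded
continuous coefficients. -/
structure ForceField where
  S : ℝ → ℝ
  C : ℝ → ℝ
  B : ℝ
  contS : Continuous S
  contC : Continuous C
  boundS : ∀ t, |S t| ≤ B
  boundC : ∀ t, |C t| ≤ B

namespace ForceField

variable (F : ForceField)

/-- The force at time `t` and phase `θ`. -/
noncomputable def val (t θ : ℝ) : ℝ := F.S t * Real.cos θ - F.C t * Real.sin θ

/-- The phase derivative of the force. The second phase derivative is `-val`. -/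
noncomputable def der (t θ : ℝ) : ℝ := -(F.S t * Real.sin θ + F.C t * Real.cos θ)

lemma B_nonneg : 0 ≤ F.B := (abs_nonneg _).trans (F.boundS 0)

lemma continuous_val : Continuous fun p : ℝ × ℝ => F.val p.1 p.2 := by
  have := F.contS; have := F.contC
  unfold val; fun_prop

lemma continuous_der : Continuous fun p : ℝ × ℝ => F.der p.1 p.2 := by
  have := F.contS; have := F.contC
  unfold der; fun_prop

lemma continuous_val_comp {X : Type*} [TopologicalSpace X] {f g : X → ℝ} (hf : Continuous f)
    (hg : Continuous g) : Continuous fun p => F.val (f p) (g p) :=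
  F.continuous_val.comp (hf.prodMk hg)

lemma continuous_der_comp {X : Type*} [TopologicalSpace X] {f g : X → ℝ} (hf : Continuous f)
    (hg : Continuous g) : Continuous fun p => F.der (f p) (g p) :=
  F.continuous_der.comp (hf.prodMk hg)

lemma hasDerivAt_val (t θ : ℝ) : HasDerivAt (F.val t) (F.der t θ) θ := by
  have := ((Real.hasDerivAt_cos θ).const_mul (F.S t)).sub
    ((Real.hasDerivAt_sin θ).const_mul (F.C t))
  exact this.congr_deriv (by unfold der; ring)

lemma hasDerivAt_der (t θ : ℝ) : HasDerivAt (F.der t) (-F.val t θ) θ := by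
  have := (((Real.hasDerivAt_sin θ).const_mul (F.S t)).add
    ((Real.hasDerivAt_cos θ).const_mul (F.C t))).neg
  exact this.congr_deriv (by unfold val; ring)

lemma abs_val_le (t θ : ℝ) : |F.val t θ| ≤ 2 * F.B := by
  unfold val
  have h1 : |F.S t * Real.cos θ| ≤ F.B * 1 := by
    rw [abs_mul]
    exact mul_le_mul (F.boundS t) (Real.abs_cos_le_one θ) (abs_nonneg _) F.B_nonneg
  have h2 : |F.C t * Real.sin θ| ≤ F.B * 1 := by
    rw [abs_mul]
    exact mul_le_mul (F.boundC t) (Real.abs_sin_le_one θ) (abs_nonneg _) F.B_nonneg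
  exact (abs_sub _ _).trans (by linarith)

lemma abs_der_le (t θ : ℝ) : |F.der t θ| ≤ 2 * F.B := by
  unfold der
  have h1 : |F.S t * Real.sin θ| ≤ F.B * 1 := by
    rw [abs_mul]
    exact mul_le_mul (F.boundS t) (Real.abs_sin_le_one θ) (abs_nonneg _) F.B_nonneg
  have h2 : |F.C t * Real.cos θ| ≤ F.B * 1 := by
    rw [abs_mul]
    exact mul_le_mul (F.boundC t) (Real.abs_cos_le_one θ) (abs_nonneg _) F.B_nonneg
  rw [abs_neg]
  exact (abs_add_le _ _).trans (by linarith)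

lemma abs_sub_le_of_hasDerivAt {f f' : ℝ → ℝ} {K : ℝ} (hf : ∀ x, HasDerivAt f (f' x) x)
    (hK : ∀ x, |f' x| ≤ K) (x y : ℝ) : |f y - f x| ≤ K * |y - x| :=
  Convex.norm_image_sub_le_of_norm_hasDerivWithin_le (fun x _ => (hf x).hasDerivWithinAt)
    (fun x _ => hK x) convex_univ (Set.mem_univ x) (Set.mem_univ y)

/-- Taylor's estimate of first order. -/
lemma abs_sub_sub_le_of_hasDerivAt {f f' f'' : ℝ → ℝ} {K : ℝ} (hf : ∀ x, HasDerivAt f (f' x) x)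
    (hf' : ∀ x, HasDerivAt f' (f'' x) x) (hK : ∀ x, |f'' x| ≤ K) (x y : ℝ) :
    |f y - f x - f' x * (y - x)| ≤ K * |y - x| ^ 2 := by
  have hK0 : 0 ≤ K := (abs_nonneg _).trans (hK 0)
  have h1 := Convex.norm_image_sub_le_of_norm_hasDerivWithin_le (s := Set.uIcc x y)
    (f := fun s => f s - f' x * s) (f' := fun s => f' s - f' x) (C := K * |y - x|)
    (x := x) (y := y)
    (fun s _ => by
      have := (hf s).sub ((hasDerivAt_id s).const_mul (f' x))
      exact (this.congr_deriv (by simp)).hasDerivWithinAt)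
    (fun s hs => (abs_sub_le_of_hasDerivAt hf' hK x s).trans
      (mul_le_mul_of_nonneg_left (Set.abs_sub_left_of_mem_uIcc hs) hK0)) (convex_uIcc x y) Set.left_mem_uIcc
      Set.right_mem_uIcc
  have h2 : f y - f x - f' x * (y - x) = (f y - f' x * y) - (f x - f' x * x) := by ring
  rw [h2]
  simp only [Real.norm_eq_abs] at h1
  calc _ ≤ K * |y - x| * |y - x| := h1
    _ = _ := by ring

lemma abs_val_sub_le (t x y : ℝ) : |F.val t y - F.val t x| ≤ 2 * F.B * |y - x| :=
  abs_sub_le_of_hasDerivAt (F.hasDerivAt_val t) (F.abs_der_le t) x y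

lemma abs_der_sub_le (t x y : ℝ) : |F.der t y - F.der t x| ≤ 2 * F.B * |y - x| :=
  abs_sub_le_of_hasDerivAt (F.hasDerivAt_der t) (fun θ => by simpa using F.abs_val_le t θ) x y

lemma abs_val_taylor (t x y : ℝ) :
    |F.val t y - F.val t x - F.der t x * (y - x)| ≤ 2 * F.B * |y - x| ^ 2 :=
  abs_sub_sub_le_of_hasDerivAt (F.hasDerivAt_val t) (F.hasDerivAt_der t)
    (fun θ => by simpa using F.abs_val_le t θ) x y

lemma abs_der_taylor (t x y : ℝ) :
    |F.der t y - F.der t x + F.val t x * (y - x)| ≤ 2 * F.B * |y - x| ^ 2 := by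
  have := abs_sub_sub_le_of_hasDerivAt (F.hasDerivAt_der t) (fun θ => (F.hasDerivAt_val t θ).neg)
    (fun θ => by simpa using F.abs_der_le t θ) x y
  simpa using this

lemma val_add_two_pi (t θ : ℝ) : F.val t (θ + 2 * Real.pi) = F.val t θ := by
  simp [val]

theorem exists_flow (a b α v : ℝ) :
    ∃ z : (ℝ → ℝ) × (ℝ → ℝ), z.1 0 = α ∧ z.2 0 = v ∧ (∀ t, HasDerivAt z.1 (z.2 t) t) ∧
      ∀ t, HasDerivAt z.2 (-(a * z.2 t) + (b + F.val t (z.1 t))) t := by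
  obtain ⟨x, y, h⟩ := exists_secondOrder_solution a (h := fun t x => b + F.val t x)
    (continuous_const.add F.continuous_val) (L := 2 * F.B) (M := |b| + 2 * F.B) (c := 0)
    (fun t x y => by
      rw [add_sub_add_left_eq_sub]; exact F.abs_val_sub_le t y x)
    (fun t => by
      simp only [zero_mul, Real.exp_zero, mul_one]
      exact (abs_add_le _ _).trans (by linarith [F.abs_val_le t 0])) α v
  exact ⟨(x, y), h⟩

/-- Position along the solution of `x'' = -a x' + b + F(t, x)`, `x(0) = α`, `x'(0) = v`. -/
noncomputable def pos (a b α v : ℝ) : ℝ → ℝ := (Classical.choose (F.exists_flow a b α v)).1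

/-- Velocity along the solution of `x'' = -a x' + b + F(t, x)`, `x(0) = α`, `x'(0) = v`. -/
noncomputable def vel (a b α v : ℝ) : ℝ → ℝ := (Classical.choose (F.exists_flow a b α v)).2

variable (a b α v : ℝ)

lemma pos_zero : F.pos a b α v 0 = α := (Classical.choose_spec (F.exists_flow a b α v)).1

lemma vel_zero : F.vel a b α v 0 = v := (Classical.choose_spec (F.exists_flow a b α v)).2.1

lemma hasDerivAt_pos (t : ℝ) : HasDerivAt (F.pos a b α v) (F.vel a b α v t) t :=
  (Classical.choose_spec (F.exists_flow a b α v)).2.2.1 t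

lemma hasDerivAt_vel (t : ℝ) : HasDerivAt (F.vel a b α v)
    (-(a * F.vel a b α v t) + (b + F.val t (F.pos a b α v t))) t :=
  (Classical.choose_spec (F.exists_flow a b α v)).2.2.2 t

/-- Lipschitz dependence of the flow on the initial data and the drift. -/
lemma flow_sub_le {b' α' v' T t : ℝ} (ht : |t| ≤ T) :
    |F.pos a b α v t - F.pos a b' α' v' t| ≤
        (|α - α'| + |v - v'| + |b - b'| * T) * Real.exp ((1 + |a| + 2 * F.B) * T) ∧
      |F.vel a b α v t - F.vel a b' α' v' t| ≤
        (|α - α'| + |v - v'| + |b - b'| * T) * Real.exp ((1 + |a| + 2 * F.B) * T) := by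
  have hB := F.B_nonneg
  have := secondOrder_bound (a := a) (c := 2 * F.B) (ε := |b - b'|) (T := T) (by positivity)
    (abs_nonneg _)
    (fun t => (F.hasDerivAt_pos a b α v t).sub (F.hasDerivAt_pos a b' α' v' t))
    (fun t => (F.hasDerivAt_vel a b α v t).sub (F.hasDerivAt_vel a b' α' v' t))
    (fun t _ => by
      have h := F.abs_val_sub_le t (F.pos a b' α' v' t) (F.pos a b α v t)
      rw [show -(a * F.vel a b α v t) + (b + F.val t (F.pos a b α v t)) -
        (-(a * F.vel a b' α' v' t) + (b' + F.val t (F.pos a b' α' v' t))) =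
        -(a * (F.vel a b α v t - F.vel a b' α' v' t)) +
          ((F.val t (F.pos a b α v t) - F.val t (F.pos a b' α' v' t)) + (b - b')) by ring]
      refine (abs_add_le _ _).trans ?_
      rw [abs_neg, abs_mul]
      have := abs_add_le (F.val t (F.pos a b α v t) - F.val t (F.pos a b' α' v' t)) (b - b')
      simp only [Pi.sub_apply]
      linarith) t ht
  simpa [pos_zero, vel_zero] using this

lemma continuous_flow (t : ℝ) :
    Continuous (fun p : ℝ × ℝ × ℝ => F.pos a p.1 p.2.1 p.2.2 t) ∧
      Continuous (fun p : ℝ × ℝ × ℝ => F.vel a p.1 p.2.1 p.2.2 t) := by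
  have key : ∀ p : ℝ × ℝ × ℝ, Tendsto (fun q : ℝ × ℝ × ℝ =>
      (|q.2.1 - p.2.1| + |q.2.2 - p.2.2| + |q.1 - p.1| * |t|) *
        Real.exp ((1 + |a| + 2 * F.B) * |t|)) (𝓝 p) (𝓝 0) := by
    intro p
    have : Continuous (fun q : ℝ × ℝ × ℝ =>
      (|q.2.1 - p.2.1| + |q.2.2 - p.2.2| + |q.1 - p.1| * |t|) *
        Real.exp ((1 + |a| + 2 * F.B) * |t|)) := by fun_prop
    simpa using this.tendsto p
  constructor
  · refine continuous_iff_continuousAt.2 fun p => tendsto_iff_dist_tendsto_zero.2 ?_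
    exact squeeze_zero (fun _ => dist_nonneg)
      (fun q => (F.flow_sub_le a q.1 q.2.1 q.2.2 le_rfl).1) (key p)
  · refine continuous_iff_continuousAt.2 fun p => tendsto_iff_dist_tendsto_zero.2 ?_
    exact squeeze_zero (fun _ => dist_nonneg)
      (fun q => (F.flow_sub_le a q.1 q.2.1 q.2.2 le_rfl).2) (key p)

lemma vel_bound {T t : ℝ} (ht : |t| ≤ T) :
    |F.vel a b α v t| ≤ (|v| + (|b| + 2 * F.B) * T) * Real.exp (|a| * T) := by
  have hB := F.B_nonneg
  have := gronwall_abs (e := F.vel a b α v) (T := T) (L := |a|) (ε := |b| + 2 * F.B)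
    (abs_nonneg _) (by positivity) (F.hasDerivAt_vel a b α v) (fun t _ => by
      refine (norm_add_le _ _).trans ?_
      rw [norm_neg, norm_mul]
      have := (abs_add_le b (F.val t (F.pos a b α v t))).trans
        (add_le_add_right (F.abs_val_le t (F.pos a b α v t)) _)
      simp only [Real.norm_eq_abs]
      linarith) t ht
  simpa [vel_zero] using this

/-- Uniqueness of the flow, on an interval whose end points need no differentiability. -/
lemma flow_unique {x y : ℝ → ℝ} {T : ℝ} (hx0 : x 0 = α) (hy0 : y 0 = v)
    (hxc : ContinuousOn x (Set.Icc 0 T)) (hyc : ContinuousOn y (Set.Icc 0 T))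
    (hx : ∀ t ∈ Set.Ioo 0 T, HasDerivAt x (y t) t)
    (hy : ∀ t ∈ Set.Ioo 0 T, HasDerivAt y (-(a * y t) + (b + F.val t (x t))) t) :
    ∀ t ∈ Set.Icc 0 T, x t = F.pos a b α v t ∧ y t = F.vel a b α v t := by
  intro t ht
  have hB := F.B_nonneg
  have hpc : Continuous (F.pos a b α v) :=
    continuous_iff_continuousAt.2 fun t => (F.hasDerivAt_pos a b α v t).continuousAt
  have hvc : Continuous (F.vel a b α v) :=
    continuous_iff_continuousAt.2 fun t => (F.hasDerivAt_vel a b α v t).continuousAt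
  have := gronwall_Ioo (e := fun t => (x t - F.pos a b α v t, y t - F.vel a b α v t))
    (e' := fun t => (y t - F.vel a b α v t, -(a * y t) + (b + F.val t (x t)) -
      (-(a * F.vel a b α v t) + (b + F.val t (F.pos a b α v t)))))
    (T := T) (L := 1 + |a| + 2 * F.B) (ε := 0) (by positivity) le_rfl
    ((hxc.sub hpc.continuousOn).prodMk (hyc.sub hvc.continuousOn))
    (fun t ht => ((hx t ht).sub (F.hasDerivAt_pos a b α v t)).prodMk
      ((hy t ht).sub (F.hasDerivAt_vel a b α v t)))
    (fun t _ => by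
      set z := (x t - F.pos a b α v t, y t - F.vel a b α v t) with hz
      have h1 : |x t - F.pos a b α v t| ≤ ‖z‖ := norm_fst_le z
      have h2 : |y t - F.vel a b α v t| ≤ ‖z‖ := norm_snd_le z
      have h := F.abs_val_sub_le t (F.pos a b α v t) (x t)
      have h3 : |a| * |y t - F.vel a b α v t| ≤ |a| * ‖z‖ := by gcongr
      have h4 : 2 * F.B * |x t - F.pos a b α v t| ≤ 2 * F.B * ‖z‖ := by gcongr
      have h5 : 0 ≤ |a| * ‖z‖ := by positivity
      have h6 : 0 ≤ 2 * F.B * ‖z‖ := by positivity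
      rw [Prod.norm_def]
      refine max_le ?_ ?_
      · simp only [Real.norm_eq_abs]; linarith
      · simp only [Real.norm_eq_abs]
        rw [show -(a * y t) + (b + F.val t (x t)) -
          (-(a * F.vel a b α v t) + (b + F.val t (F.pos a b α v t))) =
          -(a * (y t - F.vel a b α v t)) + (F.val t (x t) - F.val t (F.pos a b α v t)) by ring]
        refine (abs_add_le _ _).trans ?_
        rw [abs_neg, abs_mul]
        linarith [norm_nonneg z]) t ht
  simp only [hx0, hy0, pos_zero, vel_zero, sub_self, Prod.mk_zero_zero, norm_zero, zero_mul,
    add_zero, norm_le_zero_iff, Prod.mk_eq_zero] at this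
  exact ⟨sub_eq_zero.1 this.1, sub_eq_zero.1 this.2⟩

end ForceField


section Periodic

lemma periodic_of_hasDerivAt {f f' : ℝ → ℝ} {c : ℝ} (hf : Function.Periodic f c)
    (hd : ∀ x, HasDerivAt f (f' x) x) : Function.Periodic f' c := by
  intro x
  have h1 := (hd (x + c)).comp_add_const x c
  have h2 : (fun y => f (y + c)) = f := funext fun y => hf y
  rw [h2] at h1
  exact h1.unique (hd x)

lemma exists_bound_of_periodic {f : ℝ → ℝ} (hf : Function.Periodic f (2 * Real.pi))
    (hc : Continuous f) : ∃ C, ∀ x, |f x| ≤ C := by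
  obtain ⟨C, hC⟩ := (isCompact_Icc (a := (0 : ℝ)) (b := 2 * Real.pi)).exists_bound_of_continuousOn
    hc.continuousOn
  refine ⟨C, fun x => ?_⟩
  obtain ⟨y, hy, hxy⟩ := hf.exists_mem_Ico₀ Real.two_pi_pos x
  rw [hxy]
  exact hC y (Set.Ico_subset_Icc_self hy)

/-- Differentiability from a bound of the remainder by a remainder `r` which is `o(β - α)` and a
quadratic term; `r` will be the remainder of the initial data. -/
lemma hasDerivAt_of_remainder_le {g r : ℝ → ℝ} {g' α A K : ℝ}
    (h : ∀ β, |g β - g α - (β - α) * g'| ≤ A * (|r β| + K * |β - α| ^ 2))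
    (hr : r =o[𝓝 α] fun β => β - α) : HasDerivAt g g' α := by
  rw [hasDerivAt_iff_isLittleO]
  have h1 : (fun β => A * (|r β| + K * |β - α| ^ 2)) =o[𝓝 α] fun β => β - α := by
    refine Asymptotics.IsLittleO.const_mul_left (Asymptotics.IsLittleO.add ?_ ?_) A
    · exact hr.norm_left
    · refine Asymptotics.IsLittleO.const_mul_left ?_ K
      have : (fun β : ℝ => (β - α) * (β - α)) =o[𝓝 α] fun β => (1 : ℝ) * (β - α) := by
        refine Asymptotics.IsLittleO.mul_isBigO ?_ (Asymptotics.isBigO_refl _ _)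
        rw [Asymptotics.isLittleO_one_iff]
        have : Tendsto (fun β : ℝ => β - α) (𝓝 α) (𝓝 (α - α)) := (continuous_sub_right α).tendsto α
        simpa using this
      simpa [sq_abs, pow_two] using this
  refine Asymptotics.IsBigO.trans_isLittleO (Asymptotics.IsBigO.of_bound 1 ?_) h1
  refine Eventually.of_forall fun β => ?_
  rw [one_mul]
  exact (h β).trans (le_abs_self _)

/-- Joint continuity from continuity in time and continuity in the label that is uniform on bounded
time intervals. -/
lemma continuous_of_locally_uniform {f : ℝ → ℝ → ℝ} (hc : ∀ α, Continuous fun t => f t α)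
    (h : ∀ T α, ∃ r : ℝ → ℝ, Tendsto r (𝓝 α) (𝓝 0) ∧ ∀ β t, |t| ≤ T → |f t β - f t α| ≤ r β) :
    Continuous fun p : ℝ × ℝ => f p.1 p.2 := by
  refine continuous_iff_continuousAt.2 fun p => ?_
  obtain ⟨r, hr, hb⟩ := h (|p.1| + 1) p.2
  have h1 : Tendsto (fun q : ℝ × ℝ => f q.1 p.2) (𝓝 p) (𝓝 (f p.1 p.2)) :=
    ((hc p.2).comp continuous_fst).tendsto p
  have h2 : Tendsto (fun q : ℝ × ℝ => f q.1 q.2 - f q.1 p.2) (𝓝 p) (𝓝 0) := by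
    refine squeeze_zero_norm' (a := fun q : ℝ × ℝ => r q.2) ?_
      (hr.comp (continuous_snd.tendsto p))
    have : ∀ᶠ q : ℝ × ℝ in 𝓝 p, |q.1| < |p.1| + 1 :=
      (continuous_abs.comp continuous_fst).tendsto p (Iio_mem_nhds (by simp))
    filter_upwards [this] with q hq using hb q.2 q.1 hq.le
  simpa [ContinuousAt] using h2.add h1

end Periodic

/-! ### Label derivatives of the flow -/
/-- A velocity profile `v` on the circle of class `C²`, with its first two derivatives. -/
structure IsC2Profile (v v₁ v₂ : ℝ → ℝ) : Prop where
  deriv₀ : ∀ α, HasDerivAt v (v₁ α) α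
  deriv₁ : ∀ α, HasDerivAt v₁ (v₂ α) α
  cont₂ : Continuous v₂
  periodic : Function.Periodic v (2 * Real.pi)

/-- The Lagrangian flow `x(t, α)` of the particles which start at `α` with velocity `v(α)`, with its
velocity `y = ∂_t x` and the label derivatives `J = ∂_α x`, `P = ∂_α y`, `Y = ∂_α J`, `Q = ∂_α P`. -/
structure SectionFlow (a b : ℝ) (F : ForceField) (v v₁ v₂ : ℝ → ℝ) where
  x : ℝ → ℝ → ℝ
  y : ℝ → ℝ → ℝ
  J : ℝ → ℝ → ℝ
  P : ℝ → ℝ → ℝ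
  Y : ℝ → ℝ → ℝ
  Q : ℝ → ℝ → ℝ
  x_eq : ∀ t α, x t α = F.pos a b α (v α) t
  y_eq : ∀ t α, y t α = F.vel a b α (v α) t
  J_zero : ∀ α, J 0 α = 1
  P_zero : ∀ α, P 0 α = v₁ α
  Y_zero : ∀ α, Y 0 α = 0
  Q_zero : ∀ α, Q 0 α = v₂ α
  J_t : ∀ t α, HasDerivAt (fun s => J s α) (P t α) t
  P_t : ∀ t α, HasDerivAt (fun s => P s α) (-(a * P t α) + F.der t (x t α) * J t α) t
  Y_t : ∀ t α, HasDerivAt (fun s => Y s α) (Q t α) t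
  Q_t : ∀ t α, HasDerivAt (fun s => Q s α)
    (-(a * Q t α) + (F.der t (x t α) * Y t α - F.val t (x t α) * J t α ^ 2)) t
  x_a : ∀ t α, HasDerivAt (x t) (J t α) α
  y_a : ∀ t α, HasDerivAt (y t) (P t α) α
  J_a : ∀ t α, HasDerivAt (J t) (Y t α) α
  P_a : ∀ t α, HasDerivAt (P t) (Q t α) α
  cont_x : Continuous fun p : ℝ × ℝ => x p.1 p.2
  cont_y : Continuous fun p : ℝ × ℝ => y p.1 p.2
  cont_J : Continuous fun p : ℝ × ℝ => J p.1 p.2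
  cont_P : Continuous fun p : ℝ × ℝ => P p.1 p.2
  cont_Y : Continuous fun p : ℝ × ℝ => Y p.1 p.2
  cont_Q : Continuous fun p : ℝ × ℝ => Q p.1 p.2

lemma abs_forced_linear_le {a B p q j r ε A : ℝ} (hA : |A| ≤ 2 * B) (hr : |r| ≤ ε)
    (h : q = -(a * p) + (A * j + r)) : |q| ≤ |a| * |p| + 2 * B * |j| + ε := by
  rw [h]
  refine (abs_add_le _ _).trans ?_
  have h1 := abs_add_le (A * j) r
  have h2 : |A * j| ≤ 2 * B * |j| := by rw [abs_mul]; gcongr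
  rw [abs_neg, abs_mul]
  linarith

/-- The variational equations have global solutions `(J, P)` and `(Y, Q)`. These are the label
derivatives: the remainders `x(β) - x(α) - (β - α) J(α)` and `J(β) - J(α) - (β - α) Y(α)` solve
linear equations of second order with a forcing of order `|β - α|²`, so that Grönwall's inequality
bounds them by their initial values up to a quadratic term. -/
theorem exists_sectionFlow (a b : ℝ) (F : ForceField) {v v₁ v₂ : ℝ → ℝ}
    (hv : IsC2Profile v v₁ v₂) : Nonempty (SectionFlow a b F v v₁ v₂) := by
  have hB := F.B_nonneg
  set x : ℝ → ℝ → ℝ := fun t α => F.pos a b α (v α) t with hx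
  set y : ℝ → ℝ → ℝ := fun t α => F.vel a b α (v α) t with hy
  have x_t : ∀ t α, HasDerivAt (fun s => x s α) (y t α) t := fun t α => F.hasDerivAt_pos a b α _ t
  have y_t : ∀ t α, HasDerivAt (fun s => y s α) (-(a * y t α) + (b + F.val t (x t α))) t :=
    fun t α => F.hasDerivAt_vel a b α _ t
  have x_c : ∀ α, Continuous fun t => x t α := fun α =>
    continuous_iff_continuousAt.2 fun t => (x_t t α).continuousAt
  have y_c : ∀ α, Continuous fun t => y t α := fun α =>
    continuous_iff_continuousAt.2 fun t => (y_t t α).continuousAt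
  have hper₁ := periodic_of_hasDerivAt hv.periodic hv.deriv₀
  have hper₂ := periodic_of_hasDerivAt hper₁ hv.deriv₁
  obtain ⟨C₁, hC₁⟩ := exists_bound_of_periodic hper₁
    (continuous_iff_continuousAt.2 fun α => (hv.deriv₁ α).continuousAt)
  obtain ⟨C₂, hC₂⟩ := exists_bound_of_periodic hper₂ hv.cont₂
  have hC₁0 : 0 ≤ C₁ := (abs_nonneg _).trans (hC₁ 0)
  have hC₂0 : 0 ≤ C₂ := (abs_nonneg _).trans (hC₂ 0)
  set A : ℝ → ℝ := fun T => Real.exp ((1 + |a| + 2 * F.B) * T) with hA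
  have hA0 : ∀ T, 0 ≤ A T := fun T => (Real.exp_pos _).le
  -- the first variation
  have hJP : ∀ α, ∃ J P : ℝ → ℝ, J 0 = 1 ∧ P 0 = v₁ α ∧ (∀ t, HasDerivAt J (P t) t) ∧
      ∀ t, HasDerivAt P (-(a * P t) + F.der t (x t α) * J t) t := fun α =>
    exists_secondOrder_solution a (h := fun t j => F.der t (x t α) * j)
      ((F.continuous_der_comp continuous_fst ((x_c α).comp continuous_fst)).mul continuous_snd)
      (L := 2 * F.B) (M := 0) (c := 0)
      (fun t j k => by
        rw [← mul_sub, abs_mul]; gcongr; exact F.abs_der_le _ _) (fun t => by simp) 1 (v₁ α)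
  choose J' P' J_zero P_zero J_t P_t using hJP
  set J : ℝ → ℝ → ℝ := fun t α => J' α t
  set P : ℝ → ℝ → ℝ := fun t α => P' α t
  have J_c : ∀ α, Continuous fun t => J t α := fun α =>
    continuous_iff_continuousAt.2 fun t => (J_t α t).continuousAt
  have P_c : ∀ α, Continuous fun t => P t α := fun α =>
    continuous_iff_continuousAt.2 fun t => (P_t α t).continuousAt
  have JP_bd : ∀ T t α, |t| ≤ T → |J t α| ≤ (1 + C₁) * A T ∧ |P t α| ≤ (1 + C₁) * A T := by
    intro T t α ht
    have := secondOrder_bound (a := a) (c := 2 * F.B) (ε := 0) (T := T) (by positivity) le_rfl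
      (J_t α) (P_t α) (fun t _ => abs_forced_linear_le (r := 0) (F.abs_der_le t (x t α)) (by simp)
        (by ring)) t ht
    rw [J_zero, P_zero, zero_mul, add_zero, abs_one] at this
    have h1 : (1 + |v₁ α|) * A T ≤ (1 + C₁) * A T := by
      have := hA0 T; gcongr; exact hC₁ α
    exact ⟨this.1.trans h1, this.2.trans h1⟩
  -- the second variation
  have hYQ : ∀ α, ∃ Y Q : ℝ → ℝ, Y 0 = 0 ∧ Q 0 = v₂ α ∧ (∀ t, HasDerivAt Y (Q t) t) ∧
      ∀ t, HasDerivAt Q (-(a * Q t) + (F.der t (x t α) * Y t - F.val t (x t α) * J t α ^ 2)) t :=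
    fun α => exists_secondOrder_solution a
      (h := fun t j => F.der t (x t α) * j - F.val t (x t α) * J t α ^ 2)
      (((F.continuous_der_comp continuous_fst ((x_c α).comp continuous_fst)).mul
        continuous_snd).sub ((F.continuous_val_comp continuous_fst
          ((x_c α).comp continuous_fst)).mul (((J_c α).comp continuous_fst).pow 2)))
      (L := 2 * F.B) (M := 2 * F.B * (1 + C₁) ^ 2) (c := 2 * (1 + |a| + 2 * F.B))
      (fun t j k => by
        rw [sub_sub_sub_cancel_right, ← mul_sub, abs_mul]; gcongr; exact F.abs_der_le _ _)
      (fun t => by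
        have h1 := (JP_bd |t| t α le_rfl).1
        have h2 : |J t α| ^ 2 ≤ ((1 + C₁) * A |t|) ^ 2 := by gcongr
        have h3 : ((1 + C₁) * A |t|) ^ 2 =
            (1 + C₁) ^ 2 * Real.exp (2 * (1 + |a| + 2 * F.B) * |t|) := by
          rw [mul_pow, hA, ← Real.exp_nat_mul]; push_cast; ring_nf
        rw [mul_zero, zero_sub, abs_neg, abs_mul, abs_pow, mul_assoc (2 * F.B), ← h3]
        gcongr
        exact F.abs_val_le _ _) 0 (v₂ α)
  choose Y' Q' Y_zero Q_zero Y_t Q_t using hYQ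
  set Y : ℝ → ℝ → ℝ := fun t α => Y' α t
  set Q : ℝ → ℝ → ℝ := fun t α => Q' α t
  have Y_c : ∀ α, Continuous fun t => Y t α := fun α =>
    continuous_iff_continuousAt.2 fun t => (Y_t α t).continuousAt
  have Q_c : ∀ α, Continuous fun t => Q t α := fun α =>
    continuous_iff_continuousAt.2 fun t => (Q_t α t).continuousAt
  -- Lipschitz dependence on the label
  have hvL : ∀ α β, |v β - v α| ≤ C₁ * |β - α| :=
    ForceField.abs_sub_le_of_hasDerivAt hv.deriv₀ hC₁
  have hv₁L : ∀ α β, |v₁ β - v₁ α| ≤ C₂ * |β - α| :=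
    ForceField.abs_sub_le_of_hasDerivAt hv.deriv₁ hC₂
  have x_lip : ∀ T t α β, |t| ≤ T → |x t β - x t α| ≤ (1 + C₁) * A T * |β - α| ∧
      |y t β - y t α| ≤ (1 + C₁) * A T * |β - α| := by
    intro T t α β ht
    have := F.flow_sub_le a b β (v β) (b' := b) (α' := α) (v' := v α) ht
    rw [sub_self, abs_zero, zero_mul, add_zero] at this
    have h1 : (|β - α| + |v β - v α|) * A T ≤ (1 + C₁) * A T * |β - α| := by
      have := hA0 T
      calc _ ≤ (|β - α| + C₁ * |β - α|) * A T := by gcongr; exact hvL α β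
        _ = _ := by ring
    exact ⟨this.1.trans h1, this.2.trans h1⟩
  have J_lip : ∀ T t α β, |t| ≤ T →
      |J t β - J t α| ≤ (C₂ + 2 * F.B * ((1 + C₁) * A T) ^ 2 * T) * A T * |β - α| ∧
      |P t β - P t α| ≤ (C₂ + 2 * F.B * ((1 + C₁) * A T) ^ 2 * T) * A T * |β - α| := by
    intro T t α β ht
    have hT := (abs_nonneg t).trans ht
    have := secondOrder_bound (a := a) (c := 2 * F.B) (T := T)
      (ε := 2 * F.B * ((1 + C₁) * A T * |β - α|) * ((1 + C₁) * A T)) (by positivity)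
      (by have := hA0 T; positivity)
      (fun t => (J_t β t).sub (J_t α t)) (fun t => (P_t β t).sub (P_t α t)) (fun t ht =>
        abs_forced_linear_le (A := F.der t (x t β))
          (r := (F.der t (x t β) - F.der t (x t α)) * J t α)
          (F.abs_der_le _ _) (by
            rw [abs_mul]
            have h1 := (x_lip T t α β ht).1
            have h2 := (JP_bd T t α ht).1
            have h3 := F.abs_der_sub_le t (x t α) (x t β)
            have h4 : 2 * F.B * |x t β - x t α| ≤ 2 * F.B * ((1 + C₁) * A T * |β - α|) := by
              gcongr
            exact mul_le_mul (h3.trans h4) h2 (abs_nonneg _)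
              (by have := hA0 T; positivity)) (by simp only [J, Pi.sub_apply]; ring)) t ht
    simp only [Pi.sub_apply, J_zero, P_zero, sub_self, abs_zero, zero_add] at this
    have h1 : (|v₁ β - v₁ α| + 2 * F.B * ((1 + C₁) * A T * |β - α|) * ((1 + C₁) * A T) * T) * A T ≤
        (C₂ + 2 * F.B * ((1 + C₁) * A T) ^ 2 * T) * A T * |β - α| := by
      have := hA0 T
      calc _ ≤ (C₂ * |β - α| + 2 * F.B * ((1 + C₁) * A T * |β - α|) * ((1 + C₁) * A T) * T) * A T :=
            by gcongr; exact hv₁L α β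
        _ = _ := by ring
    exact ⟨this.1.trans h1, this.2.trans h1⟩
  -- first derivatives in the label
  have x_rem : ∀ T t α β, |t| ≤ T →
      |x t β - x t α - (β - α) * J t α| ≤
        (C₂ + 2 * F.B * ((1 + C₁) * A T) ^ 2 * T) * A T * |β - α| ^ 2 ∧
      |y t β - y t α - (β - α) * P t α| ≤
        (C₂ + 2 * F.B * ((1 + C₁) * A T) ^ 2 * T) * A T * |β - α| ^ 2 := by
    intro T t α β ht
    have hT := (abs_nonneg t).trans ht
    have := secondOrder_bound (a := a) (c := 2 * F.B) (T := T)
      (ε := 2 * F.B * ((1 + C₁) * A T * |β - α|) ^ 2) (by positivity) (by positivity)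
      (fun t => ((x_t t β).sub (x_t t α)).sub ((J_t α t).const_mul (β - α)))
      (fun t => ((y_t t β).sub (y_t t α)).sub ((P_t α t).const_mul (β - α))) (fun t ht =>
        abs_forced_linear_le (A := F.der t (x t α))
          (r := F.val t (x t β) - F.val t (x t α) - F.der t (x t α) * (x t β - x t α))
          (F.abs_der_le _ _) ((F.abs_val_taylor t (x t α) (x t β)).trans (by
            have h1 := (x_lip T t α β ht).1
            gcongr)) (by simp only [Pi.sub_apply]; ring)) t ht
    have hx0 : ∀ α, x 0 α = α := fun α => F.pos_zero _ _ _ _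
    have hy0 : ∀ α, y 0 α = v α := fun α => F.vel_zero _ _ _ _
    simp only [Pi.sub_apply, J_zero, P_zero, hx0, hy0, mul_one, sub_self, abs_zero,
      zero_add] at this
    have h0 := ForceField.abs_sub_sub_le_of_hasDerivAt hv.deriv₀ hv.deriv₁ hC₂ α β
    rw [mul_comm (v₁ α)] at h0
    have h1 : (|v β - v α - (β - α) * v₁ α| +
        2 * F.B * ((1 + C₁) * A T * |β - α|) ^ 2 * T) * A T ≤
        (C₂ + 2 * F.B * ((1 + C₁) * A T) ^ 2 * T) * A T * |β - α| ^ 2 := by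
      have := hA0 T
      calc _ ≤ (C₂ * |β - α| ^ 2 + 2 * F.B * ((1 + C₁) * A T * |β - α|) ^ 2 * T) * A T := by gcongr
        _ = _ := by ring
    exact ⟨this.1.trans h1, this.2.trans h1⟩
  -- second derivatives in the label
  have J_rem : ∀ T α, ∃ K, ∀ t β, |t| ≤ T →
      |J t β - J t α - (β - α) * Y t α| ≤
        A T * (|v₁ β - v₁ α - (β - α) * v₂ α| + K * |β - α| ^ 2) ∧
      |P t β - P t α - (β - α) * Q t α| ≤
        A T * (|v₁ β - v₁ α - (β - α) * v₂ α| + K * |β - α| ^ 2) := by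
    intro T α
    set D := (1 + C₁) * A T with hD
    set K₁ := (C₂ + 2 * F.B * D ^ 2 * T) * A T with hK₁
    refine ⟨(2 * F.B * D ^ 2 * D + 2 * F.B * K₁ * D + 2 * F.B * D * K₁) * T, fun t β ht => ?_⟩
    have hT := (abs_nonneg t).trans ht
    have hD0 : 0 ≤ D := by have := hA0 T; positivity
    have hK₁0 : 0 ≤ K₁ := by have := hA0 T; positivity
    have := secondOrder_bound (a := a) (c := 2 * F.B) (T := T)
      (ε := (2 * F.B * D ^ 2 * D + 2 * F.B * K₁ * D + 2 * F.B * D * K₁) * |β - α| ^ 2)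
      (by positivity) (by positivity)
      (fun t => ((J_t β t).sub (J_t α t)).sub ((Y_t α t).const_mul (β - α)))
      (fun t => ((P_t β t).sub (P_t α t)).sub ((Q_t α t).const_mul (β - α))) (fun t ht =>
        abs_forced_linear_le (A := F.der t (x t α))
          (r := (F.der t (x t β) - F.der t (x t α) + F.val t (x t α) * (x t β - x t α)) * J t β
            - F.val t (x t α) * (x t β - x t α - (β - α) * J t α) * J t β
            - F.val t (x t α) * ((β - α) * J t α) * (J t β - J t α))
          (F.abs_der_le _ _) (by
            have h1 := (x_lip T t α β ht).1
            have h2 := (x_rem T t α β ht).1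
            have h3 := (J_lip T t α β ht).1
            have h4 := (JP_bd T t β ht).1
            have h5 := (JP_bd T t α ht).1
            have h6 := F.abs_der_taylor t (x t α) (x t β)
            have h7 := F.abs_val_le t (x t α)
            rw [← hD] at h1 h2 h3 h4 h5
            rw [← hK₁] at h2 h3
            have h6' : |F.der t (x t β) - F.der t (x t α) + F.val t (x t α) * (x t β - x t α)| ≤
                2 * F.B * (D * |β - α|) ^ 2 := h6.trans (by gcongr)
            have e1 := mul_le_mul h6' h4 (abs_nonneg _) (by positivity)
            have e2 := mul_le_mul (mul_le_mul h7 h2 (abs_nonneg _) (by positivity)) h4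
              (abs_nonneg _) (by positivity)
            have e3 : |F.val t (x t α)| * (|β - α| * |J t α|) * |J t β - J t α| ≤
              2 * F.B * (|β - α| * D) * (K₁ * |β - α|) := by gcongr
            refine (abs_sub _ _).trans ?_
            refine (add_le_add_left (abs_sub _ _) _).trans ?_
            simp only [abs_mul] at e1 e2 e3 ⊢
            calc _ ≤ _ := add_le_add (add_le_add e1 e2) e3
              _ = _ := by ring)
          (by simp only [J, Pi.sub_apply]; ring)) t ht
    simp only [Pi.sub_apply, J_zero, P_zero, Y_zero, Q_zero, mul_zero, sub_self, abs_zero,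
      zero_add] at this
    refine ⟨this.1.trans (le_of_eq ?_), this.2.trans (le_of_eq ?_)⟩ <;> · simp only [hA]; ring
  have Y_lip : ∀ T α, ∃ K, ∀ t β, |t| ≤ T →
      |Y t β - Y t α| ≤ (|v₂ β - v₂ α| + K * |β - α|) * A T ∧
      |Q t β - Q t α| ≤ (|v₂ β - v₂ α| + K * |β - α|) * A T := by
    intro T α
    set D := (1 + C₁) * A T with hD
    set K₁ := (C₂ + 2 * F.B * D ^ 2 * T) * A T with hK₁
    obtain ⟨CY, hCY⟩ := (isCompact_Icc (a := -T) (b := T)).exists_bound_of_continuousOn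
      (Y_c α).continuousOn
    refine ⟨(2 * F.B * D * |CY| + 2 * F.B * D * D ^ 2 + 2 * F.B * (K₁ * (D + D))) * T,
      fun t β ht => ?_⟩
    have hT := (abs_nonneg t).trans ht
    have hD0 : 0 ≤ D := by have := hA0 T; positivity
    have hK₁0 : 0 ≤ K₁ := by have := hA0 T; positivity
    have := secondOrder_bound (a := a) (c := 2 * F.B) (T := T)
      (ε := (2 * F.B * D * |CY| + 2 * F.B * D * D ^ 2 + 2 * F.B * (K₁ * (D + D))) * |β - α|)
      (by positivity) (by positivity)
      (fun t => (Y_t β t).sub (Y_t α t)) (fun t => (Q_t β t).sub (Q_t α t)) (fun t ht =>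
        abs_forced_linear_le (A := F.der t (x t β))
          (r := (F.der t (x t β) - F.der t (x t α)) * Y t α
            - (F.val t (x t β) - F.val t (x t α)) * J t β ^ 2
            - F.val t (x t α) * ((J t β - J t α) * (J t β + J t α)))
          (F.abs_der_le _ _) (by
            have h1 := (x_lip T t α β ht).1
            have h3 := (J_lip T t α β ht).1
            have h4 := (JP_bd T t β ht).1
            have h5 := (JP_bd T t α ht).1
            have h6 := F.abs_der_sub_le t (x t α) (x t β)
            have h6' := F.abs_val_sub_le t (x t α) (x t β)
            have h7 := F.abs_val_le t (x t α)
            have h8 : |Y t α| ≤ |CY| := (hCY t (abs_le.1 ht)).trans (le_abs_self _)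
            rw [← hD] at h1 h3 h4 h5
            rw [← hK₁] at h3
            have h9 : |J t β + J t α| ≤ D + D := (abs_add_le _ _).trans (add_le_add h4 h5)
            have e1 : |F.der t (x t β) - F.der t (x t α)| * |Y t α| ≤
                2 * F.B * (D * |β - α|) * |CY| := by
              refine mul_le_mul (h6.trans ?_) h8 (abs_nonneg _) (by positivity)
              gcongr
            have e2 : |F.val t (x t β) - F.val t (x t α)| * |J t β| ^ 2 ≤
                2 * F.B * (D * |β - α|) * D ^ 2 := by
              refine mul_le_mul (h6'.trans ?_) ?_ (by positivity) (by positivity) <;> gcongr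
            have e3 : |F.val t (x t α)| * (|J t β - J t α| * |J t β + J t α|) ≤
              2 * F.B * ((K₁ * |β - α|) * (D + D)) := by gcongr
            refine (abs_sub _ _).trans ?_
            refine (add_le_add_left (abs_sub _ _) _).trans ?_
            simp only [abs_mul, abs_pow] at e1 e2 e3 ⊢
            calc _ ≤ _ := add_le_add (add_le_add e1 e2) e3
              _ = _ := by ring)
          (by simp only [J, Y, Pi.sub_apply]; ring)) t ht
    simp only [Pi.sub_apply, Y_zero, Q_zero, sub_self, abs_zero, zero_add] at this
    refine ⟨this.1.trans (le_of_eq ?_), this.2.trans (le_of_eq ?_)⟩ <;> · simp only [hA]; ring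
  have hsub : ∀ α, Tendsto (fun β : ℝ => |β - α|) (𝓝 α) (𝓝 0) := fun α => by
    have : Continuous fun β : ℝ => |β - α| := by fun_prop
    simpa using this.tendsto α
  have hlip0 : ∀ K α : ℝ, Tendsto (fun β : ℝ => K * |β - α|) (𝓝 α) (𝓝 0) := fun K α => by
    simpa using (hsub α).const_mul K
  have hY0 : ∀ K T α : ℝ, Tendsto (fun β : ℝ => (|v₂ β - v₂ α| + K * |β - α|) * A T)
      (𝓝 α) (𝓝 0) := fun K T α => by
    have : Continuous fun β => |v₂ β - v₂ α| := (hv.cont₂.sub continuous_const).abs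
    have h := ((this.tendsto α).add (hlip0 K α)).mul_const (A T)
    simpa using h
  have hsq : ∀ α, (fun β => (0 : ℝ)) =o[𝓝 α] fun β : ℝ => β - α := fun α =>
    Asymptotics.isLittleO_zero _ _
  have hv₂o : ∀ α, (fun β => v₁ β - v₁ α - (β - α) * v₂ α) =o[𝓝 α] fun β : ℝ => β - α := fun α =>
    (hasDerivAt_iff_isLittleO.1 (hv.deriv₁ α))
  exact ⟨{
    x := x, y := y, J := J, P := P, Y := Y, Q := Q
    x_eq := fun _ _ => rfl
    y_eq := fun _ _ => rfl
    J_zero := J_zero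
    P_zero := P_zero
    Y_zero := Y_zero
    Q_zero := Q_zero
    J_t := fun t α => J_t α t
    P_t := fun t α => P_t α t
    Y_t := fun t α => Y_t α t
    Q_t := fun t α => Q_t α t
    x_a := fun t α => hasDerivAt_of_remainder_le (r := fun _ => 0) (A := 1) (fun β => by
      simpa using (x_rem |t| t α β le_rfl).1) (hsq α)
    y_a := fun t α => hasDerivAt_of_remainder_le (r := fun _ => 0) (A := 1) (fun β => by
      simpa using (x_rem |t| t α β le_rfl).2) (hsq α)
    J_a := fun t α => by
      obtain ⟨K, hK⟩ := J_rem |t| α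
      exact hasDerivAt_of_remainder_le (fun β => (hK t β le_rfl).1) (hv₂o α)
    P_a := fun t α => by
      obtain ⟨K, hK⟩ := J_rem |t| α
      exact hasDerivAt_of_remainder_le (fun β => (hK t β le_rfl).2) (hv₂o α)
    cont_x := continuous_of_locally_uniform x_c fun T α =>
      ⟨_, hlip0 _ α, fun β t ht => (x_lip T t α β ht).1⟩
    cont_y := continuous_of_locally_uniform y_c fun T α =>
      ⟨_, hlip0 _ α, fun β t ht => (x_lip T t α β ht).2⟩
    cont_J := continuous_of_locally_uniform J_c fun T α =>
      ⟨_, hlip0 _ α, fun β t ht => (J_lip T t α β ht).1⟩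
    cont_P := continuous_of_locally_uniform P_c fun T α =>
      ⟨_, hlip0 _ α, fun β t ht => (J_lip T t α β ht).2⟩
    cont_Y := continuous_of_locally_uniform Y_c fun T α => by
      obtain ⟨K, hK⟩ := Y_lip T α
      exact ⟨_, hY0 K T α, fun β t ht => (hK t β ht).1⟩
    cont_Q := continuous_of_locally_uniform Q_c fun T α => by
      obtain ⟨K, hK⟩ := Y_lip T α
      exact ⟨_, hY0 K T α, fun β t ht => (hK t β ht).2⟩ }⟩


/-! ### Weak derivatives of periodic functions of one variable -/

/-- `f'` is the weak derivative of the function `f` on the circle; the test functions are the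
`2π`-periodic functions `φ` of class `C¹`, given with their derivative. -/
structure SecWeak (f f' : ℝ → ℝ) : Prop where
  int : IntervalIntegrable f volume 0 (2 * Real.pi)
  int' : IntervalIntegrable f' volume 0 (2 * Real.pi)
  weak : ∀ φ φ' : ℝ → ℝ, (∀ x, HasDerivAt φ (φ' x) x) → Continuous φ' →
    Function.Periodic φ (2 * Real.pi) →
    ∫ x in (0 : ℝ)..2 * Real.pi, f x * φ' x = -∫ x in (0 : ℝ)..2 * Real.pi, f' x * φ x

lemma continuous_of_hasDerivAt {f f' : ℝ → ℝ} (h : ∀ x, HasDerivAt f (f' x) x) : Continuous f :=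
  continuous_iff_continuousAt.2 fun x => (h x).continuousAt

namespace SecWeak

variable {f f' g g' b b' : ℝ → ℝ}

lemma of_hasDerivAt (h : ∀ x, HasDerivAt f (f' x) x) (hc : Continuous f')
    (hp : Function.Periodic f (2 * Real.pi)) : SecWeak f f' where
  int := (continuous_of_hasDerivAt h).intervalIntegrable _ _
  int' := hc.intervalIntegrable _ _
  weak φ φ' hφ hφc hφp := by
    have := intervalIntegral.integral_mul_deriv_eq_deriv_mul (a := 0) (b := 2 * Real.pi)
      (fun x _ => h x) (fun x _ => hφ x) (hc.intervalIntegrable _ _) (hφc.intervalIntegrable _ _)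
    rw [this, ← hp 0, ← hφp 0]
    simp

lemma add (hf : SecWeak f f') (hg : SecWeak g g') :
    SecWeak (fun x => f x + g x) (fun x => f' x + g' x) where
  int := hf.int.add hg.int
  int' := hf.int'.add hg.int'
  weak φ φ' hφ hφc hφp := by
    have hφ0 := continuous_of_hasDerivAt hφ
    simp only [add_mul]
    rw [intervalIntegral.integral_add (hf.int.mul_continuousOn hφc.continuousOn)
      (hg.int.mul_continuousOn hφc.continuousOn),
      intervalIntegral.integral_add (hf.int'.mul_continuousOn hφ0.continuousOn)
      (hg.int'.mul_continuousOn hφ0.continuousOn), hf.weak φ φ' hφ hφc hφp,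
      hg.weak φ φ' hφ hφc hφp]
    ring

lemma mul (hf : SecWeak f f') (hb : ∀ x, HasDerivAt b (b' x) x) (hc : Continuous b')
    (hp : Function.Periodic b (2 * Real.pi)) :
    SecWeak (fun x => f x * b x) (fun x => f' x * b x + f x * b' x) where
  int := hf.int.mul_continuousOn (continuous_of_hasDerivAt hb).continuousOn
  int' := (hf.int'.mul_continuousOn (continuous_of_hasDerivAt hb).continuousOn).add
    (hf.int.mul_continuousOn hc.continuousOn)
  weak φ φ' hφ hφc hφp := by
    have hφ0 := continuous_of_hasDerivAt hφ
    have hb0 := continuous_of_hasDerivAt hb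
    have c1 : Continuous fun x => b' x * φ x := hc.mul hφ0
    have c2 : Continuous fun x => b x * φ x := hb0.mul hφ0
    have h := hf.weak (fun x => b x * φ x) (fun x => b' x * φ x + b x * φ' x)
      (fun x => (hb x).mul (hφ x)) ((hc.mul hφ0).add (hb0.mul hφc)) (hp.mul hφp)
    have e1 : ∀ x, f x * (b' x * φ x + b x * φ' x) = f x * (b' x * φ x) + f x * b x * φ' x :=
      fun x => by ring
    have e2 : ∀ x, (f' x * b x + f x * b' x) * φ x =
      f' x * (b x * φ x) + f x * (b' x * φ x) := fun x => by ring
    simp only [e1] at h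
    simp only [e2]
    rw [intervalIntegral.integral_add (hf.int.mul_continuousOn c1.continuousOn)
      ((hf.int.mul_continuousOn hb0.continuousOn).mul_continuousOn hφc.continuousOn)] at h
    rw [intervalIntegral.integral_add (hf.int'.mul_continuousOn c2.continuousOn)
      (hf.int.mul_continuousOn c1.continuousOn)]
    linarith

lemma congr (hf : SecWeak f f') (h : ∀ x, f x = g x) (h' : ∀ x, f' x = g' x) : SecWeak g g' := by
  rw [← funext h, ← funext h']; exact hf

end SecWeak

section ParametricIntegral

/-- Differentiation under the integral sign. Continuity is required for times in `[0, t]` only, since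
the quotients by `J` to which this is applied may be singular outside. -/
lemma hasDerivAt_integral_param {G G₁ : ℝ → ℝ → ℝ} {t : ℝ} (ht : 0 ≤ t)
    (hG : ContinuousOn (fun p : ℝ × ℝ => G p.1 p.2) (Set.Icc 0 t ×ˢ Set.univ))
    (hG₁ : ContinuousOn (fun p : ℝ × ℝ => G₁ p.1 p.2) (Set.Icc 0 t ×ˢ Set.univ))
    (hd : ∀ s ∈ Set.Icc 0 t, ∀ α, HasDerivAt (G s) (G₁ s α) α) :
    (∀ α, HasDerivAt (fun α => ∫ s in (0 : ℝ)..t, G s α) (∫ s in (0 : ℝ)..t, G₁ s α) α) ∧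
      Continuous fun α => ∫ s in (0 : ℝ)..t, G₁ s α := by
  -- freeze the time outside `[0, t]`
  set π : ℝ → ℝ := fun s => (Set.projIcc 0 t ht s : ℝ) with hπ
  have hπc : Continuous π := continuous_subtype_val.comp continuous_projIcc
  have hπm : ∀ s, π s ∈ Set.Icc 0 t := fun s => (Set.projIcc 0 t ht s).2
  have hπe : ∀ s ∈ Set.uIcc 0 t, π s = s := fun s hs => by
    rw [Set.uIcc_of_le ht] at hs
    simp [hπ, Set.projIcc_of_mem ht hs]
  have hc : Continuous fun p : ℝ × ℝ => G (π p.1) p.2 :=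
    hG.comp_continuous (f := fun p : ℝ × ℝ => (π p.1, p.2)) (by fun_prop)
      fun p => ⟨hπm _, trivial⟩
  have hc₁ : Continuous fun p : ℝ × ℝ => G₁ (π p.1) p.2 :=
    hG₁.comp_continuous (f := fun p : ℝ × ℝ => (π p.1, p.2)) (by fun_prop)
      fun p => ⟨hπm _, trivial⟩
  have e : (fun α => ∫ s in (0 : ℝ)..t, G s α) = fun α => ∫ s in (0 : ℝ)..t, G (π s) α :=
    funext fun α => intervalIntegral.integral_congr fun s hs => by simp only [hπe s hs]
  have e₁ : (fun α => ∫ s in (0 : ℝ)..t, G₁ s α) = fun α => ∫ s in (0 : ℝ)..t, G₁ (π s) α :=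
    funext fun α => intervalIntegral.integral_congr fun s hs => by simp only [hπe s hs]
  constructor
  · intro α
    rw [e, show (∫ s in (0 : ℝ)..t, G₁ s α) = _ from congrFun e₁ α]
    obtain ⟨K, hK⟩ := ((isCompact_Icc (a := (0 : ℝ)) (b := t)).prod
      (isCompact_Icc (a := α - 1) (b := α + 1))).exists_bound_of_continuousOn hc₁.continuousOn
    refine (intervalIntegral.hasDerivAt_integral_of_dominated_loc_of_deriv_le
      (F := fun α s => G (π s) α) (F' := fun α s => G₁ (π s) α) (bound := fun _ => K)
      (s := Set.Icc (α - 1) (α + 1)) (Icc_mem_nhds (by linarith) (by linarith)) ?_ ?_ ?_ ?_ ?_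
      ?_).2
    · exact Eventually.of_forall fun β =>
        (hc.comp (by fun_prop : Continuous fun s : ℝ => (s, β))).aestronglyMeasurable
    · exact (hc.comp (by fun_prop : Continuous fun s : ℝ => (s, α))).intervalIntegrable _ _
    · exact (hc₁.comp (by fun_prop : Continuous fun s : ℝ => (s, α))).aestronglyMeasurable
    · refine ae_of_all _ fun s hs β hβ => ?_
      rw [Set.uIoc_of_le ht] at hs
      exact hK (s, β) ⟨⟨hs.1.le, hs.2⟩, hβ⟩
    · exact intervalIntegrable_const
    · exact ae_of_all _ fun s _ β _ => hd _ (hπm s) β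
  · rw [e₁]
    exact intervalIntegral.continuous_parametric_intervalIntegral_of_continuous'
      (f := fun α s => G₁ (π s) α)
      (hc₁.comp (by fun_prop : Continuous fun p : ℝ × ℝ => (p.2, p.1))) 0 t

lemma continuousOn_integral_of_continuousOn {f : ℝ → ℝ} {s : ℝ} (hs : 0 ≤ s)
    (hf : ContinuousOn f (Set.Icc 0 s)) :
    ContinuousOn (fun t => ∫ r in (0 : ℝ)..t, f r) (Set.Icc 0 s) := by
  have := intervalIntegral.continuousOn_primitive_interval (μ := volume) (f := f) (a := 0) (b := s)
    (by rw [Set.uIcc_of_le hs]; exact hf.integrableOn_Icc)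
  rwa [Set.uIcc_of_le hs] at this

end ParametricIntegral

/-! ### Higher label derivatives of the flow -/

namespace SectionFlow

variable {a b : ℝ} {F : ForceField} {v v₁ v₂ : ℝ → ℝ} (φ : SectionFlow a b F v v₁ v₂)

lemma x_zero (α : ℝ) : φ.x 0 α = α := by rw [φ.x_eq, F.pos_zero]

lemma y_zero (α : ℝ) : φ.y 0 α = v α := by rw [φ.y_eq, F.vel_zero]

lemma x_t (t α : ℝ) : HasDerivAt (fun s => φ.x s α) (φ.y t α) t := by
  have e : (fun s => φ.x s α) = F.pos a b α (v α) := funext fun s => φ.x_eq s α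
  rw [e, φ.y_eq]; exact F.hasDerivAt_pos a b α (v α) t

lemma y_t (t α : ℝ) :
    HasDerivAt (fun s => φ.y s α) (-(a * φ.y t α) + (b + F.val t (φ.x t α))) t := by
  have e : (fun s => φ.y s α) = F.vel a b α (v α) := funext fun s => φ.y_eq s α
  rw [e, φ.y_eq, φ.x_eq]; exact F.hasDerivAt_vel a b α (v α) t

/-- For `t ≥ 0`, the flow commutes with the translation by `2π`. -/
lemma xy_periodic (hv : Function.Periodic v (2 * Real.pi)) {t : ℝ} (ht : 0 ≤ t) (α : ℝ) :
    φ.x t (α + 2 * Real.pi) = φ.x t α + 2 * Real.pi ∧ φ.y t (α + 2 * Real.pi) = φ.y t α := by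
  have hx : ∀ s, HasDerivAt (fun s => φ.x s α + 2 * Real.pi) (φ.y s α) s := fun s =>
    (φ.x_t s α).add_const _
  have hy : ∀ s, HasDerivAt (fun s => φ.y s α)
      (-(a * φ.y s α) + (b + F.val s (φ.x s α + 2 * Real.pi))) s := fun s => by
    rw [F.val_add_two_pi]; exact φ.y_t s α
  have := F.flow_unique a b (α + 2 * Real.pi) (v α) (x := fun s => φ.x s α + 2 * Real.pi)
    (y := fun s => φ.y s α) (T := t) (by simp [φ.x_zero]) (φ.y_zero α)
    (continuous_of_hasDerivAt hx).continuousOn (continuous_of_hasDerivAt hy).continuousOn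
    (fun s _ => hx s) (fun s _ => hy s) t ⟨ht, le_rfl⟩
  rw [φ.x_eq t (α + 2 * Real.pi), φ.y_eq t (α + 2 * Real.pi), hv α]
  exact ⟨this.1.symm, this.2.symm⟩

lemma periodic_y (hv : Function.Periodic v (2 * Real.pi)) {t : ℝ} (ht : 0 ≤ t) :
    Function.Periodic (φ.y t) (2 * Real.pi) := fun α => (φ.xy_periodic hv ht α).2

lemma periodic_J (hv : Function.Periodic v (2 * Real.pi)) {t : ℝ} (ht : 0 ≤ t) :
    Function.Periodic (φ.J t) (2 * Real.pi) := by
  have h1 : Function.Periodic (fun α => φ.x t α - α) (2 * Real.pi) := fun α => by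
    simp only [(φ.xy_periodic hv ht α).1]; ring
  have h2 := periodic_of_hasDerivAt h1 (f' := fun α => φ.J t α - 1)
    (fun α => (φ.x_a t α).sub (hasDerivAt_id α))
  intro α
  simpa using h2 α

lemma periodic_P (hv : Function.Periodic v (2 * Real.pi)) {t : ℝ} (ht : 0 ≤ t) :
    Function.Periodic (φ.P t) (2 * Real.pi) :=
  periodic_of_hasDerivAt (φ.periodic_y hv ht) (φ.y_a t)

lemma periodic_Y (hv : Function.Periodic v (2 * Real.pi)) {t : ℝ} (ht : 0 ≤ t) :
    Function.Periodic (φ.Y t) (2 * Real.pi) :=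
  periodic_of_hasDerivAt (φ.periodic_J hv ht) (φ.J_a t)

lemma periodic_Q (hv : Function.Periodic v (2 * Real.pi)) {t : ℝ} (ht : 0 ≤ t) :
    Function.Periodic (φ.Q t) (2 * Real.pi) :=
  periodic_of_hasDerivAt (φ.periodic_P hv ht) (φ.P_a t)

/-- The numerator `∂_α P · J - P · ∂_α J` of the label derivative of `P / J`; along the flow
`∂_θ² u = W / J³`. -/
def W (t α : ℝ) : ℝ := φ.Q t α * φ.J t α - φ.P t α * φ.Y t α

lemma W_t (t α : ℝ) : HasDerivAt (fun s => φ.W s α)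
    (-(a * φ.W t α) - F.val t (φ.x t α) * φ.J t α ^ 3) t := by
  have := ((φ.Q_t t α).mul (φ.J_t t α)).sub ((φ.P_t t α).mul (φ.Y_t t α))
  refine this.congr_deriv ?_
  unfold W; ring

lemma cont_W : Continuous fun p : ℝ × ℝ => φ.W p.1 p.2 := by
  have := φ.cont_Q; have := φ.cont_J; have := φ.cont_P; have := φ.cont_Y
  unfold W; fun_prop

lemma periodic_W (hv : Function.Periodic v (2 * Real.pi)) {t : ℝ} (ht : 0 ≤ t) :
    Function.Periodic (φ.W t) (2 * Real.pi) := fun α => by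
  simp only [W, φ.periodic_Q hv ht α, φ.periodic_J hv ht α, φ.periodic_P hv ht α,
    φ.periodic_Y hv ht α]

/-- The force term in `e^{at} W = v'' + wForce`. -/
noncomputable def wForce (t α : ℝ) : ℝ :=
  ∫ s in (0 : ℝ)..t, -(Real.exp (a * s) * (F.val s (φ.x s α) * φ.J s α ^ 3))

/-- The label derivative of `wForce`. -/
noncomputable def wForceA (t α : ℝ) : ℝ :=
  ∫ s in (0 : ℝ)..t, -(Real.exp (a * s) * (F.der s (φ.x s α) * φ.J s α ^ 4 +
    3 * F.val s (φ.x s α) * φ.J s α ^ 2 * φ.Y s α))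

lemma cont_val : Continuous fun p : ℝ × ℝ => F.val p.1 (φ.x p.1 p.2) :=
  F.continuous_val_comp continuous_fst φ.cont_x

lemma cont_der : Continuous fun p : ℝ × ℝ => F.der p.1 (φ.x p.1 p.2) :=
  F.continuous_der_comp continuous_fst φ.cont_x

/-- `W` solves `∂_t W = -a W - F(x) J³`, in which neither `Y` nor `Q` occurs: the terms with the
highest derivatives cancel. Hence `W` is an explicit multiple of `v₂` plus a `C¹` function, and the
Eulerian derivatives lose no regularity. -/
lemma W_eq (t α : ℝ) : φ.W t α = Real.exp (-(a * t)) * (v₂ α + φ.wForce t α) := by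
  have h1 : ∀ s, HasDerivAt (fun s => Real.exp (a * s) * φ.W s α)
      (-(Real.exp (a * s) * (F.val s (φ.x s α) * φ.J s α ^ 3))) s := fun s => by
    have h2 : HasDerivAt (fun s => Real.exp (a * s)) (Real.exp (a * s) * a) s := by
      simpa using ((hasDerivAt_id s).const_mul a).exp
    refine (h2.mul (φ.W_t s α)).congr_deriv ?_
    ring
  have hc : Continuous fun s => -(Real.exp (a * s) * (F.val s (φ.x s α) * φ.J s α ^ 3)) := by
    have h1 := φ.cont_val.comp (by fun_prop : Continuous fun s : ℝ => (s, α))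
    have h2 := φ.cont_J.comp (by fun_prop : Continuous fun s : ℝ => (s, α))
    simp only [Function.comp_def] at h1 h2
    fun_prop
  have h3 := intervalIntegral.integral_eq_sub_of_hasDerivAt (a := 0) (b := t)
    (fun s _ => h1 s) (hc.intervalIntegrable _ _)
  have h4 : φ.W 0 α = v₂ α := by simp [W, φ.J_zero, φ.Y_zero, φ.Q_zero]
  simp only [mul_zero, Real.exp_zero, one_mul, h4] at h3
  have h5 : φ.wForce t α = Real.exp (a * t) * φ.W t α - v₂ α := h3
  rw [h5, add_sub_cancel, ← mul_assoc, ← Real.exp_add]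
  simp

lemma wForce_a {t : ℝ} (ht : 0 ≤ t) :
    (∀ α, HasDerivAt (φ.wForce t) (φ.wForceA t α) α) ∧ Continuous (φ.wForceA t) := by
  have c1 := φ.cont_val
  have c2 := φ.cont_J
  have c3 := φ.cont_Y
  have c4 := φ.cont_der
  refine hasDerivAt_integral_param
    (G := fun s α => -(Real.exp (a * s) * (F.val s (φ.x s α) * φ.J s α ^ 3)))
    (G₁ := fun s α => -(Real.exp (a * s) * (F.der s (φ.x s α) * φ.J s α ^ 4 +
    3 * F.val s (φ.x s α) * φ.J s α ^ 2 * φ.Y s α))) ht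
    (Continuous.continuousOn (by fun_prop)) (Continuous.continuousOn (by fun_prop))
    fun s _ α => ?_
  have h1 := (F.hasDerivAt_val s (φ.x s α)).comp α (φ.x_a s α)
  have h2 := ((h1.mul ((φ.J_a s α).pow 3)).const_mul (Real.exp (a * s))).neg
  refine h2.congr_deriv ?_
  simp only [Function.comp_def, Nat.cast_ofNat, Pi.pow_apply]
  ring

lemma periodic_wForce (hv : Function.Periodic v (2 * Real.pi)) {t : ℝ} (ht : 0 ≤ t) :
    Function.Periodic (φ.wForce t) (2 * Real.pi) := fun α => by
  unfold wForce
  refine intervalIntegral.integral_congr fun s hs => ?_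
  rw [Set.uIcc_of_le ht] at hs
  simp only [(φ.xy_periodic hv hs.1 α).1, F.val_add_two_pi, φ.periodic_J hv hs.1 α]

/-- `∂_α J / J = ∫ W / J²` as long as `J` does not vanish. -/
lemma Y_eq {t : ℝ} (ht : 0 ≤ t) {α : ℝ} (hJ : ∀ s ∈ Set.Icc 0 t, φ.J s α ≠ 0) :
    φ.Y t α = φ.J t α * ∫ s in (0 : ℝ)..t, φ.W s α / φ.J s α ^ 2 := by
  have h1 : ∀ s ∈ Set.uIcc 0 t, HasDerivAt (fun s => φ.Y s α / φ.J s α)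
      (φ.W s α / φ.J s α ^ 2) s := fun s hs => by
    rw [Set.uIcc_of_le ht] at hs
    refine ((φ.Y_t s α).div (φ.J_t s α) (hJ s hs)).congr_deriv ?_
    unfold W; ring
  have hc : ContinuousOn (fun s => φ.W s α / φ.J s α ^ 2) (Set.uIcc 0 t) := by
    rw [Set.uIcc_of_le ht]
    refine ContinuousOn.div ?_ ?_ fun s hs => pow_ne_zero 2 (hJ s hs)
    · exact (φ.cont_W.comp (by fun_prop : Continuous fun s : ℝ => (s, α))).continuousOn
    · exact ((φ.cont_J.comp (by fun_prop : Continuous fun s : ℝ => (s, α))).pow 2).continuousOn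
  have h2 := intervalIntegral.integral_eq_sub_of_hasDerivAt h1 hc.intervalIntegrable
  rw [h2, φ.Y_zero, zero_div, sub_zero, mul_div_cancel₀ _ (hJ t ⟨ht, le_rfl⟩)]

end SectionFlow


/-! ### Eulerian derivatives in Lagrangian coordinates -/
namespace SectionFlow

variable {a b : ℝ} {F : ForceField} {v v₁ v₂ : ℝ → ℝ} (φ : SectionFlow a b F v v₁ v₂)

/-- `∂_θ² u` in Lagrangian coordinates. -/
noncomputable def uxx (t α : ℝ) : ℝ := φ.W t α / φ.J t α ^ 3

/-- `∂_θ³ u` in Lagrangian coordinates; `v₃` is the third derivative of the initial velocity. -/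
noncomputable def uxxx (v₃ : ℝ → ℝ) (t α : ℝ) : ℝ :=
  (Real.exp (-(a * t)) * (v₃ α + φ.wForceA t α) / φ.J t α ^ 3 -
    3 * φ.W t α * φ.Y t α / φ.J t α ^ 4) / φ.J t α

/-- `∂_θ ρ` in Lagrangian coordinates; `r₀` is the initial density and `r₁` its derivative. -/
noncomputable def rx (r₀ r₁ : ℝ → ℝ) (t α : ℝ) : ℝ :=
  (r₁ α / φ.J t α - r₀ α * φ.Y t α / φ.J t α ^ 2) / φ.J t α

/-- The coefficient of `v₂` in `∂_α J / J`. -/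
noncomputable def vCoeff (t α : ℝ) : ℝ :=
  ∫ s in (0 : ℝ)..t, Real.exp (-(a * s)) / φ.J s α ^ 2

/-- The part of `∂_α (∂_α J / J)` which does not contain the third derivative of the initial
velocity. -/
noncomputable def lowerPart (t α : ℝ) : ℝ :=
  ∫ s in (0 : ℝ)..t, (Real.exp (-(a * s)) * φ.wForceA s α / φ.J s α ^ 2 -
    2 * φ.W s α * φ.Y s α / φ.J s α ^ 3)

/-- `∂_θ² ρ` in Lagrangian coordinates; `r₀`, `r₁`, `r₂` are the initial density and its
derivatives, `v₃` is the third derivative of the initial velocity. -/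
noncomputable def rxx (r₀ r₁ r₂ v₃ : ℝ → ℝ) (t α : ℝ) : ℝ :=
  (r₂ α / φ.J t α ^ 2 - 3 * r₁ α * φ.Y t α / φ.J t α ^ 3 -
    r₀ α * (v₃ α * φ.vCoeff t α + φ.lowerPart t α) / φ.J t α ^ 2 +
    2 * r₀ α * φ.Y t α ^ 2 / φ.J t α ^ 4) / φ.J t α

lemma cont_wForceA : Continuous fun p : ℝ × ℝ => φ.wForceA p.1 p.2 := by
  have c1 := φ.cont_val
  have c2 := φ.cont_J
  have c3 := φ.cont_Y
  have c4 := φ.cont_der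
  have h : Continuous fun p : ℝ × ℝ => -(Real.exp (a * p.1) * (F.der p.1 (φ.x p.1 p.2) *
      φ.J p.1 p.2 ^ 4 + 3 * F.val p.1 (φ.x p.1 p.2) * φ.J p.1 p.2 ^ 2 * φ.Y p.1 p.2)) := by
    fun_prop
  exact intervalIntegral.continuous_parametric_intervalIntegral_of_continuous
    (f := fun (p : ℝ × ℝ) s => -(Real.exp (a * s) * (F.der s (φ.x s p.2) * φ.J s p.2 ^ 4 +
      3 * F.val s (φ.x s p.2) * φ.J s p.2 ^ 2 * φ.Y s p.2)))
    (h.comp (by fun_prop : Continuous fun q : (ℝ × ℝ) × ℝ => (q.2, q.1.2))) continuous_fst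

lemma wForce_eq (t α : ℝ) : φ.wForce t α = Real.exp (a * t) * φ.W t α - v₂ α := by
  rw [φ.W_eq, ← mul_assoc, ← Real.exp_add]
  simp

/-- In this lemma and the following ones a weak derivative `f_α = h · J` says that `h` is the Eulerian
derivative `∂_θ` of the Eulerian quantity which corresponds to `f`. -/
lemma secWeak_y (hv : Function.Periodic v (2 * Real.pi)) {t : ℝ} (ht : 0 ≤ t)
    (hJ : ∀ α, 0 < φ.J t α) :
    SecWeak (φ.y t) (fun α => φ.P t α / φ.J t α * φ.J t α) := by
  have h : SecWeak (φ.y t) (φ.P t) := SecWeak.of_hasDerivAt (φ.y_a t)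
    (continuous_of_hasDerivAt (φ.P_a t)) (φ.periodic_y hv ht)
  exact h.congr (fun _ => rfl) fun α => by rw [div_mul_cancel₀ _ (hJ α).ne']

lemma secWeak_ux (hv : Function.Periodic v (2 * Real.pi)) {t : ℝ} (ht : 0 ≤ t)
    (hJ : ∀ α, 0 < φ.J t α) :
    SecWeak (fun α => φ.P t α / φ.J t α) (fun α => φ.uxx t α * φ.J t α) := by
  refine SecWeak.of_hasDerivAt (fun α => ?_) ?_ ?_
  · refine ((φ.P_a t α).div (φ.J_a t α) (hJ α).ne').congr_deriv ?_
    have := (hJ α).ne'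
    unfold uxx W
    field_simp
  · have c1 := φ.cont_W.comp (by fun_prop : Continuous fun α : ℝ => (t, α))
    have c2 := continuous_of_hasDerivAt (φ.J_a t)
    exact (c1.div (c2.pow 3) fun α => pow_ne_zero 3 (hJ α).ne').mul c2
  · intro α
    simp only [φ.periodic_P hv ht α, φ.periodic_J hv ht α]

lemma secWeak_rho (hv : Function.Periodic v (2 * Real.pi)) {t : ℝ} (ht : 0 ≤ t)
    (hJ : ∀ α, 0 < φ.J t α) {r₀ r₁ : ℝ → ℝ} (hr : ∀ α, HasDerivAt r₀ (r₁ α) α)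
    (hr₁ : Continuous r₁) (hrp : Function.Periodic r₀ (2 * Real.pi)) :
    SecWeak (fun α => r₀ α / φ.J t α) (fun α => φ.rx r₀ r₁ t α * φ.J t α) := by
  have c1 := continuous_of_hasDerivAt (φ.J_a t)
  have c2 := continuous_of_hasDerivAt hr
  have c3 : Continuous (φ.Y t) := φ.cont_Y.comp (by fun_prop : Continuous fun α : ℝ => (t, α))
  refine SecWeak.of_hasDerivAt (fun α => ?_) ?_ ?_
  · refine ((hr α).div (φ.J_a t α) (hJ α).ne').congr_deriv ?_
    have := (hJ α).ne'
    unfold rx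
    field_simp
  · exact (((hr₁.div c1 fun α => (hJ α).ne').sub ((c2.mul c3).div (c1.pow 2)
      fun α => pow_ne_zero 2 (hJ α).ne')).div c1 fun α => (hJ α).ne').mul c1
  · intro α
    simp only [hrp α, φ.periodic_J hv ht α]

/-- `∂_θ² u = W / J³ = e^{-at} (v₂ + wForce) / J³`, where `v₂` has the weak derivative `v₃` and all
other factors are of class `C¹`. -/
lemma secWeak_uxx (hv : Function.Periodic v (2 * Real.pi)) {v₃ : ℝ → ℝ} (hv₃ : SecWeak v₂ v₃)
    {t : ℝ} (ht : 0 ≤ t) (hJ : ∀ α, 0 < φ.J t α) :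
    SecWeak (φ.uxx t) (fun α => φ.uxxx v₃ t α * φ.J t α) := by
  have c1 := continuous_of_hasDerivAt (φ.J_a t)
  have c3 : Continuous (φ.Y t) := φ.cont_Y.comp (by fun_prop : Continuous fun α : ℝ => (t, α))
  obtain ⟨hw, hwc⟩ := φ.wForce_a ht
  have cw := continuous_of_hasDerivAt hw
  have hE : ∀ α, HasDerivAt (fun α => Real.exp (-(a * t)) / φ.J t α ^ 3)
      (-3 * Real.exp (-(a * t)) * φ.Y t α / φ.J t α ^ 4) α := fun α => by
    refine (((φ.J_a t α).pow 3).inv (pow_ne_zero 3 (hJ α).ne') |>.const_mul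
      (Real.exp (-(a * t)))).congr_deriv ?_
    have := (hJ α).ne'
    simp only [Nat.cast_ofNat, Pi.pow_apply]
    field_simp
    ring
  have hEc : Continuous fun α => -3 * Real.exp (-(a * t)) * φ.Y t α / φ.J t α ^ 4 :=
    (continuous_const.mul c3).div (c1.pow 4) fun α => pow_ne_zero 4 (hJ α).ne'
  have hEc0 : Continuous fun α => Real.exp (-(a * t)) / φ.J t α ^ 3 :=
    continuous_of_hasDerivAt hE
  have hEp : Function.Periodic (fun α => Real.exp (-(a * t)) / φ.J t α ^ 3) (2 * Real.pi) :=
    fun α => by simp only [φ.periodic_J hv ht α]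
  have h1 := hv₃.mul hE hEc hEp
  have h2 : SecWeak _ _ := SecWeak.of_hasDerivAt (fun α => (hw α).mul (hE α))
    ((hwc.mul hEc0).add (cw.mul hEc)) ((φ.periodic_wForce hv ht).mul hEp)
  refine (h1.add h2).congr (fun α => ?_) fun α => ?_
  · simp only [uxx, φ.W_eq, Pi.mul_apply]; ring
  · have := (hJ α).ne'
    simp only [uxxx, φ.W_eq]
    field_simp
    ring

lemma cont_vCoeff_aux {t : ℝ} (hJ : ∀ s ∈ Set.Icc 0 t, ∀ α, 0 < φ.J s α) (n : ℕ) :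
    ContinuousOn (fun p : ℝ × ℝ => (φ.J p.1 p.2 ^ n)⁻¹) (Set.Icc 0 t ×ˢ Set.univ) :=
  ContinuousOn.inv₀ (φ.cont_J.pow n).continuousOn
    fun p hp => pow_ne_zero n (hJ p.1 hp.1 p.2).ne'

/-- In `∂_θ ρ = (r₁ / J - r₀ Y / J²) / J` one writes `Y = J (v₂ k + l)`, where the integrals `k` and
`l` over time are of class `C¹` in the label; thus only the products of `r₁` and of `v₂` with a `C¹`
function have a derivative that is merely weak. -/
lemma secWeak_rx (hv : Function.Periodic v (2 * Real.pi)) {v₃ : ℝ → ℝ} (hv₃ : SecWeak v₂ v₃)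
    {t : ℝ} (ht : 0 ≤ t) (hJ : ∀ s ∈ Set.Icc 0 t, ∀ α, 0 < φ.J s α) {r₀ r₁ r₂ : ℝ → ℝ}
    (hr : ∀ α, HasDerivAt r₀ (r₁ α) α) (hr₁ : Continuous r₁)
    (hrp : Function.Periodic r₀ (2 * Real.pi)) (hr₂ : SecWeak r₁ r₂) :
    SecWeak (φ.rx r₀ r₁ t) (fun α => φ.rxx r₀ r₁ r₂ v₃ t α * φ.J t α) := by
  have hJt : ∀ α, 0 < φ.J t α := hJ t ⟨ht, le_rfl⟩
  have hJne : ∀ α, φ.J t α ≠ 0 := fun α => (hJt α).ne'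
  have c1 := continuous_of_hasDerivAt (φ.J_a t)
  have c3 : Continuous (φ.Y t) := φ.cont_Y.comp (by fun_prop : Continuous fun α : ℝ => (t, α))
  have cr := continuous_of_hasDerivAt hr
  have cW := φ.cont_W
  have cY := φ.cont_Y
  have cwA := φ.cont_wForceA
  have i1 := φ.cont_vCoeff_aux hJ 2
  have i3 := φ.cont_vCoeff_aux hJ 3
  have cE : Continuous fun p : ℝ × ℝ => Real.exp (-(a * p.1)) := by fun_prop
  -- the coefficient of `v₂` and the remaining part of `∂_α J / J`
  set k := φ.vCoeff t with hk
  set k' : ℝ → ℝ := fun α => ∫ s in (0 : ℝ)..t,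
    (-2 * (Real.exp (-(a * s)) * φ.Y s α)) * (φ.J s α ^ 3)⁻¹ with hk'
  set l : ℝ → ℝ := fun α => ∫ s in (0 : ℝ)..t,
    (Real.exp (-(a * s)) * (Real.exp (a * s) * φ.W s α) - Real.exp (-(a * s)) * v₂ α) *
      (φ.J s α ^ 2)⁻¹ with hl
  set l' : ℝ → ℝ := fun α => ∫ s in (0 : ℝ)..t, (Real.exp (-(a * s)) * φ.wForceA s α *
    (φ.J s α ^ 2)⁻¹ - 2 * (Real.exp (-(a * s)) * φ.wForce s α * φ.Y s α) * (φ.J s α ^ 3)⁻¹) with hl'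
  have dJ2 : ∀ s ∈ Set.Icc 0 t, ∀ α, HasDerivAt (fun α => (φ.J s α ^ 2)⁻¹)
      (-2 * φ.Y s α * (φ.J s α ^ 3)⁻¹) α := fun s hs α => by
    have := (hJ s hs α).ne'
    refine (((φ.J_a s α).pow 2).inv (pow_ne_zero 2 this)).congr_deriv ?_
    simp only [Nat.cast_ofNat, Pi.pow_apply]
    field_simp
    ring
  have cv₂ : Continuous v₂ := by
    have : v₂ = φ.Q 0 := funext fun α => (φ.Q_zero α).symm
    rw [this]
    exact φ.cont_Q.comp (by fun_prop : Continuous fun α : ℝ => ((0 : ℝ), α))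
  have cwF : Continuous fun p : ℝ × ℝ => φ.wForce p.1 p.2 := by
    simp only [φ.wForce_eq]
    have : Continuous fun p : ℝ × ℝ => v₂ p.2 := cv₂.comp continuous_snd
    fun_prop
  obtain ⟨dk, ck'⟩ := hasDerivAt_integral_param ht
    (G := fun s α => Real.exp (-(a * s)) / φ.J s α ^ 2)
    (G₁ := fun s α => (-2 * (Real.exp (-(a * s)) * φ.Y s α)) * (φ.J s α ^ 3)⁻¹)
    (by simp only [div_eq_mul_inv]; exact cE.continuousOn.mul i1)
    ((continuous_const.mul (cE.mul cY)).continuousOn.mul i3)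
    (fun s hs α => by
      simp only [div_eq_mul_inv]
      exact ((dJ2 s hs α).const_mul _).congr_deriv (by ring))
  obtain ⟨dl, cl'⟩ := hasDerivAt_integral_param ht
    (G := fun s α => Real.exp (-(a * s)) * φ.wForce s α * (φ.J s α ^ 2)⁻¹)
    (G₁ := fun s α => (Real.exp (-(a * s)) * φ.wForceA s α *
      (φ.J s α ^ 2)⁻¹ - 2 * (Real.exp (-(a * s)) * φ.wForce s α * φ.Y s α) * (φ.J s α ^ 3)⁻¹))
    ((cE.mul cwF).continuousOn.mul i1)
    (((cE.mul cwA).continuousOn.mul i1).sub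
      ((continuous_const.mul ((cE.mul cwF).mul cY)).continuousOn.mul i3))
    (fun s hs α => by
      refine ((((φ.wForce_a hs.1).1 α).const_mul _).mul (dJ2 s hs α)).congr_deriv ?_
      ring)
  have el : (fun α => ∫ s in (0 : ℝ)..t, Real.exp (-(a * s)) * φ.wForce s α * (φ.J s α ^ 2)⁻¹) =
      l := funext fun α => by
    refine intervalIntegral.integral_congr fun s _ => ?_
    simp only [φ.wForce_eq]; ring
  rw [el] at dl
  have dk : ∀ α, HasDerivAt k (k' α) α := dk
  have dl : ∀ α, HasDerivAt l (l' α) α := dl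
  have ck := continuous_of_hasDerivAt dk
  have cl := continuous_of_hasDerivAt dl
  have curve : ∀ {f : ℝ × ℝ → ℝ} (α : ℝ), ContinuousOn f (Set.Icc 0 t ×ˢ Set.univ) →
      IntervalIntegrable (fun s => f (s, α)) volume 0 t := fun {f} α hf => by
    refine ContinuousOn.intervalIntegrable ?_
    rw [Set.uIcc_of_le ht]
    exact hf.comp (by fun_prop : Continuous fun s : ℝ => (s, α)).continuousOn
      fun s hs => ⟨hs, trivial⟩
  have hYR : ∀ α, φ.Y t α = φ.J t α * (v₂ α * k α + l α) := fun α => by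
    rw [φ.Y_eq ht fun s hs => (hJ s hs α).ne']
    congr 1
    rw [hk, hl, vCoeff, ← intervalIntegral.integral_const_mul, ← intervalIntegral.integral_add]
    · refine intervalIntegral.integral_congr fun s _ => ?_
      have : Real.exp (-(a * s)) * Real.exp (a * s) = 1 := by rw [← Real.exp_add]; simp
      simp only [← mul_assoc, this]; ring
    · exact (curve α (by simpa only [div_eq_mul_inv] using cE.continuousOn.mul i1)).const_mul _
    · refine curve (f := fun p => (Real.exp (-(a * p.1)) * (Real.exp (a * p.1) * φ.W p.1 p.2) -
        Real.exp (-(a * p.1)) * v₂ p.2) * (φ.J p.1 p.2 ^ 2)⁻¹) α ?_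
      refine ContinuousOn.mul (Continuous.continuousOn ?_) i1
      have : Continuous fun p : ℝ × ℝ => v₂ p.2 := cv₂.comp continuous_snd
      fun_prop
  have hM : ∀ α, φ.lowerPart t α = v₂ α * k' α + l' α := fun α => by
    rw [lowerPart, hk', hl', ← intervalIntegral.integral_const_mul,
      ← intervalIntegral.integral_add]
    · refine intervalIntegral.integral_congr fun s _ => ?_
      simp only [φ.W_eq]; ring
    · exact (curve α ((continuous_const.mul (cE.mul cY)).continuousOn.mul i3)).const_mul _
    · exact curve α (((cE.mul cwA).continuousOn.mul i1).sub
        ((continuous_const.mul ((cE.mul cwF).mul cY)).continuousOn.mul i3))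
  have pk : Function.Periodic k (2 * Real.pi) := fun α => by
    refine intervalIntegral.integral_congr fun s hs => ?_
    rw [Set.uIcc_of_le ht] at hs
    simp only [φ.periodic_J hv hs.1 α]
  have pl : Function.Periodic l (2 * Real.pi) := fun α => by
    rw [← el]
    refine intervalIntegral.integral_congr fun s hs => ?_
    rw [Set.uIcc_of_le ht] at hs
    simp only [φ.periodic_J hv hs.1 α, φ.periodic_wForce hv hs.1 α]
  have pJ : Function.Periodic (fun α => (φ.J t α ^ 2)⁻¹) (2 * Real.pi) := fun α => by
    simp only [φ.periodic_J hv ht α]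
  have dJt := dJ2 t ⟨ht, le_rfl⟩
  have cJ2 := continuous_of_hasDerivAt dJt
  have cJ2' : Continuous fun α => -2 * φ.Y t α * (φ.J t α ^ 3)⁻¹ :=
    (continuous_const.mul c3).mul ((c1.pow 3).inv₀ fun α => pow_ne_zero 3 (hJne α))
  have s1 := hr₂.mul dJt cJ2' pJ
  have s2 := hv₃.mul (b := fun α => -(r₀ α * k α * (φ.J t α ^ 2)⁻¹))
    (fun α => (((hr α).mul (dk α)).mul (dJt α)).neg)
    ((((hr₁.mul ck).add (cr.mul ck')).mul cJ2).add ((cr.mul ck).mul cJ2')).neg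
    (fun α => by simp only [hrp α, pk α, φ.periodic_J hv ht α])
  have s3 : SecWeak (fun α => -(r₀ α * l α * (φ.J t α ^ 2)⁻¹)) _ := SecWeak.of_hasDerivAt
    (fun α => (((hr α).mul (dl α)).mul (dJt α)).neg)
    ((((hr₁.mul cl).add (cr.mul cl')).mul cJ2).add ((cr.mul cl).mul cJ2')).neg
    (fun α => by simp only [hrp α, pl α, φ.periodic_J hv ht α])
  refine ((s1.add s2).add s3).congr (fun α => ?_) fun α => ?_
  · have := hJne α
    simp only [rx, hYR α]
    field_simp
    ring
  · have := hJne α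
    simp only [rxx, hM α, hYR α, Pi.mul_apply]
    field_simp
    ring

/-- Bounds for the first and second variation which depend on the initial velocity only through a
bound of its first derivative and the size of its second derivative at the given label. -/
lemma variation_bounds {C T t α : ℝ} (hC : |v₁ α| ≤ C) (ht : |t| ≤ T) :
    |φ.J t α| ≤ (1 + C) * Real.exp ((1 + |a| + 2 * F.B) * T) ∧
    |φ.P t α| ≤ (1 + C) * Real.exp ((1 + |a| + 2 * F.B) * T) ∧
    |φ.Y t α| ≤ (|v₂ α| + 2 * F.B * ((1 + C) * Real.exp ((1 + |a| + 2 * F.B) * T)) ^ 2 * T) *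
      Real.exp ((1 + |a| + 2 * F.B) * T) ∧
    |φ.Q t α| ≤ (|v₂ α| + 2 * F.B * ((1 + C) * Real.exp ((1 + |a| + 2 * F.B) * T)) ^ 2 * T) *
      Real.exp ((1 + |a| + 2 * F.B) * T) := by
  have hB := F.B_nonneg
  have h1 : ∀ t, |t| ≤ T → |φ.J t α| ≤ (1 + C) * Real.exp ((1 + |a| + 2 * F.B) * T) ∧
      |φ.P t α| ≤ (1 + C) * Real.exp ((1 + |a| + 2 * F.B) * T) := by
    intro t ht
    have := secondOrder_bound (a := a) (c := 2 * F.B) (ε := 0) (T := T) (by positivity) le_rfl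
      (fun t => φ.J_t t α) (fun t => φ.P_t t α) (fun t _ => abs_forced_linear_le (r := 0)
        (F.abs_der_le t (φ.x t α)) (by simp) (by ring)) t ht
    rw [φ.J_zero, φ.P_zero, zero_mul, add_zero, abs_one] at this
    have h1 : (1 + |v₁ α|) * Real.exp ((1 + |a| + 2 * F.B) * T) ≤
        (1 + C) * Real.exp ((1 + |a| + 2 * F.B) * T) := by gcongr
    exact ⟨this.1.trans h1, this.2.trans h1⟩
  have h2 := secondOrder_bound (a := a) (c := 2 * F.B) (T := T)
    (ε := 2 * F.B * ((1 + C) * Real.exp ((1 + |a| + 2 * F.B) * T)) ^ 2) (by positivity)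
    (by positivity) (fun t => φ.Y_t t α) (fun t => φ.Q_t t α) (fun t ht =>
      abs_forced_linear_le (r := -(F.val t (φ.x t α) * φ.J t α ^ 2))
        (F.abs_der_le t (φ.x t α)) (by
          rw [abs_neg, abs_mul, abs_pow]
          have e1 := F.abs_val_le t (φ.x t α)
          have e2 := (h1 t ht).1
          gcongr) (by ring)) t ht
  rw [φ.Y_zero, φ.Q_zero, abs_zero, zero_add] at h2
  exact ⟨(h1 t ht).1, (h1 t ht).2, h2.1, h2.2⟩

set_option maxHeartbeats 1000000 in
/-- Bounds for the Eulerian derivatives along the flow, uniform in the label and in the frequency,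
as long as `J` is bounded from below. The products of second derivatives on the right hand side are
the reason why the second derivatives have to be controlled in `L⁴`. -/
theorem exists_derivative_bounds (a : ℝ) (F : ForceField) {C Cr T δ : ℝ} (hC : 0 ≤ C) (hT : 0 ≤ T)
    (hδ : 0 < δ) : ∃ K : ℝ, 0 ≤ K ∧ ∀ (b : ℝ) (v v₁ v₂ : ℝ → ℝ) (φ : SectionFlow a b F v v₁ v₂)
      (α : ℝ), |v₁ α| ≤ C → ∀ t ∈ Set.Icc 0 T, (∀ s ∈ Set.Icc 0 t, δ ≤ φ.J s α) →
      |φ.P t α / φ.J t α| ≤ K ∧ |φ.uxx t α| ≤ K * (1 + |v₂ α|) ∧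
      (∀ v₃ : ℝ → ℝ, |φ.uxxx v₃ t α| ≤ K * (1 + |v₃ α| + v₂ α ^ 2)) ∧
      ∀ r₀ r₁ : ℝ → ℝ, |r₀ α| ≤ Cr → |r₀ α / φ.J t α| ≤ K ∧
        |φ.rx r₀ r₁ t α| ≤ K * (1 + |r₁ α| + |v₂ α|) ∧
        ∀ r₂ v₃ : ℝ → ℝ, |φ.rxx r₀ r₁ r₂ v₃ t α| ≤
          K * (1 + |r₂ α| + |v₃ α| + r₁ α ^ 2 + v₂ α ^ 2) := by
  have hB := F.B_nonneg
  set A := Real.exp ((1 + |a| + 2 * F.B) * T) with hA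
  -- a single constant which dominates all quantities involved
  obtain ⟨D, hD1, hDJ, hDA, hDY, hDB, hDδ, hDT, hDr, hDe⟩ : ∃ D : ℝ, 1 ≤ D ∧ (1 + C) * A ≤ D ∧
      A ≤ D ∧ 2 * F.B * ((1 + C) * A) ^ 2 * T * A ≤ D ∧ 2 * F.B ≤ D ∧ 1 / δ ≤ D ∧ T ≤ D ∧
      |Cr| ≤ D ∧ Real.exp (|a| * T) ≤ D := by
    have hA0 : 0 < A := Real.exp_pos _
    refine ⟨1 + (1 + C) * A + A + 2 * F.B * ((1 + C) * A) ^ 2 * T * A + 2 * F.B + 1 / δ + T +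
      |Cr| + Real.exp (|a| * T), ?_⟩
    have p1 : 0 ≤ (1 + C) * A := by positivity
    have p2 : 0 ≤ 2 * F.B * ((1 + C) * A) ^ 2 * T * A := by positivity
    have p3 : 0 < 1 / δ := by positivity
    have p4 := abs_nonneg Cr
    have p5 := Real.exp_pos (|a| * T)
    refine ⟨?_, ?_, ?_, ?_, ?_, ?_, ?_, ?_, ?_⟩ <;> linarith
  have hD0 : 0 ≤ D := by linarith
  have hDpow : ∀ {m n : ℕ}, m ≤ n → D ^ m ≤ D ^ n := fun h => pow_le_pow_right₀ hD1 h
  refine ⟨100 * D ^ 15, by positivity, fun b v v₁ v₂ φ α hv t ht hJ => ?_⟩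
  set q : ℝ := 1 + |v₂ α| with hq
  have hq1 : 1 ≤ q := by rw [hq]; linarith [abs_nonneg (v₂ α)]
  have hq0 : 0 ≤ q := by linarith
  have hq2 : q ^ 2 ≤ 2 * (1 + v₂ α ^ 2) := by
    rw [hq, ← sq_abs (v₂ α)]; nlinarith [sq_nonneg (1 - |v₂ α|)]
  have hqq : q ≤ q ^ 2 := by nlinarith
  have bd : ∀ s ∈ Set.Icc 0 t, |φ.J s α| ≤ D ∧ |φ.P s α| ≤ D ∧ |φ.Y s α| ≤ 2 * D * q ∧
      |φ.Q s α| ≤ 2 * D * q ∧ |(φ.J s α)⁻¹| ≤ D ∧ Real.exp (-(a * s)) ≤ D ∧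
      Real.exp (a * s) ≤ D := by
    intro s hs
    have hsT : |s| ≤ T := by rw [abs_of_nonneg hs.1]; exact hs.2.trans ht.2
    obtain ⟨b1, b2, b3, b4⟩ := φ.variation_bounds hv hsT
    have e : (|v₂ α| + 2 * F.B * ((1 + C) * A) ^ 2 * T) * A ≤ 2 * D * q := by
      have e1 : |v₂ α| * A ≤ |v₂ α| * D := by gcongr
      have e2 : D ≤ D * q := le_mul_of_one_le_right hD0 hq1
      have e3 : |v₂ α| * D ≤ D * q := by rw [hq]; nlinarith
      linarith
    have e5 : |a| * |s| ≤ |a| * T := by gcongr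
    refine ⟨b1.trans hDJ, b2.trans hDJ, b3.trans e, b4.trans e, ?_, ?_, ?_⟩
    · have := hJ s hs
      rw [abs_inv, abs_of_pos (hδ.trans_le this)]
      refine le_trans ?_ hDδ
      rw [one_div]
      exact inv_anti₀ hδ this
    · refine le_trans (Real.exp_le_exp.2 ?_) hDe
      refine (neg_le_abs _).trans ?_
      rw [abs_mul]; exact e5
    · refine le_trans (Real.exp_le_exp.2 ?_) hDe
      refine (le_abs_self _).trans ?_
      rw [abs_mul]; exact e5
  have bW : ∀ s ∈ Set.Icc 0 t, |φ.W s α| ≤ 4 * D ^ 2 * q := fun s hs => by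
    obtain ⟨b1, b2, b3, b4, -, -, -⟩ := bd s hs
    refine (abs_sub _ _).trans ?_
    rw [abs_mul, abs_mul]
    calc _ ≤ 2 * D * q * D + D * (2 * D * q) := by gcongr
      _ = _ := by ring
  have bA : ∀ s ∈ Set.Icc 0 t, |φ.wForceA s α| ≤ 7 * D ^ 7 * q := fun s hs => by
    have h := intervalIntegral.norm_integral_le_of_norm_le_const (a := 0) (b := s)
      (f := fun s => -(Real.exp (a * s) * (F.der s (φ.x s α) * φ.J s α ^ 4 +
        3 * F.val s (φ.x s α) * φ.J s α ^ 2 * φ.Y s α))) (C := 7 * D ^ 6 * q) (fun r hr => by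
        rw [Set.uIoc_of_le hs.1] at hr
        have hr' : r ∈ Set.Icc 0 t := ⟨hr.1.le, hr.2.trans hs.2⟩
        obtain ⟨b1, b2, b3, b4, b5, b6, b7⟩ := bd r hr'
        have c1 := (F.abs_val_le r (φ.x r α)).trans hDB
        have c2 := (F.abs_der_le r (φ.x r α)).trans hDB
        rw [norm_neg, Real.norm_eq_abs, abs_mul, abs_of_pos (Real.exp_pos _)]
        have d1 : |F.der r (φ.x r α) * φ.J r α ^ 4 +
            3 * F.val r (φ.x r α) * φ.J r α ^ 2 * φ.Y r α| ≤
            D * D ^ 4 + 3 * D * D ^ 2 * (2 * D * q) := by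
          refine (abs_add_le _ _).trans ?_
          rw [abs_mul, abs_mul, abs_mul, abs_mul, abs_pow, abs_pow,
            abs_of_pos (by norm_num : (0 : ℝ) < 3)]
          gcongr
        calc _ ≤ D * (D * D ^ 4 + 3 * D * D ^ 2 * (2 * D * q)) := by gcongr
          _ = D ^ 6 * 1 + 6 * D ^ 5 * q := by ring
          _ ≤ D ^ 6 * q + 6 * D ^ 6 * q := by
              gcongr
              · norm_num
          _ = _ := by ring)
    rw [sub_zero, abs_of_nonneg hs.1] at h
    refine (show |φ.wForceA s α| ≤ _ from h).trans ?_
    have : s ≤ D := hs.2.trans (ht.2.trans hDT)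
    calc _ ≤ 7 * D ^ 6 * q * D := by gcongr
      _ = _ := by ring
  obtain ⟨bJ, bP, bY, bQ, bI, bE, bE'⟩ := bd t ⟨ht.1, le_rfl⟩
  have bWt := bW t ⟨ht.1, le_rfl⟩
  have bAt := bA t ⟨ht.1, le_rfl⟩
  set i := (φ.J t α)⁻¹ with hi
  have htD : t ≤ D := ht.2.trans hDT
  refine ⟨?_, ?_, fun v₃ => ?_, fun r₀ r₁ hr₀ => ?_⟩
  · rw [div_eq_mul_inv, abs_mul, ← hi]
    calc _ ≤ D * D := by gcongr
      _ = 1 * D ^ 2 := by ring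
      _ ≤ 100 * D ^ 15 := by
          gcongr
          · norm_num
          · norm_num
  · rw [uxx, div_eq_mul_inv, ← inv_pow, abs_mul, abs_pow, ← hi]
    calc _ ≤ 4 * D ^ 2 * q * D ^ 3 := by gcongr
      _ = 4 * D ^ 5 * q := by ring
      _ ≤ 100 * D ^ 15 * q := by
          gcongr
          · norm_num
          · norm_num
  · have e : φ.uxxx v₃ t α = (Real.exp (-(a * t)) * (v₃ α + φ.wForceA t α) * i ^ 3 -
        3 * φ.W t α * φ.Y t α * i ^ 4) * i := by
      rw [uxxx, hi]; simp only [div_eq_mul_inv, inv_pow]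
    rw [e, abs_mul]
    have e1 : |Real.exp (-(a * t)) * (v₃ α + φ.wForceA t α) * i ^ 3| ≤
        D * (|v₃ α| + 7 * D ^ 7 * q) * D ^ 3 := by
      rw [abs_mul, abs_mul, abs_pow, abs_of_pos (Real.exp_pos _)]
      have := (abs_add_le (v₃ α) (φ.wForceA t α)).trans (add_le_add_right bAt _)
      gcongr
    have e2 : |3 * φ.W t α * φ.Y t α * i ^ 4| ≤ 3 * (4 * D ^ 2 * q) * (2 * D * q) * D ^ 4 := by
      rw [abs_mul, abs_mul, abs_mul, abs_pow, abs_of_pos (by norm_num : (0 : ℝ) < 3)]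
      gcongr
    calc _ ≤ (D * (|v₃ α| + 7 * D ^ 7 * q) * D ^ 3 +
          3 * (4 * D ^ 2 * q) * (2 * D * q) * D ^ 4) * D :=
          mul_le_mul ((abs_sub _ _).trans (add_le_add e1 e2)) bI (abs_nonneg _) (by positivity)
      _ = D ^ 5 * |v₃ α| + 7 * D ^ 12 * q + 24 * D ^ 8 * q ^ 2 := by ring
      _ ≤ D ^ 15 * |v₃ α| + 7 * D ^ 15 * q ^ 2 + 24 * D ^ 15 * q ^ 2 := by
          gcongr <;> norm_num
      _ = D ^ 15 * (|v₃ α| + 31 * q ^ 2) := by ring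
      _ ≤ D ^ 15 * (|v₃ α| + 31 * (2 * (1 + v₂ α ^ 2))) := by gcongr
      _ ≤ D ^ 15 * (100 * (1 + |v₃ α| + v₂ α ^ 2)) := by
          gcongr; nlinarith [abs_nonneg (v₃ α), sq_nonneg (v₂ α)]
      _ = _ := by ring
  · have bR : |r₀ α| ≤ D := hr₀.trans ((le_abs_self _).trans hDr)
    refine ⟨?_, ?_, fun r₂ v₃ => ?_⟩
    · rw [div_eq_mul_inv, abs_mul, ← hi]
      calc _ ≤ D * D := by gcongr
        _ = 1 * D ^ 2 := by ring
        _ ≤ 100 * D ^ 15 := by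
            gcongr
            · norm_num
            · norm_num
    · have e : φ.rx r₀ r₁ t α = (r₁ α * i - r₀ α * φ.Y t α * i ^ 2) * i := by
        rw [rx, hi]; simp only [div_eq_mul_inv, inv_pow]
      rw [e, abs_mul]
      have e1 : |r₁ α * i| ≤ |r₁ α| * D := by rw [abs_mul]; gcongr
      have e2 : |r₀ α * φ.Y t α * i ^ 2| ≤ D * (2 * D * q) * D ^ 2 := by
        rw [abs_mul, abs_mul, abs_pow]; gcongr
      calc _ ≤ (|r₁ α| * D + D * (2 * D * q) * D ^ 2) * D :=
            mul_le_mul ((abs_sub _ _).trans (add_le_add e1 e2)) bI (abs_nonneg _) (by positivity)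
        _ = D ^ 2 * |r₁ α| + 2 * D ^ 5 * q := by ring
        _ ≤ D ^ 15 * |r₁ α| + 2 * D ^ 15 * q := by
            gcongr <;> norm_num
        _ = D ^ 15 * (|r₁ α| + 2 * (1 + |v₂ α|)) := by rw [hq]; ring
        _ ≤ D ^ 15 * (100 * (1 + |r₁ α| + |v₂ α|)) := by
            gcongr; nlinarith [abs_nonneg (r₁ α), abs_nonneg (v₂ α)]
        _ = _ := by ring
    · have bk : |φ.vCoeff t α| ≤ D ^ 4 := by
        have h := intervalIntegral.norm_integral_le_of_norm_le_const (a := 0) (b := t)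
          (f := fun s => Real.exp (-(a * s)) / φ.J s α ^ 2) (C := D ^ 3) (fun r hr => by
            rw [Set.uIoc_of_le ht.1] at hr
            obtain ⟨-, -, -, -, b5, b6, -⟩ := bd r ⟨hr.1.le, hr.2⟩
            rw [div_eq_mul_inv, ← inv_pow, Real.norm_eq_abs, abs_mul, abs_pow,
              abs_of_pos (Real.exp_pos _)]
            calc _ ≤ D * D ^ 2 := by gcongr
              _ = _ := by ring)
        rw [sub_zero, abs_of_nonneg ht.1] at h
        refine (show |φ.vCoeff t α| ≤ _ from h).trans ?_
        calc _ ≤ D ^ 3 * D := by gcongr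
          _ = _ := by ring
      have bM : |φ.lowerPart t α| ≤ 23 * D ^ 11 * q ^ 2 := by
        have h := intervalIntegral.norm_integral_le_of_norm_le_const (a := 0) (b := t)
          (f := fun s => Real.exp (-(a * s)) * φ.wForceA s α / φ.J s α ^ 2 -
            2 * φ.W s α * φ.Y s α / φ.J s α ^ 3) (C := 23 * D ^ 10 * q ^ 2) (fun r hr => by
            rw [Set.uIoc_of_le ht.1] at hr
            have hr' : r ∈ Set.Icc 0 t := ⟨hr.1.le, hr.2⟩
            obtain ⟨-, -, b3, -, b5, b6, -⟩ := bd r hr'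
            have b7 := bW r hr'
            have b8 := bA r hr'
            rw [div_eq_mul_inv, div_eq_mul_inv, ← inv_pow, ← inv_pow, Real.norm_eq_abs]
            refine (abs_sub _ _).trans ?_
            rw [abs_mul, abs_mul, abs_mul, abs_mul, abs_mul, abs_pow, abs_pow,
              abs_of_pos (Real.exp_pos _), abs_of_pos (two_pos (α := ℝ))]
            calc _ ≤ D * (7 * D ^ 7 * q) * D ^ 2 + 2 * (4 * D ^ 2 * q) * (2 * D * q) * D ^ 3 := by
                  gcongr
              _ = 7 * D ^ 10 * q + 16 * D ^ 6 * q ^ 2 := by ring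
              _ ≤ 7 * D ^ 10 * q ^ 2 + 16 * D ^ 10 * q ^ 2 := by
                  gcongr
                  norm_num
              _ = _ := by ring)
        rw [sub_zero, abs_of_nonneg ht.1] at h
        refine (show |φ.lowerPart t α| ≤ _ from h).trans ?_
        calc _ ≤ 23 * D ^ 10 * q ^ 2 * D := by gcongr
          _ = _ := by ring
      have e : φ.rxx r₀ r₁ r₂ v₃ t α = (r₂ α * i ^ 2 - 3 * r₁ α * φ.Y t α * i ^ 3 -
          r₀ α * (v₃ α * φ.vCoeff t α + φ.lowerPart t α) * i ^ 2 +
          2 * r₀ α * φ.Y t α ^ 2 * i ^ 4) * i := by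
        rw [rxx, hi]; simp only [div_eq_mul_inv, inv_pow]
      rw [e, abs_mul]
      have e1 : |r₂ α * i ^ 2| ≤ |r₂ α| * D ^ 2 := by rw [abs_mul, abs_pow]; gcongr
      have e2 : |3 * r₁ α * φ.Y t α * i ^ 3| ≤ 3 * |r₁ α| * (2 * D * q) * D ^ 3 := by
        rw [abs_mul, abs_mul, abs_mul, abs_pow, abs_of_pos (by norm_num : (0 : ℝ) < 3)]
        gcongr
      have e3 : |r₀ α * (v₃ α * φ.vCoeff t α + φ.lowerPart t α) * i ^ 2| ≤
          D * (|v₃ α| * D ^ 4 + 23 * D ^ 11 * q ^ 2) * D ^ 2 := by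
        rw [abs_mul, abs_mul, abs_pow]
        have : |v₃ α * φ.vCoeff t α + φ.lowerPart t α| ≤
            |v₃ α| * D ^ 4 + 23 * D ^ 11 * q ^ 2 := by
          refine (abs_add_le _ _).trans ?_
          rw [abs_mul]; gcongr
        gcongr
      have e4 : |2 * r₀ α * φ.Y t α ^ 2 * i ^ 4| ≤ 2 * D * (2 * D * q) ^ 2 * D ^ 4 := by
        rw [abs_mul, abs_mul, abs_mul, abs_pow, abs_pow, abs_of_pos (two_pos (α := ℝ))]
        gcongr
      have e5 : 6 * (|r₁ α| * q) ≤ 3 * (r₁ α ^ 2 + q ^ 2) := by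
        rw [← sq_abs (r₁ α)]; nlinarith [sq_nonneg (|r₁ α| - q)]
      calc _ ≤ (|r₂ α| * D ^ 2 + 3 * |r₁ α| * (2 * D * q) * D ^ 3 +
              D * (|v₃ α| * D ^ 4 + 23 * D ^ 11 * q ^ 2) * D ^ 2 +
              2 * D * (2 * D * q) ^ 2 * D ^ 4) * D :=
            mul_le_mul ((abs_add_le _ _).trans (add_le_add ((abs_sub _ _).trans (add_le_add
              ((abs_sub _ _).trans (add_le_add e1 e2)) e3)) e4)) bI (abs_nonneg _) (by positivity)
        _ = D ^ 3 * |r₂ α| + D ^ 5 * (6 * (|r₁ α| * q)) + D ^ 8 * |v₃ α| + 23 * D ^ 15 * q ^ 2 +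
              8 * D ^ 8 * q ^ 2 := by ring
        _ ≤ D ^ 15 * |r₂ α| + D ^ 15 * (3 * (r₁ α ^ 2 + q ^ 2)) + D ^ 15 * |v₃ α| +
              23 * D ^ 15 * q ^ 2 + 8 * D ^ 15 * q ^ 2 := by
            gcongr <;> norm_num
        _ = D ^ 15 * (|r₂ α| + 3 * r₁ α ^ 2 + |v₃ α| + 34 * q ^ 2) := by ring
        _ ≤ D ^ 15 * (|r₂ α| + 3 * r₁ α ^ 2 + |v₃ α| + 34 * (2 * (1 + v₂ α ^ 2))) := by gcongr
        _ ≤ D ^ 15 * (100 * (1 + |r₂ α| + |v₃ α| + r₁ α ^ 2 + v₂ α ^ 2)) := by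
            gcongr
            nlinarith [abs_nonneg (v₃ α), abs_nonneg (r₂ α), sq_nonneg (v₂ α), sq_nonneg (r₁ α)]
        _ = _ := by ring

end SectionFlow


/-! ### Changes of variables of the circle -/

/-- A lift to `ℝ` of an orientation preserving `C¹` diffeomorphism of the circle, with its
derivative. -/
structure IsCircleMap (x J : ℝ → ℝ) : Prop where
  deriv : ∀ α, HasDerivAt x (J α) α
  cont : Continuous J
  pos : ∀ α, 0 < J α
  translate : ∀ α, x (α + 2 * Real.pi) = x α + 2 * Real.pi

lemma lintegral_Ioc_periodic {H : ℝ → ENNReal} (hH : Function.Periodic H (2 * Real.pi)) (c d : ℝ) :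
    ∫⁻ θ in Set.Ioc c (c + 2 * Real.pi), H θ = ∫⁻ θ in Set.Ioc d (d + 2 * Real.pi), H θ := by
  have : Fact (0 < 2 * Real.pi) := ⟨Real.two_pi_pos⟩
  have h := fun t => AddCircle.lintegral_preimage (2 * Real.pi) t hH.lift
  simp only [Function.Periodic.lift_coe] at h
  rw [h, h]

namespace IsCircleMap

variable {x J : ℝ → ℝ} (h : IsCircleMap x J)
include h

lemma continuous : Continuous x := continuous_of_hasDerivAt h.deriv

lemma strictMono : StrictMono x :=
  strictMono_of_deriv_pos fun α => by rw [(h.deriv α).deriv]; exact h.pos α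

lemma surjective : Function.Surjective x := by
  have hp : Function.Periodic (fun α => x α - α) (2 * Real.pi) := fun α => by
    simp only [h.translate]; ring
  obtain ⟨C, hC⟩ := exists_bound_of_periodic hp (h.continuous.sub continuous_id)
  refine h.continuous.surjective ?_ ?_
  · have h1 : ∀ α, α - C ≤ x α := fun α => by
      have := (abs_le.1 (hC α)).1
      linarith
    exact tendsto_atTop_mono h1 (tendsto_atTop_add_const_right _ (-C) tendsto_id)
  · have h1 : ∀ α, x α ≤ α + C := fun α => by
      have := (abs_le.1 (hC α)).2
      linarith
    exact tendsto_atBot_mono h1 (tendsto_atBot_add_const_right _ C tendsto_id)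

lemma image_Ioc : x '' Set.Ioc 0 (2 * Real.pi) = Set.Ioc (x 0) (x 0 + 2 * Real.pi) := by
  have h2 : x 0 + 2 * Real.pi = x (2 * Real.pi) := by rw [← h.translate 0, zero_add]
  rw [h2]
  ext θ
  constructor
  · rintro ⟨α, ⟨h1, h2⟩, rfl⟩
    exact ⟨h.strictMono h1, h.strictMono.monotone h2⟩
  · rintro ⟨h1, h2⟩
    obtain ⟨α, rfl⟩ := h.surjective θ
    exact ⟨α, ⟨h.strictMono.lt_iff_lt.1 h1, h.strictMono.le_iff_le.1 h2⟩, rfl⟩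

lemma lintegral_comp {H : ℝ → ENNReal} (hH : Function.Periodic H (2 * Real.pi)) :
    ∫⁻ θ in Set.Ioc 0 (2 * Real.pi), H θ =
      ∫⁻ α in Set.Ioc 0 (2 * Real.pi), ENNReal.ofReal (J α) * H (x α) := by
  have h1 := lintegral_image_eq_lintegral_abs_deriv_mul (s := Set.Ioc 0 (2 * Real.pi))
    measurableSet_Ioc (fun α _ => (h.deriv α).hasDerivWithinAt) h.strictMono.injective.injOn H
  rw [h.image_Ioc, lintegral_Ioc_periodic hH (x 0) 0, zero_add] at h1
  rw [h1]
  simp only [abs_of_pos (h.pos _)]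

lemma integral_comp {H : ℝ → ℝ} (hH : Function.Periodic H (2 * Real.pi)) :
    ∫ θ in (0 : ℝ)..2 * Real.pi, H θ = ∫ α in (0 : ℝ)..2 * Real.pi, J α * H (x α) := by
  have h1 := integral_image_eq_integral_abs_deriv_smul (s := Set.Ioc 0 (2 * Real.pi))
    measurableSet_Ioc (fun α _ => (h.deriv α).hasDerivWithinAt) h.strictMono.injective.injOn H
  rw [h.image_Ioc, ← intervalIntegral.integral_of_le (by linarith [Real.two_pi_pos]),
    hH.intervalIntegral_add_eq (x 0) 0, zero_add] at h1
  rw [h1, intervalIntegral.integral_of_le Real.two_pi_pos.le]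
  simp only [abs_of_pos (h.pos _), smul_eq_mul]

lemma intervalIntegrable_iff {H : ℝ → ℝ} (hH : Function.Periodic H (2 * Real.pi)) :
    IntervalIntegrable H volume 0 (2 * Real.pi) ↔
      IntervalIntegrable (fun α => J α * H (x α)) volume 0 (2 * Real.pi) := by
  have h1 := integrableOn_image_iff_integrableOn_abs_deriv_smul (s := Set.Ioc 0 (2 * Real.pi))
    measurableSet_Ioc (fun α _ => (h.deriv α).hasDerivWithinAt) h.strictMono.injective.injOn H
  rw [h.image_Ioc,
    ← intervalIntegrable_iff_integrableOn_Ioc_of_le (by linarith [Real.two_pi_pos]),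
    ← intervalIntegrable_iff_integrableOn_Ioc_of_le Real.two_pi_pos.le] at h1
  simp only [abs_of_pos (h.pos _), smul_eq_mul] at h1
  rw [← h1, ← hH.intervalIntegrable_iff (t₁ := 0) (t₂ := x 0), zero_add]

lemma invFun_apply (α : ℝ) : Function.invFun x (x α) = α :=
  Function.leftInverse_invFun h.strictMono.injective α

lemma apply_invFun (θ : ℝ) : x (Function.invFun x θ) = θ :=
  Function.rightInverse_invFun h.surjective θ

lemma invFun_translate (θ : ℝ) :
    Function.invFun x (θ + 2 * Real.pi) = Function.invFun x θ + 2 * Real.pi := by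
  apply h.strictMono.injective
  rw [h.translate, h.apply_invFun, h.apply_invFun]

lemma invFun_le_iff (θ α : ℝ) : Function.invFun x θ ≤ α ↔ θ ≤ x α := by
  rw [← h.strictMono.le_iff_le, h.apply_invFun]

lemma periodic_comp_invFun {f : ℝ → ℝ} (hf : Function.Periodic f (2 * Real.pi)) :
    Function.Periodic (fun θ => f (Function.invFun x θ)) (2 * Real.pi) := fun θ => by
  simp only [h.invFun_translate]; exact hf _

/-- The chain rule: if `∂_α f = (∂_α x) q` weakly, then `q ∘ x⁻¹` is the weak derivative of
`f ∘ x⁻¹`. -/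
lemma secWeak_comp_invFun {f q : ℝ → ℝ} (hf : Function.Periodic f (2 * Real.pi))
    (hq : Function.Periodic q (2 * Real.pi)) (hw : SecWeak f (fun α => q α * J α)) :
    SecWeak (fun θ => f (Function.invFun x θ)) (fun θ => q (Function.invFun x θ)) where
  int := by
    rw [h.intervalIntegrable_iff (h.periodic_comp_invFun hf)]
    simp only [h.invFun_apply]
    exact hw.int.continuousOn_mul h.cont.continuousOn
  int' := by
    rw [h.intervalIntegrable_iff (h.periodic_comp_invFun hq)]
    simp only [h.invFun_apply]
    exact hw.int'.congr (fun α _ => mul_comm _ _)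
  weak φ φ' hφ hφc hφp := by
    have hφp' := periodic_of_hasDerivAt hφp hφ
    have h1 : Function.Periodic (fun θ => f (Function.invFun x θ) * φ' θ) (2 * Real.pi) :=
      (h.periodic_comp_invFun hf).mul hφp'
    have h2 : Function.Periodic (fun θ => q (Function.invFun x θ) * φ θ) (2 * Real.pi) :=
      (h.periodic_comp_invFun hq).mul hφp
    rw [h.integral_comp h1, h.integral_comp h2]
    simp only [h.invFun_apply]
    have h3 := hw.weak (fun α => φ (x α)) (fun α => φ' (x α) * J α)
      (fun α => (hφ (x α)).comp α (h.deriv α)) ((hφc.comp h.continuous).mul h.cont)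
      (fun α => by simp only [h.translate]; exact hφp _)
    calc _ = ∫ α in (0 : ℝ)..2 * Real.pi, f α * (φ' (x α) * J α) := by
          congr 1; ext α; ring
      _ = _ := h3
      _ = _ := by congr 2; ext α; ring

end IsCircleMap


/-! ### Mean square continuity of compositions with a moving flow -/

section SquareNorm

variable {X : Type*} [MeasurableSpace X] {μ : Measure X}

/-- The squared `L²`-norm of a real function, as an extended nonnegative number. -/
noncomputable def sqNorm (μ : Measure X) (f : X → ℝ) : ENNReal := ∫⁻ p, ENNReal.ofReal (f p ^ 2) ∂μ

lemma eLpNorm_two_eq (f : X → ℝ) : eLpNorm f 2 μ = sqNorm μ f ^ (1 / 2 : ℝ) := by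
  rw [eLpNorm_eq_lintegral_rpow_enorm_toReal two_ne_zero ENNReal.ofNat_ne_top, sqNorm]
  congr 1
  refine lintegral_congr fun p => ?_
  rw [← sq_abs, ENNReal.ofReal_pow (abs_nonneg _), ← Real.enorm_eq_ofReal_abs]
  simp

lemma sqNorm_eq (f : X → ℝ) : sqNorm μ f = eLpNorm f 2 μ ^ 2 := by
  rw [eLpNorm_two_eq, ← ENNReal.rpow_natCast, ← ENNReal.rpow_mul]
  norm_num

lemma sqNorm_lt_top_of_memLp {f : X → ℝ} (hf : MemLp f 2 μ) : sqNorm μ f < ⊤ := by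
  rw [sqNorm_eq]
  exact ENNReal.pow_lt_top hf.2

lemma memLp_two_of_sqNorm_lt_top {f : X → ℝ} (hf : AEStronglyMeasurable f μ)
    (h : sqNorm μ f < ⊤) : MemLp f 2 μ := by
  refine ⟨hf, ?_⟩
  rw [eLpNorm_two_eq]
  exact ENNReal.rpow_lt_top_of_nonneg (by norm_num) h.ne

lemma tendsto_eLpNorm_two {ι : Type*} {l : Filter ι} {f : ι → X → ℝ}
    (h : Tendsto (fun i => sqNorm μ (f i)) l (𝓝 0)) :
    Tendsto (fun i => eLpNorm (f i) 2 μ) l (𝓝 0) := by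
  simp only [eLpNorm_two_eq]
  have := (ENNReal.continuous_rpow_const (y := (1 / 2 : ℝ))).tendsto 0
  rw [ENNReal.zero_rpow_of_pos (by norm_num)] at this
  exact this.comp h

/-- Dominated convergence in `L²`. -/
lemma tendsto_sqNorm_of_dominated {ι : Type*} {l : Filter ι} [l.IsCountablyGenerated]
    {f : ι → X → ℝ} {f₀ D : X → ℝ} (hf : ∀ᶠ i in l, AEMeasurable (f i) μ)
    (hf₀ : AEMeasurable f₀ μ) (hD : ∀ᶠ i in l, ∀ᵐ p ∂μ, |f i p| ≤ D p)
    (hD₀ : ∀ᵐ p ∂μ, |f₀ p| ≤ D p) (hDL : MemLp D 2 μ)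
    (hlim : ∀ᵐ p ∂μ, Tendsto (fun i => f i p) l (𝓝 (f₀ p))) :
    Tendsto (fun i => sqNorm μ (fun p => f i p - f₀ p)) l (𝓝 0) := by
  have h0 : (0 : ENNReal) = ∫⁻ p, (fun _ : X => (0 : ENNReal)) p ∂μ := by simp
  rw [h0]
  refine tendsto_lintegral_filter_of_dominated_convergence'
    (fun p => ENNReal.ofReal (4 * D p ^ 2)) ?_ ?_ ?_ ?_
  · filter_upwards [hf] with i hi
    exact ((hi.sub hf₀).pow_const 2).ennreal_ofReal
  · filter_upwards [hD] with i hi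
    filter_upwards [hi, hD₀] with p h1 h2
    refine ENNReal.ofReal_le_ofReal ?_
    have h3 : |f i p - f₀ p| ≤ 2 * D p := by
      refine (abs_sub _ _).trans ?_
      linarith
    calc (f i p - f₀ p) ^ 2 = |f i p - f₀ p| ^ 2 := (sq_abs _).symm
      _ ≤ (2 * D p) ^ 2 := by gcongr
      _ = 4 * D p ^ 2 := by ring
  · have h4 : ∀ p, ENNReal.ofReal (4 * D p ^ 2) = ENNReal.ofReal 4 * ENNReal.ofReal (D p ^ 2) :=
      fun p => ENNReal.ofReal_mul (by norm_num)
    simp only [h4]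
    rw [lintegral_const_mul' _ _ ENNReal.ofReal_ne_top]
    exact ENNReal.mul_ne_top ENNReal.ofReal_ne_top (sqNorm_lt_top_of_memLp hDL).ne
  · filter_upwards [hlim] with p hp
    have : Tendsto (fun i => ENNReal.ofReal ((f i p - f₀ p) ^ 2)) l
        (𝓝 (ENNReal.ofReal ((f₀ p - f₀ p) ^ 2))) :=
      ENNReal.tendsto_ofReal ((hp.sub tendsto_const_nhds).pow 2)
    simpa using this

lemma sqNorm_map_le {Y : Type*} [MeasurableSpace Y] {ν : Measure Y} {ψ : X → Y} {C : ENNReal}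
    (hψ : Measurable ψ) (hmap : μ.map ψ ≤ C • ν) {k : Y → ℝ} (hk : Measurable k) :
    sqNorm μ (fun p => k (ψ p)) ≤ C * sqNorm ν k := by
  have h1 : sqNorm μ (fun p => k (ψ p)) = ∫⁻ q, ENNReal.ofReal (k q ^ 2) ∂(μ.map ψ) := by
    rw [lintegral_map (hk.pow_const 2).ennreal_ofReal hψ, sqNorm]
  rw [h1]
  calc _ ≤ ∫⁻ q, ENNReal.ofReal (k q ^ 2) ∂(C • ν) := lintegral_mono' hmap le_rfl
    _ = _ := lintegral_smul_measure _ _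

/-- Composition of a fixed `L²` function with maps that converge pointwise and push `μ` forward to
measures bounded by a fixed multiple of `ν` is continuous in `L²`, since bounded continuous
functions are dense. -/
lemma tendsto_sqNorm_comp [IsFiniteMeasure μ] {Y : Type*} [TopologicalSpace Y] [NormalSpace Y]
    [MeasurableSpace Y] [BorelSpace Y] {ν : Measure Y} [ν.WeaklyRegular]
    {ι : Type*} {l : Filter ι} [l.IsCountablyGenerated] {ψ : ι → X → Y} {ψ₀ : X → Y}
    {C : ENNReal} (hC : C ≠ ⊤) (hψ : ∀ᶠ i in l, Measurable (ψ i) ∧ μ.map (ψ i) ≤ C • ν)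
    (hψ₀ : Measurable ψ₀) (hmap₀ : μ.map ψ₀ ≤ C • ν)
    (hlim : ∀ p, Tendsto (fun i => ψ i p) l (𝓝 (ψ₀ p))) {h : Y → ℝ} (hm : Measurable h)
    (hh : MemLp h 2 ν) :
    Tendsto (fun i => sqNorm μ (fun p => h (ψ i p) - h (ψ₀ p))) l (𝓝 0) := by
  rw [ENNReal.tendsto_nhds_zero]
  intro ε hε
  -- `6 C η² ≤ ε / 2` for some `η > 0`
  obtain ⟨η, hη, hηε⟩ : ∃ η : ENNReal, η ≠ 0 ∧ 6 * (C * η ^ 2) ≤ ε / 2 := by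
    have h1 : Tendsto (fun η : ENNReal => 6 * (C * η ^ 2)) (𝓝 0) (𝓝 (6 * (C * 0 ^ 2))) :=
      ENNReal.Tendsto.const_mul (ENNReal.Tendsto.const_mul
        ((ENNReal.continuous_pow 2).tendsto 0) (Or.inr hC)) (Or.inr (by norm_num))
    have h2 : 6 * (C * 0 ^ 2) < ε / 2 := by
      simpa using (ENNReal.half_pos hε.ne')
    have h3 := h1.eventually_lt_const h2
    have h4 : ∀ᶠ η : ENNReal in 𝓝[≠] 0, 6 * (C * η ^ 2) < ε / 2 := h3.filter_mono nhdsWithin_le_nhds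
    obtain ⟨η, h5, h6⟩ := (h4.and self_mem_nhdsWithin).exists
    exact ⟨η, h6, h5.le⟩
  obtain ⟨b, hb, -⟩ := hh.exists_boundedContinuous_eLpNorm_sub_le ENNReal.ofNat_ne_top hη
  have hbm : Measurable b := b.continuous.measurable
  have hb2 : sqNorm ν (fun q => h q - b q) ≤ η ^ 2 := by
    rw [sqNorm_eq]
    gcongr
    exact hb
  have hsmall : Tendsto (fun i => 3 * sqNorm μ (fun p => b (ψ i p) - b (ψ₀ p))) l (𝓝 (3 * 0)) := by
    refine ENNReal.Tendsto.const_mul ?_ (Or.inr (by norm_num))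
    refine tendsto_sqNorm_of_dominated (D := fun _ => ‖b‖) ?_ (hbm.comp hψ₀).aemeasurable ?_ ?_
      (memLp_const _) ?_
    · filter_upwards [hψ] with i hi using (hbm.comp hi.1).aemeasurable
    · exact Eventually.of_forall fun i => Eventually.of_forall fun p => b.norm_coe_le_norm _
    · exact Eventually.of_forall fun p => b.norm_coe_le_norm _
    · exact Eventually.of_forall fun p => (b.continuous.tendsto _).comp (hlim p)
  rw [mul_zero, ENNReal.tendsto_nhds_zero] at hsmall
  filter_upwards [hψ, hsmall (ε / 2) (ENNReal.half_pos hε.ne')] with i hi hi2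
  have e1 := (sqNorm_map_le hi.1 hi.2 (hm.sub hbm)).trans (mul_le_mul_right hb2 C)
  have e2 := (sqNorm_map_le hψ₀ hmap₀ (hm.sub hbm)).trans (mul_le_mul_right hb2 C)
  simp only [Pi.sub_apply] at e1 e2
  have key : sqNorm μ (fun p => h (ψ i p) - h (ψ₀ p)) ≤
      3 * sqNorm μ (fun p => h (ψ i p) - b (ψ i p)) + 3 * sqNorm μ (fun p => h (ψ₀ p) - b (ψ₀ p))
        + 3 * sqNorm μ (fun p => b (ψ i p) - b (ψ₀ p)) := by
    have m1 : Measurable fun p => 3 * ENNReal.ofReal ((h (ψ i p) - b (ψ i p)) ^ 2) :=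
      ((((hm.sub hbm).comp hi.1).pow_const 2).ennreal_ofReal).const_mul _
    have m2 : Measurable fun p => 3 * ENNReal.ofReal ((h (ψ₀ p) - b (ψ₀ p)) ^ 2) :=
      ((((hm.sub hbm).comp hψ₀).pow_const 2).ennreal_ofReal).const_mul _
    have m12 := m1.add m2
    simp only [Pi.add_def] at m12
    simp only [sqNorm]
    rw [← lintegral_const_mul' _ _ (by norm_num), ← lintegral_const_mul' _ _ (by norm_num),
      ← lintegral_const_mul' _ _ (by norm_num), ← lintegral_add_left m1,
      ← lintegral_add_left m12]
    refine lintegral_mono fun p => ?_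
    have h3 : (3 : ENNReal) = ENNReal.ofReal 3 := by norm_num
    rw [h3, ← ENNReal.ofReal_mul (by norm_num), ← ENNReal.ofReal_mul (by norm_num),
      ← ENNReal.ofReal_mul (by norm_num), ← ENNReal.ofReal_add (by positivity) (by positivity),
      ← ENNReal.ofReal_add (by positivity) (by positivity)]
    refine ENNReal.ofReal_le_ofReal ?_
    set A := h (ψ i p) - b (ψ i p)
    set B := h (ψ₀ p) - b (ψ₀ p)
    set D := b (ψ i p) - b (ψ₀ p)
    have : h (ψ i p) - h (ψ₀ p) = A - B + D := by simp only [A, B, D]; ring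
    rw [this]
    nlinarith [sq_nonneg (A + B), sq_nonneg (A - D), sq_nonneg (B + D)]
  calc _ ≤ _ := key
    _ ≤ 3 * (C * η ^ 2) + 3 * (C * η ^ 2) + ε / 2 := by gcongr
    _ = 6 * (C * η ^ 2) + ε / 2 := by ring
    _ ≤ ε / 2 + ε / 2 := by gcongr
    _ = ε := ENNReal.add_halves ε

end SquareNorm

section Cell

instance (g : Measure ℝ) [IsFiniteMeasure g] : IsFiniteMeasure (cellMeasure g) := by
  unfold cellMeasure; infer_instance

lemma lintegral_cellMeasure (g : Measure ℝ) [SFinite g] {H : ℝ × ℝ → ENNReal}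
    (hH : Measurable H) :
    ∫⁻ p, H p ∂(cellMeasure g) = ∫⁻ Ω, (∫⁻ θ in Set.Ioc 0 (2 * Real.pi), H (θ, Ω)) ∂g := by
  exact lintegral_prod_symm _ hH.aemeasurable

/-- A measurable family of circle maps, indexed by the frequency. -/
structure IsCellMap (x J : ℝ × ℝ → ℝ) : Prop where
  meas_x : Measurable x
  meas_J : Measurable J
  circle : ∀ Ω, IsCircleMap (fun α => x (α, Ω)) (fun α => J (α, Ω))

/-- The inverse, in the first variable, of a family of circle maps. -/
noncomputable def cellInv (x : ℝ × ℝ → ℝ) (p : ℝ × ℝ) : ℝ :=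
  Function.invFun (fun α => x (α, p.2)) p.1

namespace IsCellMap

variable {x J : ℝ × ℝ → ℝ} (h : IsCellMap x J)
include h

lemma cellInv_apply (p : ℝ × ℝ) : cellInv x (x p, p.2) = p.1 := (h.circle p.2).invFun_apply p.1

lemma apply_cellInv (p : ℝ × ℝ) : x (cellInv x p, p.2) = p.1 := (h.circle p.2).apply_invFun p.1

lemma measurable_cellInv : Measurable (cellInv x) := by
  refine measurable_of_Iic fun α => ?_
  have : cellInv x ⁻¹' Set.Iic α = {p : ℝ × ℝ | p.1 ≤ x (α, p.2)} := by
    ext p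
    exact (h.circle p.2).invFun_le_iff p.1 α
  rw [this]
  exact measurableSet_le measurable_fst (h.meas_x.comp (measurable_const.prodMk measurable_snd))

lemma lintegral_comp (g : Measure ℝ) [SFinite g] {H : ℝ × ℝ → ENNReal} (hm : Measurable H)
    (hp : ∀ Ω, Function.Periodic (fun θ => H (θ, Ω)) (2 * Real.pi)) :
    ∫⁻ p, H p ∂(cellMeasure g) =
      ∫⁻ p, ENNReal.ofReal (J p) * H (x p, p.2) ∂(cellMeasure g) := by
  have hm' : Measurable fun p : ℝ × ℝ => ENNReal.ofReal (J p) * H (x p, p.2) :=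
    h.meas_J.ennreal_ofReal.mul (hm.comp (h.meas_x.prodMk measurable_snd))
  rw [lintegral_cellMeasure g hm, lintegral_cellMeasure g hm']
  exact lintegral_congr fun Ω => (h.circle Ω).lintegral_comp (hp Ω)

lemma sqNorm_comp_cellInv_le (g : Measure ℝ) [SFinite g] {C : ℝ} (hC : ∀ p, J p ≤ C)
    {f : ℝ × ℝ → ℝ} (hm : Measurable f)
    (hp : ∀ Ω, Function.Periodic (fun θ => f (θ, Ω)) (2 * Real.pi)) :
    sqNorm (cellMeasure g) (fun p => f (cellInv x p, p.2)) ≤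
      ENNReal.ofReal C * sqNorm (cellMeasure g) f := by
  have hm' : Measurable fun p : ℝ × ℝ => ENNReal.ofReal (f (cellInv x p, p.2) ^ 2) :=
    ((hm.comp (h.measurable_cellInv.prodMk measurable_snd)).pow_const 2).ennreal_ofReal
  rw [sqNorm, h.lintegral_comp g hm' fun Ω θ => by
    have := (h.circle Ω).periodic_comp_invFun (hp Ω) θ
    simp only [cellInv] at this ⊢
    rw [this]]
  simp only [h.cellInv_apply]
  rw [sqNorm, ← lintegral_const_mul' _ _ ENNReal.ofReal_ne_top]
  exact lintegral_mono fun p => by gcongr; exact hC p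

end IsCellMap

/-- Continuity in time of `t ↦ f_t ∘ x_t⁻¹` in `L²`, for a family of circle maps `x_t` and functions
`f_t` that are continuous in `t` and dominated by a square integrable function. -/
theorem memLp_and_tendsto_comp_cellInv (g : Measure ℝ) [IsFiniteMeasure g] {s δ C : ℝ}
    {x J f : ℝ → ℝ × ℝ → ℝ} {D : ℝ × ℝ → ℝ} (hδ : 0 < δ)
    (hx : ∀ t ∈ Set.Icc 0 s, IsCellMap (x t) (J t))
    (hJ : ∀ t ∈ Set.Icc 0 s, ∀ p, δ ≤ J t p ∧ J t p ≤ C)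
    (hxc : ∀ p, ContinuousOn (fun t => x t p) (Set.Icc 0 s))
    (hfm : ∀ t ∈ Set.Icc 0 s, Measurable (f t))
    (hfp : ∀ t ∈ Set.Icc 0 s, ∀ Ω, Function.Periodic (fun α => f t (α, Ω)) (2 * Real.pi))
    (hfc : ∀ p, ContinuousOn (fun t => f t p) (Set.Icc 0 s))
    (hD : ∀ t ∈ Set.Icc 0 s, ∀ p, |f t p| ≤ D p) (hDL : MemLp D 2 (cellMeasure g)) :
    (∀ t ∈ Set.Icc 0 s, MemLp (fun p => f t (cellInv (x t) p, p.2)) 2 (cellMeasure g)) ∧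
    ∀ t ∈ Set.Icc 0 s, Tendsto (fun t' => eLpNorm (fun p =>
      f t' (cellInv (x t') p, p.2) - f t (cellInv (x t) p, p.2)) 2 (cellMeasure g))
      (𝓝[Set.Icc 0 s] t) (𝓝 0) := by
  have : Fact (0 < 2 * Real.pi) := ⟨Real.two_pi_pos⟩
  have hfsq : ∀ t ∈ Set.Icc 0 s, sqNorm (cellMeasure g) (f t) < ⊤ := fun t ht =>
    lt_of_le_of_lt (lintegral_mono fun p => ENNReal.ofReal_le_ofReal
      (sq_le_sq.2 ((hD t ht p).trans (le_abs_self _)))) (sqNorm_lt_top_of_memLp hDL)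
  have hfinv : ∀ t ∈ Set.Icc 0 s, Measurable fun p => f t (cellInv (x t) p, p.2) := fun t ht =>
    (hfm t ht).comp ((hx t ht).measurable_cellInv.prodMk measurable_snd)
  have hmem : ∀ t ∈ Set.Icc 0 s,
      MemLp (fun p => f t (cellInv (x t) p, p.2)) 2 (cellMeasure g) := fun t ht =>
    memLp_two_of_sqNorm_lt_top (hfinv t ht).aestronglyMeasurable
      (lt_of_le_of_lt ((hx t ht).sqNorm_comp_cellInv_le g (fun p => (hJ t ht p).2) (hfm t ht)
        (hfp t ht)) (ENNReal.mul_lt_top ENNReal.ofReal_lt_top (hfsq t ht)))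
  refine ⟨hmem, fun t ht => tendsto_eLpNorm_two ?_⟩
  -- `π` is the projection of the strip onto the cylinder, and `h ∘ π = f_t ∘ x_t⁻¹`
  set μ := cellMeasure g
  let π : ℝ × ℝ → AddCircle (2 * Real.pi) × ℝ := fun p => ((p.1 : AddCircle (2 * Real.pi)), p.2)
  have hπ : Measurable π := (AddCircle.measurable_mk'.comp measurable_fst).prodMk measurable_snd
  let ν := μ.map π
  let h₀ : ℝ × ℝ → ℝ := fun p => f t (cellInv (x t) p, p.2)
  have hper₀ : ∀ Ω, Function.Periodic (fun θ => h₀ (θ, Ω)) (2 * Real.pi) := fun Ω =>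
    ((hx t ht).circle Ω).periodic_comp_invFun (hfp t ht Ω)
  let h : AddCircle (2 * Real.pi) × ℝ → ℝ := fun q =>
    h₀ ((AddCircle.measurableEquivIoc (2 * Real.pi) 0 q.1 : ℝ), q.2)
  have hhm : Measurable h := (hfinv t ht).comp
    ((measurable_subtype_coe.comp ((AddCircle.measurableEquivIoc (2 * Real.pi) 0).measurable.comp
      measurable_fst)).prodMk measurable_snd)
  have hhπ : ∀ p, h (π p) = h₀ p := by
    rintro ⟨θ, Ω⟩
    change h₀ ((AddCircle.measurableEquivIoc (2 * Real.pi) 0 (θ : AddCircle (2 * Real.pi)) : ℝ), Ω)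
      = h₀ (θ, Ω)
    have h1 : ((AddCircle.measurableEquivIoc (2 * Real.pi) 0 (θ : AddCircle (2 * Real.pi)) : ℝ) :
        AddCircle (2 * Real.pi)) = θ :=
      (AddCircle.equivIoc (2 * Real.pi) 0).symm_apply_apply (θ : AddCircle (2 * Real.pi))
    have h2 := congrArg (hper₀ Ω).lift h1
    simpa only [Function.Periodic.lift_coe] using h2
  have hhL : MemLp h 2 ν := by
    refine memLp_two_of_sqNorm_lt_top hhm.aestronglyMeasurable ?_
    rw [sqNorm, lintegral_map (hhm.pow_const 2).ennreal_ofReal hπ]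
    simp only [hhπ]
    exact sqNorm_lt_top_of_memLp (hmem t ht)
  -- `J ≥ δ` bounds the push-forward of the measure under the flow
  have hψm : ∀ t' ∈ Set.Icc 0 s, Measurable fun p : ℝ × ℝ => π (x t' p, p.2) := fun t' ht' =>
    hπ.comp ((hx t' ht').meas_x.prodMk measurable_snd)
  have hψle : ∀ t' ∈ Set.Icc 0 s,
      μ.map (fun p : ℝ × ℝ => π (x t' p, p.2)) ≤ ENNReal.ofReal δ⁻¹ • ν := by
    intro t' ht'
    refine Measure.le_iff.2 fun A hA => ?_
    have hm : Measurable fun p : ℝ × ℝ => A.indicator (fun _ => (1 : ENNReal)) (π p) :=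
      (measurable_const.indicator hA).comp hπ
    have hm1 : Measurable fun q => A.indicator (fun _ => (1 : ENNReal)) q :=
      measurable_const.indicator hA
    have e1 : ν A = ∫⁻ p, A.indicator (fun _ => (1 : ENNReal)) (π p) ∂μ := by
      rw [← lintegral_map hm1 hπ, lintegral_indicator hA]
      simp [ν]
    have e2 : μ.map (fun p : ℝ × ℝ => π (x t' p, p.2)) A =
        ∫⁻ p, A.indicator (fun _ => (1 : ENNReal)) (π (x t' p, p.2)) ∂μ := by
      rw [← lintegral_map hm1 (hψm t' ht'), lintegral_indicator hA]
      simp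
    rw [Measure.smul_apply, smul_eq_mul, e1, e2, (hx t' ht').lintegral_comp g hm
      (fun Ω θ => by
        have : π (θ + 2 * Real.pi, Ω) = π (θ, Ω) := by simp [π]
        simp only [this]), ← lintegral_const_mul' _ _ ENNReal.ofReal_ne_top]
    refine lintegral_mono fun p => ?_
    rw [← mul_assoc, ← ENNReal.ofReal_mul (inv_nonneg.2 hδ.le)]
    refine le_mul_of_one_le_left zero_le ?_
    rw [ENNReal.one_le_ofReal, ← div_eq_inv_mul, one_le_div hδ]
    exact (hJ t' ht' p).1
  have hlim1 := tendsto_sqNorm_comp (μ := μ) (ν := ν) (l := 𝓝[Set.Icc 0 s] t)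
    (ψ := fun t' p => π (x t' p, p.2)) (ψ₀ := fun p => π (x t p, p.2))
    (C := ENNReal.ofReal δ⁻¹) ENNReal.ofReal_ne_top
    (by filter_upwards [self_mem_nhdsWithin] with t' ht' using ⟨hψm t' ht', hψle t' ht'⟩)
    (hψm t ht) (hψle t ht)
    (fun p => ((AddCircle.continuous_mk' _).continuousAt.tendsto.comp (hxc p t ht)).prodMk_nhds
      tendsto_const_nhds) hhm hhL
  have hlim2 := tendsto_sqNorm_of_dominated (μ := μ) (l := 𝓝[Set.Icc 0 s] t) (f := f) (f₀ := f t)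
    (D := D) (by filter_upwards [self_mem_nhdsWithin] with t' ht' using (hfm t' ht').aemeasurable)
    (hfm t ht).aemeasurable
    (by filter_upwards [self_mem_nhdsWithin] with t' ht' using Eventually.of_forall (hD t' ht'))
    (Eventually.of_forall (hD t ht)) hDL (Eventually.of_forall fun p => hfc p t ht)
  -- in Lagrangian coordinates at time `t'` the difference is
  -- `(f_{t'} - f_t) + (h₀ ∘ x_t - h₀ ∘ x_{t'})` with the fixed function `h₀ = f_t ∘ x_t⁻¹`
  have hsum : Tendsto (fun t' => ENNReal.ofReal (2 * C) *
      (sqNorm μ (fun p => f t' p - f t p) +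
        sqNorm μ (fun p => h (π (x t' p, p.2)) - h (π (x t p, p.2))))) (𝓝[Set.Icc 0 s] t)
      (𝓝 (ENNReal.ofReal (2 * C) * (0 + 0))) :=
    ENNReal.Tendsto.const_mul (hlim2.add hlim1) (Or.inr ENNReal.ofReal_ne_top)
  rw [add_zero, mul_zero] at hsum
  refine tendsto_of_tendsto_of_tendsto_of_le_of_le' tendsto_const_nhds hsum
    (Eventually.of_forall fun _ => zero_le) ?_
  filter_upwards [self_mem_nhdsWithin] with t' ht'
  have hm1 : Measurable fun p : ℝ × ℝ => f t' p - h₀ (x t' p, p.2) :=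
    (hfm t' ht').sub ((hfinv t ht).comp ((hx t' ht').meas_x.prodMk measurable_snd))
  have hp1 : ∀ Ω, Function.Periodic (fun α => f t' (α, Ω) - h₀ (x t' (α, Ω), Ω)) (2 * Real.pi) :=
    fun Ω α => by
      have h1 := hfp t' ht' Ω α
      have h2 := ((hx t' ht').circle Ω).translate α
      have h3 := hper₀ Ω (x t' (α, Ω))
      simp only at h1 h2 h3 ⊢
      rw [h1, h2, h3]
  have h1 := (hx t' ht').sqNorm_comp_cellInv_le g (fun p => (hJ t' ht' p).2) hm1 hp1
  simp only [(hx t' ht').apply_cellInv] at h1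
  refine h1.trans ?_
  rw [mul_comm (2 : ℝ) C, ENNReal.ofReal_mul' (by norm_num), mul_assoc]
  gcongr
  simp only [hhπ]
  have e3 : ∀ p, h₀ (x t p, p.2) = f t p := fun p => by
    simp only [h₀, (hx t ht).cellInv_apply]
  simp only [e3, sqNorm]
  have hm2 : Measurable fun p : ℝ × ℝ => ENNReal.ofReal ((f t' p - f t p) ^ 2) :=
    (((hfm t' ht').sub (hfm t ht)).pow_const 2).ennreal_ofReal
  rw [← lintegral_add_left hm2,
    ← lintegral_const_mul' _ _ ENNReal.ofReal_ne_top]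
  refine lintegral_mono fun p => ?_
  rw [← ENNReal.ofReal_add (by positivity) (by positivity), ← ENNReal.ofReal_mul (by norm_num)]
  refine ENNReal.ofReal_le_ofReal ?_
  nlinarith [sq_nonneg (f t' p - f t p + (h₀ (x t' p, p.2) - f t p))]

end Cell


/-! ### Square integrable functions on the circle with weak derivatives -/

/-- Lebesgue measure on one period. -/
noncomputable abbrev periodMeasure : Measure ℝ :=
  (volume : Measure ℝ).restrict (Set.Ioc 0 (2 * Real.pi))

lemma _root_.MeasureTheory.MemLp.intervalIntegrable_period {f : ℝ → ℝ}
    (hf : MemLp f 2 periodMeasure) : IntervalIntegrable f volume 0 (2 * Real.pi) := by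
  rw [intervalIntegrable_iff_integrableOn_Ioc_of_le Real.two_pi_pos.le]
  exact hf.integrable (by norm_num)

/-- A square integrable function whose Fourier coefficients vanish is zero. -/
lemma ae_eq_zero_of_trig {q : ℝ → ℝ} (hq : MemLp q 2 periodMeasure)
    (hcos : ∀ k : ℤ, ∫ x in (0 : ℝ)..2 * Real.pi, q x * Real.cos (k * x) = 0)
    (hsin : ∀ k : ℤ, ∫ x in (0 : ℝ)..2 * Real.pi, q x * Real.sin (k * x) = 0) :
    q =ᵐ[periodMeasure] 0 := by
  have hqc : MemLp (fun x => (q x : ℂ)) 2 (volume.restrict (Set.Ioc 0 (2 * Real.pi))) := hq.ofReal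
  have h1 := hasSum_sq_fourierCoeffOn Real.two_pi_pos hqc
  have h2 : ∀ n : ℤ, fourierCoeffOn Real.two_pi_pos (fun x => (q x : ℂ)) n = 0 := by
    intro n
    rw [fourierCoeffOn_eq_integral]
    have h3 : ∀ x : ℝ, fourier (-n) (x : AddCircle (2 * Real.pi - 0)) • (q x : ℂ) =
        ((q x * Real.cos (n * x) : ℝ) : ℂ) - Complex.I * ((q x * Real.sin (n * x) : ℝ) : ℂ) := by
      intro x
      rw [fourier_coe_apply]
      have h4 : 2 * (Real.pi : ℂ) * Complex.I * ((-n : ℤ) : ℂ) * (x : ℂ) /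
          ((2 * Real.pi - 0 : ℝ) : ℂ) = ((-(n * x) : ℝ) : ℂ) * Complex.I := by
        have : (Real.pi : ℂ) ≠ 0 := by exact_mod_cast Real.pi_ne_zero
        push_cast
        field_simp
        ring
      rw [h4, Complex.exp_mul_I, ← Complex.ofReal_cos, ← Complex.ofReal_sin, Real.cos_neg,
        Real.sin_neg, smul_eq_mul]
      push_cast
      ring
    simp only [h3]
    have hi := hq.intervalIntegrable_period
    have i1 : IntervalIntegrable (fun x => q x * Real.cos (n * x)) volume 0 (2 * Real.pi) :=
      hi.mul_continuousOn (by fun_prop)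
    have i2 : IntervalIntegrable (fun x => q x * Real.sin (n * x)) volume 0 (2 * Real.pi) :=
      hi.mul_continuousOn (by fun_prop)
    have i1c : IntervalIntegrable (fun x => ((q x * Real.cos (n * x) : ℝ) : ℂ)) volume 0
        (2 * Real.pi) := ⟨i1.1.ofReal, i1.2.ofReal⟩
    have i2c : IntervalIntegrable (fun x => ((q x * Real.sin (n * x) : ℝ) : ℂ)) volume 0
        (2 * Real.pi) := ⟨i2.1.ofReal, i2.2.ofReal⟩
    rw [intervalIntegral.integral_sub i1c (i2c.const_mul _),
      intervalIntegral.integral_const_mul, intervalIntegral.integral_ofReal,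
      intervalIntegral.integral_ofReal, hcos, hsin]
    simp
  simp only [h2, norm_zero, ne_eq, OfNat.ofNat_ne_zero, not_false_eq_true, zero_pow] at h1
  have h3 := h1.unique hasSum_zero
  have h4 : ∫ x in (0 : ℝ)..2 * Real.pi, q x ^ 2 = 0 := by
    have : (0 : ℝ) < (2 * Real.pi - 0)⁻¹ := by rw [sub_zero]; positivity
    simpa [this.ne', Real.pi_ne_zero] using h3
  rw [intervalIntegral.integral_of_le Real.two_pi_pos.le,
    integral_eq_zero_iff_of_nonneg (fun x => sq_nonneg _) hq.integrable_sq] at h4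
  filter_upwards [h4] with x hx
  simpa using hx

lemma eq_add_integral_of_hasDerivAt {ψ ψ' : ℝ → ℝ} (h : ∀ x, HasDerivAt ψ (ψ' x) x)
    (hc : Continuous ψ') (x : ℝ) : ψ x = ψ 0 + ∫ s in (0 : ℝ)..x, ψ' s := by
  rw [intervalIntegral.integral_eq_sub_of_hasDerivAt (fun y _ => h y) (hc.intervalIntegrable _ _)]
  ring

lemma absolutelyContinuousOnInterval_primitive {f' : ℝ → ℝ} (c : ℝ)
    (h : IntervalIntegrable f' volume 0 (2 * Real.pi)) :
    AbsolutelyContinuousOnInterval (fun x => c + ∫ s in (0 : ℝ)..x, f' s) 0 (2 * Real.pi) := by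
  have h1 := h.absolutelyContinuousOnInterval_intervalIntegral (c := 0) Set.left_mem_uIcc
  have h2 : AbsolutelyContinuousOnInterval (fun _ : ℝ => c) 0 (2 * Real.pi) :=
    (LipschitzWith.const c).lipschitzOnWith.absolutelyContinuousOnInterval
  exact h2.add h1

lemma ae_deriv_primitive {f' : ℝ → ℝ} (c : ℝ)
    (h : IntervalIntegrable f' volume 0 (2 * Real.pi)) :
    ∀ᵐ x ∂periodMeasure, HasDerivAt (fun x => c + ∫ s in (0 : ℝ)..x, f' s) (f' x) x := by
  rw [ae_restrict_iff' measurableSet_Ioc]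
  filter_upwards [h.ae_hasDerivAt_integral] with x hx hx'
  have := hx (by rw [Set.uIcc_of_le Real.two_pi_pos.le]; exact Set.Ioc_subset_Icc_self hx') 0
    Set.left_mem_uIcc
  exact this.const_add c

/-- Integration by parts for the primitive of an integrable function. -/
lemma integral_primitive_mul_deriv {f' G : ℝ → ℝ} (c : ℝ)
    (h : IntervalIntegrable f' volume 0 (2 * Real.pi))
    (hG : AbsolutelyContinuousOnInterval G 0 (2 * Real.pi)) :
    ∫ x in (0 : ℝ)..2 * Real.pi, G x * f' x =
      G (2 * Real.pi) * (c + ∫ s in (0 : ℝ)..2 * Real.pi, f' s) - G 0 * c -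
        ∫ x in (0 : ℝ)..2 * Real.pi, deriv G x * (c + ∫ s in (0 : ℝ)..x, f' s) := by
  have h1 := hG.integral_mul_deriv_eq_deriv_mul (absolutelyContinuousOnInterval_primitive c h)
  rw [intervalIntegral.integral_same, add_zero] at h1
  rw [← h1]
  refine intervalIntegral.integral_congr_ae_restrict ?_
  rw [Set.uIoc_of_le Real.two_pi_pos.le]
  filter_upwards [ae_deriv_primitive c h] with x hx
  rw [hx.deriv]

lemma integral_mul_primitive {f' ψ ψ' : ℝ → ℝ} (c : ℝ)
    (h : IntervalIntegrable f' volume 0 (2 * Real.pi)) (h0 : ∫ s in (0 : ℝ)..2 * Real.pi, f' s = 0)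
    (hψ : ∀ x, HasDerivAt ψ (ψ' x) x) (hc : Continuous ψ')
    (hp : Function.Periodic ψ (2 * Real.pi)) :
    ∫ x in (0 : ℝ)..2 * Real.pi, (c + ∫ s in (0 : ℝ)..x, f' s) * ψ' x =
      -∫ x in (0 : ℝ)..2 * Real.pi, f' x * ψ x := by
  have hac := absolutelyContinuousOnInterval_primitive (ψ 0)
    (hc.intervalIntegrable (μ := volume) 0 (2 * Real.pi))
  simp only [← eq_add_integral_of_hasDerivAt hψ hc] at hac
  have h1 := integral_primitive_mul_deriv c h hac
  have h2 : ψ (2 * Real.pi) = ψ 0 := by simpa using hp 0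
  rw [h0, h2, add_zero, sub_self, zero_sub] at h1
  have h3 : ∀ x, deriv ψ x = ψ' x := fun x => (hψ x).deriv
  simp only [h3] at h1
  rw [show (∫ x in (0 : ℝ)..2 * Real.pi, f' x * ψ x) = ∫ x in (0 : ℝ)..2 * Real.pi, ψ x * f' x by
    congr 1; ext x; ring, h1, neg_neg]
  congr 1; ext x; ring

lemma hasDerivAt_cos_mul (k : ℤ) (x : ℝ) :
    HasDerivAt (fun x : ℝ => Real.cos (k * x)) (-(k * Real.sin (k * x))) x := by
  have := ((hasDerivAt_id x).const_mul (k : ℝ)).cos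
  simp only [id_eq, mul_one] at this
  exact this.congr_deriv (by ring)

lemma hasDerivAt_sin_mul (k : ℤ) (x : ℝ) :
    HasDerivAt (fun x : ℝ => Real.sin (k * x)) (k * Real.cos (k * x)) x := by
  have := ((hasDerivAt_id x).const_mul (k : ℝ)).sin
  simp only [id_eq, mul_one] at this
  exact this.congr_deriv (by ring)

lemma periodic_cos_mul (k : ℤ) : Function.Periodic (fun x : ℝ => Real.cos (k * x)) (2 * Real.pi) :=
  fun x => by
    simp only [mul_add]
    exact Real.cos_add_int_mul_two_pi _ k

lemma periodic_sin_mul (k : ℤ) : Function.Periodic (fun x : ℝ => Real.sin (k * x)) (2 * Real.pi) :=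
  fun x => by
    simp only [mul_add]
    exact Real.sin_add_int_mul_two_pi _ k

/-- A square integrable function with a square integrable derivative in the sense of trigonometric
test functions is almost everywhere equal to a primitive of this derivative. -/
lemma eq_primitive_of_trig {f f' : ℝ → ℝ} (hf : MemLp f 2 periodMeasure)
    (hf' : MemLp f' 2 periodMeasure)
    (hcos : ∀ k : ℤ, ∫ x in (0 : ℝ)..2 * Real.pi, f x * (-(k * Real.sin (k * x))) =
      -∫ x in (0 : ℝ)..2 * Real.pi, f' x * Real.cos (k * x))
    (hsin : ∀ k : ℤ, ∫ x in (0 : ℝ)..2 * Real.pi, f x * (k * Real.cos (k * x)) =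
      -∫ x in (0 : ℝ)..2 * Real.pi, f' x * Real.sin (k * x)) :
    (∫ x in (0 : ℝ)..2 * Real.pi, f' x = 0) ∧
      ∃ c, f =ᵐ[periodMeasure] fun x => c + ∫ s in (0 : ℝ)..x, f' s := by
  have hi' := hf'.intervalIntegrable_period
  have h0 : ∫ x in (0 : ℝ)..2 * Real.pi, f' x = 0 := by
    have := hcos 0
    simp at this
    exact this
  refine ⟨h0, ?_⟩
  set G : ℝ → ℝ := fun x => 0 + ∫ s in (0 : ℝ)..x, f' s with hG
  have hGc : ContinuousOn G (Set.Icc 0 (2 * Real.pi)) := by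
    have := (absolutelyContinuousOnInterval_primitive 0 hi').continuousOn
    rwa [Set.uIcc_of_le Real.two_pi_pos.le] at this
  have hGi : IntervalIntegrable G volume 0 (2 * Real.pi) :=
    (hGc.mono (by rw [Set.uIcc_of_le Real.two_pi_pos.le])).intervalIntegrable
  obtain ⟨M, hM⟩ := isCompact_Icc.exists_bound_of_continuousOn hGc
  have hGm : MemLp G 2 periodMeasure :=
    MemLp.of_bound ((hGc.mono Set.Ioc_subset_Icc_self).aestronglyMeasurable measurableSet_Ioc) M
      ((ae_restrict_iff' measurableSet_Ioc).2
        (Eventually.of_forall fun x hx => hM x (Set.Ioc_subset_Icc_self hx)))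
  have hi := hf.intervalIntegrable_period
  set c := (2 * Real.pi)⁻¹ * ∫ x in (0 : ℝ)..2 * Real.pi, (f x - G x) with hc
  refine ⟨c, ?_⟩
  have hsub : ∀ (b : ℝ → ℝ), Continuous b → ∫ x in (0 : ℝ)..2 * Real.pi, (f x - G x - c) * b x =
      (∫ x in (0 : ℝ)..2 * Real.pi, f x * b x) - (∫ x in (0 : ℝ)..2 * Real.pi, G x * b x) -
        c * ∫ x in (0 : ℝ)..2 * Real.pi, b x := by
    intro b hb
    rw [← intervalIntegral.integral_const_mul, ← intervalIntegral.integral_sub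
      (hi.mul_continuousOn hb.continuousOn) (hGi.mul_continuousOn hb.continuousOn),
      ← intervalIntegral.integral_sub ((hi.mul_continuousOn hb.continuousOn).sub
        (hGi.mul_continuousOn hb.continuousOn)) ((hb.intervalIntegrable _ _).const_mul _)]
    congr 1; ext x; ring
  -- `c` is chosen such that the Fourier coefficient of order zero vanishes as well; for `k ≠ 0` the
  -- test functions are derivatives, on which `f` and `G` agree
  have key : (fun x => f x - G x - c) =ᵐ[periodMeasure] 0 := by
    refine ae_eq_zero_of_trig ((hf.sub hGm).sub (memLp_const c)) (fun k => ?_) (fun k => ?_)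
    · by_cases hk : k = 0
      · subst hk
        have h1 := hsub (fun _ => 1) continuous_const
        simp only [Int.cast_zero, zero_mul, Real.cos_zero]
        rw [h1]
        simp only [mul_one, intervalIntegral.integral_const, sub_zero, smul_eq_mul]
        rw [hc, intervalIntegral.integral_sub hi hGi]
        have := Real.pi_ne_zero
        field_simp
        ring
      · have hk' : (k : ℝ) ≠ 0 := by exact_mod_cast hk
        have h1 := hsub (fun x => k * Real.cos (k * x)) (by fun_prop)
        rw [hsin k, integral_mul_primitive 0 hi' h0 (hasDerivAt_sin_mul k) (by fun_prop)
          (periodic_sin_mul k), intervalIntegral.integral_eq_sub_of_hasDerivAt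
            (fun x _ => hasDerivAt_sin_mul k x) (Continuous.intervalIntegrable (by fun_prop) _ _)]
          at h1
        have h2 := periodic_sin_mul k 0
        simp only [zero_add] at h2
        rw [h2, sub_self, sub_self, mul_zero, sub_zero] at h1
        have h3 : ∫ x in (0 : ℝ)..2 * Real.pi, (f x - G x - c) * (k * Real.cos (k * x)) =
            k * ∫ x in (0 : ℝ)..2 * Real.pi, (f x - G x - c) * Real.cos (k * x) := by
          rw [← intervalIntegral.integral_const_mul]
          congr 1; ext x; ring
        rw [h3] at h1
        exact (mul_eq_zero.1 h1).resolve_left hk'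
    · by_cases hk : k = 0
      · subst hk; simp
      · have hk' : (k : ℝ) ≠ 0 := by exact_mod_cast hk
        have h1 := hsub (fun x => -(k * Real.sin (k * x))) (by fun_prop)
        rw [hcos k, integral_mul_primitive 0 hi' h0 (hasDerivAt_cos_mul k) (by fun_prop)
          (periodic_cos_mul k), intervalIntegral.integral_eq_sub_of_hasDerivAt
            (fun x _ => hasDerivAt_cos_mul k x) (Continuous.intervalIntegrable (by fun_prop) _ _)]
          at h1
        have h2 := periodic_cos_mul k 0
        simp only [zero_add] at h2
        rw [h2, sub_self, sub_self, mul_zero, sub_zero] at h1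
        have h3 : ∫ x in (0 : ℝ)..2 * Real.pi, (f x - G x - c) * (-(k * Real.sin (k * x))) =
            -k * ∫ x in (0 : ℝ)..2 * Real.pi, (f x - G x - c) * Real.sin (k * x) := by
          rw [← intervalIntegral.integral_const_mul]
          congr 1; ext x; ring
        rw [h3] at h1
        exact (mul_eq_zero.1 h1).resolve_left (neg_ne_zero.2 hk')
  filter_upwards [key] with x hx
  simp only [Pi.zero_apply, hG] at hx
  linarith

lemma intervalIntegral_congr_period {f f' : ℝ → ℝ} (h : f =ᵐ[periodMeasure] f') :
    ∫ x in (0 : ℝ)..2 * Real.pi, f x = ∫ x in (0 : ℝ)..2 * Real.pi, f' x := by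
  refine intervalIntegral.integral_congr_ae_restrict ?_
  rwa [Set.uIoc_of_le Real.two_pi_pos.le]

lemma secWeak_of_trig {f f' : ℝ → ℝ} (hf : MemLp f 2 periodMeasure)
    (hf' : MemLp f' 2 periodMeasure)
    (hcos : ∀ k : ℤ, ∫ x in (0 : ℝ)..2 * Real.pi, f x * (-(k * Real.sin (k * x))) =
      -∫ x in (0 : ℝ)..2 * Real.pi, f' x * Real.cos (k * x))
    (hsin : ∀ k : ℤ, ∫ x in (0 : ℝ)..2 * Real.pi, f x * (k * Real.cos (k * x)) =
      -∫ x in (0 : ℝ)..2 * Real.pi, f' x * Real.sin (k * x)) : SecWeak f f' where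
  int := hf.intervalIntegrable_period
  int' := hf'.intervalIntegrable_period
  weak φ φ' hφ hφc hφp := by
    obtain ⟨h0, c, hc⟩ := eq_primitive_of_trig hf hf' hcos hsin
    rw [← integral_mul_primitive c hf'.intervalIntegrable_period h0 hφ hφc hφp]
    refine intervalIntegral_congr_period ?_
    filter_upwards [hc] with x hx
    rw [hx]

namespace SecWeak

lemma cos_eq {f f' : ℝ → ℝ} (h : SecWeak f f') (k : ℤ) :
    ∫ x in (0 : ℝ)..2 * Real.pi, f x * (-(k * Real.sin (k * x))) =
      -∫ x in (0 : ℝ)..2 * Real.pi, f' x * Real.cos (k * x) :=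
  h.weak _ _ (hasDerivAt_cos_mul k) (by fun_prop) (periodic_cos_mul k)

lemma sin_eq {f f' : ℝ → ℝ} (h : SecWeak f f') (k : ℤ) :
    ∫ x in (0 : ℝ)..2 * Real.pi, f x * (k * Real.cos (k * x)) =
      -∫ x in (0 : ℝ)..2 * Real.pi, f' x * Real.sin (k * x) :=
  h.weak _ _ (hasDerivAt_sin_mul k) (by fun_prop) (periodic_sin_mul k)

lemma congr_ae {f f' q q' : ℝ → ℝ} (h : SecWeak f f') (hf : f =ᵐ[periodMeasure] q)
    (hf' : f' =ᵐ[periodMeasure] q') : SecWeak q q' where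
  int := by
    rw [intervalIntegrable_iff_integrableOn_Ioc_of_le Real.two_pi_pos.le]
    exact ((intervalIntegrable_iff_integrableOn_Ioc_of_le Real.two_pi_pos.le).1 h.int).congr hf
  int' := by
    rw [intervalIntegrable_iff_integrableOn_Ioc_of_le Real.two_pi_pos.le]
    exact ((intervalIntegrable_iff_integrableOn_Ioc_of_le Real.two_pi_pos.le).1 h.int').congr hf'
  weak φ φ' hφ hφc hφp := by
    have h1 := h.weak φ φ' hφ hφc hφp
    rw [intervalIntegral_congr_period (f := fun x => f x * φ' x) (f' := fun x => q x * φ' x)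
        (by filter_upwards [hf] with x hx; rw [hx]),
      intervalIntegral_congr_period (f := fun x => f' x * φ x) (f' := fun x => q' x * φ x)
        (by filter_upwards [hf'] with x hx; rw [hx])] at h1
    exact h1

lemma unique {f f₁ f₂ : ℝ → ℝ} (h₁ : SecWeak f f₁) (h₂ : SecWeak f f₂)
    (hf₁ : MemLp f₁ 2 periodMeasure) (hf₂ : MemLp f₂ 2 periodMeasure) :
    f₁ =ᵐ[periodMeasure] f₂ := by
  have hsub : ∀ b : ℝ → ℝ, Continuous b →
      ∫ x in (0 : ℝ)..2 * Real.pi, (f₁ x - f₂ x) * b x =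
        (∫ x in (0 : ℝ)..2 * Real.pi, f₁ x * b x) - ∫ x in (0 : ℝ)..2 * Real.pi, f₂ x * b x := by
    intro b hb
    rw [← intervalIntegral.integral_sub (h₁.int'.mul_continuousOn hb.continuousOn)
      (h₂.int'.mul_continuousOn hb.continuousOn)]
    congr 1; ext x; ring
  have key : (fun x => f₁ x - f₂ x) =ᵐ[periodMeasure] 0 := by
    refine ae_eq_zero_of_trig (hf₁.sub hf₂) (fun k => ?_) (fun k => ?_)
    · rw [hsub _ (by fun_prop)]
      linarith [h₁.cos_eq k, h₂.cos_eq k]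
    · rw [hsub _ (by fun_prop)]
      linarith [h₁.sin_eq k, h₂.sin_eq k]
  filter_upwards [key] with x hx
  simpa [sub_eq_zero] using hx

/-- A continuous function with a square integrable weak derivative is a primitive of it. -/
lemma eq_primitive {f f' : ℝ → ℝ} (h : SecWeak f f') (hc : Continuous f)
    (hf' : MemLp f' 2 periodMeasure) : (∫ x in (0 : ℝ)..2 * Real.pi, f' x = 0) ∧
      ∀ x ∈ Set.Icc 0 (2 * Real.pi), f x = f 0 + ∫ s in (0 : ℝ)..x, f' s := by
  obtain ⟨M, hM⟩ := (isCompact_Icc (a := (0 : ℝ)) (b := 2 * Real.pi)).exists_bound_of_continuousOn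
    hc.continuousOn
  have hfm : MemLp f 2 periodMeasure := MemLp.of_bound hc.aestronglyMeasurable M
      ((ae_restrict_iff' measurableSet_Ioc).2
        (Eventually.of_forall fun x hx => hM x (Set.Ioc_subset_Icc_self hx)))
  obtain ⟨h0, c, hae⟩ := eq_primitive_of_trig hfm hf' h.cos_eq h.sin_eq
  have hac := (absolutelyContinuousOnInterval_primitive c h.int').continuousOn
  rw [Set.uIcc_of_le Real.two_pi_pos.le] at hac
  have heq : Set.EqOn f (fun x => c + ∫ s in (0 : ℝ)..x, f' s) (Set.Icc 0 (2 * Real.pi)) := by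
    rw [periodMeasure, ← restrict_Ioo_eq_restrict_Ioc] at hae
    refine Measure.eqOn_of_ae_eq (μ := volume) (s := Set.Icc 0 (2 * Real.pi)) ?_ hc.continuousOn
      hac ?_
    · rw [← restrict_Ioo_eq_restrict_Icc]; exact hae
    · rw [interior_Icc, closure_Ioo Real.two_pi_pos.ne]
  refine ⟨h0, fun x hx => ?_⟩
  have h1 := heq hx
  have h2 := heq (Set.left_mem_Icc.2 Real.two_pi_pos.le)
  simp only [intervalIntegral.integral_same, add_zero] at h1 h2
  rw [h1, h2]

end SecWeak


/-- An interpolation inequality of Gagliardo–Nirenberg type: `‖G'‖₄² ≤ 3 ‖G‖_∞ ‖G''‖₂`. It follows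
from `∫ f³ G' = -3 ∫ f² f' G` for `f = G'` and the Cauchy–Schwarz inequality. -/
lemma integral_pow_four_le {G f f' : ℝ → ℝ} {C : ℝ} (hG : ∀ x, HasDerivAt G (f x) x)
    (hc : Continuous f) (hp : Function.Periodic G (2 * Real.pi)) (hC : ∀ x, |G x| ≤ C)
    (h : SecWeak f f') (hf' : MemLp f' 2 periodMeasure) :
    ∫ x in (0 : ℝ)..2 * Real.pi, f x ^ 4 ≤
      9 * C ^ 2 * ∫ x in (0 : ℝ)..2 * Real.pi, f' x ^ 2 := by
  obtain ⟨h0, hprim⟩ := h.eq_primitive hc hf'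
  have hper : f (2 * Real.pi) = f 0 := by
    rw [hprim (2 * Real.pi) (Set.right_mem_Icc.2 Real.two_pi_pos.le), h0, add_zero]
  -- `F` is the absolutely continuous representative of `f`, to which integration by parts applies
  set F : ℝ → ℝ := fun x => f 0 + ∫ s in (0 : ℝ)..x, f' s with hF
  have hFac : AbsolutelyContinuousOnInterval F 0 (2 * Real.pi) :=
    absolutelyContinuousOnInterval_primitive (f 0) h.int'
  have hF3 : AbsolutelyContinuousOnInterval (fun x => F x * F x * F x) 0 (2 * Real.pi) :=
    (hFac.fun_mul hFac).fun_mul hFac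
  have h1 := integral_primitive_mul_deriv (G 0) (hc.intervalIntegrable (μ := volume) _ _) hF3
  simp only [← eq_add_integral_of_hasDerivAt hG hc] at h1
  have hG2 : G (2 * Real.pi) = G 0 := by simpa using hp 0
  have hF2 : F (2 * Real.pi) = F 0 := by simp [hF, h0]
  rw [hG2, hF2, sub_self, zero_sub] at h1
  have i4 : IntervalIntegrable (fun x => f x ^ 4) volume 0 (2 * Real.pi) :=
    (hc.pow 4).intervalIntegrable _ _
  have i2 : IntervalIntegrable (fun x => f' x ^ 2) volume 0 (2 * Real.pi) := by
    rw [intervalIntegrable_iff_integrableOn_Ioc_of_le Real.two_pi_pos.le]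
    exact hf'.integrable_sq
  have hGc := continuous_of_hasDerivAt hG
  have i3 : IntervalIntegrable (fun x => f' x * (f x ^ 2 * G x)) volume 0 (2 * Real.pi) :=
    h.int'.mul_continuousOn ((hc.pow 2).mul hGc).continuousOn
  have h2 : ∫ x in (0 : ℝ)..2 * Real.pi, f x ^ 4 = ∫ x in (0 : ℝ)..2 * Real.pi,
      F x * F x * F x * f x := by
    refine intervalIntegral.integral_congr fun x hx => ?_
    rw [Set.uIcc_of_le Real.two_pi_pos.le] at hx
    rw [show F x = f x from (hprim x hx).symm]
    ring
  have h3 : ∫ x in (0 : ℝ)..2 * Real.pi, deriv (fun x => F x * F x * F x) x * G x =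
      3 * ∫ x in (0 : ℝ)..2 * Real.pi, f' x * (f x ^ 2 * G x) := by
    rw [← intervalIntegral.integral_const_mul]
    refine intervalIntegral_congr_period ?_
    filter_upwards [ae_deriv_primitive (f 0) h.int', ae_restrict_mem measurableSet_Ioc] with x hx hx'
    have h4 : HasDerivAt F (f' x) x := hx
    rw [((h4.fun_mul h4).fun_mul h4).deriv,
      show F x = f x from (hprim x (Set.Ioc_subset_Icc_self hx')).symm]
    ring
  rw [← h2, h3] at h1
  have h5 : ∫ x in (0 : ℝ)..2 * Real.pi, -3 * (f' x * (f x ^ 2 * G x)) ≤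
      ∫ x in (0 : ℝ)..2 * Real.pi, ((1 / 2) * f x ^ 4 + (9 * C ^ 2 / 2) * f' x ^ 2) := by
    refine intervalIntegral.integral_mono_on Real.two_pi_pos.le (i3.const_mul _)
      ((i4.const_mul _).add (i2.const_mul _)) fun x _ => ?_
    have h6 : G x ^ 2 ≤ C ^ 2 := by
      rw [← sq_abs]
      exact pow_le_pow_left₀ (abs_nonneg _) (hC x) 2
    nlinarith [sq_nonneg (f x ^ 2 + 3 * G x * f' x),
      mul_le_mul_of_nonneg_right h6 (sq_nonneg (f' x))]
  rw [intervalIntegral.integral_const_mul, intervalIntegral.integral_add (i4.const_mul _)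
    (i2.const_mul _), intervalIntegral.integral_const_mul, intervalIntegral.integral_const_mul] at h5
  linarith

lemma lintegral_pow_four_le {G f f' : ℝ → ℝ} {C : ℝ} (hG : ∀ x, HasDerivAt G (f x) x)
    (hc : Continuous f) (hp : Function.Periodic G (2 * Real.pi)) (hC : ∀ x, |G x| ≤ C)
    (h : SecWeak f f') (hf' : MemLp f' 2 periodMeasure) :
    ∫⁻ x, ENNReal.ofReal ((f x ^ 2) ^ 2) ∂periodMeasure ≤
      ENNReal.ofReal (9 * C ^ 2) * ∫⁻ x, ENNReal.ofReal (f' x ^ 2) ∂periodMeasure := by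
  have h1 := integral_pow_four_le hG hc hp hC h hf'
  rw [intervalIntegral.integral_of_le Real.two_pi_pos.le,
    intervalIntegral.integral_of_le Real.two_pi_pos.le] at h1
  have i4 : Integrable (fun x => (f x ^ 2) ^ 2) periodMeasure :=
    (intervalIntegrable_iff_integrableOn_Ioc_of_le Real.two_pi_pos.le).1
      (((hc.pow 2).pow 2).intervalIntegrable (μ := volume) _ _)
  rw [← ofReal_integral_eq_lintegral_ofReal i4 (Eventually.of_forall fun x => by positivity),
    ← ofReal_integral_eq_lintegral_ofReal hf'.integrable_sq
      (Eventually.of_forall fun x => sq_nonneg _), ← ENNReal.ofReal_mul (by positivity)]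
  refine ENNReal.ofReal_le_ofReal ?_
  calc _ = ∫ x in Set.Ioc 0 (2 * Real.pi), f x ^ 4 := by congr 1; ext x; ring
    _ ≤ _ := h1

/-! ### Weak derivatives on the cylinder and on its sections -/

lemma integral_cellMeasure (g : Measure ℝ) [SFinite g] {H : ℝ × ℝ → ℝ}
    (hH : Integrable H (cellMeasure g)) :
    ∫ p, H p ∂(cellMeasure g) = ∫ Ω, (∫ θ in (0 : ℝ)..2 * Real.pi, H (θ, Ω)) ∂g := by
  simp only [intervalIntegral.integral_of_le Real.two_pi_pos.le]
  exact integral_prod_symm _ hH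

lemma ae_memLp_section (g : Measure ℝ) [SFinite g] {U : ℝ × ℝ → ℝ} (hm : Measurable U)
    (hU : MemLp U 2 (cellMeasure g)) : ∀ᵐ Ω ∂g, MemLp (fun θ => U (θ, Ω)) 2 periodMeasure := by
  have h1 : Integrable (fun p => U p ^ 2) (cellMeasure g) := hU.integrable_sq
  filter_upwards [h1.prod_left_ae] with Ω hΩ
  exact (memLp_two_iff_integrable_sq
    (hm.comp (measurable_id.prodMk measurable_const)).aestronglyMeasurable).2 hΩ

lemma ae_ae_of_ae_cellMeasure (g : Measure ℝ) [SFinite g] {p : ℝ × ℝ → Prop}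
    (h : ∀ᵐ q ∂(cellMeasure g), p q) : ∀ᵐ Ω ∂g, ∀ᵐ θ ∂periodMeasure, p (θ, Ω) :=
  Measure.ae_ae_of_ae_prod ((Measure.measurePreserving_swap
    (μ := g) (ν := periodMeasure)).quasiMeasurePreserving.ae h)

lemma integrable_mul_of_bound {X : Type*} [MeasurableSpace X] {μ : Measure X} [IsFiniteMeasure μ]
    {U b : X → ℝ} (hU : MemLp U 2 μ) (hb : AEStronglyMeasurable b μ) {C : ℝ}
    (hC : ∀ᵐ p ∂μ, |b p| ≤ C) : Integrable (fun p => U p * b p) μ :=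
  (hU.integrable (by norm_num)).mul_bdd (c := C) hb hC

/-- For one test function `ψ` of the phase, the weak derivative on the cylinder is one on almost every
section: test with the products `ψ(θ) χ(Ω)`, where `χ` is smooth with compact support. -/
lemma ae_integral_eq_of_isWeakThetaDeriv (g : Measure ℝ) [IsFiniteMeasure g] {U U' : ℝ × ℝ → ℝ}
    (hU : MemLp U 2 (cellMeasure g)) (hU' : MemLp U' 2 (cellMeasure g))
    (hw : IsWeakThetaDeriv g U U') {ψ ψ' : ℝ → ℝ} (hψ : ContDiff ℝ ∞ ψ)
    (hd : ∀ x, HasDerivAt ψ (ψ' x) x) (hc : Continuous ψ')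
    (hp : Function.Periodic ψ (2 * Real.pi)) :
    ∀ᵐ Ω ∂g, ∫ θ in (0 : ℝ)..2 * Real.pi, U (θ, Ω) * ψ' θ =
      -∫ θ in (0 : ℝ)..2 * Real.pi, U' (θ, Ω) * ψ θ := by
  obtain ⟨C, hC⟩ := exists_bound_of_periodic hp (continuous_of_hasDerivAt hd)
  obtain ⟨C', hC'⟩ := exists_bound_of_periodic (periodic_of_hasDerivAt hp hd) hc
  have iU : Integrable (fun p : ℝ × ℝ => U p * ψ' p.1) (cellMeasure g) :=
    integrable_mul_of_bound hU (hc.comp continuous_fst).aestronglyMeasurable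
      (Eventually.of_forall fun p => hC' p.1)
  have iU' : Integrable (fun p : ℝ × ℝ => U' p * ψ p.1) (cellMeasure g) :=
    integrable_mul_of_bound hU'
      ((continuous_of_hasDerivAt hd).comp continuous_fst).aestronglyMeasurable
      (Eventually.of_forall fun p => hC p.1)
  have iS : Integrable (fun p : ℝ × ℝ => U p * ψ' p.1 + U' p * ψ p.1) (cellMeasure g) := iU.add iU'
  have iA : Integrable (fun Ω => ∫ θ in (0 : ℝ)..2 * Real.pi,
      (U (θ, Ω) * ψ' θ + U' (θ, Ω) * ψ θ)) g := by
    simp only [intervalIntegral.integral_of_le Real.two_pi_pos.le]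
    exact iS.integral_prod_right
  have key := ae_eq_zero_of_integral_contDiff_smul_eq_zero iA.locallyIntegrable (by
    intro χ hχ hχc
    have htest : IsTestFunction fun p : ℝ × ℝ => ψ p.1 * χ p.2 := by
      refine ⟨(hψ.comp contDiff_fst).mul (hχ.comp contDiff_snd), fun θ Ω => by simp only [hp θ], ?_⟩
      obtain ⟨R, hR⟩ := hχc.isCompact.isBounded.subset_closedBall 0
      refine ⟨R, fun θ Ω hΩ => ?_⟩
      have : χ Ω = 0 := by
        by_contra hne
        have := hR (subset_tsupport χ hne)
        rw [mem_closedBall_zero_iff, Real.norm_eq_abs] at this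
        linarith
      simp [this]
    have h1 := hw _ htest
    have h2 : ∀ p : ℝ × ℝ, deriv (fun x => ψ (x, p.2).1 * χ (x, p.2).2) p.1 = ψ' p.1 * χ p.2 :=
      fun p => ((hd p.1).mul_const (χ p.2)).deriv
    simp only at h1 h2
    simp only [h2] at h1
    obtain ⟨M, hM⟩ := hχc.exists_bound_of_continuous hχ.continuous
    have hχm : AEStronglyMeasurable (fun p : ℝ × ℝ => χ p.2) (cellMeasure g) :=
      (hχ.continuous.comp continuous_snd).aestronglyMeasurable
    have j1 : Integrable (fun p : ℝ × ℝ => U p * (ψ' p.1 * χ p.2)) (cellMeasure g) := by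
      simp only [← mul_assoc]
      exact iU.mul_bdd (c := M) hχm (Eventually.of_forall fun p => hM p.2)
    have j2 : Integrable (fun p : ℝ × ℝ => U' p * (ψ p.1 * χ p.2)) (cellMeasure g) := by
      simp only [← mul_assoc]
      exact iU'.mul_bdd (c := M) hχm (Eventually.of_forall fun p => hM p.2)
    have h3 : ∫ p, (U p * (ψ' p.1 * χ p.2) + U' p * (ψ p.1 * χ p.2)) ∂(cellMeasure g) = 0 := by
      rw [integral_add j1 j2, h1, neg_add_cancel]
    have j12 : Integrable (fun p : ℝ × ℝ => U p * (ψ' p.1 * χ p.2) + U' p * (ψ p.1 * χ p.2))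
      (cellMeasure g) := j1.add j2
    rw [integral_cellMeasure g j12] at h3
    rw [← h3]
    congr 1
    ext Ω
    rw [smul_eq_mul, ← intervalIntegral.integral_const_mul]
    congr 1
    ext θ
    ring)
  filter_upwards [key, iU.prod_left_ae, iU'.prod_left_ae] with Ω hΩ h1 h2
  rw [intervalIntegral.integral_add] at hΩ
  · linarith
  · rw [intervalIntegrable_iff_integrableOn_Ioc_of_le Real.two_pi_pos.le]; exact h1
  · rw [intervalIntegrable_iff_integrableOn_Ioc_of_le Real.two_pi_pos.le]; exact h2

/-- Almost every section of a weak derivative on the cylinder is a weak derivative of the section: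
countably many trigonometric test functions suffice. -/
theorem ae_secWeak_of_isWeakThetaDeriv (g : Measure ℝ) [IsFiniteMeasure g] {U U' : ℝ × ℝ → ℝ}
    (hm : Measurable U) (hm' : Measurable U')
    (hU : MemLp U 2 (cellMeasure g)) (hU' : MemLp U' 2 (cellMeasure g))
    (hw : IsWeakThetaDeriv g U U') :
    ∀ᵐ Ω ∂g, SecWeak (fun θ => U (θ, Ω)) (fun θ => U' (θ, Ω)) := by
  have hcos : ∀ᵐ Ω ∂g, ∀ k : ℤ, ∫ θ in (0 : ℝ)..2 * Real.pi, U (θ, Ω) * (-(k * Real.sin (k * θ))) =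
      -∫ θ in (0 : ℝ)..2 * Real.pi, U' (θ, Ω) * Real.cos (k * θ) :=
    ae_all_iff.2 fun k => ae_integral_eq_of_isWeakThetaDeriv g hU hU' hw
      (Real.contDiff_cos.comp (contDiff_const.mul contDiff_id)) (hasDerivAt_cos_mul k)
      (by fun_prop) (periodic_cos_mul k)
  have hsin : ∀ᵐ Ω ∂g, ∀ k : ℤ, ∫ θ in (0 : ℝ)..2 * Real.pi, U (θ, Ω) * (k * Real.cos (k * θ)) =
      -∫ θ in (0 : ℝ)..2 * Real.pi, U' (θ, Ω) * Real.sin (k * θ) :=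
    ae_all_iff.2 fun k => ae_integral_eq_of_isWeakThetaDeriv g hU hU' hw
      (Real.contDiff_sin.comp (contDiff_const.mul contDiff_id)) (hasDerivAt_sin_mul k)
      (by fun_prop) (periodic_sin_mul k)
  filter_upwards [hcos, hsin, ae_memLp_section g hm hU, ae_memLp_section g hm' hU']
    with Ω h1 h2 h3 h4
  exact secWeak_of_trig h3 h4 h1 h2

/-- Weak derivatives of the sections give a weak derivative on the cylinder. -/
theorem isWeakThetaDeriv_of_ae_secWeak (g : Measure ℝ) [IsFiniteMeasure g] {U U' : ℝ × ℝ → ℝ}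
    (hU : MemLp U 2 (cellMeasure g)) (hU' : MemLp U' 2 (cellMeasure g))
    (h : ∀ᵐ Ω ∂g, SecWeak (fun θ => U (θ, Ω)) (fun θ => U' (θ, Ω))) : IsWeakThetaDeriv g U U' := by
  intro φ hφ
  have hd : ∀ θ Ω, HasDerivAt (fun x => φ (x, Ω)) (fderiv ℝ φ (θ, Ω) (1, 0)) θ := by
    intro θ Ω
    have h1 := (hφ.smooth.differentiable (by simp) (θ, Ω)).hasFDerivAt
    exact h1.comp_hasDerivAt θ ((hasDerivAt_id θ).prodMk (hasDerivAt_const θ Ω))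
  have hdc : Continuous fun p : ℝ × ℝ => fderiv ℝ φ p (1, 0) :=
    (hφ.smooth.continuous_fderiv (by simp)).clm_apply continuous_const
  have hderiv : ∀ p : ℝ × ℝ, deriv (fun x => φ (x, p.2)) p.1 = fderiv ℝ φ p (1, 0) := fun p =>
    (hd p.1 p.2).deriv
  simp only [hderiv]
  obtain ⟨R, hR⟩ := hφ.support
  have hR' : ∀ θ Ω : ℝ, R < |Ω| → fderiv ℝ φ (θ, Ω) (1, 0) = 0 := by
    intro θ Ω hΩ
    rw [← (hd θ Ω).deriv]
    have : (fun x => φ (x, Ω)) = fun _ => 0 := funext fun x => hR x Ω hΩ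
    rw [this, deriv_const]
  have hK : IsCompact (Set.Icc (0 : ℝ) (2 * Real.pi) ×ˢ Set.Icc (-R) R) :=
    isCompact_Icc.prod isCompact_Icc
  -- a continuous function that vanishes for large frequencies is bounded on the cell
  have hbd : ∀ b : ℝ × ℝ → ℝ, Continuous b → (∀ θ Ω : ℝ, R < |Ω| → b (θ, Ω) = 0) →
      ∃ C, ∀ᵐ p ∂(cellMeasure g), |b p| ≤ C := by
    intro b hb hb0
    obtain ⟨C, hC⟩ := hK.exists_bound_of_continuousOn hb.continuousOn
    have h1 : ∀ᵐ p ∂(cellMeasure g), p.1 ∈ Set.Ioc 0 (2 * Real.pi) := by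
      have h2 : ∀ᵐ θ ∂periodMeasure, θ ∈ Set.Ioc 0 (2 * Real.pi) :=
        ae_restrict_mem measurableSet_Ioc
      exact Measure.quasiMeasurePreserving_fst.ae h2
    refine ⟨max C 0, ?_⟩
    filter_upwards [h1] with p hp
    by_cases hΩ : R < |p.2|
    · rw [show b p = 0 from hb0 p.1 p.2 hΩ, abs_zero]
      exact le_max_right _ _
    · exact (hC p ⟨Set.Ioc_subset_Icc_self hp, abs_le.1 (not_lt.1 hΩ)⟩).trans (le_max_left _ _)
  obtain ⟨C₁, hC₁⟩ := hbd _ hdc hR'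
  obtain ⟨C₂, hC₂⟩ := hbd _ hφ.smooth.continuous hR
  rw [integral_cellMeasure g (integrable_mul_of_bound hU hdc.aestronglyMeasurable hC₁),
    integral_cellMeasure g
      (integrable_mul_of_bound hU' hφ.smooth.continuous.aestronglyMeasurable hC₂), ← integral_neg]
  refine integral_congr_ae ?_
  filter_upwards [h] with Ω hΩ
  exact hΩ.weak (fun x => φ (x, Ω)) (fun x => fderiv ℝ φ (x, Ω) (1, 0)) (fun x => hd x Ω)
    (hdc.comp (by fun_prop)) (fun x => hφ.periodic x Ω)


/-! ### Regularity of the initial data -/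

/-- The restriction of a function on the cylinder to the frequencies in `S`, extended by zero. -/
noncomputable def cut (S : Set ℝ) (f : ℝ → ℝ → ℝ) (p : ℝ × ℝ) : ℝ := S.indicator (f p.1) p.2

lemma cut_of_mem {S : Set ℝ} {f : ℝ → ℝ → ℝ} {θ Ω : ℝ} (h : Ω ∈ S) : cut S f (θ, Ω) = f θ Ω :=
  Set.indicator_of_mem h _

lemma cut_of_notMem {S : Set ℝ} {f : ℝ → ℝ → ℝ} {θ Ω : ℝ} (h : Ω ∉ S) : cut S f (θ, Ω) = 0 :=
  Set.indicator_of_notMem h _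

/-- The pointwise `θ`-derivative. -/
noncomputable def thetaDeriv (f : ℝ → ℝ → ℝ) (θ Ω : ℝ) : ℝ := deriv (fun x => f x Ω) θ

/-- The derivative is the pointwise limit of the difference quotients with step `1 / (n + 1)`. -/
lemma measurable_cut_of_hasDerivAt {S : Set ℝ} {f f' : ℝ → ℝ → ℝ} (hf : Measurable (cut S f))
    (h : ∀ Ω ∈ S, ∀ θ, HasDerivAt (fun x => f x Ω) (f' θ Ω) θ) : Measurable (cut S f') := by
  have hm : ∀ n : ℕ, Measurable fun p : ℝ × ℝ =>
      ((n : ℝ) + 1) * (cut S f (p.1 + 1 / ((n : ℝ) + 1), p.2) - cut S f p) := fun n =>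
    ((hf.comp ((measurable_fst.add_const _).prodMk measurable_snd)).sub hf).const_mul _
  refine measurable_of_tendsto_metrizable hm (tendsto_pi_nhds.2 ?_)
  rintro ⟨θ, Ω⟩
  by_cases hΩ : Ω ∈ S
  · simp only [cut_of_mem hΩ]
    have h1 := (h Ω hΩ θ).tendsto_slope_zero_right
    have h2 : Tendsto (fun n : ℕ => 1 / ((n : ℝ) + 1)) atTop (𝓝[>] 0) :=
      tendsto_nhdsWithin_iff.2 ⟨tendsto_one_div_add_atTop_nhds_zero_nat,
        Eventually.of_forall fun n => Set.mem_Ioi.2 (by positivity)⟩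
    refine (h1.comp h2).congr fun n => ?_
    simp only [Function.comp_apply, smul_eq_mul, one_div, inv_inv]
  · simp only [cut_of_notMem hΩ, sub_self, mul_zero]
    exact tendsto_const_nhds

/-- A family of continuous periodic functions that coincide almost everywhere with the sections of
a measurable function is jointly measurable. -/
lemma measurable_cut_of_ae_eq {S : Set ℝ} (hS : MeasurableSet S) {f : ℝ → ℝ → ℝ} {U : ℝ × ℝ → ℝ}
    (hU : Measurable U) (hc : ∀ Ω ∈ S, Continuous fun θ => f θ Ω)
    (hp : ∀ Ω ∈ S, Function.Periodic (fun θ => f θ Ω) (2 * Real.pi))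
    (he : ∀ Ω ∈ S, (fun θ => U (θ, Ω)) =ᵐ[periodMeasure] fun θ => f θ Ω) :
    Measurable (cut S f) := by
  have hcont : ∀ Ω, Continuous fun θ => cut S f (θ, Ω) := fun Ω => by
    by_cases hΩ : Ω ∈ S
    · simpa only [cut_of_mem hΩ] using hc Ω hΩ
    · simpa only [cut_of_notMem hΩ] using continuous_const
  have hsec : ∀ θ, Measurable fun Ω => cut S f (θ, Ω) := by
    intro θ
    obtain ⟨c, hcm, hθc⟩ : ∃ c ∈ Set.Ico 0 (2 * Real.pi), ∀ Ω ∈ S, f θ Ω = f c Ω := by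
      refine ⟨toIcoMod Real.two_pi_pos 0 θ, by simpa using toIcoMod_mem_Ico Real.two_pi_pos 0 θ,
        fun Ω hΩ => ?_⟩
      have := (hp Ω hΩ).sub_zsmul_eq (x := θ) (toIcoDiv Real.two_pi_pos 0 θ)
      rw [self_sub_toIcoDiv_zsmul] at this
      exact this.symm
    have hm : ∀ n : ℕ, Measurable fun Ω => S.indicator (fun Ω => ((n : ℝ) + 1) *
        ∫ s in Set.Ioc c (c + 1 / ((n : ℝ) + 1)), U (s, Ω)) Ω := by
      intro n
      refine Measurable.indicator (Measurable.const_mul ?_ _) hS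
      exact (hU.stronglyMeasurable.integral_prod_left').measurable
    refine measurable_of_tendsto_metrizable hm (tendsto_pi_nhds.2 fun Ω => ?_)
    by_cases hΩ : Ω ∈ S
    · simp only [cut_of_mem hΩ, Set.indicator_of_mem hΩ, hθc Ω hΩ]
      have h1 : HasDerivAt (fun x => ∫ s in c..x, f s Ω) (f c Ω) c :=
        intervalIntegral.integral_hasDerivAt_right ((hc Ω hΩ).intervalIntegrable _ _)
          (hc Ω hΩ).stronglyMeasurable.stronglyMeasurableAtFilter (hc Ω hΩ).continuousAt
      have h2 : Tendsto (fun n : ℕ => 1 / ((n : ℝ) + 1)) atTop (𝓝[>] 0) :=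
        tendsto_nhdsWithin_iff.2 ⟨tendsto_one_div_add_atTop_nhds_zero_nat,
          Eventually.of_forall fun n => Set.mem_Ioi.2 (by positivity)⟩
      refine (h1.tendsto_slope_zero_right.comp h2).congr' ?_
      have h3 : ∀ᶠ n : ℕ in atTop, 1 / ((n : ℝ) + 1) < 2 * Real.pi - c :=
        tendsto_one_div_add_atTop_nhds_zero_nat.eventually_lt_const (by linarith [hcm.2])
      filter_upwards [h3] with n hn
      simp only [Function.comp_apply, smul_eq_mul, one_div, inv_inv,
        intervalIntegral.integral_same, sub_zero]
      have hpos : (0 : ℝ) < ((n : ℝ) + 1)⁻¹ := by positivity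
      rw [one_div] at hn
      rw [intervalIntegral.integral_of_le (by linarith)]
      congr 1
      refine setIntegral_congr_ae measurableSet_Ioc ?_
      filter_upwards [(ae_restrict_iff' measurableSet_Ioc).1 (he Ω hΩ)] with s hs hs'
      exact (hs ⟨lt_of_le_of_lt hcm.1 hs'.1, by linarith [hs'.2]⟩).symm
    · simp only [cut_of_notMem hΩ, Set.indicator_of_notMem hΩ]
      exact tendsto_const_nhds
  have h1 := measurable_uncurry_of_continuous_of_measurable
    (u := fun θ Ω => cut S f (θ, Ω)) hcont hsec
  exact h1

/-- The periodic extension of a measurable function on the cell. -/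
lemma exists_periodic_extension {U : ℝ × ℝ → ℝ} (hU : Measurable U) : ∃ V : ℝ × ℝ → ℝ,
    Measurable V ∧ (∀ Ω, Function.Periodic (fun θ => V (θ, Ω)) (2 * Real.pi)) ∧
      ∀ Ω, ∀ θ ∈ Set.Ioc 0 (2 * Real.pi), V (θ, Ω) = U (θ, Ω) := by
  have : Fact (0 < 2 * Real.pi) := ⟨Real.two_pi_pos⟩
  refine ⟨fun p => U ((AddCircle.measurableEquivIoc (2 * Real.pi) 0
    (p.1 : AddCircle (2 * Real.pi)) : ℝ), p.2), ?_, fun Ω θ => ?_, fun Ω θ hθ => ?_⟩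
  · exact hU.comp ((measurable_subtype_coe.comp
      ((AddCircle.measurableEquivIoc (2 * Real.pi) 0).measurable.comp
        (AddCircle.measurable_mk'.comp measurable_fst))).prodMk measurable_snd)
  · simp only [AddCircle.coe_add_period]
  · have h1 : (AddCircle.measurableEquivIoc (2 * Real.pi) 0 (θ : AddCircle (2 * Real.pi)) : ℝ) =
        θ := AddCircle.equivIoc_coe_of_mem (p := 2 * Real.pi) (a := 0) (by simpa using hθ)
    simp only [h1]

lemma memLp_cut_of_section_le (g : Measure ℝ) [SFinite g] {S : Set ℝ} (hS : ∀ᵐ Ω ∂g, Ω ∈ S)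
    {f : ℝ → ℝ → ℝ} {U : ℝ × ℝ → ℝ} (hm : Measurable (cut S f)) (hU : Measurable U)
    (hUL : MemLp U 2 (cellMeasure g)) {C : ENNReal} (hC : C ≠ ⊤)
    (h : ∀ Ω ∈ S, ∫⁻ θ, ENNReal.ofReal (f θ Ω ^ 2) ∂periodMeasure ≤
      C * ∫⁻ θ, ENNReal.ofReal (U (θ, Ω) ^ 2) ∂periodMeasure) :
    MemLp (cut S f) 2 (cellMeasure g) := by
  refine memLp_two_of_sqNorm_lt_top hm.aestronglyMeasurable ?_
  have h1 := sqNorm_lt_top_of_memLp hUL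
  rw [sqNorm, lintegral_cellMeasure g (hU.pow_const 2).ennreal_ofReal] at h1
  rw [sqNorm, lintegral_cellMeasure g (hm.pow_const 2).ennreal_ofReal]
  refine lt_of_le_of_lt (lintegral_mono_ae (g := fun Ω => C *
    ∫⁻ θ, ENNReal.ofReal (U (θ, Ω) ^ 2) ∂periodMeasure) ?_) ?_
  · filter_upwards [hS] with Ω hΩ
    simpa only [cut_of_mem hΩ] using h Ω hΩ
  · rw [lintegral_const_mul' _ _ hC]
    exact ENNReal.mul_lt_top hC.lt_top h1

lemma memLp_cut_of_ae_eq (g : Measure ℝ) [SFinite g] {S : Set ℝ} (hS : ∀ᵐ Ω ∂g, Ω ∈ S)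
    {f : ℝ → ℝ → ℝ} {U : ℝ × ℝ → ℝ} (hm : Measurable (cut S f)) (hU : Measurable U)
    (hUL : MemLp U 2 (cellMeasure g))
    (h : ∀ Ω ∈ S, (fun θ => U (θ, Ω)) =ᵐ[periodMeasure] fun θ => f θ Ω) :
    MemLp (cut S f) 2 (cellMeasure g) := by
  refine memLp_cut_of_section_le g hS hm hU hUL ENNReal.one_ne_top fun Ω hΩ => ?_
  rw [one_mul]
  refine le_of_eq (lintegral_congr_ae ?_)
  filter_upwards [h Ω hΩ] with θ hθ
  rw [hθ]

lemma memLp_of_continuous {f : ℝ → ℝ} (hc : Continuous f) : MemLp f 2 periodMeasure := by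
  obtain ⟨M, hM⟩ := (isCompact_Icc (a := (0 : ℝ)) (b := 2 * Real.pi)).exists_bound_of_continuousOn
    hc.continuousOn
  exact MemLp.of_bound hc.aestronglyMeasurable M ((ae_restrict_iff' measurableSet_Ioc).2
    (Eventually.of_forall fun x hx => hM x (Set.Ioc_subset_Icc_self hx)))

/-- The regularity of the initial data on a measurable set `S` of frequencies of full measure:
joint measurability, the top weak derivatives `u₃ = ∂_θ³ u₀` and `r₂ = ∂_θ² ρ₀`, and the square
integrability of the quantities from which the derivatives of the solution are built. -/
structure RegularData (g : Measure ℝ) (G : Set ℝ) (ρ₀ u₀ : ℝ → ℝ → ℝ) (S : Set ℝ)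
    (u₃ r₂ : ℝ × ℝ → ℝ) : Prop where
  subset : S ⊆ G
  measurableSet : MeasurableSet S
  ae_mem : ∀ᵐ Ω ∂g, Ω ∈ S
  meas_u : Measurable (cut S u₀)
  meas_rho : Measurable (cut S ρ₀)
  meas_u₃ : Measurable u₃
  meas_r₂ : Measurable r₂
  periodic_u₃ : ∀ Ω, Function.Periodic (fun θ => u₃ (θ, Ω)) (2 * Real.pi)
  periodic_r₂ : ∀ Ω, Function.Periodic (fun θ => r₂ (θ, Ω)) (2 * Real.pi)
  secWeak_u : ∀ Ω ∈ S, SecWeak (fun θ => thetaDeriv (thetaDeriv u₀) θ Ω) (fun θ => u₃ (θ, Ω))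
  secWeak_rho : ∀ Ω ∈ S, SecWeak (fun θ => thetaDeriv ρ₀ θ Ω) (fun θ => r₂ (θ, Ω))
  memLp_u : MemLp (cut S u₀) 2 (cellMeasure g)
  memLp_u₂ : MemLp (cut S (thetaDeriv (thetaDeriv u₀))) 2 (cellMeasure g)
  memLp_u₂_sq : MemLp (cut S fun θ Ω => thetaDeriv (thetaDeriv u₀) θ Ω ^ 2) 2 (cellMeasure g)
  memLp_r₁ : MemLp (cut S (thetaDeriv ρ₀)) 2 (cellMeasure g)
  memLp_r₁_sq : MemLp (cut S fun θ Ω => thetaDeriv ρ₀ θ Ω ^ 2) 2 (cellMeasure g)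
  memLp_u₃ : MemLp u₃ 2 (cellMeasure g)
  memLp_r₂ : MemLp r₂ 2 (cellMeasure g)

namespace IsInitialData

variable {g : Measure ℝ} {G : Set ℝ} {ρ₀ u₀ : ℝ → ℝ → ℝ} (h : IsInitialData g G ρ₀ u₀)
include h

lemma hasDerivAt_u {Ω : ℝ} (hΩ : Ω ∈ G) (θ : ℝ) :
    HasDerivAt (fun x => u₀ x Ω) (thetaDeriv u₀ θ Ω) θ :=
  ((h.sectC2 Ω hΩ).differentiable (by norm_num) θ).hasDerivAt

lemma contDiff_u₁ {Ω : ℝ} (hΩ : Ω ∈ G) : ContDiff ℝ 1 fun θ => thetaDeriv u₀ θ Ω := by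
  have h2 : ContDiff ℝ (1 + 1) fun θ => u₀ θ Ω := h.sectC2 Ω hΩ
  exact (contDiff_succ_iff_deriv.1 h2).2.2

lemma hasDerivAt_u₁ {Ω : ℝ} (hΩ : Ω ∈ G) (θ : ℝ) :
    HasDerivAt (fun x => thetaDeriv u₀ x Ω) (thetaDeriv (thetaDeriv u₀) θ Ω) θ :=
  ((h.contDiff_u₁ hΩ).differentiable (by norm_num) θ).hasDerivAt

lemma continuous_u₂ {Ω : ℝ} (hΩ : Ω ∈ G) : Continuous fun θ => thetaDeriv (thetaDeriv u₀) θ Ω :=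
  (h.contDiff_u₁ hΩ).continuous_deriv le_rfl

lemma hasDerivAt_rho {Ω : ℝ} (hΩ : Ω ∈ G) (θ : ℝ) :
    HasDerivAt (fun x => ρ₀ x Ω) (thetaDeriv ρ₀ θ Ω) θ :=
  ((h.sectC1 Ω hΩ).differentiable (by norm_num) θ).hasDerivAt

lemma continuous_r₁ {Ω : ℝ} (hΩ : Ω ∈ G) : Continuous fun θ => thetaDeriv ρ₀ θ Ω :=
  (h.sectC1 Ω hΩ).continuous_deriv le_rfl

lemma isC2Profile {Ω : ℝ} (hΩ : Ω ∈ G) : IsC2Profile (fun θ => u₀ θ Ω)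
    (fun θ => thetaDeriv u₀ θ Ω) (fun θ => thetaDeriv (thetaDeriv u₀) θ Ω) :=
  ⟨h.hasDerivAt_u hΩ, h.hasDerivAt_u₁ hΩ, h.continuous_u₂ hΩ, h.periodic_u Ω hΩ⟩

/-- On almost every section the weak derivatives are those of the section, hence agree almost
everywhere with the pointwise ones as long as these exist. The squares of `∂_θ² u₀` and `∂_θ ρ₀` are
square integrable by interpolation between the bounds of `∂_θ u₀` and `ρ₀` and the top derivatives. -/
theorem exists_regularData [IsFiniteMeasure g] (hG : ∀ᵐ Ω ∂g, Ω ∈ G) :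
    ∃ (S : Set ℝ) (u₃ r₂ : ℝ × ℝ → ℝ), RegularData g G ρ₀ u₀ S u₃ r₂ := by
  obtain ⟨C, hC⟩ := h.bounded
  obtain ⟨U, hU, hU0⟩ := h.sobolev_u
  obtain ⟨R, hR, hR0⟩ := h.sobolev_rho
  have mU : ∀ j, Measurable (U j : ℝ × ℝ → ℝ) := fun j => (Lp.stronglyMeasurable _).measurable
  have mR : ∀ j, Measurable (R j : ℝ × ℝ → ℝ) := fun j => (Lp.stronglyMeasurable _).measurable
  have lU : ∀ j, MemLp (U j : ℝ × ℝ → ℝ) 2 (cellMeasure g) := fun j => Lp.memLp _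
  have lR : ∀ j, MemLp (R j : ℝ × ℝ → ℝ) 2 (cellMeasure g) := fun j => Lp.memLp _
  have wU : ∀ᵐ Ω ∂g, ∀ j : Fin 3, SecWeak (fun θ => U j.castSucc (θ, Ω))
      (fun θ => U j.succ (θ, Ω)) := ae_all_iff.2 fun j =>
    ae_secWeak_of_isWeakThetaDeriv g (mU _) (mU _) (lU _) (lU _) (hU j)
  have wR : ∀ᵐ Ω ∂g, ∀ j : Fin 2, SecWeak (fun θ => R j.castSucc (θ, Ω))
      (fun θ => R j.succ (θ, Ω)) := ae_all_iff.2 fun j =>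
    ae_secWeak_of_isWeakThetaDeriv g (mR _) (mR _) (lR _) (lR _) (hR j)
  have sU : ∀ᵐ Ω ∂g, ∀ j, MemLp (fun θ => U j (θ, Ω)) 2 periodMeasure :=
    ae_all_iff.2 fun j => ae_memLp_section g (mU j) (lU j)
  have sR : ∀ᵐ Ω ∂g, ∀ j, MemLp (fun θ => R j (θ, Ω)) 2 periodMeasure :=
    ae_all_iff.2 fun j => ae_memLp_section g (mR j) (lR j)
  obtain ⟨S, hSae, hSm, hS⟩ := ((hG.and (wU.and (wR.and (sU.and (sR.and
    ((ae_ae_of_ae_cellMeasure g hU0).and (ae_ae_of_ae_cellMeasure g hR0))))))).exists_measurable_mem)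
  have hSG : S ⊆ G := fun Ω hΩ => (hS Ω hΩ).1
  have e1 : ∀ Ω ∈ S, (fun θ => U 1 (θ, Ω)) =ᵐ[periodMeasure] fun θ => thetaDeriv u₀ θ Ω := by
    intro Ω hΩ
    obtain ⟨hΩG, h1, -, h2, -, h3, -⟩ := hS Ω hΩ
    refine SecWeak.unique ((h1 0).congr_ae h3 (ae_eq_refl _))
      (SecWeak.of_hasDerivAt (h.hasDerivAt_u hΩG) (h.contDiff_u₁ hΩG).continuous
        (h.periodic_u Ω hΩG)) (h2 1) (memLp_of_continuous (h.contDiff_u₁ hΩG).continuous)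
  have e2 : ∀ Ω ∈ S, (fun θ => U 2 (θ, Ω)) =ᵐ[periodMeasure]
      fun θ => thetaDeriv (thetaDeriv u₀) θ Ω := by
    intro Ω hΩ
    obtain ⟨hΩG, h1, -, h2, -, h3, -⟩ := hS Ω hΩ
    refine SecWeak.unique ((h1 1).congr_ae (e1 Ω hΩ) (ae_eq_refl _))
      (SecWeak.of_hasDerivAt (h.hasDerivAt_u₁ hΩG) (h.continuous_u₂ hΩG)
        (periodic_of_hasDerivAt (h.periodic_u Ω hΩG) (h.hasDerivAt_u hΩG))) (h2 2)
        (memLp_of_continuous (h.continuous_u₂ hΩG))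
  have e3 : ∀ Ω ∈ S, (fun θ => R 1 (θ, Ω)) =ᵐ[periodMeasure] fun θ => thetaDeriv ρ₀ θ Ω := by
    intro Ω hΩ
    obtain ⟨hΩG, -, h1, -, h2, -, h3⟩ := hS Ω hΩ
    refine SecWeak.unique ((h1 0).congr_ae h3 (ae_eq_refl _))
      (SecWeak.of_hasDerivAt (h.hasDerivAt_rho hΩG) (h.continuous_r₁ hΩG)
        (h.periodic_rho Ω hΩG)) (h2 1) (memLp_of_continuous (h.continuous_r₁ hΩG))
  obtain ⟨u₃, mu₃, pu₃, eu₃⟩ := exists_periodic_extension (mU 3)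
  obtain ⟨r₂, mr₂, pr₂, er₂⟩ := exists_periodic_extension (mR 2)
  have eu₃' : ∀ Ω, (fun θ => U 3 (θ, Ω)) =ᵐ[periodMeasure] fun θ => u₃ (θ, Ω) := fun Ω =>
    (ae_restrict_iff' measurableSet_Ioc).2 (Eventually.of_forall fun θ hθ => (eu₃ Ω θ hθ).symm)
  have er₂' : ∀ Ω, (fun θ => R 2 (θ, Ω)) =ᵐ[periodMeasure] fun θ => r₂ (θ, Ω) := fun Ω =>
    (ae_restrict_iff' measurableSet_Ioc).2 (Eventually.of_forall fun θ hθ => (er₂ Ω θ hθ).symm)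
  have su₃ : ∀ Ω ∈ S, SecWeak (fun θ => thetaDeriv (thetaDeriv u₀) θ Ω) (fun θ => u₃ (θ, Ω)) :=
    fun Ω hΩ => ((hS Ω hΩ).2.1 2).congr_ae (e2 Ω hΩ) (eu₃' Ω)
  have sr₂ : ∀ Ω ∈ S, SecWeak (fun θ => thetaDeriv ρ₀ θ Ω) (fun θ => r₂ (θ, Ω)) :=
    fun Ω hΩ => ((hS Ω hΩ).2.2.1 1).congr_ae (e3 Ω hΩ) (er₂' Ω)
  have mu : Measurable (cut S u₀) := measurable_cut_of_ae_eq hSm (mU 0)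
    (fun Ω hΩ => (h.sectC2 Ω (hSG hΩ)).continuous) (fun Ω hΩ => h.periodic_u Ω (hSG hΩ))
    (fun Ω hΩ => (hS Ω hΩ).2.2.2.2.2.1)
  have mrho : Measurable (cut S ρ₀) := measurable_cut_of_ae_eq hSm (mR 0)
    (fun Ω hΩ => (h.sectC1 Ω (hSG hΩ)).continuous) (fun Ω hΩ => h.periodic_rho Ω (hSG hΩ))
    (fun Ω hΩ => (hS Ω hΩ).2.2.2.2.2.2)
  have mu₁ := measurable_cut_of_hasDerivAt mu fun Ω hΩ => h.hasDerivAt_u (hSG hΩ)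
  have mu₂ := measurable_cut_of_hasDerivAt mu₁ fun Ω hΩ => h.hasDerivAt_u₁ (hSG hΩ)
  have mr₁ := measurable_cut_of_hasDerivAt mrho fun Ω hΩ => h.hasDerivAt_rho (hSG hΩ)
  have msq : ∀ f : ℝ → ℝ → ℝ, Measurable (cut S f) → Measurable (cut S fun θ Ω => f θ Ω ^ 2) := by
    intro f hf
    have : (cut S fun θ Ω => f θ Ω ^ 2) = fun p => cut S f p ^ 2 := by
      ext ⟨θ, Ω⟩
      by_cases hΩ : Ω ∈ S
      · simp only [cut_of_mem hΩ]
      · simp only [cut_of_notMem hΩ]; ring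
    rw [this]
    exact hf.pow_const 2
  have lofae : ∀ {V W : ℝ × ℝ → ℝ}, Measurable V → MemLp W 2 (cellMeasure g) → Measurable W →
      (∀ Ω, (fun θ => W (θ, Ω)) =ᵐ[periodMeasure] fun θ => V (θ, Ω)) →
      MemLp V 2 (cellMeasure g) := by
    intro V W hV hW hWm he
    have h1 : cut Set.univ (fun θ Ω => V (θ, Ω)) = V := by
      ext ⟨θ, Ω⟩; exact cut_of_mem (Set.mem_univ _)
    rw [← h1]
    exact memLp_cut_of_ae_eq g (Eventually.of_forall fun _ => Set.mem_univ _) (by rwa [h1]) hWm hW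
      fun Ω _ => he Ω
  have lu₃ := lofae mu₃ (lU 3) (mU 3) eu₃'
  have lr₂ := lofae mr₂ (lR 2) (mR 2) er₂'
  refine ⟨S, u₃, r₂, ⟨hSG, hSm, hSae, mu, mrho, mu₃, mr₂, pu₃, pr₂, su₃, sr₂,
    memLp_cut_of_ae_eq g hSae mu (mU 0) (lU 0) (fun Ω hΩ => (hS Ω hΩ).2.2.2.2.2.1),
    memLp_cut_of_ae_eq g hSae mu₂ (mU 2) (lU 2) e2, ?_,
    memLp_cut_of_ae_eq g hSae mr₁ (mR 1) (lR 1) e3, ?_, lu₃, lr₂⟩⟩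
  · refine memLp_cut_of_section_le g hSae (msq _ mu₂) (mU 3) (lU 3)
      (C := ENNReal.ofReal (9 * C ^ 2)) ENNReal.ofReal_ne_top fun Ω hΩ => ?_
    have hΩG := hSG hΩ
    exact lintegral_pow_four_le (h.hasDerivAt_u₁ hΩG) (h.continuous_u₂ hΩG)
      (periodic_of_hasDerivAt (h.periodic_u Ω hΩG) (h.hasDerivAt_u hΩG))
      (fun θ => (hC θ Ω hΩG).2) ((su₃ Ω hΩ).congr_ae (ae_eq_refl _) (eu₃' Ω).symm)
      ((hS Ω hΩ).2.2.2.1 3)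
  · refine memLp_cut_of_section_le g hSae (msq _ mr₁) (mR 2) (lR 2)
      (C := ENNReal.ofReal (9 * C ^ 2)) ENNReal.ofReal_ne_top fun Ω hΩ => ?_
    have hΩG := hSG hΩ
    exact lintegral_pow_four_le (h.hasDerivAt_rho hΩG) (h.continuous_r₁ hΩG)
      (h.periodic_rho Ω hΩG)
      (fun θ => (hC θ Ω hΩG).1) ((sr₂ Ω hΩ).congr_ae (ae_eq_refl _) (er₂' Ω).symm)
      ((hS Ω hΩ).2.2.2.2.1 2)

end IsInitialData


/-! ### The self-consistent mean field -/

/-- Two flows driven by different forces. In the weighted norm the distance of the flows is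
controlled by a small multiple of the distance of the forces. -/
lemma ForceField.abs_pos_sub_le (F F' : ForceField) (a b α v : ℝ) {κ δ T : ℝ} (hκ : 0 < κ)
    (hδ : 0 ≤ δ)
    (h : ∀ t ∈ Set.Icc 0 T, |F.S t - F'.S t| ≤ δ * Real.exp ((2 + |a| + 2 * F.B + 4 * κ) * t) ∧
      |F.C t - F'.C t| ≤ δ * Real.exp ((2 + |a| + 2 * F.B + 4 * κ) * t)) :
    ∀ t ∈ Set.Icc 0 T, |F.pos a b α v t - F'.pos a b α v t| ≤
      1 / (2 * κ) * δ * Real.exp ((2 + |a| + 2 * F.B + 4 * κ) * t) := by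
  set lam := 2 + |a| + 2 * F.B + 4 * κ with hlam
  have hB := F.B_nonneg
  have hval : ∀ t θ, |F.val t θ - F'.val t θ| ≤ |F.S t - F'.S t| + |F.C t - F'.C t| := by
    intro t θ
    have : F.val t θ - F'.val t θ = (F.S t - F'.S t) * Real.cos θ - (F.C t - F'.C t) * Real.sin θ := by
      simp only [ForceField.val]; ring
    rw [this]
    refine (abs_sub _ _).trans (add_le_add ?_ ?_)
    · rw [abs_mul]; exact mul_le_of_le_one_right (abs_nonneg _) (Real.abs_cos_le_one _)
    · rw [abs_mul]; exact mul_le_of_le_one_right (abs_nonneg _) (Real.abs_sin_le_one _)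
  -- strict barrier for a slightly larger `δ`
  have key : ∀ η, 0 < η → ∀ t ∈ Set.Icc 0 T, |F.pos a b α v t - F'.pos a b α v t| ≤
      1 / (2 * κ) * (δ + η) * Real.exp (lam * t) := by
    intro η hη t ht
    set e : ℝ → ℝ × ℝ := fun t => (F.pos a b α v t - F'.pos a b α v t,
      F.vel a b α v t - F'.vel a b α v t) with he
    have hed : ∀ t, HasDerivAt e (F.vel a b α v t - F'.vel a b α v t,
        (-(a * F.vel a b α v t) + (b + F.val t (F.pos a b α v t))) -
          (-(a * F'.vel a b α v t) + (b + F'.val t (F'.pos a b α v t)))) t := fun t =>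
      ((F.hasDerivAt_pos a b α v t).sub (F'.hasDerivAt_pos a b α v t)).prodMk
        ((F.hasDerivAt_vel a b α v t).sub (F'.hasDerivAt_vel a b α v t))
    have hBd : ∀ t, HasDerivAt (fun t => 1 / (2 * κ) * (δ + η) * Real.exp (lam * t))
        (1 / (2 * κ) * (δ + η) * (Real.exp (lam * t) * lam)) t := fun t => by
      have := ((hasDerivAt_id t).const_mul lam).exp.const_mul (1 / (2 * κ) * (δ + η))
      simpa using this
    have h0 : ‖e 0‖ ≤ 1 / (2 * κ) * (δ + η) * Real.exp (lam * 0) := by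
      have : e 0 = 0 := by
        simp [he, F.pos_zero, F'.pos_zero, F.vel_zero, F'.vel_zero]
      rw [this, norm_zero]; positivity
    have := image_norm_le_of_norm_deriv_right_lt_deriv_boundary (a := 0) (b := T)
      (fun t _ => (hed t).continuousAt.continuousWithinAt)
      (fun t _ => (hed t).hasDerivWithinAt) h0 hBd (fun s hs hes => by
        have hs' : s ∈ Set.Icc 0 T := Set.Ico_subset_Icc_self hs
        obtain ⟨h1, h2⟩ := h s hs'
        set E := Real.exp (lam * s) with hE
        have hEp : 0 < E := Real.exp_pos _
        set A := 1 / (2 * κ) * (δ + η) with hA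
        have hAp : 0 < A := by positivity
        have hAκ : 4 * κ * A = 2 * (δ + η) := by rw [hA]; field_simp; ring
        have n1 : |F.pos a b α v s - F'.pos a b α v s| ≤ A * E := by
          rw [← hes]; exact norm_fst_le (e s)
        have n2 : |F.vel a b α v s - F'.vel a b α v s| ≤ A * E := by
          rw [← hes]; exact norm_snd_le (e s)
        rw [Prod.norm_def, max_lt_iff]
        simp only [Real.norm_eq_abs]
        have hAE : 0 < A * E := by positivity
        have p1 : A * (E * lam) = (2 + |a| + 2 * F.B) * (A * E) + 2 * (δ + η) * E := by
          rw [hlam, ← hAκ]; ring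
        rw [p1]
        have hηE : 0 < η * E := by positivity
        have hδE : 0 ≤ δ * E := by positivity
        have haE : 0 ≤ |a| * (A * E) := by positivity
        have hbE : 0 ≤ 2 * F.B * (A * E) := by positivity
        constructor
        · nlinarith
        · have q1 : -(a * F.vel a b α v s) + (b + F.val s (F.pos a b α v s)) -
              (-(a * F'.vel a b α v s) + (b + F'.val s (F'.pos a b α v s))) =
              -(a * (F.vel a b α v s - F'.vel a b α v s)) +
              ((F.val s (F.pos a b α v s) - F.val s (F'.pos a b α v s)) +
              (F.val s (F'.pos a b α v s) - F'.val s (F'.pos a b α v s))) := by ring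
          rw [q1]
          have q2 := abs_add_le (-(a * (F.vel a b α v s - F'.vel a b α v s)))
            ((F.val s (F.pos a b α v s) - F.val s (F'.pos a b α v s)) +
              (F.val s (F'.pos a b α v s) - F'.val s (F'.pos a b α v s)))
          have q3 := abs_add_le (F.val s (F.pos a b α v s) - F.val s (F'.pos a b α v s))
              (F.val s (F'.pos a b α v s) - F'.val s (F'.pos a b α v s))
          have q4 := F.abs_val_sub_le s (F'.pos a b α v s) (F.pos a b α v s)
          have q5 := hval s (F'.pos a b α v s)
          have q6 : |-(a * (F.vel a b α v s - F'.vel a b α v s))| ≤ |a| * (A * E) := by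
            rw [abs_neg, abs_mul]; gcongr
          have q7 : 2 * F.B * |F.pos a b α v s - F'.pos a b α v s| ≤ 2 * F.B * (A * E) := by gcongr
          nlinarith) ht
    exact (norm_fst_le (e t)).trans this
  intro t ht
  have hlim : Tendsto (fun η : ℝ => 1 / (2 * κ) * (δ + η) * Real.exp (lam * t)) (𝓝[>] 0)
      (𝓝 (1 / (2 * κ) * (δ + 0) * Real.exp (lam * t))) := by
    refine Tendsto.mono_left ?_ nhdsWithin_le_nhds
    exact Continuous.tendsto (by fun_prop) 0
  rw [add_zero] at hlim
  refine ge_of_tendsto hlim ?_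
  filter_upwards [self_mem_nhdsWithin] with η hη using key η hη t ht

lemma abs_sin_sub_sin_le (x y : ℝ) : |Real.sin x - Real.sin y| ≤ |x - y| := by
  simpa using ForceField.abs_sub_le_of_hasDerivAt (K := 1) Real.hasDerivAt_sin
    Real.abs_cos_le_one y x

lemma abs_cos_sub_cos_le (x y : ℝ) : |Real.cos x - Real.cos y| ≤ |x - y| := by
  simpa using ForceField.abs_sub_le_of_hasDerivAt (K := 1) Real.hasDerivAt_cos
    (fun x => by simpa using Real.abs_sin_le_one x) y x

/-- Measurable initial velocities and a probability density, as functions of the initial phase and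
the frequency. -/
structure IsMassData (μ : Measure (ℝ × ℝ)) (v r : ℝ × ℝ → ℝ) : Prop where
  meas_v : Measurable v
  meas_r : Measurable r
  nonneg : ∀ p, 0 ≤ r p
  integrable : Integrable r μ
  integral_one : ∫ p, r p ∂μ = 1

/-- The force `F` is, up to time `T`, the mean field `κ ∫ sin(x - θ) r` of the particles that move
under `F`. -/
def IsSelfConsistent (a κ : ℝ) (μ : Measure (ℝ × ℝ)) (v r : ℝ × ℝ → ℝ) (F : ForceField) (T : ℝ) :
    Prop :=
  ∀ t ∈ Set.Icc 0 T, F.S t = κ * ∫ p, Real.sin (F.pos a (a * p.2) p.1 (v p) t) * r p ∂μ ∧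
    F.C t = κ * ∫ p, Real.cos (F.pos a (a * p.2) p.1 (v p) t) * r p ∂μ

namespace IsMassData

variable {μ : Measure (ℝ × ℝ)} {v r : ℝ × ℝ → ℝ} (h : IsMassData μ v r)
include h

lemma measurable_pos (F : ForceField) (a t : ℝ) :
    Measurable fun p : ℝ × ℝ => F.pos a (a * p.2) p.1 (v p) t :=
  (F.continuous_flow a t).1.measurable.comp
    ((measurable_snd.const_mul a).prodMk (measurable_fst.prodMk h.meas_v))

lemma integrable_bdd_mul {b : ℝ × ℝ → ℝ} (hb : AEStronglyMeasurable b μ) {C : ℝ}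
    (hC : ∀ p, |b p| ≤ C) : Integrable (fun p => b p * r p) μ :=
  h.integrable.bdd_mul (c := C) hb (Eventually.of_forall hC)

lemma abs_integral_mul_le {b : ℝ × ℝ → ℝ} {C : ℝ} (hC : ∀ p, |b p| ≤ C) :
    |∫ p, b p * r p ∂μ| ≤ C := by
  have h1 : ‖∫ p, b p * r p ∂μ‖ ≤ ∫ p, C * r p ∂μ :=
    norm_integral_le_of_norm_le (h.integrable.const_mul C) (Eventually.of_forall fun p => by
      rw [Real.norm_eq_abs, abs_mul, abs_of_nonneg (h.nonneg p)]
      exact mul_le_mul_of_nonneg_right (hC p) (h.nonneg p))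
  rwa [integral_const_mul, h.integral_one, mul_one] at h1

lemma abs_integral_comp_sub_le {f : ℝ → ℝ} (hf : Continuous f) (hf1 : ∀ x, |f x| ≤ 1)
    (hlip : ∀ x y, |f x - f y| ≤ |x - y|) {X X' : ℝ × ℝ → ℝ} (hX : Measurable X)
    (hX' : Measurable X') {C : ℝ} (hC : ∀ p, |X p - X' p| ≤ C) :
    |(∫ p, f (X p) * r p ∂μ) - ∫ p, f (X' p) * r p ∂μ| ≤ C := by
  have i1 : Integrable (fun p => f (X p) * r p) μ :=
    h.integrable_bdd_mul (hf.measurable.comp hX).aestronglyMeasurable fun p => hf1 _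
  have i2 : Integrable (fun p => f (X' p) * r p) μ :=
    h.integrable_bdd_mul (hf.measurable.comp hX').aestronglyMeasurable fun p => hf1 _
  rw [← integral_sub i1 i2]
  simp only [← sub_mul]
  exact h.abs_integral_mul_le fun p => (hlip _ _).trans (hC p)

lemma continuous_integral_comp {f : ℝ → ℝ} (hf : Continuous f) (hf1 : ∀ x, |f x| ≤ 1)
    (F : ForceField) (a : ℝ) :
    Continuous fun t => ∫ p, f (F.pos a (a * p.2) p.1 (v p) t) * r p ∂μ := by
  refine continuous_of_dominated (bound := r) (fun t => ?_) (fun t => Eventually.of_forall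
    fun p => ?_) h.integrable (Eventually.of_forall fun p => ?_)
  · exact ((hf.measurable.comp (h.measurable_pos F a t)).mul h.meas_r).aestronglyMeasurable
  · rw [norm_mul, Real.norm_eq_abs, Real.norm_eq_abs, abs_of_nonneg (h.nonneg p)]
    exact mul_le_of_le_one_left (h.nonneg p) (hf1 _)
  · exact (hf.comp (continuous_of_hasDerivAt (F.hasDerivAt_pos a _ _ _))).mul continuous_const

/-- One step of the fixed point iteration halves the weighted distance of the fields. -/
lemma abs_field_sub_le (F F' : ForceField) {a κ δ T : ℝ} (hκ : 0 < κ) (hδ : 0 ≤ δ)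
    (hd : ∀ t ∈ Set.Icc 0 T, |F.S t - F'.S t| ≤ δ * Real.exp ((2 + |a| + 2 * F.B + 4 * κ) * t) ∧
      |F.C t - F'.C t| ≤ δ * Real.exp ((2 + |a| + 2 * F.B + 4 * κ) * t))
    {f : ℝ → ℝ} (hf : Continuous f) (hf1 : ∀ x, |f x| ≤ 1)
    (hlip : ∀ x y, |f x - f y| ≤ |x - y|) {t : ℝ} (ht : t ∈ Set.Icc 0 T) :
    |κ * (∫ p, f (F.pos a (a * p.2) p.1 (v p) t) * r p ∂μ) -
      κ * ∫ p, f (F'.pos a (a * p.2) p.1 (v p) t) * r p ∂μ| ≤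
      δ / 2 * Real.exp ((2 + |a| + 2 * F.B + 4 * κ) * t) := by
  have h1 := h.abs_integral_comp_sub_le hf hf1 hlip (h.measurable_pos F a t)
    (h.measurable_pos F' a t) fun p => F.abs_pos_sub_le F' a (a * p.2) p.1 (v p) hκ hδ hd t ht
  rw [← mul_sub, abs_mul, abs_of_pos hκ]
  refine (mul_le_mul_of_nonneg_left h1 hκ.le).trans (le_of_eq ?_)
  field_simp

/-- Two self-consistent fields coincide. -/
theorem selfConsistent_unique {F F' : ForceField} {a κ T : ℝ} (hκ : 0 < κ) (hT : 0 ≤ T)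
    (hF : IsSelfConsistent a κ μ v r F T) (hF' : IsSelfConsistent a κ μ v r F' T) :
    ∀ t ∈ Set.Icc 0 T, F.S t = F'.S t ∧ F.C t = F'.C t := by
  set lam := 2 + |a| + 2 * F.B + 4 * κ with hlam
  set w : ℝ → ℝ := fun t => max |F.S t - F'.S t| |F.C t - F'.C t| * Real.exp (-(lam * t)) with hw
  have hwc : Continuous w := by
    have := F.contS; have := F.contC; have := F'.contS; have := F'.contC
    simp only [hw]
    fun_prop
  obtain ⟨t₀, ht₀, hmax⟩ := isCompact_Icc.exists_isMaxOn (Set.nonempty_Icc.2 hT) hwc.continuousOn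
  have hw0 : 0 ≤ w t₀ := mul_nonneg (le_max_of_le_left (abs_nonneg _)) (Real.exp_pos _).le
  have hexp : ∀ t, Real.exp (-(lam * t)) * Real.exp (lam * t) = 1 := fun t => by
    rw [← Real.exp_add]; simp
  have hd : ∀ t ∈ Set.Icc 0 T, |F.S t - F'.S t| ≤ w t₀ * Real.exp (lam * t) ∧
      |F.C t - F'.C t| ≤ w t₀ * Real.exp (lam * t) := by
    intro t ht
    have h1 : w t ≤ w t₀ := hmax ht
    have h2 : max |F.S t - F'.S t| |F.C t - F'.C t| = w t * Real.exp (lam * t) := by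
      simp only [hw]; rw [mul_assoc, hexp, mul_one]
    have h3 := mul_le_mul_of_nonneg_right h1 (Real.exp_pos (lam * t)).le
    rw [← h2] at h3
    exact ⟨(le_max_left _ _).trans h3, (le_max_right _ _).trans h3⟩
  have e1 := h.abs_field_sub_le F F' hκ hw0 hd Real.continuous_sin Real.abs_sin_le_one
    abs_sin_sub_sin_le ht₀
  have e2 := h.abs_field_sub_le F F' hκ hw0 hd Real.continuous_cos Real.abs_cos_le_one
    abs_cos_sub_cos_le ht₀
  rw [← (hF t₀ ht₀).1, ← (hF' t₀ ht₀).1] at e1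
  rw [← (hF t₀ ht₀).2, ← (hF' t₀ ht₀).2] at e2
  have e3 := mul_le_mul_of_nonneg_right (max_le e1 e2) (Real.exp_pos (-(lam * t₀))).le
  rw [mul_assoc, mul_comm (Real.exp _), hexp, mul_one] at e3
  have e4 : w t₀ = 0 := by
    have : w t₀ ≤ w t₀ / 2 := e3
    linarith
  intro t ht
  have h4 := hd t ht
  rw [e4, zero_mul] at h4
  exact ⟨sub_eq_zero.1 (abs_nonpos_iff.1 h4.1), sub_eq_zero.1 (abs_nonpos_iff.1 h4.2)⟩

/-- Existence of the self-consistent field for all times. -/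
theorem exists_selfConsistent {a κ : ℝ} (hκ : 0 < κ) :
    ∃ F : ForceField, ∀ T, IsSelfConsistent a κ μ v r F T := by
  -- the force generated by a path in the plane, clipped to the size `κ` of every mean field
  let clip : ℝ → ℝ := fun s => max (-κ) (min κ s)
  have hclipc : Continuous clip := by fun_prop
  have hclip : ∀ s, |clip s| ≤ κ := fun s =>
    abs_le.2 ⟨le_max_left _ _, max_le (by linarith) (min_le_left _ _)⟩
  have hclipl : ∀ s s', |clip s - clip s'| ≤ |s - s'| := fun s s' =>
    (abs_max_sub_max_le_max _ _ _ _).trans (by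
      rw [sub_self, abs_zero]
      exact max_le (abs_nonneg _) ((abs_min_sub_min_le_max _ _ _ _).trans (by simp)))
  have hclipe : ∀ s, |s| ≤ κ → clip s = s := fun s hs => by
    simp only [clip]
    rw [min_eq_right (abs_le.1 hs).2, max_eq_right (abs_le.1 hs).1]
  classical
  let field : (ℝ → ℝ × ℝ) → ForceField := fun Z =>
    if hZ : Continuous Z then
      ⟨fun t => clip (Z t).1, fun t => clip (Z t).2, κ, hclipc.comp hZ.fst, hclipc.comp hZ.snd,
        fun t => hclip _, fun t => hclip _⟩
    else ⟨fun _ => 0, fun _ => 0, κ, continuous_const, continuous_const,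
        fun t => by simpa using hκ.le, fun t => by simpa using hκ.le⟩
  have hfield : ∀ Z, Continuous Z → (field Z).B = κ ∧ (∀ t, (field Z).S t = clip (Z t).1) ∧
      ∀ t, (field Z).C t = clip (Z t).2 := fun Z hZ => by
    simp only [field, dif_pos hZ, implies_true, and_self]
  let I : (ℝ → ℝ) → ForceField → ℝ → ℝ := fun f F t =>
    κ * ∫ p, f (F.pos a (a * p.2) p.1 (v p) t) * r p ∂μ
  have hI : ∀ f F t, (∀ x, |f x| ≤ 1) → |I f F t| ≤ κ := fun f F t hf => by
    simp only [I]
    rw [abs_mul, abs_of_pos hκ]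
    exact mul_le_of_le_one_right hκ.le (h.abs_integral_mul_le fun p => hf _)
  let Γ : (ℝ → ℝ × ℝ) → ℝ → ℝ × ℝ := fun Z t =>
    (I Real.sin (field Z) (max t 0), I Real.cos (field Z) (max t 0))
  set lam := 2 + |a| + 2 * κ + 4 * κ with hlam
  have hlamp : 0 ≤ lam := by positivity
  obtain ⟨Z, hZc, hZ⟩ := exists_fixedPoint_weighted Γ lam κ
    (fun Z _ => by
      have h1 := h.continuous_integral_comp Real.continuous_sin Real.abs_sin_le_one (field Z) a
      have h2 := h.continuous_integral_comp Real.continuous_cos Real.abs_cos_le_one (field Z) a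
      have h3 : Continuous fun t : ℝ => max t 0 := by fun_prop
      exact (continuous_const.mul (h1.comp h3)).prodMk (continuous_const.mul (h2.comp h3)))
    (fun Z Z' hZ hZ' δ hδ hd t => by
      obtain ⟨b1, s1, c1⟩ := hfield Z hZ
      obtain ⟨b2, s2, c2⟩ := hfield Z' hZ'
      have hd' : ∀ s ∈ Set.Icc 0 (max t 0),
          |(field Z).S s - (field Z').S s| ≤
            δ * Real.exp ((2 + |a| + 2 * (field Z).B + 4 * κ) * s) ∧
          |(field Z).C s - (field Z').C s| ≤
            δ * Real.exp ((2 + |a| + 2 * (field Z).B + 4 * κ) * s) := by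
        intro s hs
        have h1 := hd s
        rw [abs_of_nonneg hs.1] at h1
        rw [b1, s1, s2, c1, c2]
        exact ⟨(hclipl _ _).trans ((norm_fst_le (Z s - Z' s)).trans h1),
          (hclipl _ _).trans ((norm_snd_le (Z s - Z' s)).trans h1)⟩
      have hmem : max t 0 ∈ Set.Icc 0 (max t 0) := ⟨le_max_right _ _, le_rfl⟩
      have e1 := h.abs_field_sub_le _ _ hκ hδ hd' Real.continuous_sin Real.abs_sin_le_one
        abs_sin_sub_sin_le hmem
      have e2 := h.abs_field_sub_le _ _ hκ hδ hd' Real.continuous_cos Real.abs_cos_le_one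
        abs_cos_sub_cos_le hmem
      rw [b1] at e1 e2
      have e3 : δ / 2 * Real.exp (lam * max t 0) ≤ δ / 2 * Real.exp (lam * |t|) := by
        gcongr
        exact max_le (le_abs_self t) (abs_nonneg t)
      exact (max_le e1 e2).trans e3)
    (fun t => by
      have h1 : ‖Γ (fun _ => 0) t‖ ≤ κ := max_le (hI _ _ _ Real.abs_sin_le_one)
        (hI _ _ _ Real.abs_cos_le_one)
      exact h1.trans (le_mul_of_one_le_right hκ.le (Real.one_le_exp (by positivity))))
  obtain ⟨-, s1, c1⟩ := hfield Z hZc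
  refine ⟨field Z, fun T t ht => ?_⟩
  have h1 : Z t = (I Real.sin (field Z) t, I Real.cos (field Z) t) := by
    have := congrFun hZ t
    simp only [Γ, max_eq_left ht.1] at this
    exact this.symm
  rw [s1, c1, h1]
  exact ⟨hclipe _ (hI _ _ _ Real.abs_sin_le_one), hclipe _ (hI _ _ _ Real.abs_cos_le_one)⟩

/-- A self-consistent force at `θ` is the integral of `κ sin(x - θ)` over the mass. -/
lemma val_eq {F : ForceField} {a κ T t : ℝ} (hF : IsSelfConsistent a κ μ v r F T)
    (ht : t ∈ Set.Icc 0 T) (θ : ℝ) :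
    F.val t θ = κ * ∫ p, Real.sin (F.pos a (a * p.2) p.1 (v p) t - θ) * r p ∂μ := by
  have i1 : Integrable (fun p => Real.sin (F.pos a (a * p.2) p.1 (v p) t) * r p) μ :=
    h.integrable_bdd_mul (Real.continuous_sin.measurable.comp
      (h.measurable_pos F a t)).aestronglyMeasurable fun p => Real.abs_sin_le_one _
  have i2 : Integrable (fun p => Real.cos (F.pos a (a * p.2) p.1 (v p) t) * r p) μ :=
    h.integrable_bdd_mul (Real.continuous_cos.measurable.comp
      (h.measurable_pos F a t)).aestronglyMeasurable fun p => Real.abs_cos_le_one _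
  rw [ForceField.val, (hF t ht).1, (hF t ht).2, mul_assoc, mul_assoc, ← mul_sub,
    ← integral_mul_const, ← integral_mul_const, ← integral_sub (i1.mul_const _) (i2.mul_const _)]
  congr 2
  ext p
  rw [Real.sin_sub]
  ring

/-- The phase derivative of a self-consistent force is bounded by `κ`, because the total mass is
one. This is the only information on the force that enters the sign analysis of the Jacobian. -/
lemma abs_der_le {F : ForceField} {a κ T t : ℝ} (hκ : 0 < κ)
    (hF : IsSelfConsistent a κ μ v r F T) (ht : t ∈ Set.Icc 0 T) (θ : ℝ) : |F.der t θ| ≤ κ := by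
  have i1 : Integrable (fun p => Real.sin (F.pos a (a * p.2) p.1 (v p) t) * r p) μ :=
    h.integrable_bdd_mul (Real.continuous_sin.measurable.comp
      (h.measurable_pos F a t)).aestronglyMeasurable fun p => Real.abs_sin_le_one _
  have i2 : Integrable (fun p => Real.cos (F.pos a (a * p.2) p.1 (v p) t) * r p) μ :=
    h.integrable_bdd_mul (Real.continuous_cos.measurable.comp
      (h.measurable_pos F a t)).aestronglyMeasurable fun p => Real.abs_cos_le_one _
  have h1 : F.der t θ =
      -(κ * ∫ p, Real.cos (F.pos a (a * p.2) p.1 (v p) t - θ) * r p ∂μ) := by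
    rw [ForceField.der, (hF t ht).1, (hF t ht).2, mul_assoc, mul_assoc, ← mul_add,
      ← integral_mul_const, ← integral_mul_const, ← integral_add (i1.mul_const _) (i2.mul_const _)]
    congr 3
    ext p
    rw [Real.cos_sub]
    ring
  rw [h1, abs_neg, abs_mul, abs_of_pos hκ]
  exact mul_le_of_le_one_right hκ.le (h.abs_integral_mul_le fun p => Real.abs_cos_le_one _)

end IsMassData


/-! ### Eulerian quantities at a fixed frequency -/

/-- A function of two variables with continuous partial derivatives is `C¹`. -/
lemma contDiff_one_of_partials {f f₁ f₂ : ℝ → ℝ → ℝ}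
    (h₁ : ∀ s z, HasDerivAt (fun s => f s z) (f₁ s z) s)
    (h₂ : ∀ s z, HasDerivAt (fun z => f s z) (f₂ s z) z)
    (c₁ : Continuous fun p : ℝ × ℝ => f₁ p.1 p.2) (c₂ : Continuous fun p : ℝ × ℝ => f₂ p.1 p.2) :
    ContDiff ℝ 1 (fun p : ℝ × ℝ => f p.1 p.2) ∧
      ∀ p : ℝ × ℝ, HasFDerivAt (fun p : ℝ × ℝ => f p.1 p.2)
        (f₁ p.1 p.2 • ContinuousLinearMap.fst ℝ ℝ ℝ + f₂ p.1 p.2 • ContinuousLinearMap.snd ℝ ℝ ℝ)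
        p := by
  have key : ∀ p : ℝ × ℝ, HasFDerivAt (fun p : ℝ × ℝ => f p.1 p.2)
      (f₁ p.1 p.2 • ContinuousLinearMap.fst ℝ ℝ ℝ + f₂ p.1 p.2 • ContinuousLinearMap.snd ℝ ℝ ℝ)
      p := by
    intro p
    have h := hasStrictFDerivAt_uncurry_coprod (𝕜 := ℝ) (u := p) (f := f)
      (f₁ := fun s z => f₁ s z • ContinuousLinearMap.id ℝ ℝ)
      (f₂ := fun s z => f₂ s z • ContinuousLinearMap.id ℝ ℝ)
      (Eventually.of_forall fun v => by
        have := (h₁ v.1 v.2).hasFDerivAt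
        refine this.congr_fderiv ?_
        ext; simp [Function.HasUncurry.uncurry])
      (Eventually.of_forall fun v => by
        have := (h₂ v.1 v.2).hasFDerivAt
        refine this.congr_fderiv ?_
        ext; simp [Function.HasUncurry.uncurry])
      (c₁.smul continuous_const).continuousAt (c₂.smul continuous_const).continuousAt
    refine h.hasFDerivAt.congr_fderiv ?_
    ext <;> simp [Function.HasUncurry.uncurry]
  refine ⟨contDiff_one_iff_fderiv.2 ⟨fun p => (key p).differentiableAt, ?_⟩, key⟩
  have : (fderiv ℝ fun p : ℝ × ℝ => f p.1 p.2) = fun p : ℝ × ℝ =>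
      f₁ p.1 p.2 • ContinuousLinearMap.fst ℝ ℝ ℝ + f₂ p.1 p.2 • ContinuousLinearMap.snd ℝ ℝ ℝ :=
    funext fun p => (key p).fderiv
  rw [this]
  exact (c₁.smul continuous_const).add (c₂.smul continuous_const)

namespace SectionFlow

variable {a b : ℝ} {F : ForceField} {v v₁ v₂ : ℝ → ℝ} (φ : SectionFlow a b F v v₁ v₂)

/-- The Lagrangian label of the particle that is at the phase `θ` at time `t`. -/
noncomputable def inv (t θ : ℝ) : ℝ := Function.invFun (φ.x t) θ

lemma x_translate (hv : Function.Periodic v (2 * Real.pi)) {t : ℝ} (ht : 0 ≤ t) (α : ℝ) :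
    φ.x t (α + 2 * Real.pi) = φ.x t α + 2 * Real.pi := (φ.xy_periodic hv ht α).1

lemma isCircleMap (hv : Function.Periodic v (2 * Real.pi)) {t : ℝ} (ht : 0 ≤ t)
    (hJ : ∀ α, 0 < φ.J t α) : IsCircleMap (φ.x t) (φ.J t) :=
  ⟨φ.x_a t, φ.cont_J.comp (by fun_prop : Continuous fun α : ℝ => (t, α)), hJ, φ.x_translate hv ht⟩

lemma contDiff_x : ContDiff ℝ 1 fun p : ℝ × ℝ => φ.x p.1 p.2 :=
  (contDiff_one_of_partials (fun t α => φ.x_t t α) φ.x_a φ.cont_y φ.cont_J).1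

lemma contDiff_y : ContDiff ℝ 1 fun p : ℝ × ℝ => φ.y p.1 p.2 := by
  refine (contDiff_one_of_partials (fun t α => φ.y_t t α) φ.y_a ?_ φ.cont_P).1
  exact (continuous_const.mul φ.cont_y).neg.add (continuous_const.add φ.cont_val)

lemma contDiff_J : ContDiff ℝ 1 fun p : ℝ × ℝ => φ.J p.1 p.2 :=
  (contDiff_one_of_partials φ.J_t φ.J_a φ.cont_P φ.cont_Y).1

section Inverse

variable {I : Set ℝ} (hv : Function.Periodic v (2 * Real.pi)) (hI : ∀ t ∈ I, 0 ≤ t)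
  (hJ : ∀ t ∈ I, ∀ α, 0 < φ.J t α)
include hv hI hJ

lemma inv_x {t : ℝ} (ht : t ∈ I) (α : ℝ) : φ.inv t (φ.x t α) = α :=
  (φ.isCircleMap hv (hI t ht) (hJ t ht)).invFun_apply α

lemma x_inv {t : ℝ} (ht : t ∈ I) (θ : ℝ) : φ.x t (φ.inv t θ) = θ :=
  (φ.isCircleMap hv (hI t ht) (hJ t ht)).apply_invFun θ

/-- The inverse function theorem, applied to `(t, α) ↦ (t, x(t, α))`: a quantity that is `C¹` in
Lagrangian coordinates is `C¹` in Eulerian coordinates. -/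
lemma contDiffOn_comp_inv {f : ℝ × ℝ → ℝ} (hf : ∀ t ∈ I, ∀ α, ContDiffAt ℝ 1 f (t, α)) :
    ContDiffOn ℝ 1 (fun q : ℝ × ℝ => f (q.1, φ.inv q.1 q.2)) (I ×ˢ Set.univ) := by
  rintro ⟨t, θ⟩ ⟨ht, -⟩
  simp only at ht
  set α := φ.inv t θ with hα
  have hxα : φ.x t α = θ := φ.x_inv hv hI hJ ht θ
  have hJp := hJ t ht α
  let Φ : ℝ × ℝ → ℝ × ℝ := fun p => (p.1, φ.x p.1 p.2)
  have hΦ : ContDiff ℝ 1 Φ := contDiff_fst.prodMk φ.contDiff_x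
  let L : (ℝ × ℝ) →L[ℝ] ℝ × ℝ := (ContinuousLinearMap.fst ℝ ℝ ℝ).prod
    (φ.y t α • ContinuousLinearMap.fst ℝ ℝ ℝ + φ.J t α • ContinuousLinearMap.snd ℝ ℝ ℝ)
  let L' : (ℝ × ℝ) →L[ℝ] ℝ × ℝ := (ContinuousLinearMap.fst ℝ ℝ ℝ).prod
    ((φ.J t α)⁻¹ • (ContinuousLinearMap.snd ℝ ℝ ℝ - φ.y t α • ContinuousLinearMap.fst ℝ ℝ ℝ))
  let E : (ℝ × ℝ) ≃L[ℝ] ℝ × ℝ := ContinuousLinearEquiv.equivOfInverse L L'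
    (fun p => by
      ext
      · simp [L, L']
      · simp [L, L']; field_simp)
    (fun p => by
      ext
      · simp [L, L']
      · simp [L, L']; field_simp; ring)
  have hE : HasFDerivAt Φ (E : (ℝ × ℝ) →L[ℝ] ℝ × ℝ) (t, α) :=
    hasFDerivAt_fst.prodMk
      ((contDiff_one_of_partials (fun t α => φ.x_t t α) φ.x_a φ.cont_y φ.cont_J).2 (t, α))
  have hΦa : ContDiffAt ℝ 1 Φ (t, α) := hΦ.contDiffAt
  set Ψ := hΦa.localInverse hE one_ne_zero with hΨ
  have hΦt : Φ (t, α) = (t, θ) := by simp only [Φ, hxα]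
  have hΨ0 : Ψ (t, θ) = (t, α) := by
    rw [← hΦt]; exact hΦa.localInverse_apply_image hE one_ne_zero
  have hΨc : ContDiffAt ℝ 1 Ψ (t, θ) := by
    rw [← hΦt]; exact hΦa.to_localInverse hE one_ne_zero
  have hΨr : ∀ᶠ q in 𝓝 (t, θ), Φ (Ψ q) = q := by
    rw [← hΦt]; exact (hΦa.hasStrictFDerivAt' hE one_ne_zero).eventually_right_inverse
  have hcomp : ContDiffAt ℝ 1 (fun q => f (Ψ q)) (t, θ) := by
    refine ContDiffAt.comp (t, θ) ?_ hΨc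
    rw [hΨ0]; exact hf t ht α
  have heq : ∀ᶠ q in 𝓝[I ×ˢ Set.univ] (t, θ), f (q.1, φ.inv q.1 q.2) = f (Ψ q) := by
    filter_upwards [hΨr.filter_mono nhdsWithin_le_nhds, self_mem_nhdsWithin] with q hq hqI
    have h1 : (Ψ q).1 = q.1 := (Prod.ext_iff.1 hq).1
    have h2 : φ.x (Ψ q).1 (Ψ q).2 = q.2 := (Prod.ext_iff.1 hq).2
    rw [h1] at h2
    have h3 : φ.inv q.1 q.2 = (Ψ q).2 := by rw [← h2]; exact φ.inv_x hv hI hJ hqI.1 _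
    rw [h3, ← h1]
  refine hcomp.contDiffWithinAt.congr_of_eventuallyEq heq ?_
  exact heq.self_of_nhdsWithin ⟨ht, Set.mem_univ _⟩

end Inverse

end SectionFlow

/-- The partial derivatives of a function that is differentiable at `(t, θ)`, together with the
chain rule along curves. -/
lemma hasDerivAt_of_contDiffOn {f : ℝ → ℝ → ℝ} {I : Set ℝ} {t : ℝ} (hI : I ∈ 𝓝 t) (θ : ℝ)
    (hf : ContDiffOn ℝ 1 (fun p : ℝ × ℝ => f p.1 p.2) (I ×ˢ Set.univ)) :
    ∃ f₁ f₂ : ℝ, HasDerivAt (fun s => f s θ) f₁ t ∧ HasDerivAt (fun z => f t z) f₂ θ ∧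
      ∀ (c : ℝ → ℝ) (c' : ℝ), c t = θ → HasDerivAt c c' t →
        HasDerivAt (fun s => f s (c s)) (f₁ + f₂ * c') t := by
  have h1 : I ×ˢ (Set.univ : Set ℝ) ∈ 𝓝 (t, θ) := prod_mem_nhds hI univ_mem
  have h2 := ((hf.contDiffAt h1).differentiableAt one_ne_zero).hasFDerivAt
  set L := fderiv ℝ (fun p : ℝ × ℝ => f p.1 p.2) (t, θ)
  refine ⟨L (1, 0), L (0, 1), ?_, ?_, ?_⟩
  · exact h2.comp_hasDerivAt t ((hasDerivAt_id t).prodMk (hasDerivAt_const t θ))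
  · exact h2.comp_hasDerivAt θ ((hasDerivAt_const θ t).prodMk (hasDerivAt_id θ))
  · rintro c c' rfl hc
    have h3 := h2.comp_hasDerivAt t ((hasDerivAt_id t).prodMk hc)
    refine h3.congr_deriv ?_
    have : ((1 : ℝ), c') = (1, 0) + c' • ((0 : ℝ), (1 : ℝ)) := by ext <;> simp
    rw [this, map_add, map_smul, smul_eq_mul, mul_comm]

namespace SectionFlow

variable {a b : ℝ} {F : ForceField} {v v₁ v₂ : ℝ → ℝ} (φ : SectionFlow a b F v v₁ v₂)

/-- The Eulerian velocity. -/
noncomputable def eulU (t θ : ℝ) : ℝ := φ.y t (φ.inv t θ)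

/-- The Eulerian density of particles with initial density `r`. -/
noncomputable def eulRho (r : ℝ → ℝ) (t θ : ℝ) : ℝ := r (φ.inv t θ) / φ.J t (φ.inv t θ)

variable {I : Set ℝ} (hv : Function.Periodic v (2 * Real.pi)) (hI : ∀ t ∈ I, 0 ≤ t)
  (hJ : ∀ t ∈ I, ∀ α, 0 < φ.J t α) {r r₁ : ℝ → ℝ}
include hv hI hJ

lemma inv_zero (h0 : (0 : ℝ) ∈ I) (θ : ℝ) : φ.inv 0 θ = θ := by
  have := φ.inv_x hv hI hJ h0 θ
  rwa [φ.x_zero] at this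

lemma eulU_zero (h0 : (0 : ℝ) ∈ I) (θ : ℝ) : φ.eulU 0 θ = v θ := by
  rw [eulU, φ.inv_zero hv hI hJ h0, φ.y_zero]

lemma eulRho_zero (h0 : (0 : ℝ) ∈ I) (θ : ℝ) : φ.eulRho r 0 θ = r θ := by
  rw [eulRho, φ.inv_zero hv hI hJ h0, φ.J_zero, div_one]

lemma periodic_eulU {t : ℝ} (ht : t ∈ I) : Function.Periodic (φ.eulU t) (2 * Real.pi) :=
  (φ.isCircleMap hv (hI t ht) (hJ t ht)).periodic_comp_invFun (φ.periodic_y hv (hI t ht))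

lemma periodic_eulRho (hr : Function.Periodic r (2 * Real.pi)) {t : ℝ} (ht : t ∈ I) :
    Function.Periodic (φ.eulRho r t) (2 * Real.pi) :=
  (φ.isCircleMap hv (hI t ht) (hJ t ht)).periodic_comp_invFun
    (f := fun α => r α / φ.J t α) (hr.div (φ.periodic_J hv (hI t ht)))

lemma contDiffOn_eulU :
    ContDiffOn ℝ 1 (fun p : ℝ × ℝ => φ.eulU p.1 p.2) (I ×ˢ Set.univ) :=
  φ.contDiffOn_comp_inv hv hI hJ (f := fun p => φ.y p.1 p.2) fun _ _ _ =>
    φ.contDiff_y.contDiffAt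

lemma contDiffOn_eulRho (hr : ContDiff ℝ 1 r) :
    ContDiffOn ℝ 1 (fun p : ℝ × ℝ => φ.eulRho r p.1 p.2) (I ×ˢ Set.univ) :=
  φ.contDiffOn_comp_inv hv hI hJ (f := fun p => r p.2 / φ.J p.1 p.2) fun t ht α =>
    (hr.comp contDiff_snd).contDiffAt.div φ.contDiff_J.contDiffAt (hJ t ht α).ne'

lemma hasDerivAt_eulU {t : ℝ} (ht : t ∈ I) (θ : ℝ) :
    HasDerivAt (φ.eulU t) (φ.P t (φ.inv t θ) / φ.J t (φ.inv t θ)) θ := by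
  have hne := (hJ t ht (φ.inv t θ)).ne'
  have hinv : HasDerivAt (φ.inv t) (φ.J t (φ.inv t θ))⁻¹ θ := by
    have hc : Continuous (φ.inv t) := by
      refine ((φ.isCircleMap hv (hI t ht) (hJ t ht)).strictMono.orderIsoOfSurjective _
        (φ.isCircleMap hv (hI t ht) (hJ t ht)).surjective).symm.continuous.congr fun z => ?_
      apply (φ.isCircleMap hv (hI t ht) (hJ t ht)).strictMono.injective
      rw [φ.x_inv hv hI hJ ht]
      exact OrderIso.apply_symm_apply ((φ.isCircleMap hv (hI t ht)
        (hJ t ht)).strictMono.orderIsoOfSurjective _ _) z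
    exact HasDerivAt.of_local_left_inverse hc.continuousAt (φ.x_a t _) hne
      (Eventually.of_forall fun z => φ.x_inv hv hI hJ ht z)
  exact ((φ.y_a t _).comp θ hinv).congr_deriv (div_eq_mul_inv _ _).symm

/-- The Eulerian density and velocity solve the equations of motion, in the form in which the time
derivatives are taken along the characteristics. -/
lemma eulerian_equations (hr : ContDiff ℝ 1 r) {t : ℝ} (ht : t ∈ I) (hIt : I ∈ 𝓝 t) (θ : ℝ) :
    ∃ ut uθ ρt ρθ : ℝ, HasDerivAt (fun s => φ.eulU s θ) ut t ∧
      HasDerivAt (fun z => φ.eulU t z) uθ θ ∧ HasDerivAt (fun s => φ.eulRho r s θ) ρt t ∧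
      HasDerivAt (fun z => φ.eulRho r t z) ρθ θ ∧
      ρt + ρθ * φ.eulU t θ + φ.eulRho r t θ * uθ = 0 ∧
      ut + uθ * φ.eulU t θ = -(a * φ.eulU t θ) + (b + F.val t θ) := by
  set α := φ.inv t θ with hα
  have hxα : φ.x t α = θ := φ.x_inv hv hI hJ ht θ
  have hyα : φ.eulU t θ = φ.y t α := rfl
  have hne := (hJ t ht α).ne'
  obtain ⟨ut, uθ, h1, h2, h3⟩ := hasDerivAt_of_contDiffOn hIt θ (φ.contDiffOn_eulU hv hI hJ)
  obtain ⟨ρt, ρθ, h4, h5, h6⟩ := hasDerivAt_of_contDiffOn hIt θ (φ.contDiffOn_eulRho hv hI hJ hr)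
  refine ⟨ut, uθ, ρt, ρθ, h1, h2, h4, h5, ?_, ?_⟩
  · have e1 := h6 (fun s => φ.x s α) _ hxα (φ.x_t t α)
    have e2 : (fun s => φ.eulRho r s (φ.x s α)) =ᶠ[𝓝 t] fun s => r α / φ.J s α := by
      filter_upwards [hIt] with s hs
      rw [eulRho, φ.inv_x hv hI hJ hs]
    have e3 := (e1.congr_of_eventuallyEq e2.symm).unique
      ((hasDerivAt_const t (r α)).div (φ.J_t t α) hne)
    have e4 : uθ = φ.P t α / φ.J t α := h2.unique (φ.hasDerivAt_eulU hv hI hJ ht θ)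
    have e5 : φ.eulRho r t θ = r α / φ.J t α := rfl
    rw [hyα, e3, e4, e5]
    field_simp
    ring
  · have e1 := h3 (fun s => φ.x s α) _ hxα (φ.x_t t α)
    have e2 : (fun s => φ.eulU s (φ.x s α)) =ᶠ[𝓝 t] fun s => φ.y s α := by
      filter_upwards [hIt] with s hs
      rw [eulU, φ.inv_x hv hI hJ hs]
    have e3 := (e1.congr_of_eventuallyEq e2.symm).unique (φ.y_t t α)
    rw [hyα, e3, hxα]

end SectionFlow


/-! ### Continuity in time with values in the Sobolev spaces -/

lemma measurable_cut_of_eq {S : Set ℝ} (hS : MeasurableSet S) {f : ℝ → ℝ → ℝ} {H : ℝ × ℝ → ℝ}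
    (hH : Measurable H) (h : ∀ Ω ∈ S, ∀ θ, f θ Ω = H (θ, Ω)) : Measurable (cut S f) := by
  have : cut S f = (Prod.snd ⁻¹' S).indicator H := by
    ext ⟨θ, Ω⟩
    by_cases hΩ : Ω ∈ S
    · rw [cut_of_mem hΩ, Set.indicator_of_mem (by exact hΩ), h Ω hΩ]
    · rw [cut_of_notMem hΩ, Set.indicator_of_notMem (by exact hΩ)]
  rw [this]
  exact hH.indicator (measurable_snd hS)

/-- Measurability of a parametric integral whose integrand is continuous in time and measurable in the
parameters, hence jointly measurable. -/
lemma measurable_cut_integral {S : Set ℝ} {G : ℝ → ℝ → ℝ → ℝ} {t : ℝ} (ht : 0 ≤ t)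
    (hm : ∀ s ∈ Set.Icc 0 t, Measurable (cut S (G s)))
    (hc : ∀ Ω ∈ S, ∀ α, ContinuousOn (fun s => G s α Ω) (Set.Icc 0 t)) :
    Measurable (cut S fun α Ω => ∫ s in (0 : ℝ)..t, G s α Ω) := by
  have hproj : ∀ s : ℝ, max 0 (min s t) ∈ Set.Icc 0 t := fun s =>
    ⟨le_max_left _ _, max_le ht (min_le_right _ _)⟩
  have h1 : Measurable (Function.uncurry fun (s : ℝ) (p : ℝ × ℝ) =>
      cut S (G (max 0 (min s t))) p) := by
    refine measurable_uncurry_of_continuous_of_measurable (fun p => ?_) fun s => hm _ (hproj s)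
    obtain ⟨α, Ω⟩ := p
    by_cases hΩ : Ω ∈ S
    · simp only [cut_of_mem hΩ]
      exact (hc Ω hΩ α).comp_continuous (by fun_prop) hproj
    · simp only [cut_of_notMem hΩ]; exact continuous_const
  have h2 : (cut S fun α Ω => ∫ s in (0 : ℝ)..t, G s α Ω) =
      fun p => ∫ s in Set.Ioc 0 t, cut S (G (max 0 (min s t))) p := by
    ext ⟨α, Ω⟩
    by_cases hΩ : Ω ∈ S
    · simp only [cut_of_mem hΩ]
      rw [intervalIntegral.integral_of_le ht]
      refine setIntegral_congr_fun measurableSet_Ioc fun s hs => ?_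
      rw [min_eq_left hs.2, max_eq_right hs.1.le]
    · simp only [cut_of_notMem hΩ]; simp
  rw [h2]
  exact (StronglyMeasurable.integral_prod_left (μ := volume.restrict (Set.Ioc 0 t))
    h1.stronglyMeasurable).measurable

lemma ae_snd_mem (g : Measure ℝ) [SFinite g] {S : Set ℝ} (hS : ∀ᵐ Ω ∂g, Ω ∈ S) :
    ∀ᵐ p ∂(cellMeasure g), p.2 ∈ S :=
  Measure.quasiMeasurePreserving_snd.ae hS

/-- Lagrangian quantities `f`, given at the frequencies in a set of full measure and dominated by a
square integrable function, yield Eulerian quantities which are continuous in time in `L²`. -/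
theorem memLp_and_tendsto_eulerian (g : Measure ℝ) [IsFiniteMeasure g] {S : Set ℝ}
    (hS : MeasurableSet S) (hSae : ∀ᵐ Ω ∂g, Ω ∈ S) {s δ C : ℝ} {x J f : ℝ → ℝ → ℝ → ℝ}
    {D : ℝ × ℝ → ℝ} (hδ : 0 < δ)
    (hcirc : ∀ t ∈ Set.Icc 0 s, ∀ Ω ∈ S, IsCircleMap (fun α => x t α Ω) (fun α => J t α Ω))
    (hJ : ∀ t ∈ Set.Icc 0 s, ∀ Ω ∈ S, ∀ α, δ ≤ J t α Ω ∧ J t α Ω ≤ C)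
    (hxm : ∀ t ∈ Set.Icc 0 s, Measurable (cut S (x t)))
    (hJm : ∀ t ∈ Set.Icc 0 s, Measurable (cut S (J t)))
    (hxc : ∀ Ω ∈ S, ∀ α, ContinuousOn (fun t => x t α Ω) (Set.Icc 0 s))
    (hfm : ∀ t ∈ Set.Icc 0 s, Measurable (cut S (f t)))
    (hfp : ∀ t ∈ Set.Icc 0 s, ∀ Ω ∈ S, Function.Periodic (fun α => f t α Ω) (2 * Real.pi))
    (hfc : ∀ Ω ∈ S, ∀ α, ContinuousOn (fun t => f t α Ω) (Set.Icc 0 s))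
    (hD : ∀ t ∈ Set.Icc 0 s, ∀ Ω ∈ S, ∀ α, |f t α Ω| ≤ D (α, Ω)) (hD0 : ∀ p, 0 ≤ D p)
    (hDL : MemLp D 2 (cellMeasure g)) :
    (∀ t ∈ Set.Icc 0 s, MemLp (fun p : ℝ × ℝ =>
      f t (Function.invFun (fun α => x t α p.2) p.1) p.2) 2 (cellMeasure g)) ∧
    ∀ t ∈ Set.Icc 0 s, Tendsto (fun t' => eLpNorm (fun p : ℝ × ℝ =>
      f t' (Function.invFun (fun α => x t' α p.2) p.1) p.2 -
        f t (Function.invFun (fun α => x t α p.2) p.1) p.2) 2 (cellMeasure g))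
      (𝓝[Set.Icc 0 s] t) (𝓝 0) := by
  classical
  let X : ℝ → ℝ × ℝ → ℝ := fun t p => if p.2 ∈ S then cut S (x t) p else p.1
  let JJ : ℝ → ℝ × ℝ → ℝ := fun t p => if p.2 ∈ S then cut S (J t) p else 1
  have hXS : ∀ t α Ω, Ω ∈ S → X t (α, Ω) = x t α Ω := fun t α Ω h => by
    simp only [X, if_pos h, cut_of_mem h]
  have hXN : ∀ t α Ω, Ω ∉ S → X t (α, Ω) = α := fun t α Ω h => by
    simp only [X, if_neg h]
  have hJS : ∀ t α Ω, Ω ∈ S → JJ t (α, Ω) = J t α Ω := fun t α Ω h => by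
    simp only [JJ, if_pos h, cut_of_mem h]
  have hJN : ∀ t α Ω, Ω ∉ S → JJ t (α, Ω) = 1 := fun t α Ω h => by
    simp only [JJ, if_neg h]
  have hcell : ∀ t ∈ Set.Icc 0 s, IsCellMap (X t) (JJ t) := fun t ht =>
    { meas_x := Measurable.ite (measurable_snd hS) (hxm t ht) measurable_fst
      meas_J := Measurable.ite (measurable_snd hS) (hJm t ht) measurable_const
      circle := fun Ω => by
        by_cases hΩ : Ω ∈ S
        · simp only [hXS t _ Ω hΩ, hJS t _ Ω hΩ]; exact hcirc t ht Ω hΩ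
        · simp only [hXN t _ Ω hΩ, hJN t _ Ω hΩ]
          exact ⟨hasDerivAt_id, continuous_const, fun _ => one_pos, fun _ => rfl⟩ }
  have key := memLp_and_tendsto_comp_cellInv g (x := X) (J := JJ) (f := fun t => cut S (f t))
    (D := D) (δ := min δ 1) (C := max C 1) (s := s) (by positivity) hcell
    (fun t ht p => by
      obtain ⟨α, Ω⟩ := p
      by_cases hΩ : Ω ∈ S
      · rw [hJS t _ Ω hΩ]
        exact ⟨(min_le_left _ _).trans (hJ t ht Ω hΩ α).1,
          (hJ t ht Ω hΩ α).2.trans (le_max_left _ _)⟩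
      · rw [hJN t _ Ω hΩ]; exact ⟨min_le_right _ _, le_max_right _ _⟩)
    (fun p => by
      obtain ⟨α, Ω⟩ := p
      by_cases hΩ : Ω ∈ S
      · simp only [hXS _ _ Ω hΩ]; exact hxc Ω hΩ α
      · simp only [hXN _ _ Ω hΩ]; exact continuousOn_const)
    hfm
    (fun t ht Ω => by
      by_cases hΩ : Ω ∈ S
      · simp only [cut_of_mem hΩ]; exact hfp t ht Ω hΩ
      · simp only [cut_of_notMem hΩ]; exact fun _ => rfl)
    (fun p => by
      obtain ⟨α, Ω⟩ := p
      by_cases hΩ : Ω ∈ S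
      · simp only [cut_of_mem hΩ]; exact hfc Ω hΩ α
      · simp only [cut_of_notMem hΩ]; exact continuousOn_const)
    (fun t ht p => by
      obtain ⟨α, Ω⟩ := p
      by_cases hΩ : Ω ∈ S
      · rw [cut_of_mem hΩ]; exact hD t ht Ω hΩ α
      · rw [cut_of_notMem hΩ, abs_zero]; exact hD0 _) hDL
  have hae : ∀ t, (fun p : ℝ × ℝ => cut S (f t) (cellInv (X t) p, p.2)) =ᵐ[cellMeasure g]
      fun p => f t (Function.invFun (fun α => x t α p.2) p.1) p.2 := by
    intro t
    filter_upwards [ae_snd_mem g hSae] with p hp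
    rw [cut_of_mem hp, cellInv]
    simp only [hXS t _ _ hp]
  refine ⟨fun t ht => (memLp_congr_ae (hae t)).1 (key.1 t ht), fun t ht =>
    (key.2 t ht).congr fun t' => eLpNorm_congr_ae ?_⟩
  filter_upwards [hae t, hae t'] with p h1 h2
  rw [h1, h2]

/-- A criterion for continuity in time with values in `H^k_g`: square integrable functions
`e₀, …, e_k`, continuous in time in `L²`, each of which is on almost every section the weak
derivative of the preceding one. -/
theorem continuousInSobolev_of_sections (g : Measure ℝ) [IsFiniteMeasure g] {k : ℕ} {I : Set ℝ}
    {f : ℝ → ℝ → ℝ → ℝ} (e : Fin (k + 1) → ℝ → ℝ × ℝ → ℝ)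
    (hmem : ∀ j, ∀ t ∈ I, MemLp (e j t) 2 (cellMeasure g))
    (hlim : ∀ j, ∀ t ∈ I, Tendsto (fun t' => eLpNorm (fun p => e j t' p - e j t p) 2
      (cellMeasure g)) (𝓝[I] t) (𝓝 0))
    (hweak : ∀ j : Fin k, ∀ t ∈ I, ∀ᵐ Ω ∂g,
      SecWeak (fun θ => e j.castSucc t (θ, Ω)) (fun θ => e j.succ t (θ, Ω)))
    (h0 : ∀ t ∈ I, ∀ p, e 0 t p = f t p.1 p.2) : ContinuousInSobolev g k I f := by
  classical
  let U : Fin (k + 1) → ℝ → Lp ℝ 2 (cellMeasure g) := fun j t =>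
    if h : t ∈ I then (hmem j t h).toLp (e j t) else 0
  have hU : ∀ j, ∀ t ∈ I, (U j t : ℝ × ℝ → ℝ) =ᵐ[cellMeasure g] e j t := fun j t ht => by
    simp only [U, dif_pos ht]
    exact MemLp.coeFn_toLp _
  refine ⟨fun t => WithLp.toLp 2 fun j => U j t, ?_, fun t ht => ⟨fun j => ?_, ?_⟩⟩
  · refine (PiLp.continuous_toLp 2 _).comp_continuousOn (continuousOn_pi.2 fun j t ht => ?_)
    change Tendsto (U j) (𝓝[I] t) (𝓝 (U j t))
    rw [Lp.tendsto_Lp_iff_tendsto_eLpNorm']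
    refine (hlim j t ht).congr' ?_
    filter_upwards [self_mem_nhdsWithin] with t' ht'
    refine eLpNorm_congr_ae ?_
    filter_upwards [hU j t ht, hU j t' ht'] with p h1 h2
    rw [Pi.sub_apply, h1, h2]
  · have h1 := isWeakThetaDeriv_of_ae_secWeak g (hmem j.castSucc t ht) (hmem j.succ t ht)
      (hweak j t ht)
    intro φ hφ
    have h2 := h1 φ hφ
    have e1 := hU j.castSucc t ht
    have e2 := hU j.succ t ht
    rw [integral_congr_ae (g := fun p => e j.castSucc t p * deriv (fun x => φ (x, p.2)) p.1)
        (by filter_upwards [e1] with p hp; rw [← hp]), h2,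
      integral_congr_ae (f := fun p => e j.succ t p * φ p)
        (by filter_upwards [e2] with p hp; rw [← hp])]
  · refine (hU 0 t ht).trans (Eventually.of_forall fun p => h0 t ht p)


namespace SectionFlow

variable {a b : ℝ} {F : ForceField} {v v₁ v₂ : ℝ → ℝ} (φ : SectionFlow a b F v v₁ v₂)

/-! ### Periodicity and continuity in time of the Lagrangian derivatives -/

lemma periodic_wForceA (hv : Function.Periodic v (2 * Real.pi)) {t : ℝ} (ht : 0 ≤ t) :
    Function.Periodic (φ.wForceA t) (2 * Real.pi) :=
  periodic_of_hasDerivAt (φ.periodic_wForce hv ht) (φ.wForce_a ht).1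

lemma periodic_uxx (hv : Function.Periodic v (2 * Real.pi)) {t : ℝ} (ht : 0 ≤ t) :
    Function.Periodic (φ.uxx t) (2 * Real.pi) := fun α => by
  simp only [uxx, φ.periodic_W hv ht α, φ.periodic_J hv ht α]

lemma periodic_uxxx (hv : Function.Periodic v (2 * Real.pi)) {v₃ : ℝ → ℝ}
    (hv₃ : Function.Periodic v₃ (2 * Real.pi)) {t : ℝ} (ht : 0 ≤ t) :
    Function.Periodic (φ.uxxx v₃ t) (2 * Real.pi) := fun α => by
  simp only [uxxx, φ.periodic_W hv ht α, φ.periodic_J hv ht α, φ.periodic_Y hv ht α,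
    φ.periodic_wForceA hv ht α, hv₃ α]

lemma periodic_rx (hv : Function.Periodic v (2 * Real.pi)) {r₀ r₁ : ℝ → ℝ}
    (hr₀ : Function.Periodic r₀ (2 * Real.pi)) (hr₁ : Function.Periodic r₁ (2 * Real.pi)) {t : ℝ}
    (ht : 0 ≤ t) : Function.Periodic (φ.rx r₀ r₁ t) (2 * Real.pi) := fun α => by
  simp only [rx, φ.periodic_J hv ht α, φ.periodic_Y hv ht α, hr₀ α, hr₁ α]

lemma periodic_rxx (hv : Function.Periodic v (2 * Real.pi)) {r₀ r₁ r₂ v₃ : ℝ → ℝ}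
    (hr₀ : Function.Periodic r₀ (2 * Real.pi)) (hr₁ : Function.Periodic r₁ (2 * Real.pi))
    (hr₂ : Function.Periodic r₂ (2 * Real.pi)) (hv₃ : Function.Periodic v₃ (2 * Real.pi)) {t : ℝ}
    (ht : 0 ≤ t) : Function.Periodic (φ.rxx r₀ r₁ r₂ v₃ t) (2 * Real.pi) := fun α => by
  have h1 : φ.vCoeff t (α + 2 * Real.pi) = φ.vCoeff t α := by
    refine intervalIntegral.integral_congr fun s hs => ?_
    rw [Set.uIcc_of_le ht] at hs
    simp only [φ.periodic_J hv hs.1 α]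
  have h2 : φ.lowerPart t (α + 2 * Real.pi) = φ.lowerPart t α := by
    refine intervalIntegral.integral_congr fun s hs => ?_
    rw [Set.uIcc_of_le ht] at hs
    simp only [φ.periodic_J hv hs.1 α, φ.periodic_Y hv hs.1 α, φ.periodic_W hv hs.1 α,
      φ.periodic_wForceA hv hs.1 α]
  simp only [rxx, φ.periodic_J hv ht α, φ.periodic_Y hv ht α, hr₀ α, hr₁ α, hr₂ α, hv₃ α, h1, h2]

lemma continuous_time (α : ℝ) : Continuous (fun t => φ.x t α) ∧ Continuous (fun t => φ.y t α) ∧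
    Continuous (fun t => φ.J t α) ∧ Continuous (fun t => φ.P t α) ∧
    Continuous (fun t => φ.Y t α) ∧ Continuous (fun t => φ.W t α) ∧
    Continuous (fun t => φ.wForceA t α) := by
  have key : ∀ f : ℝ → ℝ → ℝ, (Continuous fun p : ℝ × ℝ => f p.1 p.2) →
      Continuous fun t => f t α := fun f hf =>
    hf.comp (by fun_prop : Continuous fun t : ℝ => (t, α))
  exact ⟨key φ.x φ.cont_x, key φ.y φ.cont_y, key φ.J φ.cont_J, key φ.P φ.cont_P,
    key φ.Y φ.cont_Y, key φ.W φ.cont_W, key φ.wForceA φ.cont_wForceA⟩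

section Time

variable {s α : ℝ} (hs : 0 ≤ s) (hJ : ∀ t ∈ Set.Icc 0 s, 0 < φ.J t α)
include hJ

lemma continuousOn_ux : ContinuousOn (fun t => φ.P t α / φ.J t α) (Set.Icc 0 s) := by
  obtain ⟨hx, hy, hj, hP, hY, hW, hw⟩ := φ.continuous_time α
  exact hP.continuousOn.div hj.continuousOn fun t ht => (hJ t ht).ne'

lemma continuousOn_uxx : ContinuousOn (fun t => φ.uxx t α) (Set.Icc 0 s) := by
  obtain ⟨hx, hy, hj, hP, hY, hW, hw⟩ := φ.continuous_time α
  exact hW.continuousOn.div (hj.pow 3).continuousOn fun t ht => pow_ne_zero 3 (hJ t ht).ne'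

lemma continuousOn_uxxx (v₃ : ℝ → ℝ) : ContinuousOn (fun t => φ.uxxx v₃ t α) (Set.Icc 0 s) := by
  obtain ⟨hx, hy, hj, hP, hY, hW, hw⟩ := φ.continuous_time α
  have h1 : ∀ t ∈ Set.Icc 0 s, φ.J t α ≠ 0 := fun t ht => (hJ t ht).ne'
  unfold uxxx
  refine ContinuousOn.div (ContinuousOn.sub (ContinuousOn.div (Continuous.continuousOn (by fun_prop))
    (hj.pow 3).continuousOn fun t ht => pow_ne_zero 3 (h1 t ht)) (ContinuousOn.div
    (Continuous.continuousOn (by fun_prop)) (hj.pow 4).continuousOn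
    fun t ht => pow_ne_zero 4 (h1 t ht))) hj.continuousOn h1

lemma continuousOn_rho (r₀ : ℝ → ℝ) : ContinuousOn (fun t => r₀ α / φ.J t α) (Set.Icc 0 s) := by
  obtain ⟨hx, hy, hj, hP, hY, hW, hw⟩ := φ.continuous_time α
  exact continuousOn_const.div hj.continuousOn fun t ht => (hJ t ht).ne'

lemma continuousOn_rx (r₀ r₁ : ℝ → ℝ) :
    ContinuousOn (fun t => φ.rx r₀ r₁ t α) (Set.Icc 0 s) := by
  obtain ⟨hx, hy, hj, hP, hY, hW, hw⟩ := φ.continuous_time α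
  have h1 : ∀ t ∈ Set.Icc 0 s, φ.J t α ≠ 0 := fun t ht => (hJ t ht).ne'
  unfold rx
  exact ContinuousOn.div (ContinuousOn.sub (continuousOn_const.div hj.continuousOn h1)
    (ContinuousOn.div (Continuous.continuousOn (by fun_prop)) (hj.pow 2).continuousOn
    fun t ht => pow_ne_zero 2 (h1 t ht))) hj.continuousOn h1

lemma continuousOn_vIntegrand :
    ContinuousOn (fun t => Real.exp (-(a * t)) / φ.J t α ^ 2) (Set.Icc 0 s) := by
  obtain ⟨hx, hy, hj, hP, hY, hW, hw⟩ := φ.continuous_time α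
  exact ContinuousOn.div (Continuous.continuousOn (by fun_prop)) (hj.pow 2).continuousOn
    fun t ht => pow_ne_zero 2 (hJ t ht).ne'

lemma continuousOn_lowerIntegrand :
    ContinuousOn (fun t => Real.exp (-(a * t)) * φ.wForceA t α / φ.J t α ^ 2 -
      2 * φ.W t α * φ.Y t α / φ.J t α ^ 3) (Set.Icc 0 s) := by
  obtain ⟨hx, hy, hj, hP, hY, hW, hw⟩ := φ.continuous_time α
  exact ContinuousOn.sub (ContinuousOn.div (Continuous.continuousOn (by fun_prop))
    (hj.pow 2).continuousOn fun t ht => pow_ne_zero 2 (hJ t ht).ne')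
    (ContinuousOn.div (Continuous.continuousOn (by fun_prop))
    (hj.pow 3).continuousOn fun t ht => pow_ne_zero 3 (hJ t ht).ne')

include hs in
lemma continuousOn_rxx (r₀ r₁ r₂ v₃ : ℝ → ℝ) :
    ContinuousOn (fun t => φ.rxx r₀ r₁ r₂ v₃ t α) (Set.Icc 0 s) := by
  obtain ⟨hx, hy, hj, hP, hY, hW, hw⟩ := φ.continuous_time α
  have h1 : ∀ t ∈ Set.Icc 0 s, φ.J t α ≠ 0 := fun t ht => (hJ t ht).ne'
  have h2 : ContinuousOn (fun t => φ.vCoeff t α) (Set.Icc 0 s) :=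
    continuousOn_integral_of_continuousOn hs (φ.continuousOn_vIntegrand hJ)
  have h3 : ContinuousOn (fun t => φ.lowerPart t α) (Set.Icc 0 s) :=
    continuousOn_integral_of_continuousOn hs (φ.continuousOn_lowerIntegrand hJ)
  have hjo := hj.continuousOn (s := Set.Icc 0 s)
  have hYo := hY.continuousOn (s := Set.Icc 0 s)
  unfold rxx
  refine ContinuousOn.div (ContinuousOn.add (ContinuousOn.sub (ContinuousOn.sub ?_ ?_) ?_) ?_)
    hjo h1
  · exact continuousOn_const.div (hjo.pow 2) fun t ht => pow_ne_zero 2 (h1 t ht)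
  · exact (continuousOn_const.mul hYo).div (hjo.pow 3) fun t ht => pow_ne_zero 3 (h1 t ht)
  · exact (continuousOn_const.mul ((continuousOn_const.mul h2).add h3)).div (hjo.pow 2)
      fun t ht => pow_ne_zero 2 (h1 t ht)
  · exact (continuousOn_const.mul (hYo.pow 2)).div (hjo.pow 4) fun t ht => pow_ne_zero 4 (h1 t ht)

end Time

end SectionFlow

/-! ### The flow on the cylinder -/

/-- The flows at all frequencies under a common force, with initial velocity `u₀` at the
frequencies in `G` and zero initial velocity at the others. -/
abbrev CylinderFlow (a : ℝ) (F : ForceField) (G : Set ℝ) (u₀ : ℝ → ℝ → ℝ) : Type :=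
  ∀ Ω : ℝ, SectionFlow a (a * Ω) F (fun θ => cut G u₀ (θ, Ω)) (fun θ => cut G (thetaDeriv u₀) (θ, Ω))
    (fun θ => cut G (thetaDeriv (thetaDeriv u₀)) (θ, Ω))

lemma IsInitialData.exists_cylinderFlow {g : Measure ℝ} {G : Set ℝ} {ρ₀ u₀ : ℝ → ℝ → ℝ}
    (h : IsInitialData g G ρ₀ u₀) (a : ℝ) (F : ForceField) :
    Nonempty (CylinderFlow a F G u₀) := by
  have : ∀ Ω, Nonempty (SectionFlow a (a * Ω) F (fun θ => cut G u₀ (θ, Ω))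
      (fun θ => cut G (thetaDeriv u₀) (θ, Ω))
      (fun θ => cut G (thetaDeriv (thetaDeriv u₀)) (θ, Ω))) := by
    intro Ω
    refine exists_sectionFlow a (a * Ω) F ?_
    by_cases hΩ : Ω ∈ G
    · simp only [cut_of_mem hΩ]; exact h.isC2Profile hΩ
    · simp only [cut_of_notMem hΩ]
      exact ⟨fun α => hasDerivAt_const α 0, fun α => hasDerivAt_const α 0, continuous_const,
        fun _ => rfl⟩
  exact ⟨fun Ω => (this Ω).some⟩

/-- The mass is one since `g` is a probability measure and each `ρ₀(·, Ω)` has integral one. -/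
lemma RegularData.isMassData {g : Measure ℝ} [IsProbabilityMeasure g] {G S : Set ℝ}
    {ρ₀ u₀ : ℝ → ℝ → ℝ} {u₃ r₂ : ℝ × ℝ → ℝ} (hS : RegularData g G ρ₀ u₀ S u₃ r₂)
    (h : IsInitialData g G ρ₀ u₀) : IsMassData (cellMeasure g) (cut S u₀) (cut S ρ₀) := by
  obtain ⟨C, hC⟩ := h.bounded
  have hint : Integrable (cut S ρ₀) (cellMeasure g) := by
    refine Integrable.of_bound hS.meas_rho.aestronglyMeasurable C ?_
    filter_upwards [ae_snd_mem g hS.ae_mem] with p hp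
    obtain ⟨θ, Ω⟩ := p
    rw [cut_of_mem (by exact hp)]
    exact (hC θ Ω (hS.subset hp)).1
  refine ⟨hS.meas_u, hS.meas_rho, fun p => ?_, hint, ?_⟩
  · obtain ⟨θ, Ω⟩ := p
    by_cases hΩ : Ω ∈ S
    · rw [cut_of_mem hΩ]; exact (h.positive θ Ω (hS.subset hΩ)).le
    · rw [cut_of_notMem hΩ]
  · rw [integral_cellMeasure g hint]
    have h1 : (fun Ω => ∫ θ in (0 : ℝ)..2 * Real.pi, cut S ρ₀ (θ, Ω)) =ᵐ[g] fun _ => (1 : ℝ) := by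
      filter_upwards [hS.ae_mem] with Ω hΩ
      simp only [cut_of_mem hΩ]
      exact h.normalized Ω (hS.subset hΩ)
    rw [integral_congr_ae h1]
    simp

section Measurability

variable {g : Measure ℝ} {G S : Set ℝ} {ρ₀ u₀ : ℝ → ℝ → ℝ} {u₃ r₂ : ℝ × ℝ → ℝ}
  (hS : RegularData g G ρ₀ u₀ S u₃ r₂) (h : IsInitialData g G ρ₀ u₀) {a : ℝ} {F : ForceField}
  (Φ : CylinderFlow a F G u₀)
include hS

lemma RegularData.measurable_xy (t : ℝ) : Measurable (cut S fun α Ω => (Φ Ω).x t α) ∧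
    Measurable (cut S fun α Ω => (Φ Ω).y t α) := by
  have hm : Measurable fun p : ℝ × ℝ => (a * p.2, p.1, cut S u₀ p) :=
    (measurable_snd.const_mul a).prodMk (measurable_fst.prodMk hS.meas_u)
  constructor
  · refine measurable_cut_of_eq hS.measurableSet
      ((F.continuous_flow a t).1.measurable.comp hm) fun Ω hΩ α => ?_
    rw [(Φ Ω).x_eq, cut_of_mem (hS.subset hΩ), Function.comp_apply, cut_of_mem hΩ]
  · refine measurable_cut_of_eq hS.measurableSet
      ((F.continuous_flow a t).2.measurable.comp hm) fun Ω hΩ α => ?_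
    rw [(Φ Ω).y_eq, cut_of_mem (hS.subset hΩ), Function.comp_apply, cut_of_mem hΩ]

lemma RegularData.measurable_J (t : ℝ) : Measurable (cut S fun α Ω => (Φ Ω).J t α) :=
  measurable_cut_of_hasDerivAt (hS.measurable_xy Φ t).1 fun Ω _ α => (Φ Ω).x_a t α

lemma RegularData.measurable_P (t : ℝ) : Measurable (cut S fun α Ω => (Φ Ω).P t α) :=
  measurable_cut_of_hasDerivAt (hS.measurable_xy Φ t).2 fun Ω _ α => (Φ Ω).y_a t α

lemma RegularData.measurable_Y (t : ℝ) : Measurable (cut S fun α Ω => (Φ Ω).Y t α) :=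
  measurable_cut_of_hasDerivAt (hS.measurable_J Φ t) fun Ω _ α => (Φ Ω).J_a t α

lemma RegularData.measurable_Q (t : ℝ) : Measurable (cut S fun α Ω => (Φ Ω).Q t α) :=
  measurable_cut_of_hasDerivAt (hS.measurable_P Φ t) fun Ω _ α => (Φ Ω).P_a t α

lemma RegularData.measurable_W (t : ℝ) : Measurable (cut S fun α Ω => (Φ Ω).W t α) := by
  have h1 := hS.measurable_J Φ t
  have h2 := hS.measurable_P Φ t
  have h3 := hS.measurable_Y Φ t
  have h4 := hS.measurable_Q Φ t
  refine measurable_cut_of_eq hS.measurableSet ((h4.mul h1).sub (h2.mul h3)) fun Ω hΩ α => ?_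
  simp only [Pi.sub_apply, Pi.mul_apply, cut_of_mem hΩ, SectionFlow.W]

include h

lemma RegularData.measurable_u₂ : Measurable (cut S (thetaDeriv (thetaDeriv u₀))) :=
  measurable_cut_of_hasDerivAt (measurable_cut_of_hasDerivAt hS.meas_u
    fun _ hΩ => h.hasDerivAt_u (hS.subset hΩ)) fun _ hΩ => h.hasDerivAt_u₁ (hS.subset hΩ)

lemma RegularData.measurable_r₁ : Measurable (cut S (thetaDeriv ρ₀)) :=
  measurable_cut_of_hasDerivAt hS.meas_rho fun _ hΩ => h.hasDerivAt_rho (hS.subset hΩ)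

lemma RegularData.measurable_wForceA {t : ℝ} (ht : 0 ≤ t) :
    Measurable (cut S fun α Ω => (Φ Ω).wForceA t α) := by
  have h1 : Measurable (cut S fun α Ω => (Φ Ω).wForce t α) := by
    refine measurable_cut_of_eq hS.measurableSet
      (((hS.measurable_W Φ t).const_mul (Real.exp (a * t))).sub (hS.measurable_u₂ h))
      fun Ω hΩ α => ?_
    rw [SectionFlow.wForce_eq, cut_of_mem (hS.subset hΩ), Pi.sub_apply, cut_of_mem hΩ,
      cut_of_mem hΩ]
  exact measurable_cut_of_hasDerivAt h1 fun Ω _ α => ((Φ Ω).wForce_a ht).1 α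

omit h in
lemma RegularData.measurable_ux (t : ℝ) :
    Measurable (cut S fun α Ω => (Φ Ω).P t α / (Φ Ω).J t α) := by
  refine measurable_cut_of_eq hS.measurableSet
    ((hS.measurable_P Φ t).div (hS.measurable_J Φ t)) fun Ω hΩ α => ?_
  rw [Pi.div_apply, cut_of_mem hΩ, cut_of_mem hΩ]

omit h in
lemma RegularData.measurable_uxx (t : ℝ) : Measurable (cut S fun α Ω => (Φ Ω).uxx t α) := by
  refine measurable_cut_of_eq hS.measurableSet
    ((hS.measurable_W Φ t).div ((hS.measurable_J Φ t).pow_const 3)) fun Ω hΩ α => ?_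
  rw [Pi.div_apply, cut_of_mem hΩ, cut_of_mem hΩ, SectionFlow.uxx]

lemma RegularData.measurable_uxxx {t : ℝ} (ht : 0 ≤ t) :
    Measurable (cut S fun α Ω => (Φ Ω).uxxx (fun θ => u₃ (θ, Ω)) t α) := by
  have h1 := hS.measurable_J Φ t
  have h2 := hS.measurable_W Φ t
  have h3 := hS.measurable_Y Φ t
  have h4 := hS.measurable_wForceA h Φ ht
  have h5 := hS.meas_u₃
  have hm : Measurable fun p : ℝ × ℝ => (Real.exp (-(a * t)) *
      (u₃ p + cut S (fun α Ω => (Φ Ω).wForceA t α) p) / cut S (fun α Ω => (Φ Ω).J t α) p ^ 3 -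
      3 * cut S (fun α Ω => (Φ Ω).W t α) p * cut S (fun α Ω => (Φ Ω).Y t α) p /
        cut S (fun α Ω => (Φ Ω).J t α) p ^ 4) / cut S (fun α Ω => (Φ Ω).J t α) p := by
    fun_prop
  refine measurable_cut_of_eq hS.measurableSet hm fun Ω hΩ α => ?_
  simp only [cut_of_mem hΩ, SectionFlow.uxxx]

omit h in
lemma RegularData.measurable_rho (t : ℝ) :
    Measurable (cut S fun α Ω => ρ₀ α Ω / (Φ Ω).J t α) := by
  refine measurable_cut_of_eq hS.measurableSet
    (hS.meas_rho.div (hS.measurable_J Φ t)) fun Ω hΩ α => ?_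
  rw [Pi.div_apply, cut_of_mem hΩ, cut_of_mem hΩ]

lemma RegularData.measurable_rx (t : ℝ) : Measurable (cut S fun α Ω =>
    (Φ Ω).rx (fun θ => ρ₀ θ Ω) (fun θ => thetaDeriv ρ₀ θ Ω) t α) := by
  have h1 := hS.measurable_J Φ t
  have h3 := hS.measurable_Y Φ t
  have h4 := hS.meas_rho
  have h5 := hS.measurable_r₁ h
  have hm : Measurable fun p : ℝ × ℝ => (cut S (thetaDeriv ρ₀) p / cut S (fun α Ω => (Φ Ω).J t α) p -
      cut S ρ₀ p * cut S (fun α Ω => (Φ Ω).Y t α) p / cut S (fun α Ω => (Φ Ω).J t α) p ^ 2) /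
      cut S (fun α Ω => (Φ Ω).J t α) p := by fun_prop
  refine measurable_cut_of_eq hS.measurableSet hm fun Ω hΩ α => ?_
  simp only [cut_of_mem hΩ, SectionFlow.rx]

lemma RegularData.measurable_rxx {t : ℝ} (ht : 0 ≤ t)
    (hJ : ∀ Ω ∈ S, ∀ α, ∀ s ∈ Set.Icc 0 t, 0 < (Φ Ω).J s α) : Measurable (cut S fun α Ω =>
    (Φ Ω).rxx (fun θ => ρ₀ θ Ω) (fun θ => thetaDeriv ρ₀ θ Ω) (fun θ => r₂ (θ, Ω))
      (fun θ => u₃ (θ, Ω)) t α) := by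
  have h1 := fun t => hS.measurable_J Φ t
  have h2 := fun t => hS.measurable_W Φ t
  have h3 := fun t => hS.measurable_Y Φ t
  have h4 := hS.meas_rho
  have h5 := hS.measurable_r₁ h
  have h6 := hS.meas_u₃
  have h7 := hS.meas_r₂
  have hV : Measurable (cut S fun α Ω => (Φ Ω).vCoeff t α) := by
    refine measurable_cut_integral ht (fun s _ => ?_) fun Ω hΩ α =>
      (Φ Ω).continuousOn_vIntegrand (hJ Ω hΩ α)
    have h1s := h1 s
    have hm : Measurable fun p : ℝ × ℝ =>
      Real.exp (-(a * s)) / cut S (fun α Ω => (Φ Ω).J s α) p ^ 2 := by fun_prop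
    refine measurable_cut_of_eq hS.measurableSet hm fun Ω hΩ α => ?_
    simp only [cut_of_mem hΩ]
  have hL : Measurable (cut S fun α Ω => (Φ Ω).lowerPart t α) := by
    refine measurable_cut_integral ht (fun s hs => ?_) fun Ω hΩ α =>
      (Φ Ω).continuousOn_lowerIntegrand (hJ Ω hΩ α)
    have h1s := h1 s
    have h2s := h2 s
    have h3s := h3 s
    have h4s := hS.measurable_wForceA h Φ hs.1
    have hm : Measurable fun p : ℝ × ℝ =>
      Real.exp (-(a * s)) * cut S (fun α Ω => (Φ Ω).wForceA s α) p /
        cut S (fun α Ω => (Φ Ω).J s α) p ^ 2 - 2 * cut S (fun α Ω => (Φ Ω).W s α) p *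
        cut S (fun α Ω => (Φ Ω).Y s α) p / cut S (fun α Ω => (Φ Ω).J s α) p ^ 3 := by fun_prop
    refine measurable_cut_of_eq hS.measurableSet hm fun Ω hΩ α => ?_
    simp only [cut_of_mem hΩ]
  have h1t := h1 t
  have h3t := h3 t
  have hm : Measurable fun p : ℝ × ℝ =>
      (r₂ p / cut S (fun α Ω => (Φ Ω).J t α) p ^ 2 -
        3 * cut S (thetaDeriv ρ₀) p * cut S (fun α Ω => (Φ Ω).Y t α) p /
          cut S (fun α Ω => (Φ Ω).J t α) p ^ 3 -
        cut S ρ₀ p * (u₃ p * cut S (fun α Ω => (Φ Ω).vCoeff t α) p +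
          cut S (fun α Ω => (Φ Ω).lowerPart t α) p) / cut S (fun α Ω => (Φ Ω).J t α) p ^ 2 +
        2 * cut S ρ₀ p * cut S (fun α Ω => (Φ Ω).Y t α) p ^ 2 /
          cut S (fun α Ω => (Φ Ω).J t α) p ^ 4) / cut S (fun α Ω => (Φ Ω).J t α) p := by
    fun_prop
  refine measurable_cut_of_eq hS.measurableSet hm fun Ω hΩ α => ?_
  simp only [cut_of_mem hΩ, SectionFlow.rxx]

end Measurability


/-! ### The classical solution carried by the flow -/

/-- Intervals of the form `[0, T)` or `[0, ∞)`. -/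
structure IsTimeInterval (I : Set ℝ) : Prop where
  zero_mem : (0 : ℝ) ∈ I
  nonneg : ∀ t ∈ I, 0 ≤ t
  Icc_subset : ∀ s ∈ I, Set.Icc 0 s ⊆ I
  exists_gt : ∀ t ∈ I, ∃ s ∈ I, t < s

lemma isTimeInterval_Ico {T : ℝ} (hT : 0 < T) : IsTimeInterval (Set.Ico 0 T) :=
  ⟨⟨le_rfl, hT⟩, fun _ h => h.1, fun _ hs _ ht => ⟨ht.1, ht.2.trans_lt hs.2⟩,
    fun t ht => ⟨(t + T) / 2, ⟨by linarith [ht.1, ht.2], by linarith [ht.2]⟩, by linarith [ht.2]⟩⟩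

lemma isTimeInterval_Ici : IsTimeInterval (Set.Ici 0) :=
  ⟨Set.self_mem_Ici, fun _ h => h, fun _ _ _ ht => ht.1,
    fun t ht => ⟨t + 1, by have : (0 : ℝ) ≤ t := ht; exact (by linarith : (0 : ℝ) ≤ t + 1),
      by linarith⟩⟩

lemma IsTimeInterval.nhdsWithin_le {I : Set ℝ} (hI : IsTimeInterval I) {t s : ℝ} (hts : t < s) :
    𝓝[I] t ≤ 𝓝[Set.Icc 0 s] t := by
  refine le_inf nhdsWithin_le_nhds (le_principal_iff.2 ?_)
  filter_upwards [self_mem_nhdsWithin, mem_nhdsWithin_of_mem_nhds (Iio_mem_nhds hts)] with t' h1 h2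
  exact ⟨hI.nonneg _ h1, h2.le⟩

lemma IsTimeInterval.mem_nhds {I : Set ℝ} (hI : IsTimeInterval I) {t : ℝ} (ht : t ∈ I)
    (h0 : 0 < t) : I ∈ 𝓝 t := by
  obtain ⟨s, hs, hts⟩ := hI.exists_gt t ht
  exact mem_of_superset (Icc_mem_nhds h0 hts) (hI.Icc_subset s hs)

/-- Transport of mass: `R ∘ x · J = r` says that `r` is carried to `R` by `x`. -/
lemma IsCircleMap.integral_mul_comp {x J : ℝ → ℝ} (hc : IsCircleMap x J) {b R r : ℝ → ℝ}
    (hb : Function.Periodic b (2 * Real.pi)) (hR : Function.Periodic R (2 * Real.pi))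
    (h : ∀ α, R (x α) * J α = r α) :
    ∫ θ in (0 : ℝ)..2 * Real.pi, b θ * R θ = ∫ α in (0 : ℝ)..2 * Real.pi, b (x α) * r α := by
  rw [hc.integral_comp (H := fun θ => b θ * R θ) fun θ => by simp only [hb θ, hR θ]]
  refine intervalIntegral.integral_congr fun α _ => ?_
  simp only [← h α]
  ring

section Existence

variable {g : Measure ℝ} [IsProbabilityMeasure g] {G S : Set ℝ} {ρ₀ u₀ : ℝ → ℝ → ℝ}
  {u₃ r₂ : ℝ × ℝ → ℝ} {a : ℝ} {F : ForceField} (Φ : CylinderFlow a F G u₀)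

omit [IsProbabilityMeasure g] in
lemma IsInitialData.periodic_cut (h : IsInitialData g G ρ₀ u₀) (Ω : ℝ) :
    Function.Periodic (fun θ => cut G u₀ (θ, Ω)) (2 * Real.pi) := by
  by_cases hΩ : Ω ∈ G
  · simp only [cut_of_mem hΩ]; exact h.periodic_u Ω hΩ
  · simp only [cut_of_notMem hΩ]; exact fun _ => rfl

variable (hS : RegularData g G ρ₀ u₀ S u₃ r₂) (h : IsInitialData g G ρ₀ u₀) {s δ : ℝ}
  (hδ : 0 < δ) (hJ : ∀ t ∈ Set.Icc 0 s, ∀ Ω ∈ G, ∀ α, δ ≤ (Φ Ω).J t α)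
include hS h hδ hJ

/-- A Lagrangian quantity that is dominated in `L²` gives an Eulerian quantity which is continuous
in time with values in `L²`. -/
lemma RegularData.memLp_and_tendsto {f : ℝ → ℝ → ℝ → ℝ} {D : ℝ × ℝ → ℝ}
    (hfm : ∀ t ∈ Set.Icc 0 s, Measurable (cut S (f t)))
    (hfp : ∀ t ∈ Set.Icc 0 s, ∀ Ω ∈ S, Function.Periodic (fun α => f t α Ω) (2 * Real.pi))
    (hfc : ∀ Ω ∈ S, ∀ α, ContinuousOn (fun t => f t α Ω) (Set.Icc 0 s))
    (hD : ∀ t ∈ Set.Icc 0 s, ∀ Ω ∈ S, ∀ α, |f t α Ω| ≤ D (α, Ω)) (hD0 : ∀ p, 0 ≤ D p)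
    (hDL : MemLp D 2 (cellMeasure g)) :
    (∀ t ∈ Set.Icc 0 s, MemLp (fun p : ℝ × ℝ => f t ((Φ p.2).inv t p.1) p.2) 2 (cellMeasure g)) ∧
    ∀ t ∈ Set.Icc 0 s, Tendsto (fun t' => eLpNorm (fun p : ℝ × ℝ =>
      f t' ((Φ p.2).inv t' p.1) p.2 - f t ((Φ p.2).inv t p.1) p.2) 2 (cellMeasure g))
      (𝓝[Set.Icc 0 s] t) (𝓝 0) := by
  obtain ⟨C, hC⟩ := h.bounded
  refine memLp_and_tendsto_eulerian g hS.measurableSet hS.ae_mem (x := fun t α Ω => (Φ Ω).x t α)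
    (J := fun t α Ω => (Φ Ω).J t α) (C := (1 + C) * Real.exp ((1 + |a| + 2 * F.B) * s)) hδ
    (fun t ht Ω hΩ => ?_) (fun t ht Ω hΩ α => ⟨hJ t ht Ω (hS.subset hΩ) α, ?_⟩)
    (fun t _ => (hS.measurable_xy Φ t).1) (fun t _ => hS.measurable_J Φ t)
    (fun Ω _ α => ((Φ Ω).continuous_time α).1.continuousOn) hfm hfp hfc hD hD0 hDL
  · exact (Φ Ω).isCircleMap (h.periodic_cut Ω) ht.1
      fun α => hδ.trans_le (hJ t ht Ω (hS.subset hΩ) α)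
  · refine (le_abs_self _).trans ((Φ Ω).variation_bounds ?_ (abs_le.2 ⟨by linarith [ht.1, ht.2],
      ht.2⟩)).1
    rw [cut_of_mem (hS.subset hΩ)]
    exact (hC α Ω (hS.subset hΩ)).2

omit hS [IsProbabilityMeasure g] in
/-- The bounds of `SectionFlow.exists_derivative_bounds` with one constant for all frequencies in
`G`, while the Jacobian is at least `δ`. -/
lemma IsInitialData.derivative_bounds (hs : 0 ≤ s) : ∃ K : ℝ, 0 ≤ K ∧ ∀ t ∈ Set.Icc 0 s,
    ∀ Ω ∈ G, ∀ α, |(Φ Ω).P t α / (Φ Ω).J t α| ≤ K ∧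
      |(Φ Ω).uxx t α| ≤ K * (1 + |thetaDeriv (thetaDeriv u₀) α Ω|) ∧
      (∀ v₃ : ℝ → ℝ, |(Φ Ω).uxxx v₃ t α| ≤
        K * (1 + |v₃ α| + thetaDeriv (thetaDeriv u₀) α Ω ^ 2)) ∧
      |ρ₀ α Ω / (Φ Ω).J t α| ≤ K ∧
      |(Φ Ω).rx (fun θ => ρ₀ θ Ω) (fun θ => thetaDeriv ρ₀ θ Ω) t α| ≤
        K * (1 + |thetaDeriv ρ₀ α Ω| + |thetaDeriv (thetaDeriv u₀) α Ω|) ∧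
      ∀ q v₃ : ℝ → ℝ, |(Φ Ω).rxx (fun θ => ρ₀ θ Ω) (fun θ => thetaDeriv ρ₀ θ Ω) q v₃ t α| ≤
        K * (1 + |q α| + |v₃ α| + thetaDeriv ρ₀ α Ω ^ 2 + thetaDeriv (thetaDeriv u₀) α Ω ^ 2) := by
  obtain ⟨C, hC⟩ := h.bounded
  obtain ⟨K, hK0, hK⟩ := SectionFlow.exists_derivative_bounds a F (C := max C 0) (Cr := C) (T := s)
    (δ := δ) (le_max_right _ _) hs hδ
  refine ⟨K, hK0, fun t ht Ω hΩ α => ?_⟩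
  obtain ⟨h1, h2, h3, h4⟩ := hK _ _ _ _ (Φ Ω) α
    (by rw [cut_of_mem hΩ]; exact (hC α Ω hΩ).2.trans (le_max_left _ _)) t ht
    fun s' hs' => hJ s' ⟨hs'.1, hs'.2.trans ht.2⟩ Ω hΩ α
  simp only [cut_of_mem hΩ] at h2 h3 h4
  obtain ⟨h5, h6, h7⟩ := h4 (fun θ => ρ₀ θ Ω) (fun θ => thetaDeriv ρ₀ θ Ω) (hC α Ω hΩ).1
  exact ⟨h1, h2, h3, h5, h6, h7⟩

/-- The velocity and its first three derivatives are continuous in time with values in `L²`. -/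
lemma RegularData.continuous_velocity (hs : 0 ≤ s) (hg : Integrable (fun Ω : ℝ => Ω ^ 2) g)
    (j : Fin 4) :
    let e : ℝ → ℝ × ℝ → ℝ := fun t p =>
      ![(Φ p.2).y t, fun α => (Φ p.2).P t α / (Φ p.2).J t α, (Φ p.2).uxx t,
        (Φ p.2).uxxx (fun θ => u₃ (θ, p.2)) t] j ((Φ p.2).inv t p.1)
    (∀ t ∈ Set.Icc 0 s, MemLp (e t) 2 (cellMeasure g)) ∧
    ∀ t ∈ Set.Icc 0 s, Tendsto (fun t' => eLpNorm (fun p => e t' p - e t p) 2 (cellMeasure g))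
      (𝓝[Set.Icc 0 s] t) (𝓝 0) := by
  intro e
  have hJp : ∀ Ω ∈ S, ∀ α, ∀ t ∈ Set.Icc 0 s, 0 < (Φ Ω).J t α := fun Ω hΩ α t ht =>
    hδ.trans_le (hJ t ht Ω (hS.subset hΩ) α)
  obtain ⟨K, hK0, hK⟩ := h.derivative_bounds Φ hδ hJ hs
  have hone : MemLp (fun _ : ℝ × ℝ => (1 : ℝ)) 2 (cellMeasure g) := memLp_const 1
  fin_cases j
  · refine hS.memLp_and_tendsto Φ h hδ hJ (f := fun t α Ω => (Φ Ω).y t α)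
      (D := fun p => (|cut S u₀ p| + (|a| * |p.2| + 2 * F.B) * s) * Real.exp (|a| * s))
      (fun t _ => (hS.measurable_xy Φ t).2)
      (fun t ht Ω _ => (Φ Ω).periodic_y (h.periodic_cut Ω) ht.1)
      (fun Ω _ α => ((Φ Ω).continuous_time α).2.1.continuousOn)
      (fun t ht Ω hΩ α => ?_) (fun p => ?_) ?_
    · rw [(Φ Ω).y_eq, cut_of_mem (hS.subset hΩ), cut_of_mem hΩ, ← abs_mul]
      exact F.vel_bound _ _ _ _ (abs_le.2 ⟨by linarith [ht.1, ht.2], ht.2⟩)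
    · have := F.B_nonneg
      positivity
    · have h1 : MemLp (fun Ω : ℝ => Ω) 2 g := (memLp_two_iff_integrable_sq
        measurable_id.aestronglyMeasurable).2 hg
      have h2 : MemLp (fun p : ℝ × ℝ => p.2) 2 (cellMeasure g) := h1.comp_snd _
      exact (hS.memLp_u.abs.add (((h2.abs.const_mul |a|).add (memLp_const _)).mul_const s)).mul_const _
  · refine hS.memLp_and_tendsto Φ h hδ hJ (f := fun t α Ω => (Φ Ω).P t α / (Φ Ω).J t α)
      (D := fun p => K) (fun t _ => hS.measurable_ux Φ t)
      (fun t ht Ω _ => ((Φ Ω).periodic_P (h.periodic_cut Ω) ht.1).div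
        ((Φ Ω).periodic_J (h.periodic_cut Ω) ht.1))
      (fun Ω hΩ α => (Φ Ω).continuousOn_ux (hJp Ω hΩ α))
      (fun t ht Ω hΩ α => (hK t ht Ω (hS.subset hΩ) α).1) (fun p => hK0) (memLp_const _)
  · refine hS.memLp_and_tendsto Φ h hδ hJ (f := fun t α Ω => (Φ Ω).uxx t α)
      (D := fun p => K * (1 + |cut S (thetaDeriv (thetaDeriv u₀)) p|))
      (fun t _ => hS.measurable_uxx Φ t)
      (fun t ht Ω _ => (Φ Ω).periodic_uxx (h.periodic_cut Ω) ht.1)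
      (fun Ω hΩ α => (Φ Ω).continuousOn_uxx (hJp Ω hΩ α))
      (fun t ht Ω hΩ α => ?_) (fun p => by positivity)
      ((hone.add hS.memLp_u₂.abs).const_mul K)
    rw [cut_of_mem hΩ]
    exact (hK t ht Ω (hS.subset hΩ) α).2.1
  · refine hS.memLp_and_tendsto Φ h hδ hJ
      (f := fun t α Ω => (Φ Ω).uxxx (fun θ => u₃ (θ, Ω)) t α)
      (D := fun p => K * (1 + |u₃ p| +
        |cut S (fun θ Ω => thetaDeriv (thetaDeriv u₀) θ Ω ^ 2) p|))
      (fun t ht => hS.measurable_uxxx h Φ ht.1)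
      (fun t ht Ω _ => (Φ Ω).periodic_uxxx (h.periodic_cut Ω) (hS.periodic_u₃ Ω) ht.1)
      (fun Ω hΩ α => (Φ Ω).continuousOn_uxxx (hJp Ω hΩ α) _)
      (fun t ht Ω hΩ α => ?_) (fun p => by positivity)
      (((hone.add hS.memLp_u₃.abs).add hS.memLp_u₂_sq.abs).const_mul K)
    rw [cut_of_mem hΩ, abs_of_nonneg (sq_nonneg (thetaDeriv (thetaDeriv u₀) α Ω))]
    exact (hK t ht Ω (hS.subset hΩ) α).2.2.1 _

/-- The density and its first two derivatives are continuous in time with values in `L²`. -/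
lemma RegularData.continuous_density (hs : 0 ≤ s) (j : Fin 3) :
    let e : ℝ → ℝ × ℝ → ℝ := fun t p =>
      ![fun α => ρ₀ α p.2 / (Φ p.2).J t α,
        (Φ p.2).rx (fun θ => ρ₀ θ p.2) (fun θ => thetaDeriv ρ₀ θ p.2) t,
        (Φ p.2).rxx (fun θ => ρ₀ θ p.2) (fun θ => thetaDeriv ρ₀ θ p.2) (fun θ => r₂ (θ, p.2))
          (fun θ => u₃ (θ, p.2)) t] j ((Φ p.2).inv t p.1)
    (∀ t ∈ Set.Icc 0 s, MemLp (e t) 2 (cellMeasure g)) ∧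
    ∀ t ∈ Set.Icc 0 s, Tendsto (fun t' => eLpNorm (fun p => e t' p - e t p) 2 (cellMeasure g))
      (𝓝[Set.Icc 0 s] t) (𝓝 0) := by
  intro e
  have hJp : ∀ Ω ∈ S, ∀ α, ∀ t ∈ Set.Icc 0 s, 0 < (Φ Ω).J t α := fun Ω hΩ α t ht =>
    hδ.trans_le (hJ t ht Ω (hS.subset hΩ) α)
  obtain ⟨K, hK0, hK⟩ := h.derivative_bounds Φ hδ hJ hs
  have hone : MemLp (fun _ : ℝ × ℝ => (1 : ℝ)) 2 (cellMeasure g) := memLp_const 1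
  have hr1p : ∀ Ω ∈ S, Function.Periodic (fun θ => thetaDeriv ρ₀ θ Ω) (2 * Real.pi) := fun Ω hΩ =>
    periodic_of_hasDerivAt (h.periodic_rho Ω (hS.subset hΩ)) (h.hasDerivAt_rho (hS.subset hΩ))
  fin_cases j
  · refine hS.memLp_and_tendsto Φ h hδ hJ (f := fun t α Ω => ρ₀ α Ω / (Φ Ω).J t α)
      (D := fun p => K) (fun t _ => hS.measurable_rho Φ t)
      (fun t ht Ω hΩ => (h.periodic_rho Ω (hS.subset hΩ)).div
        ((Φ Ω).periodic_J (h.periodic_cut Ω) ht.1))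
      (fun Ω hΩ α => (Φ Ω).continuousOn_rho (hJp Ω hΩ α) (fun θ => ρ₀ θ Ω))
      (fun t ht Ω hΩ α => (hK t ht Ω (hS.subset hΩ) α).2.2.2.1) (fun p => hK0) (memLp_const _)
  · refine hS.memLp_and_tendsto Φ h hδ hJ
      (f := fun t α Ω => (Φ Ω).rx (fun θ => ρ₀ θ Ω) (fun θ => thetaDeriv ρ₀ θ Ω) t α)
      (D := fun p => K * (1 + |cut S (thetaDeriv ρ₀) p| + |cut S (thetaDeriv (thetaDeriv u₀)) p|))
      (fun t _ => hS.measurable_rx h Φ t)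
      (fun t ht Ω hΩ => (Φ Ω).periodic_rx (h.periodic_cut Ω) (h.periodic_rho Ω (hS.subset hΩ))
        (hr1p Ω hΩ) ht.1)
      (fun Ω hΩ α => (Φ Ω).continuousOn_rx (hJp Ω hΩ α) _ _)
      (fun t ht Ω hΩ α => ?_) (fun p => by positivity)
      (((hone.add hS.memLp_r₁.abs).add hS.memLp_u₂.abs).const_mul K)
    rw [cut_of_mem hΩ, cut_of_mem hΩ]
    exact (hK t ht Ω (hS.subset hΩ) α).2.2.2.2.1
  · refine hS.memLp_and_tendsto Φ h hδ hJ
      (f := fun t α Ω => (Φ Ω).rxx (fun θ => ρ₀ θ Ω) (fun θ => thetaDeriv ρ₀ θ Ω)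
        (fun θ => r₂ (θ, Ω)) (fun θ => u₃ (θ, Ω)) t α)
      (D := fun p => K * (1 + |r₂ p| + |u₃ p| + |cut S (fun θ Ω => thetaDeriv ρ₀ θ Ω ^ 2) p| +
        |cut S (fun θ Ω => thetaDeriv (thetaDeriv u₀) θ Ω ^ 2) p|))
      (fun t ht => hS.measurable_rxx h Φ ht.1 fun Ω hΩ α s' hs' =>
        hJp Ω hΩ α s' ⟨hs'.1, hs'.2.trans ht.2⟩)
      (fun t ht Ω hΩ => (Φ Ω).periodic_rxx (h.periodic_cut Ω) (h.periodic_rho Ω (hS.subset hΩ))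
        (hr1p Ω hΩ) (hS.periodic_r₂ Ω) (hS.periodic_u₃ Ω) ht.1)
      (fun Ω hΩ α => (Φ Ω).continuousOn_rxx hs (hJp Ω hΩ α) _ _ _ _)
      (fun t ht Ω hΩ α => ?_) (fun p => by positivity)
      (((((hone.add hS.memLp_r₂.abs).add hS.memLp_u₃.abs).add hS.memLp_r₁_sq.abs).add
        hS.memLp_u₂_sq.abs).const_mul K)
    rw [cut_of_mem hΩ, cut_of_mem hΩ, abs_of_nonneg (sq_nonneg (thetaDeriv ρ₀ α Ω)),
      abs_of_nonneg (sq_nonneg (thetaDeriv (thetaDeriv u₀) α Ω))]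
    exact (hK t ht Ω (hS.subset hΩ) α).2.2.2.2.2 _ _

end Existence


section Existence

variable {g : Measure ℝ} [IsProbabilityMeasure g] {G S : Set ℝ} {ρ₀ u₀ : ℝ → ℝ → ℝ}
  {u₃ r₂ : ℝ × ℝ → ℝ} {a κ : ℝ} {F : ForceField} (Φ : CylinderFlow a F G u₀)
  (hS : RegularData g G ρ₀ u₀ S u₃ r₂) (h : IsInitialData g G ρ₀ u₀)

/-- Change from Eulerian to Lagrangian coordinates in integrals over the cylinder. -/
lemma RegularData.integral_lagrangian {x J : ℝ → ℝ → ℝ} {R : ℝ → ℝ → ℝ} {X : ℝ × ℝ → ℝ} {b : ℝ → ℝ}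
    (hS : RegularData g G ρ₀ u₀ S u₃ r₂) (h : IsInitialData g G ρ₀ u₀)
    (hX : Measurable X) (hxX : ∀ Ω ∈ S, ∀ α, X (α, Ω) = x α Ω)
    (hcirc : ∀ Ω ∈ S, IsCircleMap (fun α => x α Ω) fun α => J α Ω)
    (hR : ∀ Ω ∈ S, Function.Periodic (fun θ => R θ Ω) (2 * Real.pi))
    (hRr : ∀ Ω ∈ S, ∀ α, R (x α Ω) Ω * J α Ω = ρ₀ α Ω)
    (hRL : MemLp (fun p => R p.1 p.2) 2 (cellMeasure g))
    (hb : Continuous b) (hbp : Function.Periodic b (2 * Real.pi)) {C : ℝ} (hbC : ∀ θ, |b θ| ≤ C) :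
    ∫ p, b p.1 * R p.1 p.2 ∂(cellMeasure g) = ∫ p, b (X p) * cut S ρ₀ p ∂(cellMeasure g) := by
  have hm := hS.isMassData h
  have i1 : Integrable (fun p : ℝ × ℝ => b p.1 * R p.1 p.2) (cellMeasure g) :=
    (hRL.integrable one_le_two).bdd_mul (c := C)
      (hb.measurable.comp measurable_fst).aestronglyMeasurable (Eventually.of_forall fun p => hbC _)
  have i2 : Integrable (fun p : ℝ × ℝ => b (X p) * cut S ρ₀ p) (cellMeasure g) :=
    hm.integrable_bdd_mul (hb.measurable.comp hX).aestronglyMeasurable fun p => hbC _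
  rw [integral_cellMeasure g i1, integral_cellMeasure g i2]
  refine integral_congr_ae ?_
  filter_upwards [hS.ae_mem] with Ω hΩ
  simp only [hxX Ω hΩ, cut_of_mem hΩ]
  exact (hcirc Ω hΩ).integral_mul_comp (R := fun θ => R θ Ω) hbp (hR Ω hΩ) (hRr Ω hΩ)

include h

omit [IsProbabilityMeasure g] in
lemma IsInitialData.eulRho_apply_x {t : ℝ} (ht : 0 ≤ t) {Ω : ℝ} (hJ : ∀ α, 0 < (Φ Ω).J t α)
    (α : ℝ) : (Φ Ω).eulRho (fun θ => ρ₀ θ Ω) t ((Φ Ω).x t α) * (Φ Ω).J t α = ρ₀ α Ω := by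
  have h1 : (Φ Ω).inv t ((Φ Ω).x t α) = α :=
    ((Φ Ω).isCircleMap (h.periodic_cut Ω) ht hJ).invFun_apply α
  rw [SectionFlow.eulRho, h1, div_mul_cancel₀ _ (hJ α).ne']

include hS

/-- As long as the flow is uniformly non-degenerate, it carries a classical solution. -/
theorem RegularData.isClassicalSolution {m K : ℝ} (ha : a = 1 / m) (hκ : κ = K / m)
    (hg : Integrable (fun Ω : ℝ => Ω ^ 2) g) {I : Set ℝ} (hI : IsTimeInterval I)
    (hF : ∀ T, IsSelfConsistent a κ (cellMeasure g) (cut S u₀) (cut S ρ₀) F T)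
    (hJ : ∀ s ∈ I, ∃ δ > 0, ∀ t ∈ Set.Icc 0 s, ∀ Ω ∈ G, ∀ α, δ ≤ (Φ Ω).J t α) :
    IsClassicalSolution m K g G ρ₀ u₀ I (fun t θ Ω => (Φ Ω).eulRho (fun θ => ρ₀ θ Ω) t θ)
      (fun t θ Ω => (Φ Ω).eulU t θ) := by
  have hJp : ∀ Ω ∈ G, ∀ t ∈ I, ∀ α, 0 < (Φ Ω).J t α := fun Ω hΩ t ht α => by
    obtain ⟨δ, hδ, h1⟩ := hJ t ht
    exact hδ.trans_le (h1 t ⟨hI.nonneg t ht, le_rfl⟩ Ω hΩ α)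
  have hcm : ∀ t ∈ I, ∀ Ω ∈ G, IsCircleMap ((Φ Ω).x t) ((Φ Ω).J t) := fun t ht Ω hΩ =>
    (Φ Ω).isCircleMap (h.periodic_cut Ω) (hI.nonneg t ht) (hJp Ω hΩ t ht)
  have hmass := hS.isMassData h
  have hr1p : ∀ Ω ∈ S, Function.Periodic (fun θ => thetaDeriv ρ₀ θ Ω) (2 * Real.pi) := fun Ω hΩ =>
    periodic_of_hasDerivAt (h.periodic_rho Ω (hS.subset hΩ)) (h.hasDerivAt_rho (hS.subset hΩ))
  -- the velocity
  have hu : ContinuousInSobolev g 3 I fun t θ Ω => (Φ Ω).eulU t θ := by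
    refine continuousInSobolev_of_sections g (k := 3) (fun j t p =>
      ![(Φ p.2).y t, fun α => (Φ p.2).P t α / (Φ p.2).J t α, (Φ p.2).uxx t,
        (Φ p.2).uxxx (fun θ => u₃ (θ, p.2)) t] j ((Φ p.2).inv t p.1)) (fun j t ht => ?_)
      (fun j t ht => ?_) (fun j t ht => ?_) fun t ht p => rfl
    · obtain ⟨δ, hδ, h1⟩ := hJ t ht
      have ht0 := hI.nonneg t ht
      exact (hS.continuous_velocity Φ h hδ h1 ht0 hg j).1 t ⟨ht0, le_rfl⟩
    · obtain ⟨s, hs, hts⟩ := hI.exists_gt t ht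
      obtain ⟨δ, hδ, h1⟩ := hJ s hs
      have ht0 := hI.nonneg t ht
      exact ((hS.continuous_velocity Φ h hδ h1 (hI.nonneg s hs) hg j).2 t ⟨ht0, hts.le⟩).mono_left
        (hI.nhdsWithin_le hts)
    · filter_upwards [hS.ae_mem] with Ω hΩ
      have hΩG := hS.subset hΩ
      have hc := hcm t ht Ω hΩG
      have hp := h.periodic_cut Ω
      have ht0 := hI.nonneg t ht
      have hw : SecWeak (fun θ => cut G (thetaDeriv (thetaDeriv u₀)) (θ, Ω))
          (fun θ => u₃ (θ, Ω)) := by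
        simp only [cut_of_mem hΩG]; exact hS.secWeak_u Ω hΩ
      fin_cases j
      · exact hc.secWeak_comp_invFun ((Φ Ω).periodic_y hp ht0)
          (((Φ Ω).periodic_P hp ht0).div ((Φ Ω).periodic_J hp ht0))
          ((Φ Ω).secWeak_y hp ht0 (hJp Ω hΩG t ht))
      · exact hc.secWeak_comp_invFun (((Φ Ω).periodic_P hp ht0).div ((Φ Ω).periodic_J hp ht0))
          ((Φ Ω).periodic_uxx hp ht0) ((Φ Ω).secWeak_ux hp ht0 (hJp Ω hΩG t ht))
      · exact hc.secWeak_comp_invFun ((Φ Ω).periodic_uxx hp ht0)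
          ((Φ Ω).periodic_uxxx hp (hS.periodic_u₃ Ω) ht0)
          ((Φ Ω).secWeak_uxx hp hw ht0 (hJp Ω hΩG t ht))
  -- the density
  have hrho : ContinuousInSobolev g 2 I fun t θ Ω => (Φ Ω).eulRho (fun θ => ρ₀ θ Ω) t θ := by
    refine continuousInSobolev_of_sections g (k := 2) (fun j t p =>
      ![fun α => ρ₀ α p.2 / (Φ p.2).J t α,
        (Φ p.2).rx (fun θ => ρ₀ θ p.2) (fun θ => thetaDeriv ρ₀ θ p.2) t,
        (Φ p.2).rxx (fun θ => ρ₀ θ p.2) (fun θ => thetaDeriv ρ₀ θ p.2) (fun θ => r₂ (θ, p.2))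
          (fun θ => u₃ (θ, p.2)) t] j ((Φ p.2).inv t p.1)) (fun j t ht => ?_)
      (fun j t ht => ?_) (fun j t ht => ?_) fun t ht p => rfl
    · obtain ⟨δ, hδ, h1⟩ := hJ t ht
      have ht0 := hI.nonneg t ht
      exact (hS.continuous_density Φ h hδ h1 ht0 j).1 t ⟨ht0, le_rfl⟩
    · obtain ⟨s, hs, hts⟩ := hI.exists_gt t ht
      obtain ⟨δ, hδ, h1⟩ := hJ s hs
      have ht0 := hI.nonneg t ht
      exact ((hS.continuous_density Φ h hδ h1 (hI.nonneg s hs) j).2 t ⟨ht0, hts.le⟩).mono_left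
        (hI.nhdsWithin_le hts)
    · filter_upwards [hS.ae_mem] with Ω hΩ
      have hΩG := hS.subset hΩ
      have hc := hcm t ht Ω hΩG
      have hp := h.periodic_cut Ω
      have ht0 := hI.nonneg t ht
      have hw : SecWeak (fun θ => cut G (thetaDeriv (thetaDeriv u₀)) (θ, Ω))
          (fun θ => u₃ (θ, Ω)) := by
        simp only [cut_of_mem hΩG]; exact hS.secWeak_u Ω hΩ
      have hr0p := h.periodic_rho Ω hΩG
      fin_cases j
      · exact hc.secWeak_comp_invFun (hr0p.div ((Φ Ω).periodic_J hp ht0))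
          ((Φ Ω).periodic_rx hp hr0p (hr1p Ω hΩ) ht0)
          ((Φ Ω).secWeak_rho hp ht0 (hJp Ω hΩG t ht) (h.hasDerivAt_rho hΩG) (h.continuous_r₁ hΩG)
            hr0p)
      · exact hc.secWeak_comp_invFun ((Φ Ω).periodic_rx hp hr0p (hr1p Ω hΩ) ht0)
          ((Φ Ω).periodic_rxx hp hr0p (hr1p Ω hΩ) (hS.periodic_r₂ Ω) (hS.periodic_u₃ Ω) ht0)
          ((Φ Ω).secWeak_rx hp hw ht0
            (fun s hs => hJp Ω hΩG s (hI.Icc_subset t ht hs)) (h.hasDerivAt_rho hΩG)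
            (h.continuous_r₁ hΩG) hr0p (hS.secWeak_rho Ω hΩ))
  -- the force in Eulerian coordinates
  have hforce : ∀ t ∈ I, ∀ θ, F.val t θ = κ * ∫ p, Real.sin (p.1 - θ) *
      (Φ p.2).eulRho (fun θ => ρ₀ θ p.2) t p.1 ∂(cellMeasure g) := by
    intro t ht θ
    have ht0 := hI.nonneg t ht
    obtain ⟨δ, hδ, h1⟩ := hJ t ht
    rw [hmass.val_eq (hF t) ⟨ht0, le_rfl⟩]
    congr 1
    refine (hS.integral_lagrangian h (x := fun α Ω => (Φ Ω).x t α) (J := fun α Ω => (Φ Ω).J t α)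
      (R := fun θ Ω => (Φ Ω).eulRho (fun θ => ρ₀ θ Ω) t θ) (b := fun z => Real.sin (z - θ)) (C := 1)
      (hmass.measurable_pos F a t) (fun Ω hΩ α => ?_) (fun Ω hΩ => hcm t ht Ω (hS.subset hΩ))
      (fun Ω hΩ => ?_) (fun Ω hΩ α => ?_) ?_ (by fun_prop) (fun z => ?_)
      fun z => Real.abs_sin_le_one _).symm
    · rw [(Φ Ω).x_eq, cut_of_mem hΩ, cut_of_mem (hS.subset hΩ)]
    · exact (Φ Ω).periodic_eulRho (h.periodic_cut Ω) hI.nonneg (hJp Ω (hS.subset hΩ))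
        (h.periodic_rho Ω (hS.subset hΩ)) ht
    · exact h.eulRho_apply_x Φ ht0 (hJp Ω (hS.subset hΩ) t ht) α
    · exact (hS.continuous_density Φ h hδ h1 ht0 0).1 t ⟨ht0, le_rfl⟩
    · simp only [add_sub_right_comm, Real.sin_add_two_pi]
  refine
  { periodic_rho := fun t ht Ω hΩ => (Φ Ω).periodic_eulRho (h.periodic_cut Ω) hI.nonneg (hJp Ω hΩ)
      (h.periodic_rho Ω hΩ) ht
    periodic_u := fun t ht Ω hΩ => (Φ Ω).periodic_eulU (h.periodic_cut Ω) hI.nonneg (hJp Ω hΩ) ht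
    contDiff_rho := fun Ω hΩ => (Φ Ω).contDiffOn_eulRho (h.periodic_cut Ω) hI.nonneg (hJp Ω hΩ)
      (h.sectC1 Ω hΩ)
    contDiff_u := fun Ω hΩ => (Φ Ω).contDiffOn_eulU (h.periodic_cut Ω) hI.nonneg (hJp Ω hΩ)
    sobolev_rho := hrho
    sobolev_u := hu
    bounded := fun s hs => ?_
    initial := fun θ Ω hΩ => ⟨(Φ Ω).eulRho_zero (h.periodic_cut Ω) hI.nonneg (hJp Ω hΩ) hI.zero_mem θ,
      by rw [(Φ Ω).eulU_zero (h.periodic_cut Ω) hI.nonneg (hJp Ω hΩ) hI.zero_mem, cut_of_mem hΩ]⟩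
    continuity_eq := fun t ht ht0 θ Ω hΩ => ?_
    momentum_eq := fun t ht ht0 θ Ω hΩ => ?_ }
  · obtain ⟨δ, hδ, h1⟩ := hJ s hs
    obtain ⟨C, hC0, hC⟩ := h.derivative_bounds Φ hδ h1 (hI.nonneg s hs)
    refine ⟨C, fun t ht θ Ω hΩ => ?_⟩
    have htI := hI.Icc_subset s hs ht
    refine ⟨(hC t ht Ω hΩ ((Φ Ω).inv t θ)).2.2.2.1, ?_⟩
    have := ((Φ Ω).hasDerivAt_eulU (h.periodic_cut Ω) hI.nonneg (hJp Ω hΩ) htI θ).deriv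
    rw [show deriv (fun x => (Φ Ω).eulU t x) θ = _ from this]
    exact (hC t ht Ω hΩ ((Φ Ω).inv t θ)).1
  · obtain ⟨ut, uθ, ρt, ρθ, h1, h2, h3, h4, h5, h6⟩ := (Φ Ω).eulerian_equations (h.periodic_cut Ω)
      hI.nonneg (hJp Ω hΩ) (h.sectC1 Ω hΩ) ht (hI.mem_nhds ht ht0) θ
    have e2 : deriv (fun x => (Φ Ω).eulRho (fun θ => ρ₀ θ Ω) t x * (Φ Ω).eulU t x) θ = _ :=
      (h4.mul h2).deriv
    rw [h3.deriv, e2]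
    linarith
  · obtain ⟨ut, uθ, ρt, ρθ, h1, h2, h3, h4, h5, h6⟩ := (Φ Ω).eulerian_equations (h.periodic_cut Ω)
      hI.nonneg (hJp Ω hΩ) (h.sectC1 Ω hΩ) ht (hI.mem_nhds ht ht0) θ
    have e1 : deriv (fun s => (Φ Ω).eulRho (fun θ => ρ₀ θ Ω) s θ * (Φ Ω).eulU s θ) t = _ :=
      (h3.mul h1).deriv
    have e2 : deriv (fun x => (Φ Ω).eulRho (fun θ => ρ₀ θ Ω) t x * (Φ Ω).eulU t x ^ 2) θ = _ :=
      (h4.mul (h2.pow 2)).deriv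
    have e3 := hforce t ht θ
    set q := ∫ p, Real.sin (p.1 - θ) * (Φ p.2).eulRho (fun θ => ρ₀ θ p.2) t p.1 ∂(cellMeasure g)
    rw [e1, e2]
    rw [e3] at h6
    have hκ' : κ = K * a := by rw [hκ, ha]; ring
    set U := (Φ Ω).eulU t θ
    set R := (Φ Ω).eulRho (fun θ => ρ₀ θ Ω) t θ
    have e4 : 1 / m * (-(R * U) + R * Ω + K * R * q) =
        R * (-(a * U) + (a * Ω + κ * q)) := by rw [← ha, hκ']; ring
    rw [e4, ← h6]
    simp only [Pi.pow_apply]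
    push_cast
    linear_combination U * h5

end Existence


/-! ### Classical solutions follow the flow -/

/-- A positive solution of a linear scalar equation decays at most exponentially. -/
lemma mul_exp_le_of_linear {e e' : ℝ → ℝ} {s C : ℝ} (hC : 0 ≤ C)
    (hc : ContinuousOn e (Set.Icc 0 s)) (hd : ∀ t ∈ Set.Ioo 0 s, HasDerivAt e (e' t) t)
    (hb : ∀ t ∈ Set.Ioo 0 s, |e' t| ≤ C * |e t|) (h0 : 0 < e 0) :
    ∀ t ∈ Set.Icc 0 s, e 0 * Real.exp (-(C * t)) ≤ e t := by
  have habs : ∀ t ∈ Set.Icc 0 s, e 0 ≤ |e t| * Real.exp (C * t) := by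
    intro t ht
    have h1 := gronwall_Ioo (e := fun τ => e (t - τ)) (e' := fun τ => -e' (t - τ)) (T := t) (L := C)
      (ε := 0) hC le_rfl
      (hc.comp (continuous_const.sub continuous_id).continuousOn fun τ hτ =>
        ⟨by simpa using hτ.2, show t - τ ≤ s by linarith [hτ.1, ht.2]⟩)
      (fun τ hτ => by
        have h2 := hd (t - τ) ⟨by linarith [hτ.2], by linarith [hτ.1, ht.2]⟩
        have h3 := h2.comp τ ((hasDerivAt_id τ).const_sub t)
        exact h3.congr_deriv (by ring))
      (fun τ hτ => by
        rw [norm_neg, add_zero]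
        exact hb (t - τ) ⟨by linarith [hτ.2], by linarith [hτ.1, ht.2]⟩) t ⟨ht.1, le_rfl⟩
    simpa [abs_of_pos h0] using h1
  have hne : ∀ t ∈ Set.Icc 0 s, e t ≠ 0 := fun t ht h => by
    have := habs t ht
    rw [h, abs_zero, zero_mul] at this
    linarith
  intro t ht
  have hpos : 0 < e t := by
    by_contra hneg
    have hsub : Set.Icc 0 t ⊆ Set.Icc 0 s := Set.Icc_subset_Icc_right ht.2
    obtain ⟨z, hz, hz0⟩ := intermediate_value_Icc' ht.1 (hc.mono hsub)
      (show (0 : ℝ) ∈ Set.Icc (e t) (e 0) from ⟨not_lt.1 hneg, h0.le⟩)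
    exact hne z (hsub hz) hz0
  have h2 := habs t ht
  rw [abs_of_pos hpos] at h2
  rw [Real.exp_neg, ← div_eq_mul_inv, div_le_iff₀ (Real.exp_pos _)]
  exact h2

/-- Bounded linear functionals of a function in `C(I; H^k_g)` are continuous in time. -/
lemma ContinuousInSobolev.continuousOn_integral {g : Measure ℝ} [IsFiniteMeasure g] {k : ℕ}
    {I : Set ℝ} {f : ℝ → ℝ → ℝ → ℝ} (h : ContinuousInSobolev g k I f) {b : ℝ × ℝ → ℝ}
    (hb : Measurable b) {C : ℝ} (hC : ∀ p, |b p| ≤ C) :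
    ContinuousOn (fun t => ∫ p, b p * f t p.1 p.2 ∂(cellMeasure g)) I := by
  obtain ⟨U, hU, hf⟩ := h
  have hbL : MemLp b 2 (cellMeasure g) := MemLp.of_bound hb.aestronglyMeasurable C
    (Eventually.of_forall hC)
  have h1 : ContinuousOn (fun t => U t 0) I :=
    (PiLp.continuous_apply 2 (fun _ : Fin (k + 1) => Lp ℝ 2 (cellMeasure g)) 0).comp_continuousOn hU
  have h2 : ContinuousOn (fun t => inner ℝ (U t 0) (hbL.toLp b)) I := ContinuousOn.inner (𝕜 := ℝ) h1 continuousOn_const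
  refine h2.congr fun t ht => ?_
  simp only [L2.inner_def]
  refine integral_congr_ae ?_
  filter_upwards [(hf t ht).2, hbL.coeFn_toLp] with p h3 h4
  rw [h3, h4]
  simp

lemma ContinuousInSobolev.memLp {g : Measure ℝ} {k : ℕ} {I : Set ℝ} {f : ℝ → ℝ → ℝ → ℝ}
    (h : ContinuousInSobolev g k I f) {t : ℝ} (ht : t ∈ I) :
    MemLp (fun p : ℝ × ℝ => f t p.1 p.2) 2 (cellMeasure g) := by
  obtain ⟨U, -, hf⟩ := h
  exact (memLp_congr_ae (hf t ht).2).1 (Lp.memLp (U t 0))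

/-- A force field that is prescribed on a time interval. -/
lemma ForceField.exists_eq {S C : ℝ → ℝ} {s : ℝ} (hs : 0 ≤ s) (hS : ContinuousOn S (Set.Icc 0 s))
    (hC : ContinuousOn C (Set.Icc 0 s)) :
    ∃ F : ForceField, ∀ t ∈ Set.Icc 0 s, F.S t = S t ∧ F.C t = C t := by
  obtain ⟨M, hM⟩ := isCompact_Icc.exists_bound_of_continuousOn hS
  obtain ⟨N, hN⟩ := isCompact_Icc.exists_bound_of_continuousOn hC
  have hproj : ∀ t : ℝ, max 0 (min t s) ∈ Set.Icc 0 s := fun t =>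
    ⟨le_max_left _ _, max_le hs (min_le_right _ _)⟩
  refine ⟨⟨fun t => S (max 0 (min t s)), fun t => C (max 0 (min t s)), max M N,
    hS.comp_continuous (by fun_prop) hproj, hC.comp_continuous (by fun_prop) hproj,
    fun t => (hM _ (hproj t)).trans (le_max_left _ _),
    fun t => (hN _ (hproj t)).trans (le_max_right _ _)⟩, fun t ht => ?_⟩
  simp only [min_eq_left ht.2, max_eq_right ht.1, and_self]

/-- The flow is determined up to time `s` by the force up to time `s`. -/
lemma ForceField.flow_congr {F F' : ForceField} {a b α v s : ℝ}
    (h : ∀ t ∈ Set.Icc 0 s, F.S t = F'.S t ∧ F.C t = F'.C t) :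
    ∀ t ∈ Set.Icc 0 s, F.pos a b α v t = F'.pos a b α v t ∧
      F.vel a b α v t = F'.vel a b α v t := by
  refine F'.flow_unique a b α v (F.pos_zero a b α v) (F.vel_zero a b α v)
    (fun t _ => (F.hasDerivAt_pos a b α v t).continuousAt.continuousWithinAt)
    (fun t _ => (F.hasDerivAt_vel a b α v t).continuousAt.continuousWithinAt)
    (fun t _ => F.hasDerivAt_pos a b α v t) (fun t ht => ?_)
  refine (F.hasDerivAt_vel a b α v t).congr_deriv ?_
  obtain ⟨h1, h2⟩ := h t (Set.Ioo_subset_Icc_self ht)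
  simp only [ForceField.val, h1, h2]

namespace IsClassicalSolution

variable {m K : ℝ} {g : Measure ℝ} [IsProbabilityMeasure g] {G S : Set ℝ} {ρ₀ u₀ : ℝ → ℝ → ℝ}
  {u₃ r₂ : ℝ × ℝ → ℝ} {I : Set ℝ} {ρ u : ℝ → ℝ → ℝ → ℝ}
  (hsol : IsClassicalSolution m K g G ρ₀ u₀ I ρ u)
include hsol

omit [IsProbabilityMeasure g] in
lemma hasDerivAt_u {t : ℝ} (ht : t ∈ I) {Ω : ℝ} (hΩ : Ω ∈ G) (θ : ℝ) :
    HasDerivAt (fun x => u t x Ω) (deriv (fun x => u t x Ω) θ) θ := by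
  have h1 : ContDiff ℝ 1 fun x : ℝ => (fun p : ℝ × ℝ => u p.1 p.2 Ω) (t, x) :=
    contDiffOn_univ.1 ((hsol.contDiff_u Ω hΩ).comp (s := Set.univ)
      (contDiff_const.prodMk contDiff_id).contDiffOn fun x _ => ⟨ht, Set.mem_univ _⟩)
  exact (h1.differentiable one_ne_zero θ).hasDerivAt

omit [IsProbabilityMeasure g] in
lemma continuousOn_u {s : ℝ} (hs : Set.Icc 0 s ⊆ I) {Ω : ℝ} (hΩ : Ω ∈ G) {c : ℝ → ℝ}
    (hc : ContinuousOn c (Set.Icc 0 s)) : ContinuousOn (fun t => u t (c t) Ω) (Set.Icc 0 s) :=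
  (hsol.contDiff_u Ω hΩ).continuousOn.comp (continuousOn_id.prodMk hc)
    fun _ ht => ⟨hs ht, Set.mem_univ _⟩

omit [IsProbabilityMeasure g] in
lemma continuousOn_rho {s : ℝ} (hs : Set.Icc 0 s ⊆ I) {Ω : ℝ} (hΩ : Ω ∈ G) {c : ℝ → ℝ}
    (hc : ContinuousOn c (Set.Icc 0 s)) : ContinuousOn (fun t => ρ t (c t) Ω) (Set.Icc 0 s) :=
  (hsol.contDiff_rho Ω hΩ).continuousOn.comp (continuousOn_id.prodMk hc)
    fun _ ht => ⟨hs ht, Set.mem_univ _⟩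

omit [IsProbabilityMeasure g] in
/-- The particle trajectories of a classical solution. -/
lemma exists_characteristic (hI : IsTimeInterval I) {s : ℝ} (hs : s ∈ I) {Ω : ℝ} (hΩ : Ω ∈ G)
    (α : ℝ) : ∃ X : ℝ → ℝ, X 0 = α ∧ Continuous X ∧
      ∀ t ∈ Set.Icc 0 s, HasDerivAt X (u t (X t) Ω) t := by
  have hs0 := hI.nonneg s hs
  have hsub := hI.Icc_subset s hs
  obtain ⟨C, hC⟩ := hsol.bounded s hs
  have hproj : ∀ t : ℝ, max 0 (min t s) ∈ Set.Icc 0 s := fun t =>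
    ⟨le_max_left _ _, max_le hs0 (min_le_right _ _)⟩
  obtain ⟨M, hM⟩ := isCompact_Icc.exists_bound_of_continuousOn
    (hsol.continuousOn_u hsub hΩ (continuousOn_const (c := (0 : ℝ))))
  have hcont : Continuous fun p : ℝ × ℝ => u (max 0 (min p.1 s)) p.2 Ω :=
    (hsol.contDiff_u Ω hΩ).continuousOn.comp_continuous
      (f := fun p : ℝ × ℝ => (max 0 (min p.1 s), p.2)) (by fun_prop)
      fun p => ⟨hsub (hproj _), Set.mem_univ _⟩
  obtain ⟨X, hX0, hX⟩ := exists_global_solution (f := fun t x => u (max 0 (min t s)) x Ω) hcont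
    (L := C) (M := M) (c := 0)
    (fun t x y => ForceField.abs_sub_le_of_hasDerivAt (hsol.hasDerivAt_u (hsub (hproj t)) hΩ)
      (fun z => (hC _ (hproj t) z Ω hΩ).2) y x)
    (fun t => by simpa using hM _ (hproj t)) α
  refine ⟨X, hX0, continuous_of_hasDerivAt hX, fun t ht => ?_⟩
  have := hX t
  rwa [min_eq_left ht.2, max_eq_right ht.1] at this

omit [IsProbabilityMeasure g] in
/-- Along a trajectory the density satisfies a linear equation, hence remains positive, and the
velocity obeys the law of motion under the force exerted by the solution. -/
lemma equations_along (h : IsInitialData g G ρ₀ u₀) (hI : IsTimeInterval I) {s : ℝ} (hs : s ∈ I)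
    {F : ForceField}
    (hF : ∀ t ∈ Set.Icc 0 s, ∀ θ, F.val t θ =
      K / m * ∫ p, Real.sin (p.1 - θ) * ρ t p.1 p.2 ∂(cellMeasure g))
    {Ω : ℝ} (hΩ : Ω ∈ G) {X : ℝ → ℝ} (hXc : Continuous X)
    (hX : ∀ t ∈ Set.Icc 0 s, HasDerivAt X (u t (X t) Ω) t) :
    (∀ t ∈ Set.Ioo 0 s, HasDerivAt (fun t => ρ t (X t) Ω)
      (-(ρ t (X t) Ω * deriv (fun x => u t x Ω) (X t))) t) ∧
    ∀ t ∈ Set.Ioo 0 s, HasDerivAt (fun t => u t (X t) Ω)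
      (-(1 / m * u t (X t) Ω) + (1 / m * Ω + F.val t (X t))) t := by
  have hsub := hI.Icc_subset s hs
  obtain ⟨C, hC⟩ := hsol.bounded s hs
  have hnhds : ∀ t ∈ Set.Ioo 0 s, I ∈ 𝓝 t := fun t ht =>
    mem_of_superset (Icc_mem_nhds ht.1 ht.2) hsub
  have hρ : ∀ t ∈ Set.Ioo 0 s, HasDerivAt (fun t => ρ t (X t) Ω)
      (-(ρ t (X t) Ω * deriv (fun x => u t x Ω) (X t))) t := by
    intro t ht
    have htI := hsub (Set.Ioo_subset_Icc_self ht)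
    obtain ⟨ρt, ρθ, h1, h2, h3⟩ := hasDerivAt_of_contDiffOn (f := fun t x => ρ t x Ω)
      (hnhds t ht) (X t) (hsol.contDiff_rho Ω hΩ)
    have h4 := hsol.hasDerivAt_u htI hΩ (X t)
    have h5 := hsol.continuity_eq t htI ht.1 (X t) Ω hΩ
    rw [h1.deriv, show deriv (fun x => ρ t x Ω * u t x Ω) (X t) = _ from (h2.mul h4).deriv] at h5
    exact (h3 X _ rfl (hX t (Set.Ioo_subset_Icc_self ht))).congr_deriv (by linarith)
  refine ⟨hρ, fun t ht => ?_⟩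
  have hC0 : 0 ≤ C := (abs_nonneg _).trans (hC s ⟨hI.nonneg s hs, le_rfl⟩ 0 Ω hΩ).1
  have hpos : 0 < ρ t (X t) Ω := by
    have h0 : 0 < ρ 0 (X 0) Ω := by
      rw [(hsol.initial (X 0) Ω hΩ).1]; exact h.positive _ _ hΩ
    refine lt_of_lt_of_le (by positivity) (mul_exp_le_of_linear (e := fun t => ρ t (X t) Ω) hC0
      (hsol.continuousOn_rho hsub hΩ hXc.continuousOn) hρ (fun t ht => ?_) h0 t
      (Set.Ioo_subset_Icc_self ht))
    rw [abs_neg, abs_mul, mul_comm]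
    exact mul_le_mul_of_nonneg_right (hC t (Set.Ioo_subset_Icc_self ht) _ Ω hΩ).2 (abs_nonneg _)
  have htI := hsub (Set.Ioo_subset_Icc_self ht)
  obtain ⟨ρt, ρθ, h1, h2, -⟩ := hasDerivAt_of_contDiffOn (f := fun t x => ρ t x Ω)
    (hnhds t ht) (X t) (hsol.contDiff_rho Ω hΩ)
  obtain ⟨ut, uθ, k1, k2, k3⟩ := hasDerivAt_of_contDiffOn (f := fun t x => u t x Ω)
    (hnhds t ht) (X t) (hsol.contDiff_u Ω hΩ)
  have e1 := hsol.continuity_eq t htI ht.1 (X t) Ω hΩ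
  have e2 := hsol.momentum_eq t htI ht.1 (X t) Ω hΩ
  rw [h1.deriv, show deriv (fun x => ρ t x Ω * u t x Ω) (X t) = _ from (h2.mul k2).deriv] at e1
  rw [show deriv (fun s => ρ s (X t) Ω * u s (X t) Ω) t = _ from (h1.mul k1).deriv,
    show deriv (fun x => ρ t x Ω * u t x Ω ^ 2) (X t) = _ from (h2.mul (k2.pow 2)).deriv] at e2
  simp only [Pi.pow_apply] at e2
  push_cast at e2
  refine (k3 X _ rfl (hX t (Set.Ioo_subset_Icc_self ht))).congr_deriv ?_
  rw [hF t (Set.Ioo_subset_Icc_self ht)]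
  set q := ∫ p, Real.sin (p.1 - X t) * ρ t p.1 p.2 ∂(cellMeasure g)
  refine mul_left_cancel₀ hpos.ne' ?_
  linear_combination e2 - u t (X t) Ω * e1

omit [IsProbabilityMeasure g] hsol in
lemma field_val_eq {R : ℝ → ℝ → ℝ} {κ A B : ℝ} (hR : Integrable (fun p : ℝ × ℝ => R p.1 p.2) (cellMeasure g))
    (hA : A = κ * ∫ p, Real.sin p.1 * R p.1 p.2 ∂(cellMeasure g))
    (hB : B = κ * ∫ p, Real.cos p.1 * R p.1 p.2 ∂(cellMeasure g)) (θ : ℝ) :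
    A * Real.cos θ - B * Real.sin θ =
      κ * ∫ p, Real.sin (p.1 - θ) * R p.1 p.2 ∂(cellMeasure g) := by
  have i1 : Integrable (fun p : ℝ × ℝ => Real.sin p.1 * R p.1 p.2) (cellMeasure g) :=
    hR.bdd_mul (c := 1) (by fun_prop) (Eventually.of_forall fun p => Real.abs_sin_le_one _)
  have i2 : Integrable (fun p : ℝ × ℝ => Real.cos p.1 * R p.1 p.2) (cellMeasure g) :=
    hR.bdd_mul (c := 1) (by fun_prop) (Eventually.of_forall fun p => Real.abs_cos_le_one _)
  rw [hA, hB, mul_assoc, mul_assoc, ← mul_sub, ← integral_mul_const, ← integral_mul_const,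
    ← integral_sub (i1.mul_const _) (i2.mul_const _)]
  congr 2
  ext p
  rw [Real.sin_sub]
  ring

omit [IsProbabilityMeasure g] in
/-- A classical solution is carried by the flow under any force with which its particles move
according to the law of motion. -/
lemma eq_flow_of_trajectories (h : IsInitialData g G ρ₀ u₀) (hI : IsTimeInterval I) {s : ℝ} (hs : s ∈ I)
    {F F' : ForceField}
    (hF : ∀ t ∈ Set.Icc 0 s, ∀ θ, F.val t θ =
      K / m * ∫ p, Real.sin (p.1 - θ) * ρ t p.1 p.2 ∂(cellMeasure g))
    (hFF : ∀ t ∈ Set.Icc 0 s, F.S t = F'.S t ∧ F.C t = F'.C t)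
    (Φ : CylinderFlow (1 / m) F' G u₀) :
    ∃ δ > 0, ∀ t ∈ Set.Icc 0 s, ∀ Ω ∈ G, ∀ α, δ ≤ (Φ Ω).J t α ∧
      u t ((Φ Ω).x t α) Ω = (Φ Ω).y t α ∧
      deriv (fun x => u t x Ω) ((Φ Ω).x t α) * (Φ Ω).J t α = (Φ Ω).P t α ∧
      ρ t ((Φ Ω).x t α) Ω * (Φ Ω).J t α = ρ₀ α Ω := by
  have hsub := hI.Icc_subset s hs
  have hs0 := hI.nonneg s hs
  obtain ⟨C', hC'⟩ := hsol.bounded s hs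
  set C := max C' 0
  have hC0 : 0 ≤ C := le_max_right _ _
  have hC : ∀ t ∈ Set.Icc 0 s, ∀ θ, ∀ Ω ∈ G, |deriv (fun x => u t x Ω) θ| ≤ C :=
    fun t ht θ Ω hΩ => (hC' t ht θ Ω hΩ).2.trans (le_max_left _ _)
  -- the trajectories
  have hX : ∀ Ω ∈ G, ∀ α, (∀ t ∈ Set.Icc 0 s, u t ((Φ Ω).x t α) Ω = (Φ Ω).y t α) ∧
      ∀ t ∈ Set.Ioo 0 s, HasDerivAt (fun t => ρ t ((Φ Ω).x t α) Ω)
        (-(ρ t ((Φ Ω).x t α) Ω * deriv (fun x => u t x Ω) ((Φ Ω).x t α))) t := by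
    intro Ω hΩ α
    obtain ⟨X, hX0, hXc, hXd⟩ := hsol.exists_characteristic hI hs hΩ α
    obtain ⟨hρ, hu⟩ := hsol.equations_along h hI hs hF hΩ hXc hXd
    have h1 := F.flow_unique (1 / m) (1 / m * Ω) α (u₀ α Ω) (T := s) hX0
      (y := fun t => u t (X t) Ω) (by rw [(hsol.initial (X 0) Ω hΩ).2, hX0]) hXc.continuousOn
      (hsol.continuousOn_u hsub hΩ hXc.continuousOn)
      (fun t ht => hXd t (Set.Ioo_subset_Icc_self ht)) hu
    have h2 : ∀ t ∈ Set.Icc 0 s, X t = (Φ Ω).x t α ∧ u t (X t) Ω = (Φ Ω).y t α := by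
      intro t ht
      obtain ⟨k1, k2⟩ := h1 t ht
      obtain ⟨k3, k4⟩ := ForceField.flow_congr hFF (a := 1 / m) (b := 1 / m * Ω) (α := α)
        (v := u₀ α Ω) t ht
      rw [(Φ Ω).x_eq, (Φ Ω).y_eq, cut_of_mem hΩ, ← k3, ← k4]
      exact ⟨k1, k2⟩
    refine ⟨fun t ht => by rw [← (h2 t ht).1]; exact (h2 t ht).2, fun t ht => ?_⟩
    have h3 := hρ t ht
    rw [(h2 t (Set.Ioo_subset_Icc_self ht)).1] at h3
    refine h3.congr_of_eventuallyEq ?_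
    filter_upwards [Icc_mem_nhds ht.1 ht.2] with t' ht'
    rw [(h2 t' ht').1]
  have hP : ∀ t ∈ Set.Icc 0 s, ∀ Ω ∈ G, ∀ α,
      deriv (fun x => u t x Ω) ((Φ Ω).x t α) * (Φ Ω).J t α = (Φ Ω).P t α := by
    intro t ht Ω hΩ α
    have h1 := (hsol.hasDerivAt_u (hsub ht) hΩ ((Φ Ω).x t α)).comp α ((Φ Ω).x_a t α)
    have h2 : ((fun x => u t x Ω) ∘ (Φ Ω).x t) = (Φ Ω).y t :=
      funext fun β => (hX Ω hΩ β).1 t ht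
    rw [h2] at h1
    exact h1.unique ((Φ Ω).y_a t α)
  have hJ : ∀ t ∈ Set.Icc 0 s, ∀ Ω ∈ G, ∀ α, Real.exp (-(C * s)) ≤ (Φ Ω).J t α := by
    intro t ht Ω hΩ α
    have h1 := mul_exp_le_of_linear (e := fun t => (Φ Ω).J t α) (s := s) hC0
      (fun t _ => ((Φ Ω).J_t t α).continuousAt.continuousWithinAt) (fun t _ => (Φ Ω).J_t t α)
      (fun t ht => by
        rw [← hP t (Set.Ioo_subset_Icc_self ht) Ω hΩ α, abs_mul]
        exact mul_le_mul_of_nonneg_right (hC t (Set.Ioo_subset_Icc_self ht) _ Ω hΩ) (abs_nonneg _))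
      (by simp only [(Φ Ω).J_zero]; exact one_pos) t ht
    simp only [(Φ Ω).J_zero, one_mul] at h1
    refine le_trans (Real.exp_le_exp.2 ?_) h1
    have := mul_le_mul_of_nonneg_left ht.2 hC0
    linarith
  refine ⟨Real.exp (-(C * s)), Real.exp_pos _, fun t ht Ω hΩ α =>
    ⟨hJ t ht Ω hΩ α, (hX Ω hΩ α).1 t ht, hP t ht Ω hΩ α, ?_⟩⟩
  have hxc : ContinuousOn (fun t => (Φ Ω).x t α) (Set.Icc 0 s) :=
    ((Φ Ω).continuous_time α).1.continuousOn
  have hJc : ContinuousOn (fun t => (Φ Ω).J t α) (Set.Icc 0 s) :=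
    ((Φ Ω).continuous_time α).2.2.1.continuousOn
  have h1 := gronwall_Ioo (e := fun t => ρ t ((Φ Ω).x t α) Ω * (Φ Ω).J t α - ρ₀ α Ω)
    (e' := fun _ => 0) (T := s) (L := 0) (ε := 0) le_rfl le_rfl
    (((hsol.continuousOn_rho hsub hΩ hxc).mul hJc).sub continuousOn_const) (fun t ht => by
      refine ((((hX Ω hΩ α).2 t ht).mul ((Φ Ω).J_t t α)).sub_const _).congr_deriv ?_
      rw [← hP t (Set.Ioo_subset_Icc_self ht) Ω hΩ α]
      ring) (fun t _ => by simp) t ht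
  simp only [(Φ Ω).J_zero, (Φ Ω).x_zero, (hsol.initial α Ω hΩ).1, mul_one, sub_self, norm_zero,
    zero_mul, add_zero] at h1
  exact sub_eq_zero.1 (norm_le_zero_iff.1 h1)

/-- Every classical solution is carried by the flow under the self-consistent force, which is
non-degenerate as long as the solution exists. -/
theorem eq_flow (hm : 0 < m) (hK : 0 < K) (hS : RegularData g G ρ₀ u₀ S u₃ r₂)
    (h : IsInitialData g G ρ₀ u₀) (hI : IsTimeInterval I) {F : ForceField}
    (hF : ∀ T, IsSelfConsistent (1 / m) (K / m) (cellMeasure g) (cut S u₀) (cut S ρ₀) F T)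
    (Φ : CylinderFlow (1 / m) F G u₀) {s : ℝ} (hs : s ∈ I) :
    ∃ δ > 0, ∀ t ∈ Set.Icc 0 s, ∀ Ω ∈ G, ∀ α, δ ≤ (Φ Ω).J t α ∧
      u t ((Φ Ω).x t α) Ω = (Φ Ω).y t α ∧
      deriv (fun x => u t x Ω) ((Φ Ω).x t α) * (Φ Ω).J t α = (Φ Ω).P t α ∧
      ρ t ((Φ Ω).x t α) Ω * (Φ Ω).J t α = ρ₀ α Ω := by
  have hsub := hI.Icc_subset s hs
  have hs0 := hI.nonneg s hs
  have hmass := hS.isMassData h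
  -- the force exerted by the solution
  obtain ⟨F', hF'⟩ := ForceField.exists_eq hs0
    (S := fun t => K / m * ∫ p, Real.sin p.1 * ρ t p.1 p.2 ∂(cellMeasure g))
    (C := fun t => K / m * ∫ p, Real.cos p.1 * ρ t p.1 p.2 ∂(cellMeasure g))
    (continuousOn_const.mul ((hsol.sobolev_rho.continuousOn_integral
      (b := fun p => Real.sin p.1) (by fun_prop) fun p => Real.abs_sin_le_one _).mono hsub))
    (continuousOn_const.mul ((hsol.sobolev_rho.continuousOn_integral
      (b := fun p => Real.cos p.1) (by fun_prop) fun p => Real.abs_cos_le_one _).mono hsub))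
  have hval : ∀ t ∈ Set.Icc 0 s, ∀ θ, F'.val t θ =
      K / m * ∫ p, Real.sin (p.1 - θ) * ρ t p.1 p.2 ∂(cellMeasure g) := fun t ht θ =>
    field_val_eq ((hsol.sobolev_rho.memLp (hsub ht)).integrable one_le_two) (hF' t ht).1
      (hF' t ht).2 θ
  obtain ⟨Ψ⟩ := h.exists_cylinderFlow (1 / m) F'
  obtain ⟨δ, hδ, hΨ⟩ := hsol.eq_flow_of_trajectories h hI hs hval (fun _ _ => ⟨rfl, rfl⟩) Ψ
  -- by mass transport, this force is self-consistent
  have hint : ∀ t ∈ Set.Icc 0 s, ∀ b : ℝ → ℝ, Continuous b → Function.Periodic b (2 * Real.pi) →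
      (∀ θ, |b θ| ≤ 1) → ∫ p, b p.1 * ρ t p.1 p.2 ∂(cellMeasure g) =
        ∫ p, b (F'.pos (1 / m) (1 / m * p.2) p.1 (cut S u₀ p) t) * cut S ρ₀ p ∂(cellMeasure g) := by
    intro t ht b hb hbp hb1
    refine hS.integral_lagrangian h (x := fun α Ω => (Ψ Ω).x t α) (J := fun α Ω => (Ψ Ω).J t α)
      (R := ρ t) (hmass.measurable_pos F' (1 / m) t) (fun Ω hΩ α => ?_) (fun Ω hΩ => ?_)
      (fun Ω hΩ => hsol.periodic_rho t (hsub ht) Ω (hS.subset hΩ))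
      (fun Ω hΩ α => (hΨ t ht Ω (hS.subset hΩ) α).2.2.2) (hsol.sobolev_rho.memLp (hsub ht))
      hb hbp hb1
    · rw [(Ψ Ω).x_eq, cut_of_mem hΩ, cut_of_mem (hS.subset hΩ)]
    · exact (Ψ Ω).isCircleMap (h.periodic_cut Ω) ht.1
        fun α => hδ.trans_le (hΨ t ht Ω (hS.subset hΩ) α).1
  have hF'c : IsSelfConsistent (1 / m) (K / m) (cellMeasure g) (cut S u₀) (cut S ρ₀) F' s := by
    intro t ht
    rw [(hF' t ht).1, (hF' t ht).2,
      hint t ht Real.sin Real.continuous_sin Real.sin_periodic Real.abs_sin_le_one,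
      hint t ht Real.cos Real.continuous_cos Real.cos_periodic Real.abs_cos_le_one]
    exact ⟨rfl, rfl⟩
  exact hsol.eq_flow_of_trajectories h hI hs hval
    (hmass.selfConsistent_unique (div_pos hK hm) hs0 hF'c (hF s)) Φ

end IsClassicalSolution


/-! ### Sign analysis of the Jacobian -/

/-- Continuous induction: positivity up to a time implies positivity at this time. At `τ = a` the
hypothesis says that `f a` is positive. -/
lemma pos_of_pos_before {f : ℝ → ℝ} {a b : ℝ} (hf : ContinuousOn f (Set.Icc a b))
    (h : ∀ τ ∈ Set.Icc a b, (∀ t ∈ Set.Ico a τ, 0 < f t) → 0 < f τ) :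
    ∀ t ∈ Set.Icc a b, 0 < f t := by
  by_contra! hcon
  obtain ⟨t, ht, hft⟩ := hcon
  -- the first time at which `f` fails to be positive
  have hcl : IsClosed (Set.Icc a b ∩ f ⁻¹' Set.Iic 0) :=
    hf.preimage_isClosed_of_isClosed isClosed_Icc isClosed_Iic
  have hbdd : BddBelow (Set.Icc a b ∩ f ⁻¹' Set.Iic 0) := ⟨a, fun z hz => hz.1.1⟩
  have hmem := hcl.csInf_mem ⟨t, ht, hft⟩ hbdd
  refine absurd (h _ hmem.1 fun z hz => ?_) (not_lt.2 hmem.2)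
  by_contra hz0
  exact absurd (csInf_le hbdd ⟨⟨hz.1, hz.2.le.trans hmem.1.2⟩, not_lt.1 hz0⟩) (not_le.2 hz.2)

/-- A cooperative system preserves the positive quadrant: while `J > 0`, the quantity `N e^{-A}` is
nondecreasing, so `N ≥ 0` and `J' ≥ -Λ J`. -/
lemma le_of_cooperative {J N A lam μ c : ℝ → ℝ} {a b Λ : ℝ}
    (hJ : ∀ t ∈ Set.Icc a b, HasDerivAt J (N t - lam t * J t) t)
    (hN : ∀ t ∈ Set.Icc a b, HasDerivAt N (μ t * N t + c t * J t) t)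
    (hA : ∀ t ∈ Set.Icc a b, HasDerivAt A (μ t) t) (hlam : ∀ t ∈ Set.Icc a b, lam t ≤ Λ)
    (hc : ∀ t ∈ Set.Icc a b, 0 ≤ c t) (hJa : 0 < J a) (hNa : 0 ≤ N a) :
    ∀ t ∈ Set.Icc a b, J a * Real.exp (-(Λ * (t - a))) ≤ J t := by
  have key : ∀ τ ∈ Set.Icc a b, (∀ t ∈ Set.Ico a τ, 0 < J t) →
      J a * Real.exp (-(Λ * (τ - a))) ≤ J τ := by
    intro τ hτ hpos
    have hsub : Set.Icc a τ ⊆ Set.Icc a b := Set.Icc_subset_Icc_right hτ.2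
    have hint : ∀ t ∈ interior (Set.Icc a τ), t ∈ Set.Icc a b ∧ 0 < J t := fun t ht => by
      rw [interior_Icc] at ht
      exact ⟨hsub (Set.Ioo_subset_Icc_self ht), hpos t ⟨ht.1.le, ht.2⟩⟩
    have d1 : ∀ t ∈ Set.Icc a b, HasDerivAt (fun t => N t * Real.exp (-A t))
        (c t * J t * Real.exp (-A t)) t := fun t ht =>
      ((hN t ht).mul (hA t ht).neg.exp).congr_deriv (by simp only [Pi.neg_apply]; ring)
    have m1 : MonotoneOn (fun t => N t * Real.exp (-A t)) (Set.Icc a τ) := by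
      refine monotoneOn_of_deriv_nonneg (convex_Icc a τ)
        (fun t ht => (d1 t (hsub ht)).continuousAt.continuousWithinAt)
        (fun t ht => (d1 t (hint t ht).1).differentiableAt.differentiableWithinAt) fun t ht => ?_
      rw [(d1 t (hint t ht).1).deriv]
      exact mul_nonneg (mul_nonneg (hc t (hint t ht).1) (hint t ht).2.le) (Real.exp_pos _).le
    have hN0 : ∀ t ∈ Set.Icc a τ, 0 ≤ N t := fun t ht => by
      have h1 := m1 (Set.left_mem_Icc.2 hτ.1) ht ht.1
      have h2 : 0 ≤ N a * Real.exp (-A a) := by positivity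
      exact nonneg_of_mul_nonneg_left (h2.trans h1) (Real.exp_pos _)
    have d2 : ∀ t ∈ Set.Icc a b, HasDerivAt (fun t => J t * Real.exp (Λ * (t - a)))
        ((N t + (Λ - lam t) * J t) * Real.exp (Λ * (t - a))) t := fun t ht => by
      have h1 : HasDerivAt (fun t => Real.exp (Λ * (t - a))) (Real.exp (Λ * (t - a)) * Λ) t := by
        simpa using (((hasDerivAt_id t).sub_const a).const_mul Λ).exp
      exact ((hJ t ht).mul h1).congr_deriv (by ring)
    have m2 : MonotoneOn (fun t => J t * Real.exp (Λ * (t - a))) (Set.Icc a τ) := by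
      refine monotoneOn_of_deriv_nonneg (convex_Icc a τ)
        (fun t ht => (d2 t (hsub ht)).continuousAt.continuousWithinAt)
        (fun t ht => (d2 t (hint t ht).1).differentiableAt.differentiableWithinAt) fun t ht => ?_
      rw [(d2 t (hint t ht).1).deriv]
      have h1 := hN0 t (interior_subset ht)
      have h2 := hlam t (hint t ht).1
      have h3 := (hint t ht).2
      exact mul_nonneg (add_nonneg h1 (mul_nonneg (by linarith) h3.le)) (Real.exp_pos _).le
    have h1 := m2 (Set.left_mem_Icc.2 hτ.1) (Set.right_mem_Icc.2 hτ.1) hτ.1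
    simp only [sub_self, mul_zero, Real.exp_zero, mul_one] at h1
    rw [Real.exp_neg, ← div_eq_mul_inv, div_le_iff₀ (Real.exp_pos _)]
    exact h1
  have hpos := pos_of_pos_before (f := J) (a := a) (b := b)
    (fun t ht => (hJ t ht).continuousAt.continuousWithinAt)
    fun τ hτ h => lt_of_lt_of_le (by positivity) (key τ hτ h)
  exact fun t ht => key t ht fun z hz => hpos z ⟨hz.1, hz.2.le.trans ht.2⟩

namespace SectionFlow

variable {a b κ : ℝ} {F : ForceField} {v v₁ v₂ : ℝ → ℝ} (φ : SectionFlow a b F v v₁ v₂)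

/-- If the initial slope is not below the root `d` of `d² + a d + κ = 0`, then the
Jacobian stays positive for all times: `N = P - d J` satisfies `N' = -(a + d) N + (F_θ + κ) J`, so
that `(J, N)` is cooperative. -/
lemma exp_le_J (hder : ∀ t, 0 ≤ t → ∀ θ, |F.der t θ| ≤ κ) {d : ℝ} (hd : d ^ 2 + a * d + κ = 0)
    {α : ℝ} (hα : d ≤ v₁ α) {t : ℝ} (ht : 0 ≤ t) : Real.exp (d * t) ≤ φ.J t α := by
  have h := le_of_cooperative (J := fun t => φ.J t α) (N := fun t => φ.P t α - d * φ.J t α)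
    (A := fun t => -(a + d) * t) (lam := fun _ => -d) (μ := fun _ => -(a + d))
    (c := fun t => F.der t (φ.x t α) + κ) (a := 0) (b := t) (Λ := -d)
    (fun s _ => (φ.J_t s α).congr_deriv (by ring))
    (fun s _ => ((φ.P_t s α).sub ((φ.J_t s α).const_mul d)).congr_deriv (by
      linear_combination -φ.J s α * hd))
    (fun s _ => by simpa using (hasDerivAt_id s).const_mul (-(a + d))) (fun _ _ => le_rfl)
    (fun s hs => by have := (abs_le.1 (hder s hs.1 (φ.x s α))).1; linarith)
    (by simp only [φ.J_zero]; exact one_pos)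
    (by simp only [φ.J_zero, φ.P_zero]; linarith) t ⟨ht, le_rfl⟩
  simp only [φ.J_zero, one_mul, sub_zero] at h
  rwa [neg_mul, neg_neg] at h

/-- If the initial slope is below the negative root `d` of `d² + a d - κ = 0`, then the Jacobian
vanishes in finite time: as long as `J > 0`, the quantity `(P - d J) e^{(a + d) t}` is nonincreasing,
which with `a + d ≤ 0` and `d ≤ 0` gives `J' = P ≤ v₁ - d < 0`. -/
lemma time_lt_of_J_pos (hder : ∀ t, 0 ≤ t → ∀ θ, |F.der t θ| ≤ κ) {d : ℝ}
    (hd : d ^ 2 + a * d - κ = 0) (hd0 : d ≤ 0) (had : a + d ≤ 0) {α : ℝ} (hα : v₁ α < d) {s : ℝ}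
    (hs : 0 ≤ s) (hJ : ∀ t ∈ Set.Icc 0 s, 0 < φ.J t α) : s < 1 / (d - v₁ α) := by
  have hn : 0 < d - v₁ α := by linarith
  have d1 : ∀ t, HasDerivAt (fun t => (φ.P t α - d * φ.J t α) * Real.exp ((a + d) * t))
      ((F.der t (φ.x t α) - κ) * φ.J t α * Real.exp ((a + d) * t)) t := fun t => by
    have h1 : HasDerivAt (fun t => Real.exp ((a + d) * t)) (Real.exp ((a + d) * t) * (a + d)) t := by
      simpa using ((hasDerivAt_id t).const_mul (a + d)).exp
    refine (((φ.P_t t α).sub ((φ.J_t t α).const_mul d)).mul h1).congr_deriv ?_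
    simp only [Pi.sub_apply]
    linear_combination -φ.J t α * Real.exp ((a + d) * t) * hd
  have m1 : AntitoneOn (fun t => (φ.P t α - d * φ.J t α) * Real.exp ((a + d) * t))
      (Set.Icc 0 s) := by
    refine antitoneOn_of_deriv_nonpos (convex_Icc 0 s)
      (fun t _ => (d1 t).continuousAt.continuousWithinAt)
      (fun t _ => (d1 t).differentiableAt.differentiableWithinAt) fun t ht => ?_
    have ht' := interior_subset ht
    rw [(d1 t).deriv]
    have h1 := (abs_le.1 (hder t ht'.1 (φ.x t α))).2
    exact mul_nonpos_of_nonpos_of_nonneg (mul_nonpos_of_nonpos_of_nonneg (by linarith)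
      (hJ t ht').le) (Real.exp_pos _).le
  have hN : ∀ t ∈ Set.Icc 0 s, φ.P t α - d * φ.J t α ≤ -(d - v₁ α) := by
    intro t ht
    have h1 := m1 (Set.left_mem_Icc.2 hs) ht ht.1
    simp only [φ.J_zero, φ.P_zero, mul_zero, Real.exp_zero, mul_one] at h1
    have h2 : Real.exp ((a + d) * t) ≤ 1 :=
      Real.exp_le_one_iff.2 (mul_nonpos_of_nonpos_of_nonneg had ht.1)
    by_contra hcon
    push Not at hcon
    have h3 := Real.exp_pos ((a + d) * t)
    nlinarith
  have d2 : ∀ t, HasDerivAt (fun t => φ.J t α + (d - v₁ α) * t) (φ.P t α + (d - v₁ α)) t :=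
    fun t => ((φ.J_t t α).add ((hasDerivAt_id t).const_mul (d - v₁ α))).congr_deriv (by ring)
  have m2 : AntitoneOn (fun t => φ.J t α + (d - v₁ α) * t) (Set.Icc 0 s) := by
    refine antitoneOn_of_deriv_nonpos (convex_Icc 0 s)
      (fun t _ => (d2 t).continuousAt.continuousWithinAt)
      (fun t _ => (d2 t).differentiableAt.differentiableWithinAt) fun t ht => ?_
    have ht' := interior_subset ht
    rw [(d2 t).deriv]
    have h1 := hN t ht'
    have h2 := mul_nonpos_of_nonpos_of_nonneg hd0 (hJ t ht').le
    linarith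
  have h1 := m2 (Set.left_mem_Icc.2 hs) (Set.right_mem_Icc.2 hs) hs
  simp only [φ.J_zero, mul_zero, add_zero] at h1
  have h2 := hJ s (Set.right_mem_Icc.2 hs)
  rw [lt_div_iff₀ hn]
  linarith

/-- A lower bound of the slope `P / J` at one time keeps the Jacobian positive for a time that
depends on this bound only. -/
lemma mul_exp_le_J_of_slope (ha : 0 ≤ a) (hκ : 0 < κ)
    (hder : ∀ t, 0 ≤ t → ∀ θ, |F.der t θ| ≤ κ) {L t₁ α : ℝ} (hL : 0 ≤ L) (ht₁ : 0 ≤ t₁)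
    (hJ : 0 < φ.J t₁ α) (hP : -(L * φ.J t₁ α) ≤ φ.P t₁ α) :
    ∀ t ∈ Set.Icc t₁ (t₁ + 1 / ((L + 1) ^ 2 + κ)),
      φ.J t₁ α * Real.exp (-((L + 1) * (t - t₁))) ≤ φ.J t α := by
  set M := (L + 1) ^ 2 + κ with hM
  have hM0 : 0 < M := by positivity
  -- `L + M (t - t₁)` is a supersolution of the Riccati equation of `-P / J` up to the time
  -- at which it reaches `L + 1`
  have hlam : ∀ t ∈ Set.Icc t₁ (t₁ + 1 / M), 0 ≤ L + M * (t - t₁) ∧ L + M * (t - t₁) ≤ L + 1 := by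
    intro t ht
    have h1 : 0 ≤ M * (t - t₁) := mul_nonneg hM0.le (by linarith [ht.1])
    have h2 : M * (t - t₁) ≤ M * (1 / M) := mul_le_mul_of_nonneg_left (by linarith [ht.2]) hM0.le
    rw [mul_one_div_cancel hM0.ne'] at h2
    constructor <;> linarith
  refine le_of_cooperative (J := fun t => φ.J t α)
    (N := fun t => φ.P t α + (L + M * (t - t₁)) * φ.J t α)
    (A := fun t => (L - a) * t + M * (t - t₁) ^ 2 / 2) (lam := fun t => L + M * (t - t₁))
    (μ := fun t => L + M * (t - t₁) - a)
    (c := fun t => F.der t (φ.x t α) + M + a * (L + M * (t - t₁)) - (L + M * (t - t₁)) ^ 2)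
    (fun t _ => (φ.J_t t α).congr_deriv (by ring)) (fun t _ => ?_) (fun t _ => ?_)
    (fun t ht => (hlam t ht).2) (fun t ht => ?_) hJ (by simp only [sub_self, mul_zero]; linarith)
  · have h1 : HasDerivAt (fun t => L + M * (t - t₁)) M t := by
      simpa using (((hasDerivAt_id t).sub_const t₁).const_mul M).const_add L
    exact ((φ.P_t t α).add (h1.mul (φ.J_t t α))).congr_deriv (by ring)
  · have h1 : HasDerivAt (fun t => (L - a) * t) (L - a) t := by
      simpa using (hasDerivAt_id t).const_mul (L - a)
    have h2 := (((((hasDerivAt_id t).sub_const t₁).pow 2).const_mul M).div_const 2)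
    refine (h1.add h2).congr_deriv ?_
    simp only [id]
    push_cast
    ring
  · obtain ⟨h1, h2⟩ := hlam t ht
    have h3 := (abs_le.1 (hder t (ht₁.trans ht.1) (φ.x t α))).1
    have h4 : (L + M * (t - t₁)) ^ 2 ≤ (L + 1) ^ 2 := pow_le_pow_left₀ h1 h2 2
    have h5 := mul_nonneg ha h1
    linarith

end SectionFlow


/-! ### The maximal time of existence -/

section Lifespan

variable {a κ : ℝ} {F : ForceField} {G : Set ℝ} {u₀ : ℝ → ℝ → ℝ}

/-- The flow is uniformly non-degenerate on `[0, s]`. -/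
def IsNondegenerate (Φ : CylinderFlow a F G u₀) (s : ℝ) : Prop :=
  ∃ δ > 0, ∀ t ∈ Set.Icc 0 s, ∀ Ω ∈ G, ∀ α, δ ≤ (Φ Ω).J t α

lemma IsNondegenerate.mono {Φ : CylinderFlow a F G u₀} {s s' : ℝ} (h : IsNondegenerate Φ s)
    (hs : s' ≤ s) : IsNondegenerate Φ s' := by
  obtain ⟨δ, hδ, h⟩ := h
  exact ⟨δ, hδ, fun t ht => h t ⟨ht.1, ht.2.trans hs⟩⟩

/-- `J` starts at `1` and `∂_t J = P` is bounded uniformly in the label and the frequency, since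
`∂_θ u₀` is bounded on `G`. -/
lemma IsInitialData.exists_isNondegenerate {g : Measure ℝ} {ρ₀ : ℝ → ℝ → ℝ}
    (h : IsInitialData g G ρ₀ u₀) (Φ : CylinderFlow a F G u₀) :
    ∃ s > 0, IsNondegenerate Φ s := by
  obtain ⟨C', hC'⟩ := h.bounded
  set C := max C' 0
  have hC0 : 0 ≤ C := le_max_right _ _
  set M := (1 + C) * Real.exp ((1 + |a| + 2 * F.B) * 1) with hM
  have hM0 : 0 < M := by positivity
  have hP : ∀ t ∈ Set.Icc (0 : ℝ) 1, ∀ Ω ∈ G, ∀ α, |(Φ Ω).P t α| ≤ M := fun t ht Ω hΩ α => by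
    refine ((Φ Ω).variation_bounds (C := C) (T := 1) ?_ (abs_le.2 ⟨by linarith [ht.1], ht.2⟩)).2.1
    rw [cut_of_mem hΩ]
    exact (hC' α Ω hΩ).2.trans (le_max_left _ _)
  refine ⟨min 1 (1 / (2 * M)), by positivity, 1 / 2, by norm_num, fun t ht Ω hΩ α => ?_⟩
  have ht1 : t ≤ 1 := ht.2.trans (min_le_left _ _)
  have ht2 : t ≤ 1 / (2 * M) := ht.2.trans (min_le_right _ _)
  have h1 : |(Φ Ω).J t α - (Φ Ω).J 0 α| ≤ M * |t - 0| :=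
    Convex.norm_image_sub_le_of_norm_hasDerivWithin_le (s := Set.Icc (0 : ℝ) 1)
      (f := fun t => (Φ Ω).J t α)
      (fun t _ => ((Φ Ω).J_t t α).hasDerivWithinAt) (fun t ht => hP t ht Ω hΩ α)
      (convex_Icc 0 1) ⟨le_rfl, zero_le_one⟩ ⟨ht.1, ht1⟩
  rw [(Φ Ω).J_zero, sub_zero, abs_of_nonneg ht.1] at h1
  have h2 : M * t ≤ 1 / 2 := by
    have := mul_le_mul_of_nonneg_left ht2 hM0.le
    rwa [show M * (1 / (2 * M)) = 1 / 2 by field_simp] at this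
  linarith [(abs_le.1 h1).1]

/-- The supremum `T` of the times up to which the flow is uniformly non-degenerate. A uniform lower
bound of the slopes `P / J` at a time close to `T` would let the flow continue beyond `T`. -/
lemma IsInitialData.exists_lifespan {g : Measure ℝ} {ρ₀ : ℝ → ℝ → ℝ}
    (h : IsInitialData g G ρ₀ u₀) (Φ : CylinderFlow a F G u₀) (ha : 0 ≤ a) (hκ : 0 < κ)
    (hder : ∀ t, 0 ≤ t → ∀ θ, |F.der t θ| ≤ κ) {τ : ℝ} (hτ : ¬ IsNondegenerate Φ τ) :
    ∃ T > 0, (∀ s < T, IsNondegenerate Φ s) ∧ (∀ s > T, ¬ IsNondegenerate Φ s) ∧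
      ∀ L ≥ 0, ∀ᶠ t in 𝓝[<] T, ∃ Ω ∈ G, ∃ α, (Φ Ω).P t α < -(L * (Φ Ω).J t α) := by
  obtain ⟨s₀, hs₀, hns₀⟩ := h.exists_isNondegenerate Φ
  have hbdd : BddAbove {s | IsNondegenerate Φ s} := ⟨τ, fun s hs => by
    by_contra hlt
    exact hτ (hs.mono (not_le.1 hlt).le)⟩
  have hT0 : 0 < sSup {s | IsNondegenerate Φ s} := hs₀.trans_le (le_csSup hbdd hns₀)
  have hlt : ∀ s < sSup {s | IsNondegenerate Φ s}, IsNondegenerate Φ s := fun s hs => by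
    obtain ⟨s', hs', hss'⟩ := exists_lt_of_lt_csSup ⟨s₀, hns₀⟩ hs
    exact hs'.mono hss'.le
  have hgt : ∀ s > sSup {s | IsNondegenerate Φ s}, ¬ IsNondegenerate Φ s := fun s hs hn =>
    absurd (le_csSup hbdd hn) (not_le.2 hs)
  refine ⟨_, hT0, hlt, hgt, fun L hL => ?_⟩
  set T := sSup {s | IsNondegenerate Φ s}
  set η := 1 / ((L + 1) ^ 2 + κ) with hη
  have hη0 : 0 < η := by positivity
  filter_upwards [Ioo_mem_nhdsLT (show max 0 (T - η) < T from max_lt hT0 (by linarith))] with t ht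
  have ht0 : 0 ≤ t := (le_max_left _ _).trans ht.1.le
  have htη : T < t + η := by linarith [(le_max_right 0 (T - η)).trans_lt ht.1]
  by_contra! hcon
  obtain ⟨δ, hδ, hJ⟩ := hlt t ht.2
  refine hgt _ htη ⟨δ * Real.exp (-((L + 1) * η)), by positivity, fun t' ht' Ω hΩ α => ?_⟩
  have hη' : (L + 1) * η ≥ 0 := by positivity
  rcases le_total t' t with hle | hle
  · refine le_trans ?_ (hJ t' ⟨ht'.1, hle⟩ Ω hΩ α)
    exact mul_le_of_le_one_right hδ.le (Real.exp_le_one_iff.2 (by linarith))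
  · have hJt := hJ t ⟨ht0, le_rfl⟩ Ω hΩ α
    refine le_trans ?_ ((Φ Ω).mul_exp_le_J_of_slope ha hκ hder hL ht0 (hδ.trans_le hJt)
      (hcon Ω hΩ α) t' ⟨hle, ht'.2⟩)
    have h1 : (L + 1) * (t' - t) ≤ (L + 1) * η :=
      mul_le_mul_of_nonneg_left (by linarith [ht'.2]) (by linarith)
    exact mul_le_mul hJt (Real.exp_le_exp.2 (by linarith)) (Real.exp_pos _).le
      (hδ.le.trans hJt)

end Lifespan


end KuramotoHydro


theorem theorem5p3 (m K : ℝ) (hm : 0 < m) (hK : 0 < K)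
    (g : MeasureTheory.Measure ℝ) [MeasureTheory.IsProbabilityMeasure g]
    (hg : MeasureTheory.Integrable (fun Ω : ℝ => Ω ^ 2) g)
    (G : Set ℝ) (hG : ∀ᵐ Ω ∂g, Ω ∈ G)
    (ρ₀ u₀ : ℝ → ℝ → ℝ) (hdata : KuramotoHydro.IsInitialData g G ρ₀ u₀) :
    -- subcritical region
    (4 * K * m ≤ 1 →
      (∀ θ : ℝ, ∀ Ω ∈ G,
        (-1 - Real.sqrt (1 - 4 * K * m)) / (2 * m) ≤ deriv (fun x => u₀ x Ω) θ) →
      ∃ ρ u : ℝ → ℝ → ℝ → ℝ,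
        KuramotoHydro.IsClassicalSolution m K g G ρ₀ u₀ (Set.Ici 0) ρ u ∧
        ∀ T : ℝ, 0 < T → ∀ ρ' u' : ℝ → ℝ → ℝ → ℝ,
          KuramotoHydro.IsClassicalSolution m K g G ρ₀ u₀ (Set.Ico 0 T) ρ' u' →
          ∀ t ∈ Set.Ico 0 T, ∀ θ : ℝ, ∀ Ω ∈ G, ρ' t θ Ω = ρ t θ Ω ∧ u' t θ Ω = u t θ Ω) ∧
    -- supercritical region
    ((∃ θ : ℝ, ∃ Ω ∈ G,
        deriv (fun x => u₀ x Ω) θ < (-1 - Real.sqrt (1 + 4 * K * m)) / (2 * m)) →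
      ∃ T : ℝ, 0 < T ∧
        (∃ ρ u : ℝ → ℝ → ℝ → ℝ,
          KuramotoHydro.IsClassicalSolution m K g G ρ₀ u₀ (Set.Ico 0 T) ρ u) ∧
        (∀ ρ u : ℝ → ℝ → ℝ → ℝ,
          KuramotoHydro.IsClassicalSolution m K g G ρ₀ u₀ (Set.Ico 0 T) ρ u →
          ∀ L : ℝ, ∀ᶠ t in 𝓝[<] T, ∃ θ : ℝ, ∃ Ω ∈ G, deriv (fun x => u t x Ω) θ < -L) ∧
        (∀ T' : ℝ, T < T' → ¬ ∃ ρ u : ℝ → ℝ → ℝ → ℝ,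
          KuramotoHydro.IsClassicalSolution m K g G ρ₀ u₀ (Set.Ico 0 T') ρ u)) := by
  -- the flow under the self-consistent force with `a = 1 / m` and `κ = K / m` exists for all times
  obtain ⟨S, u₃, r₂, hS⟩ := hdata.exists_regularData hG
  have hmass := hS.isMassData hdata
  have ha : 0 < 1 / m := one_div_pos.2 hm
  have hκ : 0 < K / m := div_pos hK hm
  obtain ⟨F, hF⟩ := hmass.exists_selfConsistent (a := 1 / m) hκ
  obtain ⟨Φ⟩ := hdata.exists_cylinderFlow (1 / m) F
  have hder : ∀ t, 0 ≤ t → ∀ θ, |F.der t θ| ≤ K / m := fun t ht θ =>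
    hmass.abs_der_le hκ (hF t) ⟨ht, le_rfl⟩ θ
  refine ⟨fun hKm hsub => ?_, fun ⟨θ, Ω, hΩ, hsuper⟩ => ?_⟩
  · set d := (-1 - Real.sqrt (1 - 4 * K * m)) / (2 * m) with hd
    have hroot : d ^ 2 + 1 / m * d + K / m = 0 := by
      have hw := Real.sq_sqrt (show 0 ≤ 1 - 4 * K * m by linarith)
      rw [hd]
      field_simp
      linear_combination hw
    have hd0 : d ≤ 0 := div_nonpos_of_nonpos_of_nonneg
      (by linarith [Real.sqrt_nonneg (1 - 4 * K * m)]) (by positivity)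
    have hJ : ∀ t, 0 ≤ t → ∀ Ω ∈ G, ∀ α, Real.exp (d * t) ≤ (Φ Ω).J t α := fun t ht Ω hΩ α =>
      (Φ Ω).exp_le_J hder hroot (by rw [KuramotoHydro.cut_of_mem hΩ]; exact hsub α Ω hΩ) ht
    refine ⟨_, _, hS.isClassicalSolution Φ hdata rfl rfl hg KuramotoHydro.isTimeInterval_Ici hF
      fun s _ => ⟨Real.exp (d * s), Real.exp_pos _, fun t ht Ω hΩ α =>
        (Real.exp_le_exp.2 (mul_le_mul_of_nonpos_left ht.2 hd0)).trans (hJ t ht.1 Ω hΩ α)⟩,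
      fun T hT ρ' u' hsol t ht θ Ω hΩ => ?_⟩
    obtain ⟨δ, hδ, h1⟩ := hsol.eq_flow hm hK hS hdata (KuramotoHydro.isTimeInterval_Ico hT) hF Φ ht
    have h2 := h1 t ⟨ht.1, le_rfl⟩ Ω hΩ
    have hx : (Φ Ω).x t ((Φ Ω).inv t θ) = θ := ((Φ Ω).isCircleMap (hdata.periodic_cut Ω) ht.1
      fun α => hδ.trans_le (h2 α).1).apply_invFun θ
    obtain ⟨hJ', hu, -, hρ⟩ := h2 ((Φ Ω).inv t θ)
    rw [hx] at hu hρ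
    exact ⟨eq_div_of_mul_eq (hδ.trans_le hJ').ne' hρ, hu⟩
  · set d := (-1 - Real.sqrt (1 + 4 * K * m)) / (2 * m) with hd
    have hpos : 0 < K * m := mul_pos hK hm
    have hw := Real.sq_sqrt (show 0 ≤ 1 + 4 * K * m by linarith)
    have hw1 : 1 ≤ Real.sqrt (1 + 4 * K * m) := Real.one_le_sqrt.2 (by linarith)
    have hroot : d ^ 2 + 1 / m * d - K / m = 0 := by
      rw [hd]
      field_simp
      linear_combination hw
    have hd0 : d ≤ 0 := div_nonpos_of_nonpos_of_nonneg (by linarith) (by positivity)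
    have had : 1 / m + d ≤ 0 := by
      rw [hd, show 1 / m + (-1 - Real.sqrt (1 + 4 * K * m)) / (2 * m) =
        (1 - Real.sqrt (1 + 4 * K * m)) / (2 * m) by field_simp; ring]
      exact div_nonpos_of_nonpos_of_nonneg (by linarith) (by positivity)
    -- the flow degenerates along the label at which the initial slope is below `d`
    have hdeg : ¬ KuramotoHydro.IsNondegenerate Φ (1 / (d - deriv (fun x => u₀ x Ω) θ)) := by
      rintro ⟨δ, hδ, hJ⟩
      have h1 : KuramotoHydro.cut G (KuramotoHydro.thetaDeriv u₀) (θ, Ω) =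
        deriv (fun x => u₀ x Ω) θ := KuramotoHydro.cut_of_mem hΩ
      have h2 := (Φ Ω).time_lt_of_J_pos hder hroot hd0 had (α := θ)
        (s := 1 / (d - deriv (fun x => u₀ x Ω) θ)) (by rw [h1]; exact hsuper)
        (one_div_nonneg.2 (by linarith)) fun t ht => hδ.trans_le (hJ t ht Ω hΩ θ)
      rw [h1] at h2
      exact lt_irrefl _ h2
    obtain ⟨T, hT, hlt, hgt, hlim⟩ := hdata.exists_lifespan Φ ha.le hκ hder hdeg
    refine ⟨T, hT, ⟨_, _, hS.isClassicalSolution Φ hdata rfl rfl hg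
      (KuramotoHydro.isTimeInterval_Ico hT) hF fun s hs => hlt s hs.2⟩, fun ρ u hsol L => ?_,
      fun T' hT' ⟨ρ, u, hsol⟩ => ?_⟩
    -- the slope `∂_θ u = P / J` of the solution at `x(t, α)`
    · filter_upwards [hlim (max L 0) (le_max_right _ _), Ioo_mem_nhdsLT hT] with t ⟨Ω, hΩ, α, hα⟩ ht
      obtain ⟨δ, hδ, h1⟩ := hsol.eq_flow hm hK hS hdata (KuramotoHydro.isTimeInterval_Ico hT) hF Φ
        (Set.Ioo_subset_Ico_self ht)
      obtain ⟨hJ, -, hP, -⟩ := h1 t ⟨ht.1.le, le_rfl⟩ Ω hΩ α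
      refine ⟨(Φ Ω).x t α, Ω, hΩ, ?_⟩
      rw [← hP, ← neg_mul] at hα
      have h2 := lt_of_mul_lt_mul_right hα (hδ.le.trans hJ)
      linarith [le_max_left L 0]
    -- a solution beyond `T` would make the flow nondegenerate beyond `T`
    · obtain ⟨δ, hδ, h1⟩ := hsol.eq_flow hm hK hS hdata
        (KuramotoHydro.isTimeInterval_Ico (hT.trans hT')) hF Φ
        (s := (T + T') / 2) ⟨by linarith, by linarith⟩
      exact hgt ((T + T') / 2) (by linarith)
        ⟨δ, hδ, fun t ht Ω hΩ α => (h1 t ht Ω hΩ α).1⟩
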